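/- **Setting.** Write $x=(x_z,x_r)$ for points of $\mathbb R^2_+=\{x_r>0\}$. Fix $X^*=(z^*,r^*)\in\mathbb R^2_+$, points $Y_1,\dots,Y_N\in\mathbb R^2$ with pairwise distinct radial components $Y_{i,r}$, and $\gamma>0$, $M_0>0$. Let $d_0=\frac14\min_{j\ne k}|Y_{j,r}-Y_{k,r}|$ (any positive number if $N=1$), and $X_{i,0}^\varepsilon=X^*+Y_i/\sqrt{|\ln\varepsilon|}$. *Initial data.* $\omega_0^\varepsilon=\sum_{i=1}^N\omega_{i,0}^\varepsilon$ with $\omega_{i,0}^\varepsilon\ge 0$, $\operatorname{supp}\omega_{i,0}^\varepsilon\subset \overline B(X_{i,0}^\varepsilon,\varepsilon)$, $\int_{\mathbb R^2_+} x_r\omega_{i,0}^\varepsilon\,dx=\gamma$ and $|\omega_0^\varepsilon|\le M_0/\varepsilon^2$. *Evolution.* Let $T_0>0$ and let $(\omega^\varepsilon,u^\varepsilon)$ be the weak solution on $[0,T_0]$, with initial datum $\omega_0^\varepsilon$, of the axisymmetric Euler equations without swirl in the time scale $1/|\ln\varepsilon|$, $$\partial_t\omega^\varepsilon+\tfrac{1}{|\ln\varepsilon|}u^\varepsilon\cdot\nabla\omega^\varepsilon=0,\qquad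 \operatorname{div}(x_ru^\varepsilon)=0,\qquad \operatorname{curl}u^\varepsilon=x_r\omega^\varepsilon .$$ This means: $x_r\omega^\varepsilon\in L^\infty([0,T_0];L^1\cap L^\infty)$, $x_r^2\omega^\varepsilon\in L^\infty([0,T_0];L^1)$, and $\omega^\varepsilon,u^\varepsilon$ are essentially bounded; $u^\varepsilon$ is given by the axisymmetric Biot–Savart law $$u_z(t,x)=-\frac1{4\pi}\int_{\mathbb R^2_+}y_r^2\int_{-\pi}^{\pi}\frac{\omega(t,y)(x_r\cos\theta-y_r)}{[|x-y|^2+2x_ry_r(1-\cos\theta)]^{3/2}}d\theta\,dy,\quad u_r(t,x)=\frac1{4\pi}\int_{\mathbb R^2_+}y_r^2\int_{-\pi}^{\pi}\frac{\omega(t,y)(x_z-y_z)\cos\theta}{[|x-y|^2+2x_ry_r(1-\cos\theta)]^{3/2}}d\theta\,dy;$$ for all $\Phi\in C_c^\infty([0,T_0]\times\mathbb R^2_+)$ and $t\in[0,T_0]$, $$\int\Phi(t,\cdot)x_r\omega^\varepsilon(t,\cdot)\,dx-\int\Phi(0,\cdot)x_r\omega^\varepsilon_0\,dx=\int_0^t\!\!\int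 x_r\omega^\varepsilon\big(\partial_t\Phi+\tfrac1{|\ln\varepsilon|}u^\varepsilon\cdot\nabla\Phi\big)dx\,ds;$$ and $\omega^\varepsilon(t,X(t,x))=\omega_0^\varepsilon(x)$ for a.e. $x$, where $X$ is the flow of $u^\varepsilon/|\ln\varepsilon|$ on $\mathbb R^2_+$. The $i$-th blob $\omega_i^\varepsilon$ is defined by $\omega_i^\varepsilon(t,X(t,x))=\omega_{i,0}^\varepsilon(x)$. *Rectangles and exit time.* For $h_0>0$ put $\mathcal A_i^\varepsilon=\{x\in\mathbb R^2_+: |x_r-X_{i,0,r}^\varepsilon|\le d_0/\sqrt{|\ln\varepsilon|},\ |x_z-z^*|\le h_0\}$ and $$T_\varepsilon=\sup\{t\in[0,T_0]:\ \forall s\in[0,t],\ \forall i,\ \operatorname{supp}\omega_i^\varepsilon(s,\cdot)\subset\mathcal A_i^\varepsilon\}.$$ *Exterior field.* Let $F_i^\varepsilon(t,x)=\frac1{x_r}\sum_{j\ne i}\int_{\mathbb R^2_+}\nabla_x^\perp\mathcal G(x,y)\,y_r\omega_j^\varepsilon(t,y)\,dy$, where $\nabla^\perp=(-\partial_r,\partial_z)$,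 $\mathcal G(x,y)=-\frac1{2\pi}\sqrt{x_ry_r}\,F\big(\frac{|x-y|^2}{x_ry_r}\big)$ and $F(s)=\int_0^{\pi/2}\frac{\cos 2\theta}{\sqrt{\sin^2\theta+s/4}}\,d\theta$. **Proposition.** There is a constant $C^*>0$ depending only on $X^*$ such that, with $C'_F=\gamma C^*/d_0^2$, the following holds. (0) There is $\varepsilon_0>0$ depending only on $X^*,(Y_i),d_0,M_0$ such that, whenever $0<h_0\le 1$, for all $\varepsilon\in(0,\varepsilon_0]$, all $\gamma>0$, $T_0>0$, all data and solutions as above, every $i$, $t\in[0,T_\varepsilon]$ and $x,y\in\mathcal A_i^\varepsilon$: $|F_i^\varepsilon(t,x)-F_i^\varepsilon(t,y)|\le C'_F|\ln\varepsilon||x-y|$. (1) Let $0<h_0\le\min(r^*/240,1/2)$. For every positive function $\rho$ with $\rho(\varepsilon)\sqrt{|\ln\varepsilon|}\to0$ as $\varepsilon\to0^+$ there is $\varepsilon_\rho>0$, depending only on $\rho$, $h_0$ and the fixed data $X^*,(Y_i),d_0,\gamma,M_0$, such that for all $\varepsilon\in(0,\varepsilon_\rho]$, all $0<T_0\le 1/(24C'_F)$,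 all data and solutions as above, every $i$ and all $t\in[0,T_\varepsilon]$ there is an open set $\Omega_{\rho,i}^\varepsilon(t)\subset\mathbb R^2_+$ with $$\frac1\gamma\int_{\Omega_{\rho,i}^\varepsilon(t)}x_r\omega_i^\varepsilon(t,x)\,dx\ \ge\ 1-\frac{h_0}{r^*}\rho(\varepsilon)\ln|\ln\varepsilon|\qquad\text{and}\qquad \operatorname{diam}\Omega_{\rho,i}^\varepsilon(t)\le\varepsilon e^{120/\rho(\varepsilon)} .$$ (2) In particular, with $h_0$ and $T_0$ as in (1), for every $\eta>0$ and all sufficiently small $\varepsilon$ (depending only on $\eta$, $h_0$ and the fixed data), for every $i$ and $t\in[0,T_\varepsilon]$ there is an open set $\hat\Omega_i^\varepsilon(t)\subset\mathbb R^2_+$ with $$\frac1\gamma\int_{\hat\Omega_i^\varepsilon(t)}x_r\omega_i^\varepsilon(t,x)\,dx\ \ge\ 1-\frac{h_0}{r^*}\,\frac{120}{\eta}\,\frac{\ln|\ln\varepsilon|}{|\ln\varepsilon|}\qquad\text{and}\qquad \operatorname{diam}\hat\Omega_i^\varepsilon(t)\le\varepsilon^{1-\eta}.$$ -/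

import Mathlib

open Real Set Filter Topology MeasureTheory
open scoped ENNReal NNReal

noncomputable section

namespace VortexRings

/-- The Euclidean plane; a point `x` has axial coordinate `x_z = x 0` and radial coordinate
`x_r = x 1`. -/
abbrev Plane : Type := EuclideanSpace ℝ (Fin 2)

/-- The open half plane `ℝ²₊ = {(z, r) : r > 0}`. -/
def halfPlane : Set Plane := {x | 0 < x 1}

/-- Lebesgue measure on the half plane. -/
def halfVol : Measure Plane := volume.restrict halfPlane

/-- The (essential) support of a function on the half plane: `x` belongs to it iff the function
does not vanish almost everywhere on any neighbourhood of `x`. -/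
def essSupport (f : Plane → ℝ) : Set Plane :=
  {x | ∀ U ∈ 𝓝 x, halfVol (U ∩ Function.support f) ≠ 0}

/-! ### Axisymmetric Biot-Savart law and Green function -/

/-- The common denominator `[|x - y|² + 2 x_r y_r (1 - cos θ)]^{3/2}`. -/
def bsDenom (x y : Plane) (θ : ℝ) : ℝ :=
  (‖x - y‖ ^ 2 + 2 * x 1 * y 1 * (1 - cos θ)) ^ (3 / 2 : ℝ)

/-- The axisymmetric Biot-Savart law without swirl: the velocity `(u_z, u_r)` generated by the
potential vorticity `w`. -/
def biotSavart (w : Plane → ℝ) (x : Plane) : Plane :=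
  !₂[-(1 / (4 * π)) * ∫ y, (y 1) ^ 2 *
        (∫ θ in (-π)..π, w y * (x 1 * cos θ - y 1) / bsDenom x y θ) ∂halfVol,
     (1 / (4 * π)) * ∫ y, (y 1) ^ 2 *
        (∫ θ in (-π)..π, w y * ((x 0 - y 0) * cos θ) / bsDenom x y θ) ∂halfVol]

/-- `F(s) = ∫₀^{π/2} cos(2θ) / √(sin²θ + s/4) dθ`. -/
def greenProfile (s : ℝ) : ℝ :=
  ∫ θ in (0 : ℝ)..(π / 2), cos (2 * θ) / √(sin θ ^ 2 + s / 4)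

/-- The Green function `𝒢(x,y)` of `div (x_r⁻¹ ∇ ·)` on the half plane with zero boundary values. -/
def green (x y : Plane) : ℝ :=
  -(1 / (2 * π)) * √(x 1 * y 1) * greenProfile (‖x - y‖ ^ 2 / (x 1 * y 1))

/-- `∇^⊥ f = (-∂_r f, ∂_z f)`. -/
def gradPerp (f : Plane → ℝ) (x : Plane) : Plane :=
  !₂[-(fderiv ℝ f x (EuclideanSpace.single 1 1)), fderiv ℝ f x (EuclideanSpace.single 0 1)]

/-! ### Weak solutions in the logarithmic time scale -/

/-- `f ∈ L^∞([0,T]; L^p(ℝ²₊))`. -/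
def InLinftyLp (p : ℝ≥0∞) (T : ℝ) (f : ℝ → Plane → ℝ) : Prop :=
  AEStronglyMeasurable (Function.uncurry f) ((volume.restrict (Icc 0 T)).prod halfVol) ∧
  ∃ C : ℝ≥0, ∀ᵐ t ∂(volume.restrict (Icc 0 T)), eLpNorm (f t) p halfVol ≤ C

/-- `(ω, u)` is a weak solution on `[0,T]`, with initial datum `ω₀` and flow `X`, of the
axisymmetric Euler equations without swirl in the time scale `1 / |ln ε|`,
`∂_t ω + |ln ε|⁻¹ u · ∇ω = 0`, `div (x_r u) = 0`, `curl u = x_r ω`. -/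
structure IsWeakSolution (ε T : ℝ) (ω₀ : Plane → ℝ) (ω : ℝ → Plane → ℝ)
    (u : ℝ → Plane → Plane) (X : ℝ → Plane → Plane) : Prop where
  rω_L1 : InLinftyLp 1 T (fun t x => x 1 * ω t x)
  rω_Linfty : InLinftyLp ∞ T (fun t x => x 1 * ω t x)
  r2ω_L1 : InLinftyLp 1 T (fun t x => (x 1) ^ 2 * ω t x)
  ω_Linfty : InLinftyLp ∞ T ω
  u_Linfty : MemLp (Function.uncurry u) ∞ ((volume.restrict (Icc 0 T)).prod halfVol)
  /-- the velocity is given by the Biot-Savart law -/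
  velocity : ∀ t ∈ Icc 0 T, ∀ x ∈ halfPlane, u t x = biotSavart (ω t) x
  /-- the equation holds in the sense of distributions, for all test functions in
  `C_c^∞([0,T] × ℝ²₊)` (restrictions of smooth functions compactly supported in `ℝ × ℝ²₊`) -/
  weak : ∀ Φ : ℝ × Plane → ℝ, ContDiff ℝ ((⊤ : ℕ∞) : WithTop ℕ∞) Φ → HasCompactSupport Φ →
    tsupport Φ ⊆ univ ×ˢ halfPlane → ∀ t ∈ Icc 0 T,
      ∫ x, Φ (t, x) * (x 1 * ω t x) ∂halfVol - ∫ x, Φ (0, x) * (x 1 * ω₀ x) ∂halfVol =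
        ∫ s in (0 : ℝ)..t, ∫ x, x 1 * ω s x *
          fderiv ℝ Φ (s, x) ((1 : ℝ), (1 / |log ε|) • u s x) ∂halfVol
  /-- `X` is the flow of `u / |ln ε|` on the half plane -/
  flow_zero : ∀ x ∈ halfPlane, X 0 x = x
  flow_mem : ∀ t ∈ Icc 0 T, ∀ x ∈ halfPlane, X t x ∈ halfPlane
  flow_deriv : ∀ x ∈ halfPlane, ∀ t ∈ Icc 0 T,
    HasDerivWithinAt (fun s => X s x) ((1 / |log ε|) • u t (X t x)) (Icc 0 T) t
  /-- the potential vorticity is transported by the flow -/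
  transport : ∀ t ∈ Icc 0 T, ∀ᵐ x ∂halfVol, ω t (X t x) = ω₀ x

/-! ### The leapfrogging setting -/

/-- The initial centres `X_{i,0}^ε = X^* + Y_{i,0} / √|ln ε|`. -/
def initCenter {N : ℕ} (Xs : Plane) (Y : Fin N → Plane) (ε : ℝ) (i : Fin N) : Plane :=
  Xs + (1 / √|log ε|) • Y i

/-- `N` concentrated blobs, together with their evolution on `[0,T]`: initial blobs `ω_{i,0}` of
mass `γ > 0` concentrated at scale `ε`, the weak solution `(ω, u)` with flow `X` which they
generate, and the transported blobs `ω_i`. -/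
structure BlobFlow {N : ℕ} (Xs : Plane) (Y : Fin N → Plane) (γ M₀ ε T : ℝ) where
  /-- the initial blobs `ω_{i,0}^ε` -/
  blob₀ : Fin N → Plane → ℝ
  blob₀_meas : ∀ i, AEStronglyMeasurable (blob₀ i) halfVol
  blob₀_supp : ∀ i, essSupport (blob₀ i) ⊆ Metric.closedBall (initCenter Xs Y ε i) ε
  blob₀_nonneg : ∀ i, ∀ᵐ x ∂halfVol, 0 ≤ blob₀ i x
  blob₀_mass : ∀ i, ∫ x, x 1 * blob₀ i x ∂halfVol = γ
  blob₀_bound : ∀ᵐ x ∂halfVol, |∑ i, blob₀ i x| ≤ M₀ / ε ^ 2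
  /-- the potential vorticity `ω^ε` -/
  ω : ℝ → Plane → ℝ
  /-- the velocity `u^ε` -/
  u : ℝ → Plane → Plane
  /-- the flow -/
  X : ℝ → Plane → Plane
  isWeakSolution : IsWeakSolution ε T (fun x => ∑ i, blob₀ i x) ω u X
  /-- the transported blobs `ω_i^ε` -/
  blob : Fin N → ℝ → Plane → ℝ
  blob_transport : ∀ i, ∀ t ∈ Icc 0 T, ∀ᵐ x ∂halfVol, blob i t (X t x) = blob₀ i x

/-- `d₀ = ¼ min_{j ≠ k} |Y_{j,r} - Y_{k,r}|`. For a single blob the minimum is over the empty set,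
and `d₀` may be any positive number. -/
def IsSeparation {N : ℕ} (Y : Fin N → Plane) (d₀ : ℝ) : Prop :=
  0 < d₀ ∧
  (2 ≤ N → IsLeast {a : ℝ | ∃ j k : Fin N, j ≠ k ∧ a = (1 / 4) * |Y j 1 - Y k 1|} d₀)

/-- The rectangle `𝒜_ε^{r₀}(d, h₀) = {|r - r₀| ≤ d / √|ln ε|, |z - z^*| ≤ h₀}`. -/
def rect (Xs : Plane) (ε r₀ d h₀ : ℝ) : Set Plane :=
  {x | x ∈ halfPlane ∧ |x 1 - r₀| ≤ d / √|log ε| ∧ |x 0 - Xs 0| ≤ h₀}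

namespace BlobFlow

variable {N : ℕ} {Xs : Plane} {Y : Fin N → Plane} {γ M₀ ε T : ℝ}

/-- `T_ε`: the supremum of the times `t ∈ [0,T]` up to which the support of every blob stays in its
rectangle `𝒜_ε^{X_{i,0,r}^ε}(d₀, h₀)`. -/
def exitTime (S : BlobFlow Xs Y γ M₀ ε T) (d₀ h₀ : ℝ) : ℝ :=
  sSup {t : ℝ | t ∈ Icc 0 T ∧ ∀ s ∈ Icc 0 t, ∀ i : Fin N,
    essSupport (S.blob i s) ⊆ rect Xs ε (initCenter Xs Y ε i 1) d₀ h₀}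

/-- The exterior field `F_i^ε`, the velocity generated by the blobs `ω_j`, `j ≠ i`. -/
def exteriorField (S : BlobFlow Xs Y γ M₀ ε T) (i : Fin N) (t : ℝ) (x : Plane) : Plane :=
  (1 / x 1) • ∑ j ∈ Finset.univ.erase i,
    ∫ y, (y 1 * S.blob j t y) • gradPerp (fun x' => green x' y) x ∂halfVol

end BlobFlow

/-- `C'_F = γ C^* / d₀²`. -/
def lipConst (γ Cs d₀ : ℝ) : ℝ := γ * Cs / d₀ ^ 2

/-- `Cs > 0` is a constant `C^*` for the reference point `Xs`: for all configurations and all small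
`ε`, the exterior fields are Lipschitz with constant `C'_F |ln ε|`, `C'_F = γ C^* / d₀²`, on the
rectangles `𝒜_ε^{X_{i,0,r}^ε}(d₀, h₀)` up to the time `T_ε`. -/
def IsExteriorLipConst (Xs : Plane) (Cs : ℝ) : Prop :=
  0 < Cs ∧
  ∀ (N : ℕ) (Y : Fin N → Plane) (d₀ M₀ : ℝ), Function.Injective (fun j => Y j 1) →
    IsSeparation Y d₀ → 0 < M₀ →
    ∃ ε₀ > 0, ∀ ε ∈ Ioc 0 ε₀, ∀ γ > 0, ∀ h₀ ∈ Ioc (0 : ℝ) 1, ∀ T₀ > 0,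
      ∀ S : BlobFlow Xs Y γ M₀ ε T₀, ∀ i : Fin N, ∀ t ∈ Icc 0 (S.exitTime d₀ h₀),
        ∀ x ∈ rect Xs ε (initCenter Xs Y ε i 1) d₀ h₀,
        ∀ y ∈ rect Xs ε (initCenter Xs Y ε i 1) d₀ h₀,
          ‖S.exteriorField i t x - S.exteriorField i t y‖
            ≤ lipConst γ Cs d₀ * |log ε| * ‖x - y‖

end VortexRings

end

open Real Set Filter Topology MeasureTheory
open scoped ENNReal NNReal
noncomputable section
namespace VortexRings


/-! Write L = |log ε| and r = r^*. For part (0), points of two different blobs differ in height by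
at least |Y_i - Y_j|/(2√L), measured in radial components. The velocity of a vortex ring at radial
distance a has derivative of order 1/a². Each blob j thus contributes a Lipschitz constant of order
γL/(Y_i - Y_j)², and `sum_inv_sq_le` sums these independently of the number of blobs. This gives
`isExteriorLipConst`.

Parts (1) and (2) rest on a renormalised energy. For two points of one blob, at heights a, b and
squared distance A, the stream function is -√(ab)/(2π) log √A + O(1). Heights in a blob differ from
r by O(1/√L). Hence L/(4πr) ((a² + b²)/2 + r²) equals √(ab) L/(2π) + O(1), because the difference is
L/(4πr) times a sum of squares. The integrand `defect`, which is this quadratic term minus the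
stream function, is therefore √(ab)/(2π) log(√A/ε) + O(1). Its double integral over the blob bounds
the mean of |log(|x - y|/ε)|: the negative part of the logarithm is at most ε/|x - y|, whose
potential is bounded since the density is at most M₀/ε².

At time zero the energy is O(1), as the blob lies in a ball of radius ε. The self-interaction
conserves both the kinetic energy and ∫ x_r² ω, so it does not change the renormalised energy
(`integral_defectRate_self`, up to a regularisation error). The exterior field has size √L and
Lipschitz constant of order L, while the clock runs at speed 1/L. The radial coefficient in the
energy variation cancels to leading order (`NearRing.abs_radial_coeff_le`), so the exterior
contribution is at most a constant times 1 + |log(√A/ε)|. Gronwall's inequality gives a mean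
logarithmic distance bounded uniformly in ε (`BlobFlow.exists_logDist_bound`). Chebyshev's
inequality about a well chosen centre leaves mass of order ρ outside a ball of radius ε e^{120/ρ}/2,
and the factor log |log ε| eventually beats the constant.

The energy can be differentiated along trajectories only if the flow is measurable, injective and
preserves x_r dx. None of this is assumed; it is deduced from the Biot-Savart law. The velocity is
uniformly within O(√δ) of a field with Lipschitz constant O(1 + log(1/δ)). The Euler scheme with n
steps and δ = 1/n converges over short times, and each of its steps preserves x_r dx up to the
square of the small step Lipschitz constant (`perturb_ringVol`), so the defects vanish in the limit
(`IsVelocityFlow.map_extFlow`). -/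

/-! ### Cylindrical coordinates and integrals of radial kernels in ℝ³. -/

/-- The regularised squared distance in `ℝ³` between the points with cylindrical coordinates
`(x, 0)` and `(y, θ)`. -/
def den (δ : ℝ) (x y : Plane) (θ : ℝ) : ℝ :=
  ‖x - y‖ ^ 2 + δ ^ 2 + 2 * x 1 * y 1 * (1 - cos θ)

/-- The measure `dy dθ` on the half plane times the circle. -/
def cylMeasure : Measure (Plane × ℝ) := halfVol.prod (volume.restrict (Ioc (-π) π))

lemma norm_sub_sq_eq (x y : Plane) : ‖x - y‖ ^ 2 = (x 0 - y 0) ^ 2 + (x 1 - y 1) ^ 2 := by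
  rw [EuclideanSpace.norm_sq_eq]; simp [Fin.sum_univ_two]

lemma norm_sq_eq (x : Plane) : ‖x‖ ^ 2 = (x 0) ^ 2 + (x 1) ^ 2 := by
  rw [EuclideanSpace.norm_sq_eq]; simp [Fin.sum_univ_two]

lemma abs_apply_le_norm (x : Plane) (i : Fin 2) : |x i| ≤ ‖x‖ := by
  simpa using PiLp.norm_apply_le x i

lemma norm_le_abs_add (x : Plane) : ‖x‖ ≤ |x 0| + |x 1| := by
  have h := norm_sq_eq x
  nlinarith [norm_nonneg x, abs_nonneg (x 0), abs_nonneg (x 1), sq_abs (x 0), sq_abs (x 1)]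

lemma den_eq_source (δ : ℝ) (x y : Plane) (θ : ℝ) :
    den δ x y θ = δ ^ 2 + (x 0 - y 0) ^ 2 + (x 1 - y 1 * cos θ) ^ 2 + (y 1 * sin θ) ^ 2 := by
  rw [den, norm_sub_sq_eq]
  have := sin_sq_add_cos_sq θ
  linear_combination (-(y 1) ^ 2) * this

lemma den_eq_target (δ : ℝ) (x y : Plane) (θ : ℝ) :
    den δ x y θ = δ ^ 2 + (x 0 - y 0) ^ 2 + (x 1 * cos θ - y 1) ^ 2 + (x 1 * sin θ) ^ 2 := by
  rw [den, norm_sub_sq_eq]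
  have := sin_sq_add_cos_sq θ
  linear_combination (-(x 1) ^ 2) * this

lemma den_nonneg (δ : ℝ) (x y : Plane) (θ : ℝ) : 0 ≤ den δ x y θ := by
  rw [den_eq_source]; positivity

lemma den_pos {δ : ℝ} (hδ : 0 < δ) (x y : Plane) (θ : ℝ) : 0 < den δ x y θ := by
  rw [den_eq_source]; positivity

lemma den_eq_add (δ : ℝ) (x y : Plane) (θ : ℝ) : den δ x y θ = den 0 x y θ + δ ^ 2 := by
  simp only [den]; ring

/-- The coordinates of the plane as a measure preserving equivalence. -/
def planeEquiv : Plane ≃ᵐ ℝ × ℝ :=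
  (MeasurableEquiv.toLp 2 (Fin 2 → ℝ)).symm.trans MeasurableEquiv.finTwoArrow

lemma planeEquiv_apply (x : Plane) : planeEquiv x = (x 0, x 1) := rfl

lemma measurePreserving_planeEquiv : MeasurePreserving planeEquiv := by
  have h1 := (PiLp.volume_preserving_ofLp (Fin 2))
  exact (volume_preserving_finTwoArrow ℝ).comp h1

lemma planeEquiv_symm_apply (p : ℝ × ℝ) : planeEquiv.symm p = !₂[p.1, p.2] := by
  apply planeEquiv.injective
  rw [MeasurableEquiv.apply_symm_apply, planeEquiv_apply]; simp

lemma measurableSet_halfPlane : MeasurableSet halfPlane :=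
  measurableSet_lt measurable_const (by fun_prop)

lemma isOpen_halfPlane : IsOpen halfPlane :=
  isOpen_lt continuous_const (by fun_prop)

lemma lintegral_halfVol (f : Plane → ℝ≥0∞) :
    ∫⁻ x, f x ∂halfVol = ∫⁻ p in (univ : Set ℝ) ×ˢ Ioi (0 : ℝ), f !₂[p.1, p.2] := by
  have h : halfPlane = planeEquiv ⁻¹' (univ ×ˢ Ioi (0 : ℝ)) := by
    ext x; simp [planeEquiv_apply, halfPlane]
  rw [halfVol, h, ← measurePreserving_planeEquiv.setLIntegral_comp_preimage_emb
    planeEquiv.measurableEmbedding]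
  refine lintegral_congr fun x => ?_
  rw [← planeEquiv_symm_apply, MeasurableEquiv.symm_apply_apply]

instance : (volume : Measure (ℝ × ℝ × ℝ)).IsAddHaarMeasure :=
  Measure.prod.instIsAddHaarMeasure (volume : Measure ℝ) (volume : Measure (ℝ × ℝ))

/-- Polar coordinates in the last two variables: y_r dy dθ is Lebesgue measure on ℝ³, and `den 0` is
the squared Euclidean distance to the point (x_z, x_r, 0), which a translation moves to the origin.
Only an inequality holds because the norm of `ℝ × ℝ × ℝ` is the sup norm, which is smaller than the
Euclidean one. -/
lemma lintegral_cyl_le {f : ℝ → ℝ≥0∞} (hf : Antitone f) (x : Plane) :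
    ∫⁻ q, ENNReal.ofReal (q.1 1) * f √(den 0 x q.1 q.2) ∂cylMeasure ≤
      ∫⁻ Z : ℝ × ℝ × ℝ, f ‖Z‖ := by
  have hfm : Measurable f := hf.measurable
  have hm : Measurable fun q : Plane × ℝ =>
      ENNReal.ofReal (q.1 1) * f √(den 0 x q.1 q.2) := by
    have : Measurable fun q : Plane × ℝ => den 0 x q.1 q.2 := by
      unfold den; fun_prop
    fun_prop
  rw [cylMeasure, lintegral_prod _ hm.aemeasurable, lintegral_halfVol]
  rw [Measure.volume_eq_prod ℝ ℝ, ← Measure.prod_restrict, Measure.restrict_univ,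
    lintegral_prod]
  swap
  · have : Measurable fun p : ℝ × ℝ => ((!₂[p.1, p.2] : Plane)) := by fun_prop
    exact (hm.lintegral_prod_right'.comp this).aemeasurable
  rw [← lintegral_sub_left_eq_self (fun Z : ℝ × ℝ × ℝ => f ‖Z‖) ((x 0, x 1, 0) : ℝ × ℝ × ℝ)]
  rw [Measure.volume_eq_prod ℝ (ℝ × ℝ), lintegral_prod _ (by fun_prop)]
  refine lintegral_mono fun z => ?_
  rw [← lintegral_comp_polarCoord_symm, polarCoord_target, Measure.volume_eq_prod ℝ ℝ,
    ← Measure.prod_restrict, lintegral_prod _ (by fun_prop)]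
  refine lintegral_mono fun r => ?_
  rw [restrict_Ioo_eq_restrict_Ioc]
  refine lintegral_mono fun θ => ?_
  simp only [polarCoord_symm_apply, smul_eq_mul, den_eq_source]
  simp only [Matrix.cons_val_zero, Matrix.cons_val_one]
  gcongr
  apply hf
  rw [Prod.norm_def, Prod.norm_def]
  simp only [Prod.fst_sub, Prod.snd_sub, Real.norm_eq_abs]
  refine max_le ?_ (max_le ?_ ?_) <;> refine Real.abs_le_sqrt ?_ <;> ring_nf <;> nlinarith [sq_nonneg (x 0 - z), sq_nonneg (x 1 - r * cos θ), sq_nonneg (r * sin θ)]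

/-- Integration in spherical shells of the sup norm: 24 is the dimension 3 times the volume 8 of the
unit ball, which is a cube of side 2. -/
lemma lintegral_ball_norm_fin {f : ℝ → ℝ} (hf0 : ∀ r, 0 ≤ f r) {g : ℝ → ℝ} (hfm : Measurable f)
    (hg : IntegrableOn g (Ioo 0 1)) (hfg : ∀ r ∈ Ioo (0 : ℝ) 1, r ^ 2 * f r ≤ g r) :
    ∫⁻ Z : ℝ × ℝ × ℝ, ENNReal.ofReal ((Iio (1 : ℝ)).indicator f ‖Z‖) ≤
      ENNReal.ofReal (24 * ∫ r in Ioo (0 : ℝ) 1, g r) := by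
  have hint : IntegrableOn (fun r => r ^ 2 * f r) (Ioo 0 1) := by
    refine Integrable.mono' hg (by fun_prop) ?_
    filter_upwards [ae_restrict_mem measurableSet_Ioo] with r hr
    rw [Real.norm_of_nonneg (mul_nonneg (sq_nonneg _) (hf0 _))]
    exact hfg r hr
  have hdim : Module.finrank ℝ (ℝ × ℝ × ℝ) = 3 := by simp
  have hind : IntegrableOn (fun r => r ^ (3 - 1) • (Iio (1 : ℝ)).indicator f r) (Ioi 0) := by
    have : (fun r => r ^ (3 - 1) • (Iio (1 : ℝ)).indicator f r) =
        (Iio (1 : ℝ)).indicator (fun r => r ^ 2 * f r) := by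
      ext r; by_cases h : r ∈ Iio (1 : ℝ) <;> simp [h, indicator]
    rw [this, IntegrableOn, integrable_indicator_iff measurableSet_Iio, IntegrableOn,
      Measure.restrict_restrict measurableSet_Iio, inter_comm, Ioi_inter_Iio]
    exact hint
  have hvol : (volume : Measure (ℝ × ℝ × ℝ)).real (Metric.ball 0 1) = 8 := by
    have : Metric.ball (0 : ℝ × ℝ × ℝ) 1 =
        Metric.ball (0 : ℝ) 1 ×ˢ (Metric.ball (0 : ℝ) 1 ×ˢ Metric.ball (0 : ℝ) 1) := by
      rw [ball_prod_same, ball_prod_same]; rfl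
    rw [this, Measure.volume_eq_prod ℝ (ℝ × ℝ), Measure.real, Measure.prod_prod,
      Measure.volume_eq_prod ℝ ℝ, Measure.prod_prod, Real.volume_ball]
    rw [← ENNReal.ofReal_mul (by norm_num), ← ENNReal.ofReal_mul (by norm_num)]
    norm_num
  have hint3 : Integrable (fun Z : ℝ × ℝ × ℝ => (Iio (1 : ℝ)).indicator f ‖Z‖) := by
    rw [integrable_fun_norm_addHaar volume (f := (Iio (1 : ℝ)).indicator f), hdim]
    exact hind
  rw [← ofReal_integral_eq_lintegral_ofReal hint3
    (Eventually.of_forall fun Z => indicator_nonneg (fun r _ => hf0 r) _),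
    integral_fun_norm_addHaar volume, hdim, hvol]
  apply ENNReal.ofReal_le_ofReal
  simp only [nsmul_eq_mul, smul_eq_mul]
  have : ∫ y in Ioi (0 : ℝ), y ^ (3 - 1) * (Iio (1 : ℝ)).indicator f y =
      ∫ r in Ioo (0 : ℝ) 1, r ^ 2 * f r := by
    rw [← Ioi_inter_Iio, ← setIntegral_indicator measurableSet_Iio]
    refine integral_congr_ae (Eventually.of_forall fun r => ?_)
    by_cases h : r ∈ Iio (1 : ℝ) <;> simp [h, indicator]
  rw [this]
  have := setIntegral_mono_on hint hg measurableSet_Ioo hfg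
  norm_num
  linarith

/-- Potential vorticities with `|y_r w| ≤ M` and `∫ y_r² |w| ≤ M`. -/
structure Admissible (M : ℝ) (w : Plane → ℝ) : Prop where
  meas : AEStronglyMeasurable w halfVol
  bound : ∀ᵐ y ∂halfVol, |y 1 * w y| ≤ M
  mass : ∫⁻ y, ENNReal.ofReal ((y 1) ^ 2 * |w y|) ∂halfVol ≤ ENNReal.ofReal M

instance : IsFiniteMeasure (volume.restrict (Ioc (-π) π)) :=
  ⟨by simp⟩

lemma lintegral_cyl_mul_two_pi {f : Plane → ℝ≥0∞} (hf : AEMeasurable f halfVol) :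
    ∫⁻ q, f q.1 ∂cylMeasure = ENNReal.ofReal (2 * π) * ∫⁻ y, f y ∂halfVol := by
  rw [cylMeasure, lintegral_prod _ hf.comp_fst]
  simp only [lintegral_const, Measure.restrict_apply MeasurableSet.univ, univ_inter,
    Real.volume_Ioc]
  rw [lintegral_mul_const'' _ hf, mul_comm]
  congr 2; ring

lemma ae_cyl {p : Plane → Prop} (h : ∀ᵐ y ∂halfVol, p y) : ∀ᵐ q ∂cylMeasure, p q.1 :=
  Measure.quasiMeasurePreserving_fst.ae h

lemma aemeasurable_cyl {β : Type*} [MeasurableSpace β] {f : Plane → β}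
    (hf : AEMeasurable f halfVol) : AEMeasurable (fun q : Plane × ℝ => f q.1) cylMeasure :=
  hf.comp_fst

lemma ae_halfVol_pos : ∀ᵐ y ∂halfVol, 0 < y 1 := ae_restrict_mem measurableSet_halfPlane

/-- Split at distance 1. Nearby, one factor y_r is absorbed by y_r |w| ≤ M and the other is the
Jacobian of polar coordinates. Far away the kernel is at most `f 1` and the mass bound applies, with
a factor 2π from the angle. -/
lemma lintegral_cyl_source_le {M : ℝ} (hM : 0 < M) {w : Plane → ℝ} (hw : Admissible M w)
    {f : ℝ → ℝ} (hf0 : ∀ r, 0 ≤ f r) (hf : AntitoneOn f (Ioi 0)) (hfm : Measurable f) {g : ℝ → ℝ}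
    (hg : IntegrableOn g (Ioo 0 1)) (hfg : ∀ r ∈ Ioo (0 : ℝ) 1, r ^ 2 * f r ≤ g r) (x : Plane) :
    ∫⁻ q, ENNReal.ofReal ((q.1 1) ^ 2 * |w q.1| * f √(den 0 x q.1 q.2)) ∂cylMeasure ≤
      ENNReal.ofReal (M * (24 * (∫ r in Ioo (0 : ℝ) 1, g r) + 2 * π * f 1)) := by
  -- The value ⊤ at r ≤ 0 makes `F` antitone on the whole line, and makes the pointwise bound
  -- trivial where the distance vanishes, so no null set has to be removed there.
  set F : ℝ → ℝ≥0∞ := fun r =>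
    if r ≤ 0 then ⊤ else if r < 1 then ENNReal.ofReal (f r) else 0 with hF
  have hFanti : Antitone F := by
    intro a b hab
    simp only [hF]
    split_ifs with h1 h2 h3 h4 h5 h6 <;> first | exact le_top | exact zero_le | skip
    · linarith
    · linarith
    · exact ENNReal.ofReal_le_ofReal (hf (mem_Ioi.2 (by linarith)) (mem_Ioi.2 (by linarith)) hab)
    · linarith
  have hFint : ∫⁻ Z : ℝ × ℝ × ℝ, F ‖Z‖ ≤ ENNReal.ofReal (24 * ∫ r in Ioo (0 : ℝ) 1, g r) := by
    refine le_trans (le_of_eq (lintegral_congr_ae ?_)) (lintegral_ball_norm_fin hf0 hfm hg hfg)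
    have : ∀ᵐ Z : ℝ × ℝ × ℝ, Z ≠ 0 := by
      simp [ae_iff, measure_singleton]
    filter_upwards [this] with Z hZ
    have : ¬ ‖Z‖ ≤ 0 := by simpa using hZ
    by_cases h : ‖Z‖ < 1 <;> simp [hF, h, indicator, hZ]
  have key : ∀ᵐ q ∂cylMeasure,
      ENNReal.ofReal ((q.1 1) ^ 2 * |w q.1| * f √(den 0 x q.1 q.2)) ≤
        ENNReal.ofReal M * (ENNReal.ofReal (q.1 1) * F √(den 0 x q.1 q.2)) +
        ENNReal.ofReal (f 1) * ENNReal.ofReal ((q.1 1) ^ 2 * |w q.1|) := by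
    filter_upwards [ae_cyl hw.bound, ae_cyl ae_halfVol_pos] with q hq hq1
    have hρ := Real.sqrt_nonneg (den 0 x q.1 q.2)
    generalize √(den 0 x q.1 q.2) = ρ at hρ ⊢
    rw [abs_mul, abs_of_pos hq1] at hq
    rcases hρ.eq_or_lt with h0 | h0
    · have : F ρ = ⊤ := by simp [hF, ← h0]
      rw [this, ENNReal.mul_top (by simpa using hq1), ENNReal.mul_top (by simpa using hM)]
      simp
    · rcases lt_or_ge ρ 1 with h1 | h1
      · have : F ρ = ENNReal.ofReal (f ρ) := by simp [hF, h1, not_le.2 h0]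
        rw [this, ← ENNReal.ofReal_mul hq1.le, ← ENNReal.ofReal_mul hM.le]
        refine le_trans (ENNReal.ofReal_le_ofReal ?_) le_self_add
        have := hf0 ρ
        calc (q.1 1) ^ 2 * |w q.1| * f ρ = (q.1 1 * |w q.1|) * (q.1 1 * f ρ) := by ring
          _ ≤ M * (q.1 1 * f ρ) := by gcongr
      · rw [← ENNReal.ofReal_mul (hf0 1)]
        refine le_trans (ENNReal.ofReal_le_ofReal ?_) le_add_self
        rw [mul_comm]
        have := hf (mem_Ioi.2 one_pos) h0 h1
        gcongr
  have hwm : AEMeasurable (fun y : Plane => ENNReal.ofReal ((y 1) ^ 2 * |w y|)) halfVol := by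
    have := hw.meas.aemeasurable
    have : AEMeasurable (fun y : Plane => (y 1) ^ 2 * |w y|) halfVol := by
      refine AEMeasurable.mul (by fun_prop) ?_
      exact continuous_abs.measurable.comp_aemeasurable this
    exact this.ennreal_ofReal
  calc _ ≤ ∫⁻ q, (ENNReal.ofReal M * (ENNReal.ofReal (q.1 1) * F √(den 0 x q.1 q.2)) +
        ENNReal.ofReal (f 1) * ENNReal.ofReal ((q.1 1) ^ 2 * |w q.1|)) ∂cylMeasure :=
        lintegral_mono_ae key
    _ = ENNReal.ofReal M * (∫⁻ q, (ENNReal.ofReal (q.1 1) * F √(den 0 x q.1 q.2)) ∂cylMeasure) +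
        ENNReal.ofReal (f 1) * (ENNReal.ofReal (2 * π) *
          ∫⁻ y, ENNReal.ofReal ((y 1) ^ 2 * |w y|) ∂halfVol) := by
        rw [lintegral_add_right' _ (AEMeasurable.const_mul (aemeasurable_cyl hwm) _),
          lintegral_const_mul' _ _ ENNReal.ofReal_ne_top,
          lintegral_const_mul' _ _ ENNReal.ofReal_ne_top,
          ← lintegral_cyl_mul_two_pi hwm]
    _ ≤ ENNReal.ofReal M * ENNReal.ofReal (24 * ∫ r in Ioo (0 : ℝ) 1, g r) +
        ENNReal.ofReal (f 1) * (ENNReal.ofReal (2 * π) * ENNReal.ofReal M) := by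
        gcongr
        · exact (lintegral_cyl_le hFanti x).trans hFint
        · exact hw.mass
    _ = _ := by
        have hg0 : 0 ≤ ∫ r in Ioo (0 : ℝ) 1, g r := by
          refine setIntegral_nonneg measurableSet_Ioo fun r hr => le_trans ?_ (hfg r hr)
          exact mul_nonneg (sq_nonneg _) (hf0 r)
        have := hf0 1
        have hpi := pi_pos
        rw [← ENNReal.ofReal_mul hM.le, ← ENNReal.ofReal_mul (by positivity),
          ← ENNReal.ofReal_mul (hf0 1), ← ENNReal.ofReal_add (by positivity) (by positivity)]
        congr 1; ring

/-! ### The regularised Biot-Savart kernel and its derivative. -/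

lemma rpow_neg_three_halves {a : ℝ} (ha : 0 ≤ a) : a ^ (-(3 / 2) : ℝ) = (√a ^ 3)⁻¹ := by
  rw [Real.rpow_neg ha, Real.sqrt_eq_rpow, ← Real.rpow_natCast, ← Real.rpow_mul ha]
  norm_num

lemma rpow_neg_five_halves {a : ℝ} (ha : 0 ≤ a) : a ^ (-(5 / 2) : ℝ) = (√a ^ 5)⁻¹ := by
  rw [Real.rpow_neg ha, Real.sqrt_eq_rpow, ← Real.rpow_natCast, ← Real.rpow_mul ha]
  norm_num

/-- Integrand of the regularised Biot-Savart law. -/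
def kern (δ : ℝ) (x y : Plane) (θ : ℝ) : Plane :=
  (4 * π)⁻¹ • !₂[-(x 1 * cos θ - y 1) * den δ x y θ ^ (-(3 / 2) : ℝ),
    (x 0 - y 0) * cos θ * den δ x y θ ^ (-(3 / 2) : ℝ)]

/-- The linear form `(z, r) ↦ a z + b r`. -/
def linForm (a b : ℝ) : Plane →L[ℝ] ℝ :=
  a • EuclideanSpace.proj 0 + b • EuclideanSpace.proj 1

/-- The endomorphism of the plane with matrix `((a, b), (c, d))`. -/
def planeMap (a b c d : ℝ) : Plane →L[ℝ] Plane :=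
  (linForm a b).smulRight (EuclideanSpace.single 0 1) +
    (linForm c d).smulRight (EuclideanSpace.single 1 1)

@[simp] lemma linForm_apply (a b : ℝ) (v : Plane) : linForm a b v = a * v 0 + b * v 1 := by
  simp [linForm]

@[simp] lemma planeMap_apply_zero (a b c d : ℝ) (v : Plane) :
    planeMap a b c d v 0 = a * v 0 + b * v 1 := by
  simp [planeMap]

@[simp] lemma planeMap_apply_one (a b c d : ℝ) (v : Plane) :
    planeMap a b c d v 1 = c * v 0 + d * v 1 := by
  simp [planeMap]

lemma norm_planeMap_le {a b c d K : ℝ} (h1 : |a| ≤ K) (h2 : |b| ≤ K) (h3 : |c| ≤ K)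
    (h4 : |d| ≤ K) : ‖planeMap a b c d‖ ≤ 4 * K := by
  have hK : 0 ≤ K := (abs_nonneg _).trans h1
  refine ContinuousLinearMap.opNorm_le_bound _ (by positivity) fun v => ?_
  refine (norm_le_abs_add _).trans ?_
  rw [planeMap_apply_zero, planeMap_apply_one]
  have e0 := abs_apply_le_norm v 0
  have e1 := abs_apply_le_norm v 1
  calc _ ≤ (|a| * |v 0| + |b| * |v 1|) + (|c| * |v 0| + |d| * |v 1|) := by
        rw [← abs_mul, ← abs_mul, ← abs_mul, ← abs_mul]
        exact add_le_add (abs_add_le _ _) (abs_add_le _ _)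
    _ ≤ (K * ‖v‖ + K * ‖v‖) + (K * ‖v‖ + K * ‖v‖) := by gcongr
    _ = _ := by ring

/-- Derivative of `kern δ x y θ` with respect to `x`. -/
def kernDeriv (δ : ℝ) (x y : Plane) (θ : ℝ) : Plane →L[ℝ] Plane :=
  (4 * π)⁻¹ • planeMap
    (3 * (x 1 * cos θ - y 1) * (x 0 - y 0) * den δ x y θ ^ (-(5 / 2) : ℝ))
    (-cos θ * den δ x y θ ^ (-(3 / 2) : ℝ) +
      3 * (x 1 * cos θ - y 1) * (x 1 - y 1 * cos θ) * den δ x y θ ^ (-(5 / 2) : ℝ))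
    (cos θ * den δ x y θ ^ (-(3 / 2) : ℝ) -
      3 * (x 0 - y 0) ^ 2 * cos θ * den δ x y θ ^ (-(5 / 2) : ℝ))
    (-(3 * (x 0 - y 0) * cos θ * (x 1 - y 1 * cos θ) * den δ x y θ ^ (-(5 / 2) : ℝ)))

lemma hasFDerivAt_den (δ : ℝ) (x y : Plane) (θ : ℝ) :
    HasFDerivAt (fun x => den δ x y θ)
      (linForm (2 * (x 0 - y 0)) (2 * (x 1 - y 1 * cos θ))) x := by
  have h0 : HasFDerivAt (fun x : Plane => x 0) (EuclideanSpace.proj 0 : Plane →L[ℝ] ℝ) x :=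
    (EuclideanSpace.proj 0 : Plane →L[ℝ] ℝ).hasFDerivAt
  have h1 : HasFDerivAt (fun x : Plane => x 1) (EuclideanSpace.proj 1 : Plane →L[ℝ] ℝ) x :=
    (EuclideanSpace.proj 1 : Plane →L[ℝ] ℝ).hasFDerivAt
  have := ((((h0.sub_const (y 0)).pow 2).const_add (δ ^ 2)).add
    ((h1.sub_const (y 1 * cos θ)).pow 2)).add_const ((y 1 * sin θ) ^ 2)
  simp only [den_eq_source]
  refine this.congr_fderiv ?_
  ext v; simp [linForm]

lemma hasFDerivAt_kern {δ : ℝ} {x y : Plane} {θ : ℝ} (h : 0 < den δ x y θ) :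
    HasFDerivAt (fun x => kern δ x y θ) (kernDeriv δ x y θ) x := by
  have h0 : HasFDerivAt (fun x : Plane => x 0) (EuclideanSpace.proj 0 : Plane →L[ℝ] ℝ) x :=
    (EuclideanSpace.proj 0 : Plane →L[ℝ] ℝ).hasFDerivAt
  have h1 : HasFDerivAt (fun x : Plane => x 1) (EuclideanSpace.proj 1 : Plane →L[ℝ] ℝ) x :=
    (EuclideanSpace.proj 1 : Plane →L[ℝ] ℝ).hasFDerivAt
  have hD := (hasFDerivAt_den δ x y θ).rpow_const (p := -(3 / 2)) (Or.inl h.ne')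
  have e : (-(3 / 2) - 1 : ℝ) = -(5 / 2) := by norm_num
  rw [e] at hD
  have hz := (((h1.mul_const (cos θ)).sub_const (y 1)).neg).mul hD
  have hr := ((h0.sub_const (y 0)).mul_const (cos θ)).mul hD
  rw [← hasFDerivWithinAt_univ, hasFDerivWithinAt_euclidean]
  intro i
  rw [hasFDerivWithinAt_univ]
  fin_cases i
  · refine (hz.const_mul (4 * π)⁻¹).congr_fderiv ?_
    ext v; simp [kernDeriv]; ring
  · refine (hr.const_mul (4 * π)⁻¹).congr_fderiv ?_
    ext v; simp [kernDeriv]; ring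

lemma four_pi_inv_le : (4 * π)⁻¹ ≤ 1 / 12 := by
  rw [inv_eq_one_div]
  apply one_div_le_one_div_of_le <;> linarith [pi_gt_three]

/-- All factors in the numerators are bounded by the distance s in ℝ³, or by 1 for the cosine. Each
entry of the matrix is then at most 4/s³, its norm at most 16/s³, and 16/(4π) ≤ 2. -/
lemma norm_kernDeriv_le {δ : ℝ} {x y : Plane} {θ : ℝ} (h : 0 < den δ x y θ) :
    ‖kernDeriv δ x y θ‖ ≤ 2 * den δ x y θ ^ (-(3 / 2) : ℝ) := by
  rw [rpow_neg_three_halves h.le]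
  have h5 : den δ x y θ ^ (-(5 / 2) : ℝ) = (√(den δ x y θ) ^ 5)⁻¹ := rpow_neg_five_halves h.le
  have hs : √(den δ x y θ) ^ 2 = den δ x y θ := Real.sq_sqrt h.le
  have hs0 : 0 < √(den δ x y θ) := Real.sqrt_pos.2 h
  have h3 := rpow_neg_three_halves h.le
  set s := √(den δ x y θ)
  have e1 : |x 1 * cos θ - y 1| ≤ s := abs_le_of_sq_le_sq (by
    rw [hs, den_eq_target]; nlinarith [sq_nonneg δ, sq_nonneg (x 0 - y 0), sq_nonneg (x 1 * sin θ)]) hs0.le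
  have e2 : |x 1 - y 1 * cos θ| ≤ s := abs_le_of_sq_le_sq (by
    rw [hs, den_eq_source]; nlinarith [sq_nonneg δ, sq_nonneg (x 0 - y 0), sq_nonneg (y 1 * sin θ)]) hs0.le
  have e3 : |x 0 - y 0| ≤ s := abs_le_of_sq_le_sq (by
    rw [hs, den_eq_source]; nlinarith [sq_nonneg δ, sq_nonneg (x 1 - y 1 * cos θ), sq_nonneg (y 1 * sin θ)]) hs0.le
  have e4 : |cos θ| ≤ 1 := abs_cos_le_one θ
  have key : ∀ a b c : ℝ, |a| ≤ s → |b| ≤ s → |c| ≤ 1 → |3 * a * b * c * (s ^ 5)⁻¹| ≤ 3 * (s ^ 3)⁻¹ := by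
    intro a b c ha hb hc
    rw [abs_mul, abs_mul, abs_mul, abs_mul, abs_of_pos (by norm_num : (0 : ℝ) < 3),
      abs_of_pos (by positivity : 0 < (s ^ 5)⁻¹)]
    calc 3 * |a| * |b| * |c| * (s ^ 5)⁻¹ ≤ 3 * s * s * 1 * (s ^ 5)⁻¹ := by gcongr
      _ = 3 * (s ^ 3)⁻¹ := by field_simp
  have key2 : |cos θ * (s ^ 3)⁻¹| ≤ (s ^ 3)⁻¹ := by
    rw [abs_mul, abs_of_pos (by positivity : 0 < (s ^ 3)⁻¹)]
    exact mul_le_of_le_one_left (by positivity) e4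
  have hp : 0 < (s ^ 3)⁻¹ := by positivity
  rw [kernDeriv, norm_smul, Real.norm_of_nonneg (by positivity), h3, h5]
  have : ‖planeMap _ _ _ _‖ ≤ 4 * (4 * (s ^ 3)⁻¹) := norm_planeMap_le
    (a := 3 * (x 1 * cos θ - y 1) * (x 0 - y 0) * (s ^ 5)⁻¹)
    (b := -cos θ * (s ^ 3)⁻¹ + 3 * (x 1 * cos θ - y 1) * (x 1 - y 1 * cos θ) * (s ^ 5)⁻¹)
    (c := cos θ * (s ^ 3)⁻¹ - 3 * (x 0 - y 0) ^ 2 * cos θ * (s ^ 5)⁻¹)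
    (d := -(3 * (x 0 - y 0) * cos θ * (x 1 - y 1 * cos θ) * (s ^ 5)⁻¹))
    (by have := key _ _ 1 e1 e3 (by simp)
        rw [mul_one] at this; linarith)
    (by have := key _ _ 1 e1 e2 (by simp)
        rw [mul_one] at this
        rw [neg_mul, abs_le] at *
        constructor <;> linarith [this.1, this.2, key2.1, key2.2])
    (by have := key _ _ _ e3 e3 e4
        rw [show 3 * (x 0 - y 0) ^ 2 * cos θ * (s ^ 5)⁻¹ =
          3 * (x 0 - y 0) * (x 0 - y 0) * cos θ * (s ^ 5)⁻¹ by ring, abs_le] at *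
        constructor <;> linarith [this.1, this.2, key2.1, key2.2])
    (by have := key _ _ _ e3 e2 e4
        rw [show 3 * (x 0 - y 0) * cos θ * (x 1 - y 1 * cos θ) * (s ^ 5)⁻¹ =
          3 * (x 0 - y 0) * (x 1 - y 1 * cos θ) * cos θ * (s ^ 5)⁻¹ by ring, abs_neg]
        linarith)
  have h4 := four_pi_inv_le
  nlinarith [norm_nonneg (planeMap (3 * (x 1 * cos θ - y 1) * (x 0 - y 0) * (s ^ 5)⁻¹)
    (-cos θ * (s ^ 3)⁻¹ + 3 * (x 1 * cos θ - y 1) * (x 1 - y 1 * cos θ) * (s ^ 5)⁻¹)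
    (cos θ * (s ^ 3)⁻¹ - 3 * (x 0 - y 0) ^ 2 * cos θ * (s ^ 5)⁻¹)
    (-(3 * (x 0 - y 0) * cos θ * (x 1 - y 1 * cos θ) * (s ^ 5)⁻¹)))]

/-- The numerator vector of the kernel is at most the distance in `ℝ³`. -/
lemma norm_kern_num_le (x y : Plane) (θ : ℝ) :
    ‖(!₂[-(x 1 * cos θ - y 1), (x 0 - y 0) * cos θ] : Plane)‖ ≤ √(den 0 x y θ) := by
  apply Real.le_sqrt_of_sq_le
  rw [norm_sq_eq, den_eq_target]
  simp only [Matrix.cons_val_zero, Matrix.cons_val_one]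
  have : ((x 0 - y 0) * cos θ) ^ 2 ≤ (x 0 - y 0) ^ 2 := by
    rw [mul_pow]; exact mul_le_of_le_one_right (sq_nonneg _) (cos_sq_le_one θ)
  nlinarith [sq_nonneg (x 1 * sin θ)]

lemma kern_eq_smul (δ : ℝ) (x y : Plane) (θ : ℝ) :
    kern δ x y θ = ((4 * π)⁻¹ * den δ x y θ ^ (-(3 / 2) : ℝ)) •
      !₂[-(x 1 * cos θ - y 1), (x 0 - y 0) * cos θ] := by
  ext i; fin_cases i <;> simp [kern] <;> ring

lemma norm_kern_le (δ : ℝ) (x y : Plane) (θ : ℝ) :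
    ‖kern δ x y θ‖ ≤ (√(den 0 x y θ) ^ 2)⁻¹ := by
  have hn := norm_kern_num_le x y θ
  rw [kern_eq_smul, norm_smul]
  have hD := den_nonneg 0 x y θ
  -- At a coincidence point the numerator vanishes too, and the right-hand side is 0 by the
  -- convention for inverses.
  rcases hD.eq_or_lt with h0 | h0
  · rw [← h0, Real.sqrt_zero] at hn
    rw [le_antisymm hn (norm_nonneg _), mul_zero]; positivity
  have hle : den 0 x y θ ≤ den δ x y θ := by rw [den_eq_add δ]; linarith [sq_nonneg δ]
  rw [rpow_neg_three_halves (h0.trans_le hle).le]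
  have hs0 : 0 < √(den 0 x y θ) := Real.sqrt_pos.2 h0
  have hs := Real.sqrt_le_sqrt hle
  set s := √(den 0 x y θ)
  have h3 : (√(den δ x y θ) ^ 3)⁻¹ ≤ (s ^ 3)⁻¹ := by gcongr
  rw [Real.norm_of_nonneg (by positivity)]
  have h4 := four_pi_inv_le
  calc _ ≤ (1 * (s ^ 3)⁻¹) * s := by
        gcongr; linarith
    _ = (s ^ 2)⁻¹ := by field_simp

/-- With s the distance in ℝ³, the relative error of the cube is at most min(1, δ/s), hence at most
√(δ/s). The half power is a compromise: the resulting kernel s^{-5/2} is integrable in ℝ³, while the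
factor √δ still tends to zero. -/
lemma norm_kern_sub_le {δ : ℝ} (hδ : 0 < δ) (x y : Plane) (θ : ℝ) :
    ‖kern δ x y θ - kern 0 x y θ‖ ≤ √δ * (√(den 0 x y θ) ^ 2 * √√(den 0 x y θ))⁻¹ := by
  have hn := norm_kern_num_le x y θ
  rw [kern_eq_smul, kern_eq_smul, ← sub_smul, norm_smul]
  have hD := den_nonneg 0 x y θ
  rcases hD.eq_or_lt with h0 | h0
  · rw [← h0, Real.sqrt_zero] at hn
    rw [le_antisymm hn (norm_nonneg _), mul_zero]; positivity
  rw [rpow_neg_three_halves (den_nonneg _ _ _ _), rpow_neg_three_halves (den_nonneg _ _ _ _)]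
  have hs0 : 0 < √(den 0 x y θ) := Real.sqrt_pos.2 h0
  have hs2 : √(den 0 x y θ) ^ 2 = den 0 x y θ := Real.sq_sqrt h0.le
  have hde : den δ x y θ = √(den 0 x y θ) ^ 2 + δ ^ 2 := by rw [hs2, den_eq_add]
  rw [hde]
  set s := √(den 0 x y θ)
  set t := √(s ^ 2 + δ ^ 2) with ht
  have ht2 : t ^ 2 = s ^ 2 + δ ^ 2 := Real.sq_sqrt (by positivity)
  have ht0 : 0 < t := Real.sqrt_pos.2 (by positivity)
  have hst : s ≤ t := Real.le_sqrt_of_sq_le (by nlinarith [sq_nonneg δ])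
  have hinv : (t ^ 3)⁻¹ ≤ (s ^ 3)⁻¹ := by gcongr
  have key : (s ^ 3)⁻¹ - (t ^ 3)⁻¹ ≤ (s ^ 3)⁻¹ * (√δ / √s) := by
    have hq : √δ / √s = √(δ / s) := (Real.sqrt_div hδ.le s).symm
    rw [hq]
    have hst3 : (t ^ 3)⁻¹ = (s ^ 3)⁻¹ * (s / t) ^ 3 := by field_simp
    have h2 : 1 - (s / t) ^ 3 ≤ √(δ / s) := by
      have hq0 : 0 < δ / s := by positivity
      have h1t : s / t ≤ 1 := (div_le_one ht0).2 hst
      have h0t : 0 < s / t := by positivity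
      rcases le_total 1 (δ / s) with h1 | h1
      · have : 1 ≤ √(δ / s) := Real.one_le_sqrt.2 h1
        have : 0 < (s / t) ^ 3 := by positivity
        linarith
      · have hsq : δ / s ≤ √(δ / s) := Real.le_sqrt_of_sq_le (by nlinarith)
        refine le_trans ?_ hsq
        -- Passing to the fourth power replaces the cube by a rational function of δ/s.
        have h4 : (s / t) ^ 4 ≤ (s / t) ^ 3 := pow_le_pow_of_le_one h0t.le h1t (by norm_num)
        have h5 : (s / t) ^ 4 = 1 / (1 + (δ / s) ^ 2) ^ 2 := by
          have : (s / t) ^ 4 = (s ^ 2 / t ^ 2) ^ 2 := by rw [div_pow, div_pow]; ring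
          rw [this, ht2]; field_simp
        set q := δ / s
        have h6 : 1 - 1 / (1 + q ^ 2) ^ 2 ≤ q := by
          rw [sub_le_iff_le_add, ← sub_le_iff_le_add', le_div_iff₀ (by positivity)]
          nlinarith [sq_nonneg (q ^ 2 - q / 2), sq_nonneg (q - 4 / 7), mul_nonneg hq0.le (sq_nonneg (q ^ 2 - q / 2)), sq_nonneg (q*(q ^ 2 - q / 2)), sq_nonneg (q * (q - 4 / 7)), mul_nonneg hq0.le (sq_nonneg (q - 4 / 7))]
        linarith
    rw [hst3]
    have : 0 < (s ^ 3)⁻¹ := by positivity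
    nlinarith
  have habs : ‖(4 * π)⁻¹ * (t ^ 3)⁻¹ - (4 * π)⁻¹ * (√(s ^ 2 + 0 ^ 2) ^ 3)⁻¹‖ ≤ (s ^ 3)⁻¹ * (√δ / √s) := by
    rw [← mul_sub, norm_mul, Real.norm_of_nonneg (by positivity)]
    have : √(s ^ 2 + 0 ^ 2) = s := by simp [Real.sqrt_sq hs0.le]
    rw [this, Real.norm_eq_abs, abs_sub_comm, abs_of_nonneg (by linarith)]
    have h4 := four_pi_inv_le
    have : 0 ≤ (s ^ 3)⁻¹ - (t ^ 3)⁻¹ := by linarith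
    nlinarith
  have hs' : √(s ^ 2 + 0 ^ 2) = s := by simp [Real.sqrt_sq hs0.le]
  rw [hs'] at habs
  calc _ ≤ ((s ^ 3)⁻¹ * (√δ / √s)) * s := by gcongr
    _ = _ := by
      have : 0 < √s := Real.sqrt_pos.2 hs0
      field_simp

lemma measurable_kern (δ : ℝ) (x : Plane) :
    Measurable fun q : Plane × ℝ => kern δ x q.1 q.2 := by
  unfold kern den; fun_prop

lemma planeMap_eq_sum (a b c d : ℝ) : planeMap a b c d =
    a • planeMap 1 0 0 0 + b • planeMap 0 1 0 0 + c • planeMap 0 0 1 0 + d • planeMap 0 0 0 1 := by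
  ext v i; fin_cases i <;> simp

lemma measurable_kernDeriv (δ : ℝ) (x : Plane) :
    Measurable fun q : Plane × ℝ => kernDeriv δ x q.1 q.2 := by
  unfold kernDeriv den
  simp only [planeMap_eq_sum (_ * _)]
  fun_prop

/-- The regularised Biot-Savart law. -/
def bs (δ : ℝ) (w : Plane → ℝ) (x : Plane) : Plane :=
  ∫ q, ((q.1 1) ^ 2 * w q.1) • kern δ x q.1 q.2 ∂cylMeasure

/-- The derivative of the regularised Biot-Savart law. -/
def bsDeriv (δ : ℝ) (w : Plane → ℝ) (x : Plane) : Plane →L[ℝ] Plane :=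
  ∫ q, ((q.1 1) ^ 2 * w q.1) • kernDeriv δ x q.1 q.2 ∂cylMeasure

namespace Admissible

variable {M : ℝ} {w : Plane → ℝ}

lemma weight_meas (hw : Admissible M w) :
    AEStronglyMeasurable (fun q : Plane × ℝ => (q.1 1) ^ 2 * w q.1) cylMeasure := by
  have : AEStronglyMeasurable (fun q : Plane × ℝ => w q.1) cylMeasure := hw.meas.comp_fst
  exact AEStronglyMeasurable.mul (by fun_prop) this

lemma integrable_weight (hw : Admissible M w) :
    Integrable (fun q : Plane × ℝ => (q.1 1) ^ 2 * w q.1) cylMeasure := by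
  refine ⟨hw.weight_meas, ?_⟩
  have h1 : AEMeasurable (fun y : Plane => ENNReal.ofReal ((y 1) ^ 2 * |w y|)) halfVol := by
    have := hw.meas.aemeasurable
    have : AEMeasurable (fun y : Plane => (y 1) ^ 2 * |w y|) halfVol := by
      refine AEMeasurable.mul (by fun_prop) ?_
      exact continuous_abs.measurable.comp_aemeasurable this
    exact this.ennreal_ofReal
  rw [hasFiniteIntegral_iff_norm]
  simp only [norm_mul, Real.norm_eq_abs, abs_pow, sq_abs]
  rw [lintegral_cyl_mul_two_pi h1]
  exact ENNReal.mul_lt_top ENNReal.ofReal_lt_top (hw.mass.trans_lt ENNReal.ofReal_lt_top)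

/-- The basic estimate for integrals against radial kernels. -/
lemma norm_integral_le (hM : 0 < M) (hw : Admissible M w) {E : Type*} [NormedAddCommGroup E]
    [NormedSpace ℝ E] {k : Plane × ℝ → E} (hk : AEStronglyMeasurable k cylMeasure) {x : Plane}
    {f : ℝ → ℝ} (hkf : ∀ q, ‖k q‖ ≤ f √(den 0 x q.1 q.2)) (hf0 : ∀ r, 0 ≤ f r)
    (hf : AntitoneOn f (Ioi 0)) (hfm : Measurable f) {g : ℝ → ℝ}
    (hg : IntegrableOn g (Ioo 0 1)) (hfg : ∀ r ∈ Ioo (0 : ℝ) 1, r ^ 2 * f r ≤ g r) :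
    Integrable (fun q => ((q.1 1) ^ 2 * w q.1) • k q) cylMeasure ∧
    ∫ q, ‖((q.1 1) ^ 2 * w q.1) • k q‖ ∂cylMeasure ≤
      M * (24 * (∫ r in Ioo (0 : ℝ) 1, g r) + 2 * π * f 1) := by
  have hm : AEStronglyMeasurable (fun q => ((q.1 1) ^ 2 * w q.1) • k q) cylMeasure :=
    hw.weight_meas.smul hk
  have hle : ∫⁻ q, ENNReal.ofReal ‖((q.1 1) ^ 2 * w q.1) • k q‖ ∂cylMeasure ≤
      ENNReal.ofReal (M * (24 * (∫ r in Ioo (0 : ℝ) 1, g r) + 2 * π * f 1)) := by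
    refine le_trans (lintegral_mono fun q => ENNReal.ofReal_le_ofReal ?_)
      (lintegral_cyl_source_le hM hw hf0 hf hfm hg hfg x)
    rw [norm_smul, norm_mul, norm_pow, Real.norm_eq_abs, Real.norm_eq_abs, sq_abs]
    exact mul_le_mul_of_nonneg_left (hkf q) (by positivity)
  have hint : Integrable (fun q => ((q.1 1) ^ 2 * w q.1) • k q) cylMeasure :=
    ⟨hm, by rw [hasFiniteIntegral_iff_norm]; exact hle.trans_lt ENNReal.ofReal_lt_top⟩
  refine ⟨hint, ?_⟩
  have hg0 : 0 ≤ ∫ r in Ioo (0 : ℝ) 1, g r := by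
    refine setIntegral_nonneg measurableSet_Ioo fun r hr => le_trans ?_ (hfg r hr)
    exact mul_nonneg (sq_nonneg _) (hf0 r)
  have := hf0 1
  have hpi := pi_pos
  rw [integral_eq_lintegral_of_nonneg_ae (Eventually.of_forall fun _ => norm_nonneg _) hm.norm]
  exact ENNReal.toReal_le_of_le_ofReal (by positivity) hle

/-- The kernel s^{-2} cancels the Jacobian r² exactly, so the comparison function is 1 and the
constant is 24 + 2π ≤ 31. -/
lemma kern_integrable (hM : 0 < M) (hw : Admissible M w) (δ : ℝ) (x : Plane) :
    Integrable (fun q => ((q.1 1) ^ 2 * w q.1) • kern δ x q.1 q.2) cylMeasure ∧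
    ∫ q, ‖((q.1 1) ^ 2 * w q.1) • kern δ x q.1 q.2‖ ∂cylMeasure ≤ 31 * M := by
  have h := hw.norm_integral_le hM (measurable_kern δ x).aestronglyMeasurable (x := x)
    (f := fun r => (r ^ 2)⁻¹) (g := fun _ => 1) (fun q => norm_kern_le δ x q.1 q.2)
    (fun r => by positivity)
    (fun a ha b hb hab => by
      have : (0 : ℝ) < a := ha
      dsimp only; gcongr)
    (by fun_prop) (by simp)
    (fun r hr => by
      have := hr.1
      rw [mul_inv_cancel₀ (by positivity)])
  refine ⟨h.1, h.2.trans ?_⟩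
  simp
  nlinarith [pi_lt_d2]

lemma norm_bs_le (hM : 0 < M) (hw : Admissible M w) (δ : ℝ) (x : Plane) :
    ‖bs δ w x‖ ≤ 31 * M :=
  (norm_integral_le_integral_norm _).trans (hw.kern_integrable hM δ x).2

lemma norm_bs_sub_le (hM : 0 < M) (hw : Admissible M w) {δ : ℝ} (hδ : 0 < δ) (x : Plane) :
    ‖bs δ w x - bs 0 w x‖ ≤ 55 * M * √δ := by
  have hint : IntegrableOn (fun r : ℝ => r ^ (-(1 / 2) : ℝ)) (Ioo 0 1) := by
    have := intervalIntegral.intervalIntegrable_rpow' (a := 0) (b := 1)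
      (r := -(1 / 2)) (by norm_num)
    rw [intervalIntegrable_iff_integrableOn_Ioo_of_le zero_le_one] at this
    exact this
  have hval : ∫ r in Ioo (0 : ℝ) 1, r ^ (-(1 / 2) : ℝ) = 2 := by
    rw [← integral_Ioc_eq_integral_Ioo, ← intervalIntegral.integral_of_le zero_le_one,
      integral_rpow (Or.inl (by norm_num))]
    norm_num
  have h := hw.norm_integral_le hM
    ((measurable_kern δ x).sub (measurable_kern 0 x)).aestronglyMeasurable (x := x)
    (f := fun r => √δ * (r ^ 2 * √r)⁻¹) (g := fun r => √δ * r ^ (-(1 / 2) : ℝ))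
    (fun q => norm_kern_sub_le hδ x q.1 q.2)
    (fun r => by positivity)
    (fun a ha b hb hab => by
      have h0 : (0 : ℝ) < a := ha
      have : 0 < √a := Real.sqrt_pos.2 h0
      dsimp only; gcongr)
    (by fun_prop) (hint.const_mul _)
    (fun r hr => by
      have h0 := hr.1
      have : 0 < √r := Real.sqrt_pos.2 h0
      rw [Real.rpow_neg h0.le, ← Real.sqrt_eq_rpow]
      apply le_of_eq; field_simp)
  rw [bs, bs, ← integral_sub (hw.kern_integrable hM δ x).1 (hw.kern_integrable hM 0 x).1]
  rw [show ∫ q, _ ∂cylMeasure = _ from integral_congr_ae (Eventually.of_forall fun q =>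
    (smul_sub ((q.1 1) ^ 2 * w q.1) (kern δ x q.1 q.2) (kern 0 x q.1 q.2)).symm)]
  refine (norm_integral_le_integral_norm _).trans (h.2.trans ?_)
  rw [integral_const_mul, hval]
  simp only [one_pow, Real.sqrt_one, mul_one, inv_one]
  have h1 := Real.sqrt_pos.2 hδ
  have : 0 < M * √δ := by positivity
  nlinarith [pi_lt_d2]

/-- The derivative has the borderline singularity s^{-3}; cut off at δ it is compared with 4/(r +
δ), whose integral is logarithmic. Together with `norm_bs_sub_le` this plays the role of a
log-Lipschitz modulus: a field with Lipschitz constant of order 1 + log(1/δ) is uniformly √δ-close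
to the velocity. -/
lemma kernDeriv_integrable (hM : 0 < M) (hw : Admissible M w) {δ : ℝ} (hδ : 0 < δ) (hδ1 : δ ≤ 1)
    (x : Plane) :
    Integrable (fun q => ((q.1 1) ^ 2 * w q.1) • kernDeriv δ x q.1 q.2) cylMeasure ∧
    ∫ q, ‖((q.1 1) ^ 2 * w q.1) • kernDeriv δ x q.1 q.2‖ ∂cylMeasure ≤
      100 * M * (1 + log (1 / δ)) := by
  have hderiv : ∀ r ∈ uIcc (0 : ℝ) 1,
      HasDerivAt (fun r => 4 * log (r + δ)) (4 / (r + δ)) r := by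
    intro r hr
    rw [uIcc_of_le zero_le_one] at hr
    have := (((hasDerivAt_id' r).add_const δ).log (by linarith [hr.1])).const_mul 4
    exact this.congr_deriv (by ring)
  have hcont : ContinuousOn (fun r : ℝ => 4 / (r + δ)) (uIcc 0 1) := by
    rw [uIcc_of_le zero_le_one]
    refine ContinuousOn.div (by fun_prop) (by fun_prop) fun r hr => by linarith [hr.1]
  have hii : IntervalIntegrable (fun r : ℝ => 4 / (r + δ)) volume 0 1 :=
    hcont.intervalIntegrable
  have hval : ∫ r in Ioo (0 : ℝ) 1, 4 / (r + δ) ≤ 4 * (log 2 + log (1 / δ)) := by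
    rw [← integral_Ioc_eq_integral_Ioo, ← intervalIntegral.integral_of_le zero_le_one,
      intervalIntegral.integral_eq_sub_of_hasDerivAt hderiv hii]
    have : log (1 + δ) ≤ log 2 := Real.log_le_log (by linarith) (by linarith)
    rw [zero_add, one_div, Real.log_inv]; linarith
  rw [intervalIntegrable_iff_integrableOn_Ioo_of_le zero_le_one] at hii
  have h := hw.norm_integral_le hM (measurable_kernDeriv δ x).aestronglyMeasurable (x := x)
    (f := fun r => 2 * (√(r ^ 2 + δ ^ 2) ^ 3)⁻¹) (g := fun r => 4 / (r + δ))
    (fun q => by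
      refine (norm_kernDeriv_le (den_pos hδ _ _ _)).trans (le_of_eq ?_)
      rw [rpow_neg_three_halves (den_nonneg _ _ _ _), Real.sq_sqrt (den_nonneg _ _ _ _),
        ← den_eq_add])
    (fun r => by positivity)
    (fun a ha b hb hab => by
      have h0 : (0 : ℝ) < a := ha
      have : 0 < √(a ^ 2 + δ ^ 2) := Real.sqrt_pos.2 (by positivity)
      dsimp only; gcongr)
    (by fun_prop) hii
    (fun r hr => by
      have h0 := hr.1
      have h2 : 0 < √(r ^ 2 + δ ^ 2) := Real.sqrt_pos.2 (by positivity)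
      have h3 : r ^ 2 ≤ √(r ^ 2 + δ ^ 2) ^ 2 := by
        rw [Real.sq_sqrt (by positivity)]; nlinarith
      have h4 : (r + δ) / 2 ≤ √(r ^ 2 + δ ^ 2) :=
        Real.le_sqrt_of_sq_le (by nlinarith [sq_nonneg (r - δ), mul_pos h0 hδ])
      set s := √(r ^ 2 + δ ^ 2)
      calc r ^ 2 * (2 * (s ^ 3)⁻¹) ≤ s ^ 2 * (2 * (s ^ 3)⁻¹) := by gcongr
        _ = 2 / s := by field_simp
        _ ≤ 2 / ((r + δ) / 2) := by gcongr
        _ = 4 / (r + δ) := by field_simp; norm_num)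
  refine ⟨h.1, h.2.trans ?_⟩
  have hs : (√(1 ^ 2 + δ ^ 2) ^ 3)⁻¹ ≤ 1 := by
    apply inv_le_one_of_one_le₀
    apply one_le_pow₀
    exact Real.one_le_sqrt.2 (by nlinarith)
  have hl : 0 ≤ log (1 / δ) := Real.log_nonneg ((one_le_div hδ).2 hδ1)
  have hl2 := Real.log_two_lt_d9
  have : 24 * (∫ r in Ioo (0 : ℝ) 1, 4 / (r + δ)) + 2 * π * (2 * (√(1 ^ 2 + δ ^ 2) ^ 3)⁻¹) ≤
      100 * (1 + log (1 / δ)) := by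
    have h1 : 2 * π * (2 * (√(1 ^ 2 + δ ^ 2) ^ 3)⁻¹) ≤ 4 * π := by
      have := pi_pos
      nlinarith
    linarith [pi_lt_d2]
  calc _ ≤ M * (100 * (1 + log (1 / δ))) := by gcongr
    _ = _ := by ring

lemma norm_bsDeriv_le (hM : 0 < M) (hw : Admissible M w) {δ : ℝ} (hδ : 0 < δ) (hδ1 : δ ≤ 1)
    (x : Plane) : ‖bsDeriv δ w x‖ ≤ 100 * M * (1 + log (1 / δ)) :=
  (norm_integral_le_integral_norm _).trans (hw.kernDeriv_integrable hM hδ hδ1 x).2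

lemma hasFDerivAt_bs (hM : 0 < M) (hw : Admissible M w) {δ : ℝ} (hδ : 0 < δ) (x : Plane) :
    HasFDerivAt (bs δ w) (bsDeriv δ w x) x := by
  refine hasFDerivAt_integral_of_dominated_of_fderiv_le (s := univ)
    (F := fun x (q : Plane × ℝ) => ((q.1 1) ^ 2 * w q.1) • kern δ x q.1 q.2)
    (F' := fun x (q : Plane × ℝ) => ((q.1 1) ^ 2 * w q.1) • kernDeriv δ x q.1 q.2)
    (bound := fun (q : Plane × ℝ) => ‖(q.1 1) ^ 2 * w q.1‖ * (2 * (δ ^ 3)⁻¹)) univ_mem ?_ ?_ ?_ ?_ ?_ ?_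
  · exact Eventually.of_forall fun x =>
      hw.weight_meas.smul (measurable_kern δ x).aestronglyMeasurable
  · exact (hw.kern_integrable hM δ x).1
  · exact hw.weight_meas.smul (measurable_kernDeriv δ x).aestronglyMeasurable
  · refine Eventually.of_forall fun q x _ => ?_
    rw [norm_smul]
    have h := norm_kernDeriv_le (den_pos hδ x q.1 q.2)
    rw [rpow_neg_three_halves (den_nonneg _ _ _ _)] at h
    have h2 : δ ≤ √(den δ x q.1 q.2) := by
      apply Real.le_sqrt_of_sq_le
      rw [den_eq_add]; linarith [den_nonneg 0 x q.1 q.2]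
    have h3 : (√(den δ x q.1 q.2) ^ 3)⁻¹ ≤ (δ ^ 3)⁻¹ := by gcongr
    gcongr
    linarith
  · exact hw.integrable_weight.norm.mul_const _
  · exact Eventually.of_forall fun q x _ =>
      (hasFDerivAt_kern (den_pos hδ x q.1 q.2)).fun_const_smul _

end Admissible

/-! ### Weighted incompressibility and the original Biot-Savart law. -/

instance : SFinite halfVol := by unfold halfVol; infer_instance

lemma kern_zero_apply (δ : ℝ) (x y : Plane) (θ : ℝ) : kern δ x y θ 0 =
    (4 * π)⁻¹ * (-(x 1 * cos θ - y 1) * den δ x y θ ^ (-(3 / 2) : ℝ)) := by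
  simp [kern]

lemma kern_one_apply (δ : ℝ) (x y : Plane) (θ : ℝ) : kern δ x y θ 1 =
    (4 * π)⁻¹ * ((x 0 - y 0) * cos θ * den δ x y θ ^ (-(3 / 2) : ℝ)) := by
  simp [kern]

lemma hasDerivAt_den_angle (δ : ℝ) (x y : Plane) (θ : ℝ) :
    HasDerivAt (den δ x y) (2 * x 1 * y 1 * sin θ) θ := by
  have := (((hasDerivAt_cos θ).const_sub 1).const_mul (2 * x 1 * y 1)).const_add
    (‖x - y‖ ^ 2 + δ ^ 2)
  exact this.congr_deriv (by ring)

lemma continuous_den_angle (δ : ℝ) (x y : Plane) : Continuous (den δ x y) := by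
  unfold den; fun_prop

/-- Trace of the derivative of a planar vector field. -/
def planeTrace : (Plane →L[ℝ] Plane) →L[ℝ] ℝ :=
  (EuclideanSpace.proj 0 : Plane →L[ℝ] ℝ) ∘L
      ContinuousLinearMap.apply ℝ Plane (EuclideanSpace.single 0 1 : Plane) +
    (EuclideanSpace.proj 1 : Plane →L[ℝ] ℝ) ∘L
      ContinuousLinearMap.apply ℝ Plane (EuclideanSpace.single 1 1 : Plane)

lemma planeTrace_apply (L : Plane →L[ℝ] Plane) : planeTrace L =
    L (EuclideanSpace.single 0 1) 0 + L (EuclideanSpace.single 1 1) 1 := rfl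

/-- The kernel is divergence free for the weight `x_r`, after integration in the angle. -/
lemma integral_trace_kernDeriv {δ : ℝ} (hδ : 0 < δ) {x : Plane} (hx : x 1 ≠ 0) (y : Plane) :
    ∫ θ in Ioc (-π) π, (planeTrace (kernDeriv δ x y θ) + kern δ x y θ 1 / x 1) = 0 := by
  -- The weighted divergence is an exact θ-derivative, of a multiple of sin θ · D^{-3/2} with D the
  -- regularised squared distance; this vanishes at ±π.
  have hd : ∀ θ ∈ uIcc (-π) π, HasDerivAt
      (fun θ => (4 * π)⁻¹ * ((x 0 - y 0) / x 1 * (sin θ * den δ x y θ ^ (-(3 / 2) : ℝ))))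
      (planeTrace (kernDeriv δ x y θ) + kern δ x y θ 1 / x 1) θ := by
    intro θ _
    have h1 := (hasDerivAt_den_angle δ x y θ).rpow_const (p := -(3 / 2))
      (Or.inl (den_pos hδ x y θ).ne')
    have e : (-(3 / 2) - 1 : ℝ) = -(5 / 2) := by norm_num
    rw [e] at h1
    refine ((((hasDerivAt_sin θ).mul h1).const_mul ((x 0 - y 0) / x 1)).const_mul
      (4 * π)⁻¹).congr_deriv ?_
    rw [planeTrace_apply, kernDeriv, kern_one_apply]
    simp
    have := sin_sq_add_cos_sq θ
    have hs : sin θ ^ 2 = 1 - cos θ ^ 2 := by linarith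
    field_simp
    ring_nf
    rw [hs]; ring
  have hc : ContinuousOn (fun θ => planeTrace (kernDeriv δ x y θ) + kern δ x y θ 1 / x 1)
      (uIcc (-π) π) := by
    have hp := fun θ => (den_pos hδ x y θ).ne'
    have c1 : Continuous fun θ => den δ x y θ ^ (-(3 / 2) : ℝ) :=
      (continuous_den_angle δ x y).rpow_const fun θ => Or.inl (hp θ)
    have c2 : Continuous fun θ => den δ x y θ ^ (-(5 / 2) : ℝ) :=
      (continuous_den_angle δ x y).rpow_const fun θ => Or.inl (hp θ)
    apply Continuous.continuousOn
    simp only [planeTrace_apply, kernDeriv, kern_one_apply]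
    simp
    fun_prop
  rw [← intervalIntegral.integral_of_le (by linarith [pi_pos]),
    intervalIntegral.integral_eq_sub_of_hasDerivAt hd hc.intervalIntegrable]
  simp

namespace Admissible

variable {M : ℝ} {w : Plane → ℝ}

lemma bs_apply (hM : 0 < M) (hw : Admissible M w) (δ : ℝ) (x : Plane) (i : Fin 2) :
    bs δ w x i = ∫ q, (q.1 1) ^ 2 * w q.1 * kern δ x q.1 q.2 i ∂cylMeasure := by
  have := (EuclideanSpace.proj i : Plane →L[ℝ] ℝ).integral_comp_comm
    (hw.kern_integrable hM δ x).1
  simpa [bs] using this.symm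

lemma trace_bsDeriv (hM : 0 < M) (hw : Admissible M w) {δ : ℝ} (hδ : 0 < δ) (hδ1 : δ ≤ 1)
    {x : Plane} (hx : x 1 ≠ 0) : planeTrace (bsDeriv δ w x) + bs δ w x 1 / x 1 = 0 := by
  have i1 := (hw.kernDeriv_integrable hM hδ hδ1 x).1
  have i2 : Integrable (fun q => (q.1 1) ^ 2 * w q.1 * kern δ x q.1 q.2 1) cylMeasure := by
    simpa using (EuclideanSpace.proj 1 : Plane →L[ℝ] ℝ).integrable_comp
      (hw.kern_integrable hM δ x).1
  rw [bsDeriv, ← planeTrace.integral_comp_comm i1, hw.bs_apply hM, ← integral_div,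
    ← integral_add (planeTrace.integrable_comp i1) (i2.div_const _)]
  have i3 := (planeTrace.integrable_comp i1).add (i2.div_const (x 1))
  refine (integral_prod _ i3).trans ?_
  refine integral_eq_zero_of_ae (Eventually.of_forall fun y => ?_)
  simp only [Pi.add_apply, map_smul, smul_eq_mul, mul_div_assoc, ← mul_add, Pi.zero_apply]
  rw [integral_const_mul, integral_trace_kernDeriv hδ hx, mul_zero]

lemma biotSavart_eq (hM : 0 < M) (hw : Admissible M w) (x : Plane) :
    biotSavart w x = bs 0 w x := by
  have hden : ∀ y θ, bsDenom x y θ = (den 0 x y θ ^ (-(3 / 2) : ℝ))⁻¹ := by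
    intro y θ
    rw [Real.rpow_neg (den_nonneg _ _ _ _), inv_inv, bsDenom, den]; simp
  have hpi : -π ≤ π := by linarith [pi_pos]
  ext i
  have hi : Integrable (fun q => (q.1 1) ^ 2 * w q.1 * kern 0 x q.1 q.2 i) cylMeasure := by
    simpa using (EuclideanSpace.proj i : Plane →L[ℝ] ℝ).integrable_comp
      (hw.kern_integrable hM 0 x).1
  rw [hw.bs_apply hM, cylMeasure, integral_prod _ hi]
  fin_cases i
  · simp only [biotSavart, Fin.zero_eta, PiLp.toLp_apply, Matrix.cons_val_zero]
    rw [← integral_const_mul]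
    refine integral_congr_ae (Eventually.of_forall fun y => ?_)
    simp only [intervalIntegral.integral_of_le hpi]
    rw [← integral_const_mul, ← integral_const_mul]
    refine integral_congr_ae (Eventually.of_forall fun θ => ?_)
    simp only [hden, kern_zero_apply, div_inv_eq_mul]; field_simp
  · simp only [biotSavart, Fin.mk_one, PiLp.toLp_apply, Matrix.cons_val_one]
    rw [← integral_const_mul]
    refine integral_congr_ae (Eventually.of_forall fun y => ?_)
    simp only [intervalIntegral.integral_of_le hpi]
    rw [← integral_const_mul, ← integral_const_mul]
    refine integral_congr_ae (Eventually.of_forall fun θ => ?_)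
    simp only [hden, kern_one_apply, div_inv_eq_mul]; field_simp

end Admissible

/-! ### Almost preservation of x_r dx by small perturbations of the identity. -/

/-- The measure `x_r dx` on the half plane. -/
def ringVol : Measure Plane := halfVol.withDensity fun x => ENNReal.ofReal (x 1)

lemma det_plane (L : Plane →L[ℝ] Plane) : L.det =
    L (EuclideanSpace.single 0 1) 0 * L (EuclideanSpace.single 1 1) 1 -
      L (EuclideanSpace.single 1 1) 0 * L (EuclideanSpace.single 0 1) 1 := by
  have := LinearMap.det_toMatrix (EuclideanSpace.basisFun (Fin 2) ℝ).toBasis (L : Plane →ₗ[ℝ] Plane)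
  rw [ContinuousLinearMap.det, ← this, Matrix.det_fin_two]
  simp [LinearMap.toMatrix_apply]

lemma abs_apply_single_le (L : Plane →L[ℝ] Plane) (i j : Fin 2) :
    |L (EuclideanSpace.single i 1) j| ≤ ‖L‖ := by
  refine (abs_apply_le_norm _ j).trans ?_
  simpa using L.le_opNorm (EuclideanSpace.single i (1 : ℝ))

lemma ringVol_apply_image {Φ : Plane → Plane} {Φ' : Plane → Plane →L[ℝ] Plane}
    (hΦ : ∀ x, HasFDerivAt Φ (Φ' x) x) (hinj : Function.Injective Φ) {A : Set Plane}
    (hA : MeasurableSet A) (hAH : A ⊆ halfPlane) (hmaps : MapsTo Φ halfPlane halfPlane) :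
    ringVol (Φ '' A) = ∫⁻ x in A, ENNReal.ofReal (|(Φ' x).det| * Φ x 1) := by
  have hcont : Continuous Φ := continuous_iff_continuousAt.2 fun x => (hΦ x).continuousAt
  have hmeas : MeasurableSet (Φ '' A) :=
    hA.image_of_continuousOn_injOn hcont.continuousOn hinj.injOn
  have hsub : Φ '' A ⊆ halfPlane := (image_mono hAH).trans hmaps.image_subset
  rw [ringVol, withDensity_apply _ hmeas, halfVol, Measure.restrict_restrict hmeas,
    inter_eq_self_of_subset_left hsub,
    lintegral_image_eq_lintegral_abs_det_fderiv_mul volume hA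
      (fun x _ => (hΦ x).hasFDerivWithinAt) hinj.injOn]
  refine lintegral_congr fun x => ?_
  rw [ENNReal.ofReal_mul (abs_nonneg _)]

lemma ringVol_apply {A : Set Plane} (hA : MeasurableSet A) (hAH : A ⊆ halfPlane) :
    ringVol A = ∫⁻ x in A, ENNReal.ofReal (x 1) := by
  rw [ringVol, withDensity_apply _ hA, halfVol, Measure.restrict_restrict hA,
    inter_eq_self_of_subset_left hAH]

lemma ringVol_inter (A : Set Plane) : ringVol (A ∩ halfPlane) = ringVol A := by
  have h : ringVol.restrict halfPlane = ringVol := by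
    rw [ringVol, restrict_withDensity measurableSet_halfPlane, halfVol,
      Measure.restrict_restrict measurableSet_halfPlane, inter_self]
  conv_rhs => rw [← h, Measure.restrict_apply' measurableSet_halfPlane]

/-- A small perturbation of the identity by a field which is divergence free for the weight `x_r`
almost preserves the measure `x_r dx`. -/
lemma perturb_ringVol {v : Plane → Plane} {v' : Plane → Plane →L[ℝ] Plane} {κ : ℝ}
    (hv : ∀ x, HasFDerivAt v (v' x) x) (hκ : ∀ x, ‖v' x‖ ≤ κ) (hκ1 : κ ≤ 1 / 8)
    (htr : ∀ x : Plane, 0 < x 1 → planeTrace (v' x) + v x 1 / x 1 = 0) :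
    Measurable (fun x => x + v x) ∧ MapsTo (fun x => x + v x) halfPlane halfPlane ∧
    ringVol.map (fun x => x + v x) ≤ ENNReal.ofReal (1 + 20 * κ ^ 2) • ringVol ∧
    ringVol ≤ ENNReal.ofReal (1 + 20 * κ ^ 2) • ringVol.map (fun x => x + v x) := by
  have hκ0 : 0 ≤ κ := (norm_nonneg _).trans (hκ 0)
  set Φ : Plane → Plane := fun x => x + v x with hΦdef
  have hΦ : ∀ x, HasFDerivAt Φ (ContinuousLinearMap.id ℝ Plane + v' x) x :=
    fun x => (hasFDerivAt_id x).add (hv x)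
  have hcont : Continuous Φ := continuous_iff_continuousAt.2 fun x => (hΦ x).continuousAt
  have hlip : ∀ x y, ‖v x - v y‖ ≤ κ * ‖x - y‖ := fun x y =>
    convex_univ.norm_image_sub_le_of_norm_hasFDerivWithin_le
      (fun z _ => (hv z).hasFDerivWithinAt) (fun z _ => hκ z) (mem_univ y) (mem_univ x)
  have happ : ApproximatesLinearOn Φ ((ContinuousLinearEquiv.refl ℝ Plane : Plane →L[ℝ] Plane))
      univ κ.toNNReal := by
    intro x _ y _
    have : Φ x - Φ y - (x - y) = v x - v y := by simp only [hΦdef]; abel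
    simpa [this, Real.coe_toNNReal κ hκ0] using hlip x y
  have hc : Subsingleton Plane ∨ κ.toNNReal <
      ‖((ContinuousLinearEquiv.refl ℝ Plane).symm : Plane →L[ℝ] Plane)‖₊⁻¹ := by
    right
    have : ‖((ContinuousLinearEquiv.refl ℝ Plane).symm : Plane →L[ℝ] Plane)‖₊ = 1 := by
      apply NNReal.eq
      simp
    rw [this, inv_one, ← NNReal.coe_lt_coe, Real.coe_toNNReal κ hκ0, NNReal.coe_one]
    linarith
  have hinj : Function.Injective Φ := injOn_univ.1 (happ.injOn hc)
  have hsurj : Function.Surjective Φ := happ.surjective hc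
  -- Weighted incompressibility expresses v_r as x_r times a trace, so the radial component is
  -- automatically small near the axis and the map cannot cross it.
  have hv1 : ∀ x : Plane, 0 < x 1 → |v x 1| ≤ 2 * κ * x 1 := by
    intro x hx
    have h1 := htr x hx
    have h2 : v x 1 = -planeTrace (v' x) * x 1 := by
      field_simp at h1; linarith
    rw [h2, abs_mul, abs_neg, abs_of_pos hx, planeTrace_apply]
    gcongr
    have a := abs_apply_single_le (v' x) 0 0
    have b := abs_apply_single_le (v' x) 1 1
    have := hκ x
    exact (abs_add_le _ _).trans (by linarith)
  have haxis : ∀ p : Plane, p 1 = 0 → v p 1 = 0 := by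
    intro p hp
    have : ∀ r > 0, |v p 1| ≤ 0 + r := by
      intro r hr
      have hr1 : (p + EuclideanSpace.single 1 r : Plane) 1 = r := by simp [hp]
      have h1 := hv1 (p + EuclideanSpace.single 1 r) (by rw [hr1]; exact hr)
      have h2 := (abs_apply_le_norm (v p - v (p + EuclideanSpace.single 1 r)) 1).trans (hlip _ _)
      simp only [sub_add_cancel_left, norm_neg, PiLp.norm_single, Real.norm_eq_abs,
        abs_of_pos hr, PiLp.sub_apply] at h2
      rw [hr1] at h1
      have h3 := abs_sub_abs_le_abs_sub (v p 1) (v (p + EuclideanSpace.single 1 r) 1)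
      nlinarith
    exact abs_nonpos_iff.1 (le_of_forall_pos_le_add this)
  have hmaps : MapsTo Φ halfPlane halfPlane := by
    intro x hx
    have hx : 0 < x 1 := hx
    have := abs_le.1 (hv1 x hx)
    show 0 < (x + v x) 1
    rw [PiLp.add_apply]
    nlinarith
  have hpre : ∀ x, Φ x ∈ halfPlane → x ∈ halfPlane := by
    intro x hx
    by_contra hn
    have hx : 0 < (x + v x) 1 := hx
    have hn : x 1 ≤ 0 := not_lt.1 hn
    have h1 := haxis (x - EuclideanSpace.single 1 (x 1)) (by simp)
    have h2 := (abs_apply_le_norm (v x - v (x - EuclideanSpace.single 1 (x 1))) 1).trans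
      (hlip _ _)
    simp only [sub_sub_cancel, PiLp.norm_single, Real.norm_eq_abs,
      abs_of_nonpos hn, PiLp.sub_apply, h1, sub_zero] at h2
    rw [PiLp.add_apply] at hx
    have := abs_le.1 h2
    nlinarith
  -- With t the trace and D the determinant of `v'`, the Jacobian is 1 + t + D and the new height is
  -- (1 - t) x_r. The first order terms cancel in the product, and only O(κ²) remains. This
  -- quadratic defect is what survives the iteration over many Euler steps.
  have hJ : ∀ x ∈ halfPlane, (1 - 10 * κ ^ 2) * x 1 ≤
      |(ContinuousLinearMap.id ℝ Plane + v' x).det| * Φ x 1 ∧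
      |(ContinuousLinearMap.id ℝ Plane + v' x).det| * Φ x 1 ≤ (1 + 10 * κ ^ 2) * x 1 := by
    intro x hx
    have hx : 0 < x 1 := hx
    have h1 := htr x hx
    have h2 : v x 1 = -planeTrace (v' x) * x 1 := by
      field_simp at h1; linarith
    have hd : (ContinuousLinearMap.id ℝ Plane + v' x).det =
        1 + planeTrace (v' x) + (v' x).det := by
      rw [det_plane, det_plane, planeTrace_apply]; simp; ring
    have hΦ1 : Φ x 1 = (1 - planeTrace (v' x)) * x 1 := by
      simp only [hΦdef, PiLp.add_apply, h2]; ring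
    have a := (abs_apply_single_le (v' x) 0 0).trans (hκ x)
    have b := (abs_apply_single_le (v' x) 1 1).trans (hκ x)
    have c := (abs_apply_single_le (v' x) 0 1).trans (hκ x)
    have d := (abs_apply_single_le (v' x) 1 0).trans (hκ x)
    have ht : |planeTrace (v' x)| ≤ 2 * κ := by
      rw [planeTrace_apply]; exact (abs_add_le _ _).trans (by linarith)
    have hdet : |(v' x).det| ≤ 2 * κ ^ 2 := by
      rw [det_plane]
      refine (abs_sub _ _).trans ?_
      rw [abs_mul, abs_mul]
      have := mul_le_mul a b (abs_nonneg _) hκ0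
      have := mul_le_mul d c (abs_nonneg _) hκ0
      nlinarith
    rw [hd, hΦ1]
    set t := planeTrace (v' x)
    set D := (v' x).det
    have ht' := abs_le.1 ht
    have hD' := abs_le.1 hdet
    have hpos : 0 ≤ 1 + t + D := by nlinarith
    rw [abs_of_nonneg hpos]
    have e : (1 + t + D) * ((1 - t) * x 1) = (1 - t ^ 2 + D * (1 - t)) * x 1 := by ring
    rw [e]
    have ht2 : t ^ 2 ≤ 4 * κ ^ 2 := by nlinarith [abs_nonneg t, sq_abs t]
    have hDt : |D * (1 - t)| ≤ 2 * κ ^ 2 * 2 := by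
      rw [abs_mul]
      gcongr
      exact abs_le.2 ⟨by linarith, by linarith⟩
    have hDt' := abs_le.1 hDt
    constructor
    · exact mul_le_mul_of_nonneg_right (by nlinarith) hx.le
    · exact mul_le_mul_of_nonneg_right (by nlinarith [sq_nonneg t]) hx.le
  have himage : ∀ A, MeasurableSet A → A ⊆ halfPlane →
      ENNReal.ofReal (1 - 10 * κ ^ 2) * ringVol A ≤ ringVol (Φ '' A) ∧
      ringVol (Φ '' A) ≤ ENNReal.ofReal (1 + 10 * κ ^ 2) * ringVol A := by
    intro A hA hAH
    rw [ringVol_apply_image hΦ hinj hA hAH hmaps, ringVol_apply hA hAH,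
      ← lintegral_const_mul' _ _ ENNReal.ofReal_ne_top,
      ← lintegral_const_mul' _ _ ENNReal.ofReal_ne_top]
    constructor
    · refine setLIntegral_mono' hA fun x hx => ?_
      rw [← ENNReal.ofReal_mul (by nlinarith)]
      exact ENNReal.ofReal_le_ofReal (hJ x (hAH hx)).1
    · refine setLIntegral_mono' hA fun x hx => ?_
      rw [← ENNReal.ofReal_mul (by positivity)]
      exact ENNReal.ofReal_le_ofReal (hJ x (hAH hx)).2
  have himpre : ∀ B, MeasurableSet B → Φ '' (Φ ⁻¹' B ∩ halfPlane) = B ∩ halfPlane := by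
    intro B _
    ext y
    constructor
    · rintro ⟨x, ⟨hx, hxH⟩, rfl⟩; exact ⟨hx, hmaps hxH⟩
    · rintro ⟨hy, hyH⟩
      obtain ⟨x, rfl⟩ := hsurj y
      exact ⟨x, ⟨hy, hpre x hyH⟩, rfl⟩
  refine ⟨hcont.measurable, hmaps, ?_, ?_⟩
  · refine Measure.le_iff.2 fun B hB => ?_
    rw [Measure.map_apply hcont.measurable hB, Measure.smul_apply, smul_eq_mul,
      ← ringVol_inter, ← ringVol_inter B, ← himpre B hB]
    have h := (himage _ ((hcont.measurable hB).inter measurableSet_halfPlane)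
      inter_subset_right).1
    refine le_trans ?_ (mul_le_mul_right h _)
    rw [← mul_assoc, ← ENNReal.ofReal_mul (by positivity)]
    refine le_mul_of_one_le_left zero_le (ENNReal.one_le_ofReal.2 ?_)
    -- For κ² this small, (1 + 20κ²)(1 - 10κ²) ≥ 1, which turns the lower Jacobian bound into the
    -- upper bound for the pushforward.
    have hk : κ ^ 2 ≤ 1 / 64 := by nlinarith
    nlinarith [mul_nonneg (sq_nonneg κ) (sub_nonneg.2 hk)]
  · refine Measure.le_iff.2 fun B hB => ?_
    rw [Measure.smul_apply, Measure.map_apply hcont.measurable hB, smul_eq_mul,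
      ← ringVol_inter, ← ringVol_inter (Φ ⁻¹' B), ← himpre B hB]
    have h := (himage _ ((hcont.measurable hB).inter measurableSet_halfPlane)
      inter_subset_right).2
    refine h.trans ?_
    gcongr
    norm_num

/-! ### Time averages of the vorticity. -/

/-- Fubini for null sets needs a measurable set, so the statement is proved for a measurable
representative and transferred back. -/
lemma ae_prod_of_ae_ae {α β E : Type*} [MeasurableSpace α] [MeasurableSpace β]
    [TopologicalSpace E] [TopologicalSpace.PseudoMetrizableSpace E] [MeasurableSpace E]
    [BorelSpace E] {μ : Measure α} {ν : Measure β} [SFinite μ] [SFinite ν] {f : α × β → E}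
    (hf : AEStronglyMeasurable f (μ.prod ν)) {S : Set E} (hS : MeasurableSet S)
    (h : ∀ᵐ x ∂μ, ∀ᵐ y ∂ν, f (x, y) ∈ S) : ∀ᵐ z ∂μ.prod ν, f z ∈ S := by
  have h1 := Measure.ae_ae_of_ae_prod hf.ae_eq_mk
  have h2 : ∀ᵐ z ∂μ.prod ν, hf.mk f z ∈ S := by
    refine (Measure.ae_prod_mem_iff_ae_ae_mem (s := hf.mk f ⁻¹' S)
      (hf.stronglyMeasurable_mk.measurable hS)).2 ?_
    filter_upwards [h, h1] with x hx hx1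
    filter_upwards [hx, hx1] with y hy hy1
    rw [mem_preimage, ← hy1]; exact hy
  filter_upwards [h2, hf.ae_eq_mk] with z hz hz1
  rwa [hz1]

lemma ae_ae_swap {α β : Type*} [MeasurableSpace α] [MeasurableSpace β]
    {μ : Measure α} {ν : Measure β} [SFinite μ] [SFinite ν] {p : α × β → Prop}
    (h : ∀ᵐ z ∂μ.prod ν, p z) : ∀ᵐ y ∂ν, ∀ᵐ x ∂μ, p (x, y) := by
  have : ∀ᵐ z ∂ν.prod μ, p z.swap :=
    (Measure.measurePreserving_swap (μ := ν) (ν := μ)).quasiMeasurePreserving.ae h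
  exact Measure.ae_ae_of_ae_prod this

instance : SFinite cylMeasure := by unfold cylMeasure; infer_instance

section Average

variable {ν : Measure ℝ} [IsFiniteMeasure ν] {M : ℝ} {w : ℝ → Plane → ℝ}

/-- An Euler step uses the vorticity integrated over the time step. By linearity this is again a
single admissible vorticity, so no regularity in time beyond measurability is needed. -/
lemma admissible_average (hM : 0 < M)
    (hj : AEStronglyMeasurable (Function.uncurry w) (ν.prod halfVol))
    (ha : ∀ᵐ τ ∂ν, Admissible M (w τ)) :
    Admissible (M * ν.real univ) (fun y => ∫ τ, w τ y ∂ν) where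
  meas := hj.prod_swap.integral_prod_right'
  bound := by
    have hm : AEStronglyMeasurable (fun z : ℝ × Plane => z.2 1 * w z.1 z.2) (ν.prod halfVol) :=
      AEStronglyMeasurable.mul (by fun_prop) hj
    have h1 : ∀ᵐ z ∂ν.prod halfVol, z.2 1 * w z.1 z.2 ∈ Icc (-M) M := by
      refine ae_prod_of_ae_ae hm measurableSet_Icc ?_
      filter_upwards [ha] with τ hτ
      filter_upwards [hτ.bound] with y hy
      exact abs_le.1 hy
    filter_upwards [ae_ae_swap h1] with y hy
    rw [← integral_const_mul, ← Real.norm_eq_abs]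
    refine norm_integral_le_of_norm_le_const ?_
    filter_upwards [hy] with τ hτ
    exact abs_le.2 hτ
  mass := by
    have hm : AEMeasurable (fun z : ℝ × Plane => ENNReal.ofReal ((z.2 1) ^ 2 * |w z.1 z.2|))
        (ν.prod halfVol) := by
      have h1 : AEMeasurable (fun z : ℝ × Plane => |w z.1 z.2|) (ν.prod halfVol) :=
        continuous_abs.measurable.comp_aemeasurable hj.aemeasurable
      exact (AEMeasurable.mul (by fun_prop) h1).ennreal_ofReal
    calc ∫⁻ y, ENNReal.ofReal ((y 1) ^ 2 * |∫ τ, w τ y ∂ν|) ∂halfVol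
        ≤ ∫⁻ y, ∫⁻ τ, ENNReal.ofReal ((y 1) ^ 2 * |w τ y|) ∂ν ∂halfVol := by
          refine lintegral_mono fun y => ?_
          simp_rw [ENNReal.ofReal_mul (sq_nonneg (y 1))]
          rw [lintegral_const_mul' _ _ ENNReal.ofReal_ne_top]
          gcongr
          simp_rw [← Real.norm_eq_abs, ofReal_norm]
          exact enorm_integral_le_lintegral_enorm _
      _ = ∫⁻ τ, ∫⁻ y, ENNReal.ofReal ((y 1) ^ 2 * |w τ y|) ∂halfVol ∂ν :=
          (lintegral_lintegral_swap hm).symm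
      _ ≤ ∫⁻ _, ENNReal.ofReal M ∂ν := by
          refine lintegral_mono_ae ?_
          filter_upwards [ha] with τ hτ using hτ.mass
      _ = ENNReal.ofReal (M * ν.real univ) := by
          rw [lintegral_const, ENNReal.ofReal_mul hM.le, Measure.real,
            ENNReal.ofReal_toReal (measure_ne_top _ _)]

lemma bs_average (hM : 0 < M)
    (hj : AEStronglyMeasurable (Function.uncurry w) (ν.prod halfVol))
    (ha : ∀ᵐ τ ∂ν, Admissible M (w τ)) (δ : ℝ) (x : Plane) :
    Integrable (fun τ => bs δ (w τ) x) ν ∧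
    bs δ (fun y => ∫ τ, w τ y ∂ν) x = ∫ τ, bs δ (w τ) x ∂ν := by
  have hw : AEStronglyMeasurable (fun z : ℝ × (Plane × ℝ) => w z.1 z.2.1)
      (ν.prod cylMeasure) := by
    have hq : Measure.QuasiMeasurePreserving (Prod.map id Prod.fst : ℝ × (Plane × ℝ) → ℝ × Plane)
        (ν.prod cylMeasure) (ν.prod halfVol) :=
      MeasureTheory.QuasiMeasurePreserving.prodMap (Measure.QuasiMeasurePreserving.id ν)
        (Measure.quasiMeasurePreserving_fst (μ := halfVol))
    exact hj.comp_quasiMeasurePreserving hq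
  have hm : AEStronglyMeasurable
      (fun z : ℝ × (Plane × ℝ) => ((z.2.1 1) ^ 2 * w z.1 z.2.1) • kern δ x z.2.1 z.2.2)
      (ν.prod cylMeasure) := by
    refine AEStronglyMeasurable.smul (AEStronglyMeasurable.mul (by fun_prop) hw) ?_
    exact ((measurable_kern δ x).comp measurable_snd).aestronglyMeasurable
  have hint : Integrable
      (fun z : ℝ × (Plane × ℝ) => ((z.2.1 1) ^ 2 * w z.1 z.2.1) • kern δ x z.2.1 z.2.2)
      (ν.prod cylMeasure) := by
    rw [integrable_prod_iff hm]
    constructor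
    · filter_upwards [ha] with τ hτ using (hτ.kern_integrable hM δ x).1
    · refine Integrable.mono' (integrable_const (31 * M)) hm.norm.integral_prod_right' ?_
      filter_upwards [ha] with τ hτ
      rw [Real.norm_of_nonneg (integral_nonneg fun _ => norm_nonneg _)]
      exact (hτ.kern_integrable hM δ x).2
  refine ⟨hint.integral_prod_left, ?_⟩
  unfold bs
  rw [← integral_integral_swap (f := fun (q : Plane × ℝ) (τ : ℝ) =>
    ((q.1 1) ^ 2 * w τ q.1) • kern δ x q.1 q.2) hint.swap]
  refine integral_congr_ae (Eventually.of_forall fun q => ?_)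
  dsimp only
  rw [integral_smul_const, integral_const_mul]

end Average

/-! ### Trajectories and their comparison with the regularised dynamics. -/

/-- `X` is a flow on the half plane, on the time interval `[0,T]`, of the velocity generated by
the potential vorticity `w`. -/
structure IsVelocityFlow (T M : ℝ) (w : ℝ → Plane → ℝ) (X : ℝ → Plane → Plane) : Prop where
  M_pos : 0 < M
  joint : AEStronglyMeasurable (Function.uncurry w) ((volume.restrict (Icc 0 T)).prod halfVol)
  adm : ∀ᵐ t ∂(volume.restrict (Icc 0 T)), Admissible M (w t)
  zero : ∀ x ∈ halfPlane, X 0 x = x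
  mem : ∀ t ∈ Icc 0 T, ∀ x ∈ halfPlane, X t x ∈ halfPlane
  deriv : ∀ x ∈ halfPlane, ∀ t ∈ Icc 0 T,
    HasDerivWithinAt (fun s => X s x) (biotSavart (w t) (X t x)) (Icc 0 T) t

namespace IsVelocityFlow

variable {T M : ℝ} {w : ℝ → Plane → ℝ} {X : ℝ → Plane → Plane}

lemma continuousOn (hX : IsVelocityFlow T M w X) {x : Plane} (hx : x ∈ halfPlane) :
    ContinuousOn (fun s => X s x) (Icc 0 T) :=
  fun t ht => (hX.deriv x hx t ht).continuousWithinAt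

lemma adm_Ioc (hX : IsVelocityFlow T M w X) {s t : ℝ} (hs : 0 ≤ s) (ht : t ≤ T) :
    ∀ᵐ τ ∂(volume.restrict (Ioc s t)), Admissible M (w τ) :=
  ae_restrict_of_ae_restrict_of_subset
    ((Ioc_subset_Icc_self).trans (Icc_subset_Icc hs ht)) hX.adm

lemma joint_Ioc (hX : IsVelocityFlow T M w X) {s t : ℝ} (hs : 0 ≤ s) (ht : t ≤ T) :
    AEStronglyMeasurable (Function.uncurry w) ((volume.restrict (Ioc s t)).prod halfVol) := by
  refine hX.joint.mono_ac (Measure.AbsolutelyContinuous.prod ?_ Measure.AbsolutelyContinuous.rfl)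
  exact (Measure.restrict_mono ((Ioc_subset_Icc_self).trans (Icc_subset_Icc hs ht))
    le_rfl).absolutelyContinuous

lemma integrable_velocity (hX : IsVelocityFlow T M w X) {x : Plane} (hx : x ∈ halfPlane) :
    IntegrableOn (fun τ => biotSavart (w τ) (X τ x)) (Icc 0 T) := by
  have hm : AEStronglyMeasurable (fun τ => biotSavart (w τ) (X τ x))
      (volume.restrict (Icc 0 T)) := by
    -- Measurability in time is read off from the trajectory: the velocity along it is a derivative,
    -- and derivatives are measurable.
    have h1 : AEStronglyMeasurable (_root_.deriv fun s => X s x) (volume.restrict (Icc 0 T)) :=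
      aestronglyMeasurable_deriv _ _
    refine h1.congr ?_
    rw [← restrict_Ioo_eq_restrict_Icc]
    filter_upwards [ae_restrict_mem measurableSet_Ioo] with t ht
    exact ((hX.deriv x hx t (Ioo_subset_Icc_self ht)).hasDerivAt (Icc_mem_nhds ht.1 ht.2)).deriv
  refine Integrable.mono' (integrable_const (31 * M)) hm ?_
  filter_upwards [hX.adm] with τ hτ
  rw [hτ.biotSavart_eq hX.M_pos]
  exact hτ.norm_bs_le hX.M_pos _ _

lemma sub_eq_integral (hX : IsVelocityFlow T M w X) {x : Plane} (hx : x ∈ halfPlane) {s t : ℝ}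
    (hs : 0 ≤ s) (hst : s ≤ t) (ht : t ≤ T) :
    X t x - X s x = ∫ τ in s..t, biotSavart (w τ) (X τ x) := by
  have hsub : Icc s t ⊆ Icc 0 T := Icc_subset_Icc hs ht
  symm
  refine intervalIntegral.integral_eq_sub_of_hasDeriv_right (f := fun s => X s x) ?_ ?_ ?_
  · rw [uIcc_of_le hst]; exact (hX.continuousOn hx).mono hsub
  · intro τ hτ
    rw [min_eq_left hst, max_eq_right hst] at hτ
    exact ((hX.deriv x hx τ (hsub (Ioo_subset_Icc_self hτ))).hasDerivAt
      (Icc_mem_nhds (hs.trans_lt hτ.1) (hτ.2.trans_le ht))).hasDerivWithinAt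
  · rw [intervalIntegrable_iff_integrableOn_Ioc_of_le hst]
    exact (hX.integrable_velocity hx).mono_set (Ioc_subset_Icc_self.trans hsub)

lemma norm_sub_le (hX : IsVelocityFlow T M w X) {x : Plane} (hx : x ∈ halfPlane) {s t : ℝ}
    (hs : 0 ≤ s) (hst : s ≤ t) (ht : t ≤ T) : ‖X t x - X s x‖ ≤ 31 * M * (t - s) := by
  rw [hX.sub_eq_integral hx hs hst ht, intervalIntegral.integral_of_le hst]
  refine (norm_integral_le_of_norm_le_const (C := 31 * M) ?_).trans (le_of_eq ?_)
  · filter_upwards [hX.adm_Ioc hs ht] with τ hτ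
    rw [hτ.biotSavart_eq hX.M_pos]
    exact hτ.norm_bs_le hX.M_pos _ _
  · simp [Measure.real, hst]

/-- One Euler step with the regularised velocity. -/
lemma norm_sub_step_le (hX : IsVelocityFlow T M w X) {x : Plane} (hx : x ∈ halfPlane) {s t : ℝ}
    (hs : 0 ≤ s) (hst : s ≤ t) (ht : t ≤ T) {δ : ℝ} (hδ : 0 < δ) (hδ1 : δ ≤ 1) (p : Plane) :
    ‖X t x - (p + bs δ (fun y => ∫ τ in Ioc s t, w τ y) p)‖ ≤ ‖X s x - p‖ +
      (t - s) * (55 * M * √δ +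
        100 * M * (1 + log (1 / δ)) * (‖X s x - p‖ + 31 * M * (t - s))) := by
  have hM := hX.M_pos
  obtain ⟨hi, he⟩ := bs_average hM (hX.joint_Ioc hs ht) (hX.adm_Ioc hs ht) δ p
  have hi2 : IntegrableOn (fun τ => biotSavart (w τ) (X τ x)) (Ioc s t) :=
    (hX.integrable_velocity hx).mono_set
      (Ioc_subset_Icc_self.trans (Icc_subset_Icc hs ht))
  have h1 : X t x - (p + bs δ (fun y => ∫ τ in Ioc s t, w τ y) p) = (X s x - p) +
      ∫ τ in Ioc s t, (biotSavart (w τ) (X τ x) - bs δ (w τ) p) := by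
    rw [integral_sub hi2 hi, ← he, ← intervalIntegral.integral_of_le hst,
      ← hX.sub_eq_integral hx hs hst ht]
    abel
  rw [h1]
  refine (norm_add_le _ _).trans (add_le_add le_rfl ?_)
  have hl : 0 ≤ log (1 / δ) := Real.log_nonneg ((one_le_div hδ).2 hδ1)
  refine (norm_integral_le_of_norm_le_const (C := 55 * M * √δ +
        100 * M * (1 + log (1 / δ)) * (‖X s x - p‖ + 31 * M * (t - s))) ?_).trans (le_of_eq ?_)
  · filter_upwards [hX.adm_Ioc hs ht, ae_restrict_mem measurableSet_Ioc] with τ hτ hτm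
    rw [hτ.biotSavart_eq hM]
    have e1 := hτ.norm_bs_sub_le hM hδ (X τ x)
    have e2 : ‖bs δ (w τ) (X τ x) - bs δ (w τ) p‖ ≤
        100 * M * (1 + log (1 / δ)) * ‖X τ x - p‖ :=
      convex_univ.norm_image_sub_le_of_norm_hasFDerivWithin_le
        (fun z _ => (hτ.hasFDerivAt_bs hM hδ z).hasFDerivWithinAt)
        (fun z _ => hτ.norm_bsDeriv_le hM hδ hδ1 z) (mem_univ _) (mem_univ _)
    have e3 : ‖X τ x - p‖ ≤ ‖X s x - p‖ + 31 * M * (t - s) := by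
      have e4 := hX.norm_sub_le hx hs hτm.1.le (hτm.2.trans ht)
      have : X τ x - p = (X s x - p) + (X τ x - X s x) := by abel
      rw [this]
      refine (norm_add_le _ _).trans (add_le_add le_rfl (e4.trans ?_))
      have := hτm.2
      gcongr
    have : bs 0 (w τ) (X τ x) - bs δ (w τ) p =
        (bs δ (w τ) (X τ x) - bs δ (w τ) p) - (bs δ (w τ) (X τ x) - bs 0 (w τ) (X τ x)) := by abel
    rw [this]
    refine (_root_.norm_sub_le _ _).trans ?_
    have : 100 * M * (1 + log (1 / δ)) * ‖X τ x - p‖ ≤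
      100 * M * (1 + log (1 / δ)) * (‖X s x - p‖ + 31 * M * (t - s)) := by gcongr
    linarith
  · simp [Measure.real, hst, mul_comm]

/-- Comparison of two trajectories over a short time. -/
lemma norm_sub_backward_le (hX : IsVelocityFlow T M w X) {x x' : Plane} (hx : x ∈ halfPlane)
    (hx' : x' ∈ halfPlane) {s t : ℝ} (hs : 0 ≤ s) (hst : s ≤ t) (ht : t ≤ T) {δ : ℝ}
    (hδ : 0 < δ) (hδ1 : δ ≤ 1) :
    ‖X s x - X s x'‖ ≤ ‖X t x - X t x'‖ + (t - s) * (110 * M * √δ +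
        100 * M * (1 + log (1 / δ)) * (‖X t x - X t x'‖ + 62 * M * (t - s))) := by
  have hM := hX.M_pos
  have hi : ∀ x ∈ halfPlane, IntegrableOn (fun τ => biotSavart (w τ) (X τ x)) (Ioc s t) :=
    fun x hx => (hX.integrable_velocity hx).mono_set
      (Ioc_subset_Icc_self.trans (Icc_subset_Icc hs ht))
  have h1 : X s x - X s x' = (X t x - X t x') -
      ∫ τ in Ioc s t, (biotSavart (w τ) (X τ x) - biotSavart (w τ) (X τ x')) := by
    rw [integral_sub (hi x hx) (hi x' hx'), ← intervalIntegral.integral_of_le hst,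
      ← intervalIntegral.integral_of_le hst,
      ← hX.sub_eq_integral hx hs hst ht, ← hX.sub_eq_integral hx' hs hst ht]
    abel
  rw [h1]
  refine (_root_.norm_sub_le _ _).trans (add_le_add le_rfl ?_)
  have hl : 0 ≤ log (1 / δ) := Real.log_nonneg ((one_le_div hδ).2 hδ1)
  refine (norm_integral_le_of_norm_le_const (C := 110 * M * √δ +
        100 * M * (1 + log (1 / δ)) * (‖X t x - X t x'‖ + 62 * M * (t - s))) ?_).trans
          (le_of_eq ?_)
  · filter_upwards [hX.adm_Ioc hs ht, ae_restrict_mem measurableSet_Ioc] with τ hτ hτm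
    rw [hτ.biotSavart_eq hM, hτ.biotSavart_eq hM]
    have e1 := hτ.norm_bs_sub_le hM hδ (X τ x)
    have e1' := hτ.norm_bs_sub_le hM hδ (X τ x')
    have e2 : ‖bs δ (w τ) (X τ x) - bs δ (w τ) (X τ x')‖ ≤
        100 * M * (1 + log (1 / δ)) * ‖X τ x - X τ x'‖ :=
      convex_univ.norm_image_sub_le_of_norm_hasFDerivWithin_le
        (fun z _ => (hτ.hasFDerivAt_bs hM hδ z).hasFDerivWithinAt)
        (fun z _ => hτ.norm_bsDeriv_le hM hδ hδ1 z) (mem_univ _) (mem_univ _)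
    have e3 : ‖X τ x - X τ x'‖ ≤ ‖X t x - X t x'‖ + 62 * M * (t - s) := by
      have e4 := hX.norm_sub_le hx (hs.trans hτm.1.le) hτm.2 ht
      have e5 := hX.norm_sub_le hx' (hs.trans hτm.1.le) hτm.2 ht
      have : X τ x - X τ x' = (X t x - X t x') - (X t x - X τ x) + (X t x' - X τ x') := by abel
      rw [this]
      have e6 := norm_add_le ((X t x - X t x') - (X t x - X τ x)) (X t x' - X τ x')
      have e7 := _root_.norm_sub_le (X t x - X t x') (X t x - X τ x)
      have := hτm.1
      nlinarith
    have : bs 0 (w τ) (X τ x) - bs 0 (w τ) (X τ x') =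
        (bs δ (w τ) (X τ x) - bs δ (w τ) (X τ x')) - (bs δ (w τ) (X τ x) - bs 0 (w τ) (X τ x)) +
          (bs δ (w τ) (X τ x') - bs 0 (w τ) (X τ x')) := by abel
    rw [this]
    have e6 := norm_add_le ((bs δ (w τ) (X τ x) - bs δ (w τ) (X τ x')) -
      (bs δ (w τ) (X τ x) - bs 0 (w τ) (X τ x))) (bs δ (w τ) (X τ x') - bs 0 (w τ) (X τ x'))
    have e7 := _root_.norm_sub_le (bs δ (w τ) (X τ x) - bs δ (w τ) (X τ x'))
      (bs δ (w τ) (X τ x) - bs 0 (w τ) (X τ x))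
    have : 100 * M * (1 + log (1 / δ)) * ‖X τ x - X τ x'‖ ≤
      100 * M * (1 + log (1 / δ)) * (‖X t x - X t x'‖ + 62 * M * (t - s)) := by gcongr
    linarith
  · simp [Measure.real, hst, mul_comm]

end IsVelocityFlow

/-! ### Error analysis of the Euler scheme. -/

lemma le_of_linear_recursion {e : ℕ → ℝ} {b c : ℝ} (hb : 0 ≤ b) (hc : 0 ≤ c) (h0 : e 0 ≤ 0)
    {n : ℕ} (h : ∀ k < n, e (k + 1) ≤ (1 + c) * e k + b) :
    ∀ k ≤ n, e k ≤ k * b * (1 + c) ^ k := by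
  intro k hk
  induction k with
  | zero => simpa using h0
  | succ k ih =>
    have h1 := h k hk
    have h2 := ih (by omega)
    have h3 : (1 : ℝ) ≤ (1 + c) ^ (k + 1) := one_le_pow₀ (by linarith)
    calc e (k + 1) ≤ (1 + c) * (k * b * (1 + c) ^ k) + b * 1 := by nlinarith
      _ ≤ (1 + c) * (k * b * (1 + c) ^ k) + b * (1 + c) ^ (k + 1) := by gcongr
      _ = _ := by push_cast; ring

/-- Step size data of the Euler scheme with `n` steps on an interval of length `τ`, for the
regularisation parameter `1 / n`. -/
def stepLip (M τ : ℝ) (n : ℕ) : ℝ := τ / n * (100 * M * (1 + log (1 / (1 / n))))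

/-- Local error of the Euler scheme. -/
def stepErr (M τ : ℝ) (n : ℕ) : ℝ :=
  τ / n * (110 * M * √(1 / n) + 100 * M * (1 + log (1 / (1 / n))) * (62 * M * (τ / n)))

lemma stepLip_nonneg {M τ : ℝ} (hM : 0 < M) (hτ : 0 ≤ τ) {n : ℕ} (hn : 0 < n) :
    0 ≤ stepLip M τ n := by
  have hn' : (1 : ℝ) ≤ n := by exact_mod_cast hn
  have hl : 0 ≤ log (n : ℝ) := Real.log_nonneg hn'
  unfold stepLip; rw [one_div_one_div]; positivity

lemma stepErr_nonneg {M τ : ℝ} (hM : 0 < M) (hτ : 0 ≤ τ) {n : ℕ} (hn : 0 < n) :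
    0 ≤ stepErr M τ n := by
  have hn' : (1 : ℝ) ≤ n := by exact_mod_cast hn
  have hl : 0 ≤ log (n : ℝ) := Real.log_nonneg hn'
  unfold stepErr; rw [one_div_one_div]; positivity

/-- The power n^{1/4} serves as a common unit for δ = 1/n: it absorbs 1 + log n, its inverse square
is √δ, and it bounds e^{(1 + log n)/4} up to the factor 2. -/
lemma quarter_power {n : ℕ} (hn : 0 < n) : 0 < (n : ℝ) ^ (1 / 4 : ℝ) ∧
    ((n : ℝ) ^ (1 / 4 : ℝ)) ^ 4 = n ∧ 1 ≤ (n : ℝ) ^ (1 / 4 : ℝ) ∧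
    1 + log (1 / (1 / n)) ≤ 5 * (n : ℝ) ^ (1 / 4 : ℝ) ∧ 0 ≤ log (1 / (1 / (n : ℝ))) ∧
    √(1 / n) = (((n : ℝ) ^ (1 / 4 : ℝ)) ^ 2)⁻¹ ∧
    exp ((1 + log (1 / (1 / n))) / 4) ≤ 2 * (n : ℝ) ^ (1 / 4 : ℝ) := by
  have hn' : (1 : ℝ) ≤ n := by exact_mod_cast hn
  have hn0 : (0 : ℝ) < n := by linarith
  have h1 : 0 < (n : ℝ) ^ (1 / 4 : ℝ) := by positivity
  have h4 : ((n : ℝ) ^ (1 / 4 : ℝ)) ^ 4 = n := by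
    rw [← Real.rpow_natCast, ← Real.rpow_mul hn0.le]; norm_num
  have hge : 1 ≤ (n : ℝ) ^ (1 / 4 : ℝ) := Real.one_le_rpow hn' (by norm_num)
  have hlog := Real.log_le_rpow_div hn0.le (by norm_num : (0 : ℝ) < 1 / 4)
  refine ⟨h1, h4, hge, ?_, ?_, ?_, ?_⟩
  · rw [one_div_one_div]; linarith
  · rw [one_div_one_div]; exact Real.log_nonneg hn'
  · rw [Real.sqrt_eq_iff_mul_self_eq (by positivity) (by positivity), ← mul_inv,
      ← pow_add, h4, one_div]
  · rw [one_div_one_div, add_div, Real.exp_add, Real.rpow_def_of_pos hn0, mul_one_div]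
    gcongr
    rw [← Real.exp_log two_pos]
    apply Real.exp_le_exp.2
    linarith [Real.log_two_gt_d9]

lemma tendsto_quarter_power_inv :
    Tendsto (fun n : ℕ => ((n : ℝ) ^ (1 / 4 : ℝ))⁻¹) atTop (𝓝 0) :=
  ((tendsto_rpow_atTop (by norm_num : (0 : ℝ) < 1 / 4)).comp
    tendsto_natCast_atTop_atTop).inv_tendsto_atTop

/-- The accumulated local errors are of order n^{-1/2}. The amplification is at most exp(100Mτ(1 +
log n)), a power of n, and 400Mτ ≤ 1 keeps that power at 1/4. The argument therefore works only over
short times, which are concatenated later. -/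
lemma tendsto_globalErr {M τ : ℝ} (hM : 0 < M) (hτ : 0 ≤ τ) (hMτ : 400 * M * τ ≤ 1) :
    Tendsto (fun n : ℕ => n * stepErr M τ n * (1 + stepLip M τ n) ^ n) atTop (𝓝 0) := by
  have hlim : Tendsto (fun n : ℕ => 2 * τ * (110 * M + 31000 * M ^ 2 * τ) *
      ((n : ℝ) ^ (1 / 4 : ℝ))⁻¹) atTop (𝓝 0) := by
    simpa using tendsto_quarter_power_inv.const_mul (2 * τ * (110 * M + 31000 * M ^ 2 * τ))
  refine tendsto_of_tendsto_of_tendsto_of_le_of_le' tendsto_const_nhds hlim ?_ ?_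
  · filter_upwards [eventually_gt_atTop 0] with n hn
    have := stepErr_nonneg hM hτ hn
    have := stepLip_nonneg hM hτ hn
    positivity
  · filter_upwards [eventually_gt_atTop 0] with n hn
    obtain ⟨h1, h4, hge, hlog, hlog0, hsq, hexp⟩ := quarter_power hn
    have hn0 : (0 : ℝ) < n := by exact_mod_cast hn
    have hc := stepLip_nonneg hM hτ hn
    have hpow : (1 + stepLip M τ n) ^ n ≤ 2 * (n : ℝ) ^ (1 / 4 : ℝ) := by
      refine le_trans ?_ hexp
      have : 1 + stepLip M τ n ≤ exp (stepLip M τ n) := by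
        linarith [Real.add_one_le_exp (stepLip M τ n)]
      calc (1 + stepLip M τ n) ^ n ≤ exp (stepLip M τ n) ^ n := by gcongr
        _ = exp (100 * M * τ * (1 + log (1 / (1 / n)))) := by
          rw [← Real.exp_nat_mul, stepLip]; congr 1; field_simp
        _ ≤ _ := by apply Real.exp_le_exp.2; nlinarith
    have herr : n * stepErr M τ n ≤ τ * (110 * M + 31000 * M ^ 2 * τ) *
        (((n : ℝ) ^ (1 / 4 : ℝ)) ^ 2)⁻¹ := by
      unfold stepErr
      rw [hsq]
      set q := (n : ℝ) ^ (1 / 4 : ℝ)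
      set l := 1 + log (1 / (1 / (n : ℝ)))
      calc (n : ℝ) * (τ / n * (110 * M * (q ^ 2)⁻¹ + 100 * M * l * (62 * M * (τ / n))))
          = τ * (110 * M * (q ^ 2)⁻¹ + 6200 * M ^ 2 * τ * (l / n)) := by field_simp; ring
        _ ≤ τ * (110 * M * (q ^ 2)⁻¹ + 6200 * M ^ 2 * τ * (5 * (q ^ 2)⁻¹)) := by
          gcongr
          rw [← h4, div_le_iff₀ (by positivity)]
          have : 5 * (q ^ 2)⁻¹ * q ^ 4 = 5 * q ^ 2 := by field_simp
          rw [this]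
          nlinarith
        _ = _ := by ring
    have := stepErr_nonneg hM hτ hn
    calc _ ≤ (τ * (110 * M + 31000 * M ^ 2 * τ) * (((n : ℝ) ^ (1 / 4 : ℝ)) ^ 2)⁻¹) *
          (2 * (n : ℝ) ^ (1 / 4 : ℝ)) := by gcongr
      _ = _ := by field_simp

/-- The step Lipschitz constant is O(n^{-3/4}); its square, summed over n steps, is O(n^{-1/2}). A
volume defect linear in this constant would not give convergence. -/
lemma tendsto_jacobian {M τ : ℝ} (hM : 0 < M) (hτ : 0 ≤ τ) :
    Tendsto (fun n : ℕ => (1 + 20 * stepLip M τ n ^ 2) ^ n) atTop (𝓝 1) ∧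
    Tendsto (stepLip M τ) atTop (𝓝 0) := by
  have hle : ∀ n : ℕ, 0 < n → stepLip M τ n ≤ 500 * M * τ * ((n : ℝ) ^ (1 / 4 : ℝ))⁻¹ ^ 3 := by
    intro n hn
    obtain ⟨h1, h4, hge, hlog, hlog0, hsq, hexp⟩ := quarter_power hn
    unfold stepLip
    conv_lhs => rw [← h4]
    calc _ ≤ τ / ((n : ℝ) ^ (1 / 4 : ℝ)) ^ 4 * (100 * M * (5 * (n : ℝ) ^ (1 / 4 : ℝ))) := by
          rw [h4]; gcongr
      _ = _ := by field_simp; ring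
  constructor
  · have hlim : Tendsto (fun n : ℕ => exp (20 * (500 * M * τ) ^ 2 *
        ((n : ℝ) ^ (1 / 4 : ℝ))⁻¹ ^ 2)) atTop (𝓝 1) := by
      have := (tendsto_quarter_power_inv.pow 2).const_mul (20 * (500 * M * τ) ^ 2)
      have := (Real.continuous_exp.tendsto _).comp this
      simpa [Function.comp_def] using this
    refine tendsto_of_tendsto_of_tendsto_of_le_of_le' tendsto_const_nhds hlim ?_ ?_
    · exact Eventually.of_forall fun n => one_le_pow₀ (by nlinarith [sq_nonneg (stepLip M τ n)])
    · filter_upwards [eventually_gt_atTop 0] with n hn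
      obtain ⟨h1, h4, -⟩ := quarter_power hn
      have h0 := stepLip_nonneg hM hτ hn
      have h2 := hle n hn
      calc (1 + 20 * stepLip M τ n ^ 2) ^ n ≤ exp (20 * stepLip M τ n ^ 2) ^ n := by
            gcongr
            linarith [Real.add_one_le_exp (20 * stepLip M τ n ^ 2)]
        _ = exp (n * (20 * stepLip M τ n ^ 2)) := by rw [← Real.exp_nat_mul]
        _ ≤ exp (n * (20 * (500 * M * τ * ((n : ℝ) ^ (1 / 4 : ℝ))⁻¹ ^ 3) ^ 2)) := by gcongr
        _ = _ := by
          congr 1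
          set q := (n : ℝ) ^ (1 / 4 : ℝ)
          field_simp
          rw [h4, mul_comm]
  · have hlim : Tendsto (fun n : ℕ => 500 * M * τ * ((n : ℝ) ^ (1 / 4 : ℝ))⁻¹ ^ 3) atTop
        (𝓝 0) := by
      simpa using (tendsto_quarter_power_inv.pow 3).const_mul (500 * M * τ)
    refine tendsto_of_tendsto_of_tendsto_of_le_of_le' tendsto_const_nhds hlim ?_ ?_
    · filter_upwards [eventually_gt_atTop 0] with n hn using stepLip_nonneg hM hτ hn
    · filter_upwards [eventually_gt_atTop 0] with n hn using hle n hn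

/-! ### Passage to the limit: the flow preserves x_r dx and is injective. -/

instance : IsLocallyFiniteMeasure halfVol := by unfold halfVol; infer_instance

instance : IsLocallyFiniteMeasure ringVol :=
  IsLocallyFiniteMeasure.withDensity_ofReal (by fun_prop)

lemma ae_ringVol_mem : ∀ᵐ x ∂ringVol, x ∈ halfPlane :=
  (withDensity_absolutelyContinuous _ _).ae_le (ae_restrict_mem measurableSet_halfPlane)

/-- The flow map, extended by the identity outside of the half plane. -/
def extFlow (X : ℝ → Plane → Plane) (t : ℝ) (x : Plane) : Plane :=
  open scoped Classical in if x ∈ halfPlane then X t x else x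

lemma extFlow_of_mem (X : ℝ → Plane → Plane) (t : ℝ) {x : Plane} (hx : x ∈ halfPlane) :
    extFlow X t x = X t x := if_pos hx

lemma extFlow_of_notMem (X : ℝ → Plane → Plane) (t : ℝ) {x : Plane} (hx : x ∉ halfPlane) :
    extFlow X t x = x := if_neg hx

/-- A measurable map which is approximated uniformly on the half plane by almost measure
preserving maps is measure preserving. -/
lemma map_eq_of_approx {f g : Plane → Plane} {Ψ : ℕ → Plane → Plane} {η A : ℕ → ℝ}
    (hf : Measurable f) (hg : Measurable g) (hg' : ringVol.map g = ringVol)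
    (hη : Tendsto η atTop (𝓝 0)) (hA : Tendsto A atTop (𝓝 1))
    (hm : ∀ᶠ n in atTop, Measurable (Ψ n))
    (h1 : ∀ᶠ n in atTop, ringVol.map (Ψ n) ≤ ENNReal.ofReal (A n) • ringVol)
    (h2 : ∀ᶠ n in atTop, ringVol ≤ ENNReal.ofReal (A n) • ringVol.map (Ψ n))
    (h3 : ∀ᶠ n in atTop, ∀ x ∈ halfPlane, ‖f x - Ψ n (g x)‖ ≤ η n) :
    ringVol.map f = ringVol := by
  have hA' : Tendsto (fun n => ENNReal.ofReal (A n)) atTop (𝓝 1) := by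
    simpa using ENNReal.tendsto_ofReal hA
  -- A point sent into K by f is sent by the approximation into a small closed thickening of K, and
  -- these thickenings decrease to K in measure.
  have up : ∀ K : Set Plane, IsCompact K → ringVol.map f K ≤ ringVol K := by
    intro K hK
    have hlim : Tendsto (fun n => ENNReal.ofReal (A n) * ringVol (Metric.cthickening (η n) K))
        atTop (𝓝 (1 * ringVol K)) :=
      ENNReal.Tendsto.mul hA' (Or.inl one_ne_zero)
        ((tendsto_measure_cthickening_of_isCompact hK).comp hη) (Or.inr ENNReal.one_ne_top)
    rw [one_mul] at hlim
    refine ge_of_tendsto hlim ?_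
    filter_upwards [hm, h1, h3] with n hm h1 h3
    have hc : MeasurableSet (Metric.cthickening (η n) K) :=
      Metric.isClosed_cthickening.measurableSet
    calc ringVol.map f K = ringVol (f ⁻¹' K) := Measure.map_apply hf hK.measurableSet
      _ ≤ ringVol (g ⁻¹' (Ψ n ⁻¹' Metric.cthickening (η n) K)) := by
          refine measure_mono_ae ?_
          filter_upwards [ae_ringVol_mem] with x hx hxK
          refine Metric.mem_cthickening_of_dist_le _ (f x) _ _ hxK ?_
          rw [dist_comm, dist_eq_norm]; exact h3 x hx
      _ = (ringVol.map g).map (Ψ n) (Metric.cthickening (η n) K) := by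
          rw [Measure.map_apply hm hc, Measure.map_apply hg (hm hc)]
      _ = ringVol.map (Ψ n) (Metric.cthickening (η n) K) := by rw [hg']
      _ ≤ ENNReal.ofReal (A n) * ringVol (Metric.cthickening (η n) K) := h1 _
  have down : ∀ K : Set Plane, IsCompact K → ringVol K ≤ ringVol.map f K := by
    intro K hK
    -- Continuity from above for the pushforward requires finite measure of some thickening; the
    -- upper bound just proved, applied to a compact thickening, supplies it.
    have hfin : ringVol.map f (Metric.cthickening 1 K) ≠ ∞ :=
      ((up _ hK.cthickening).trans_lt hK.cthickening.measure_lt_top).ne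
    have hcl := tendsto_measure_cthickening (μ := ringVol.map f) (s := K) ⟨1, one_pos, hfin⟩
    rw [hK.isClosed.closure_eq] at hcl
    have hlim : Tendsto (fun n => ENNReal.ofReal (A n) *
        ringVol.map f (Metric.cthickening (η n) K)) atTop (𝓝 (1 * ringVol.map f K)) :=
      ENNReal.Tendsto.mul hA' (Or.inl one_ne_zero) (hcl.comp hη) (Or.inr ENNReal.one_ne_top)
    rw [one_mul] at hlim
    refine ge_of_tendsto hlim ?_
    filter_upwards [hm, h2, h3] with n hm h2 h3
    have hc : MeasurableSet (Metric.cthickening (η n) K) :=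
      Metric.isClosed_cthickening.measurableSet
    calc ringVol K ≤ ENNReal.ofReal (A n) * ringVol.map (Ψ n) K := h2 _
      _ = ENNReal.ofReal (A n) * (ringVol.map g).map (Ψ n) K := by rw [hg']
      _ = ENNReal.ofReal (A n) * ringVol (g ⁻¹' (Ψ n ⁻¹' K)) := by
          rw [Measure.map_apply hm hK.measurableSet, Measure.map_apply hg (hm hK.measurableSet)]
      _ ≤ ENNReal.ofReal (A n) * ringVol (f ⁻¹' Metric.cthickening (η n) K) := by
          gcongr 1
          refine measure_mono_ae ?_
          filter_upwards [ae_ringVol_mem] with x hx hxK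
          refine Metric.mem_cthickening_of_dist_le _ (Ψ n (g x)) _ _ hxK ?_
          rw [dist_eq_norm]; exact h3 x hx
      _ = _ := by rw [Measure.map_apply hf hc]
  have heq : ∀ K : Set Plane, IsCompact K → ringVol.map f K = ringVol K :=
    fun K hK => le_antisymm (up K hK) (down K hK)
  have : IsLocallyFiniteMeasure (ringVol.map f) := by
    refine ⟨fun x => ⟨Metric.closedBall x 1, Metric.closedBall_mem_nhds x one_pos, ?_⟩⟩
    rw [heq _ (isCompact_closedBall x 1)]
    exact (isCompact_closedBall x 1).measure_lt_top
  refine Measure.OuterRegular.ext_isOpen fun U hU => ?_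
  exact (Measure.InnerRegularWRT.eq_of_innerRegularWRT_of_forall_eq Measure.Regular.innerRegular
    Measure.Regular.innerRegular heq) hU

/-- Induction along short time steps. -/
lemma induction_short_steps {T τ₀ : ℝ} (hτ₀ : 0 < τ₀) {P : ℝ → Prop} (h0 : P 0)
    (h : ∀ s t, 0 ≤ s → s < t → t ≤ T → t - s ≤ τ₀ → P s → P t) {t : ℝ} (ht : t ∈ Icc 0 T) :
    P t := by
  rcases ht.1.eq_or_lt with h00 | hpos
  · rwa [← h00]
  obtain ⟨n, hn⟩ := exists_nat_gt (t / τ₀)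
  have hn0 : (0 : ℝ) < n := lt_trans (by positivity) hn
  have key : ∀ k : ℕ, k ≤ n → P (k * (t / n)) := by
    intro k
    induction k with
    | zero => intro _; simpa using h0
    | succ k ih =>
      intro hk
      have hk' : ((k : ℝ) + 1) ≤ n := by exact_mod_cast hk
      have hstep : 0 < t / n := by positivity
      refine h (k * (t / n)) _ (by positivity) ?_ ?_ ?_ (ih (by omega))
      · push_cast; nlinarith
      · push_cast
        calc ((k : ℝ) + 1) * (t / n) ≤ n * (t / n) := by gcongr
          _ = t := by field_simp
          _ ≤ T := ht.2
      · push_cast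
        have : t / n ≤ τ₀ := by
          rw [div_le_iff₀ hn0]; rw [div_lt_iff₀ hτ₀] at hn; linarith
        nlinarith
  have := key n le_rfl
  rwa [mul_div_cancel₀ _ hn0.ne'] at this

namespace IsVelocityFlow

variable {T M : ℝ} {w : ℝ → Plane → ℝ} {X : ℝ → Plane → Plane}

/-- Euler scheme with the regularised velocity. -/
lemma exists_euler (hX : IsVelocityFlow T M w X) {s t : ℝ} (hs : 0 ≤ s) (hst : s < t)
    (ht : t ≤ T) {n : ℕ} (hn : 0 < n) (hL : stepLip M (t - s) n ≤ 1 / 8) :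
    ∃ Ψ : Plane → Plane, Measurable Ψ ∧
      ringVol.map Ψ ≤ ENNReal.ofReal ((1 + 20 * stepLip M (t - s) n ^ 2) ^ n) • ringVol ∧
      ringVol ≤ ENNReal.ofReal ((1 + 20 * stepLip M (t - s) n ^ 2) ^ n) • ringVol.map Ψ ∧
      ∀ x ∈ halfPlane, ‖X t x - Ψ (X s x)‖ ≤
        n * stepErr M (t - s) n * (1 + stepLip M (t - s) n) ^ n := by
  have hM := hX.M_pos
  have hn0 : (0 : ℝ) < n := by exact_mod_cast hn
  have hn1 : (1 : ℝ) ≤ n := by exact_mod_cast hn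
  set h : ℝ := (t - s) / n with hh
  have hhpos : 0 < h := div_pos (by linarith) hn0
  have hδ : (0 : ℝ) < 1 / n := by positivity
  have hδ1 : (1 : ℝ) / n ≤ 1 := by rw [div_le_one hn0]; exact hn1
  set c := stepLip M (t - s) n
  set b := stepErr M (t - s) n
  have hc0 : 0 ≤ c := stepLip_nonneg hM (by linarith) hn
  have hb0 : 0 ≤ b := stepErr_nonneg hM (by linarith) hn
  set step : ℕ → Plane → Plane := fun k p =>
    p + bs (1 / n) (fun y => ∫ τ in Ioc (s + k * h) (s + (k + 1) * h), w τ y) p with hstep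
  have hend : ∀ k : ℕ, k < n → s + (k + 1) * h ≤ T := by
    intro k hk
    have hk' : ((k : ℝ) + 1) ≤ n := by exact_mod_cast hk
    calc s + (k + 1) * h ≤ s + n * h := by gcongr
      _ = t := by rw [hh]; field_simp; ring
      _ ≤ T := ht
  have hperturb : ∀ k : ℕ, k < n → Measurable (step k) ∧
      ringVol.map (step k) ≤ ENNReal.ofReal (1 + 20 * c ^ 2) • ringVol ∧
      ringVol ≤ ENNReal.ofReal (1 + 20 * c ^ 2) • ringVol.map (step k) := by
    intro k hk
    have h0 : 0 ≤ s + k * h := by positivity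
    have hlen : (s + (k + 1) * h) - (s + k * h) = h := by ring
    have hadm : Admissible (M * h)
        (fun y => ∫ τ in Ioc (s + k * h) (s + (k + 1) * h), w τ y) := by
      have := admissible_average hM (hX.joint_Ioc h0 (hend k hk)) (hX.adm_Ioc h0 (hend k hk))
      simpa [Measure.real, hlen, hhpos.le] using this
    have hMh : 0 < M * h := by positivity
    have := perturb_ringVol (v := bs (1 / n) _) (κ := c)
      (fun x => hadm.hasFDerivAt_bs hMh hδ x)
      (fun x => (hadm.norm_bsDeriv_le hMh hδ hδ1 x).trans (le_of_eq (by
        simp only [c, stepLip, hh]; ring))) hL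
      (fun x hx => hadm.trace_bsDeriv hMh hδ hδ1 hx.ne')
    exact ⟨this.1, this.2.2⟩
  have key : ∀ k : ℕ, k ≤ n → ∃ Ψ : Plane → Plane, Measurable Ψ ∧
      ringVol.map Ψ ≤ ENNReal.ofReal ((1 + 20 * c ^ 2) ^ k) • ringVol ∧
      ringVol ≤ ENNReal.ofReal ((1 + 20 * c ^ 2) ^ k) • ringVol.map Ψ ∧
      ∀ x ∈ halfPlane, ‖X (s + k * h) x - Ψ (X s x)‖ ≤ k * b * (1 + c) ^ k := by
    intro k
    induction k with
    | zero =>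
      intro _
      refine ⟨id, measurable_id, ?_, ?_, ?_⟩ <;> simp
    | succ k ih =>
      intro hk
      obtain ⟨Ψ, hm, h1, h2, h3⟩ := ih (by omega)
      obtain ⟨gm, g1, g2⟩ := hperturb k hk
      have hpos : (0 : ℝ) ≤ 1 + 20 * c ^ 2 := by positivity
      refine ⟨step k ∘ Ψ, gm.comp hm, ?_, ?_, ?_⟩
      · rw [← Measure.map_map gm hm]
        calc (ringVol.map Ψ).map (step k)
            ≤ (ENNReal.ofReal ((1 + 20 * c ^ 2) ^ k) • ringVol).map (step k) :=
              Measure.map_mono h1 gm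
          _ = ENNReal.ofReal ((1 + 20 * c ^ 2) ^ k) • ringVol.map (step k) :=
              Measure.map_smul ..
          _ ≤ ENNReal.ofReal ((1 + 20 * c ^ 2) ^ k) •
                (ENNReal.ofReal (1 + 20 * c ^ 2) • ringVol) := by gcongr
          _ = _ := by rw [smul_smul, ← ENNReal.ofReal_mul (by positivity), ← pow_succ]
      · rw [← Measure.map_map gm hm]
        calc ringVol ≤ ENNReal.ofReal (1 + 20 * c ^ 2) • ringVol.map (step k) := g2
          _ ≤ ENNReal.ofReal (1 + 20 * c ^ 2) •
              (ENNReal.ofReal ((1 + 20 * c ^ 2) ^ k) • ringVol.map Ψ).map (step k) := by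
              gcongr
          _ = _ := by
              rw [Measure.map_smul, smul_smul, ← ENNReal.ofReal_mul hpos, ← pow_succ']
      · intro x hx
        have e3 := h3 x hx
        have h0 : 0 ≤ s + k * h := by positivity
        have hlen : (s + (k + 1) * h) - (s + k * h) = h := by ring
        have e := hX.norm_sub_step_le hx h0 (by nlinarith) (hend k hk) hδ hδ1 (Ψ (X s x))
        rw [hlen] at e
        have hl : 0 ≤ log (1 / (1 / (n : ℝ))) := by
          rw [one_div_one_div]; exact Real.log_nonneg hn1
        push_cast
        refine e.trans ?_
        set E := ‖X (s + k * h) x - Ψ (X s x)‖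
        -- The constants 110 and 62 in `stepErr` are those of the comparison of two trajectories;
        -- they dominate the 55 and 31 of a single Euler step, so the same error sequence serves
        -- here and in the proof of injectivity.
        have hstep1 : E + h * (55 * M * √(1 / n) + 100 * M * (1 + log (1 / (1 / n))) *
            (E + 31 * M * h)) ≤ (1 + c) * E + b := by
          have : (1 + c) * E + b = E + h * (110 * M * √(1 / n) + 100 * M *
            (1 + log (1 / (1 / n))) * (E + 62 * M * h)) := by
            simp only [c, b, stepLip, stepErr, hh]; ring
          rw [this]
          gcongr <;> norm_num
        refine hstep1.trans ?_
        have h3' : (1 : ℝ) ≤ (1 + c) ^ (k + 1) := one_le_pow₀ (by linarith)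
        calc (1 + c) * E + b ≤ (1 + c) * (k * b * (1 + c) ^ k) + b * 1 := by nlinarith
          _ ≤ (1 + c) * (k * b * (1 + c) ^ k) + b * (1 + c) ^ (k + 1) := by gcongr
          _ = _ := by ring
  obtain ⟨Ψ, hm, h1, h2, h3⟩ := key n le_rfl
  have : s + n * h = t := by rw [hh]; field_simp; ring
  rw [this] at h3
  exact ⟨Ψ, hm, h1, h2, h3⟩

/-- The flow preserves the measure `x_r dx`. -/
theorem map_extFlow (hX : IsVelocityFlow T M w X) {t : ℝ} (ht : t ∈ Icc 0 T) :
    Measurable (extFlow X t) ∧ ringVol.map (extFlow X t) = ringVol := by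
  have hM := hX.M_pos
  refine induction_short_steps (τ₀ := 1 / (400 * M)) (by positivity)
    (P := fun t => Measurable (extFlow X t) ∧ ringVol.map (extFlow X t) = ringVol) ?_ ?_ ht
  · have : extFlow X 0 = id := by
      ext1 x
      by_cases hx : x ∈ halfPlane
      · rw [extFlow_of_mem X 0 hx, hX.zero x hx, id]
      · rw [extFlow_of_notMem X 0 hx, id]
    rw [this, Measure.map_id]
    exact ⟨measurable_id, rfl⟩
  · rintro s t hs hst htT hτ ⟨hms, hmaps⟩
    have hτ' : 400 * M * (t - s) ≤ 1 := by
      rw [le_div_iff₀ (by positivity)] at hτ; linarith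
    have hη := tendsto_globalErr hM (sub_pos.2 hst).le hτ'
    obtain ⟨hA, hLip⟩ := tendsto_jacobian hM (sub_pos.2 hst).le
    have hev : ∀ᶠ n : ℕ in atTop, 0 < n ∧ stepLip M (t - s) n ≤ 1 / 8 :=
      (eventually_gt_atTop 0).and (hLip.eventually (ge_mem_nhds (by norm_num)))
    have hall : ∀ n : ℕ, ∃ Ψ : Plane → Plane, (0 < n ∧ stepLip M (t - s) n ≤ 1 / 8) →
        Measurable Ψ ∧
        ringVol.map Ψ ≤ ENNReal.ofReal ((1 + 20 * stepLip M (t - s) n ^ 2) ^ n) • ringVol ∧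
        ringVol ≤ ENNReal.ofReal ((1 + 20 * stepLip M (t - s) n ^ 2) ^ n) • ringVol.map Ψ ∧
        ∀ x ∈ halfPlane, ‖X t x - Ψ (X s x)‖ ≤
          n * stepErr M (t - s) n * (1 + stepLip M (t - s) n) ^ n := by
      intro n
      by_cases hn : 0 < n ∧ stepLip M (t - s) n ≤ 1 / 8
      · obtain ⟨Ψ, hΨ⟩ := hX.exists_euler hs hst htT hn.1 hn.2
        exact ⟨Ψ, fun _ => hΨ⟩
      · exact ⟨id, fun h => absurd h hn⟩
    choose Ψ hΨ using hall
    -- The flow map is measurable as a pointwise limit of Euler maps composed with the flow at time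
    -- s; a shift of the index drops the finitely many n for which the scheme is not controlled.
    have hmt : Measurable (extFlow X t) := by
      obtain ⟨n₀, hn₀⟩ := eventually_atTop.1 hev
      classical
      have hmeas : ∀ n, Measurable fun x =>
          if x ∈ halfPlane then Ψ (n + n₀) (extFlow X s x) else x := fun n =>
        Measurable.ite measurableSet_halfPlane
          ((hΨ _ (hn₀ _ (by omega))).1.comp hms) measurable_id
      refine measurable_of_tendsto_metrizable hmeas (tendsto_pi_nhds.2 fun x => ?_)
      by_cases hx : x ∈ halfPlane
      · simp only [hx, if_true, extFlow_of_mem X _ hx]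
        rw [tendsto_iff_norm_sub_tendsto_zero]
        refine squeeze_zero (fun _ => norm_nonneg _) (fun n => ?_)
          (hη.comp (tendsto_add_atTop_nat n₀))
        rw [norm_sub_rev]
        exact (hΨ _ (hn₀ _ (by omega))).2.2.2 x hx
      · simp only [hx, if_false, extFlow_of_notMem X _ hx]
        exact tendsto_const_nhds
    refine ⟨hmt, map_eq_of_approx hmt hms hmaps hη hA (hev.mono fun n hn => (hΨ n hn).1)
      (hev.mono fun n hn => (hΨ n hn).2.1) (hev.mono fun n hn => (hΨ n hn).2.2.1)
      (hev.mono fun n hn x hx => ?_)⟩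
    rw [extFlow_of_mem X t hx, extFlow_of_mem X s hx]
    exact (hΨ n hn).2.2.2 x hx

/-- Trajectories do not merge. -/
theorem injOn (hX : IsVelocityFlow T M w X) {t : ℝ} (ht : t ∈ Icc 0 T) :
    InjOn (X t) halfPlane := by
  have hM := hX.M_pos
  intro x hx x' hx' hxx
  revert hxx
  refine induction_short_steps (τ₀ := 1 / (400 * M)) (by positivity)
    (P := fun t => X t x = X t x' → x = x') ?_ ?_ ht
  · rw [hX.zero x hx, hX.zero x' hx']; exact id
  · rintro s t hs hst htT hτ ih heq
    apply ih
    have hτ' : 400 * M * (t - s) ≤ 1 := by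
      rw [le_div_iff₀ (by positivity)] at hτ; linarith
    have hη := tendsto_globalErr hM (sub_pos.2 hst).le hτ'
    rw [← sub_eq_zero, ← norm_le_zero_iff]
    refine ge_of_tendsto hη ?_
    filter_upwards [eventually_gt_atTop 0] with n hn
    have hn0 : (0 : ℝ) < n := by exact_mod_cast hn
    have hn1 : (1 : ℝ) ≤ n := by exact_mod_cast hn
    have hδ : (0 : ℝ) < 1 / n := by positivity
    have hδ1 : (1 : ℝ) / n ≤ 1 := by rw [div_le_one hn0]; exact hn1
    set h : ℝ := (t - s) / n with hh
    have hhpos : 0 < h := div_pos (by linarith) hn0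
    have hnh : n * h = t - s := by rw [hh]; field_simp
    -- The recursion runs backwards from time t, where the two positions agree. The distance at time
    -- s is then at most the global error for every n, hence zero.
    have := le_of_linear_recursion (e := fun k => ‖X (t - k * h) x - X (t - k * h) x'‖)
      (stepErr_nonneg hM (sub_pos.2 hst).le hn) (stepLip_nonneg hM (sub_pos.2 hst).le hn)
      (by simp [heq]) (n := n) ?_ n le_rfl
    · simpa [hnh] using this
    · intro k hk
      have hk' : ((k : ℝ) + 1) ≤ n := by exact_mod_cast hk
      have h1 : s ≤ t - (k + 1) * h := by nlinarith
      have e := hX.norm_sub_backward_le hx hx' (s := t - (k + 1) * h) (t := t - k * h)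
        (by linarith) (by nlinarith) (by nlinarith [Nat.cast_nonneg (α := ℝ) k]) hδ hδ1
      have hlen : (t - k * h) - (t - (k + 1) * h) = h := by ring
      rw [hlen] at e
      push_cast
      refine e.trans (le_of_eq ?_)
      simp only [stepLip, stepErr, hh]; ring

theorem measurableEmbedding_extFlow (hX : IsVelocityFlow T M w X) {t : ℝ} (ht : t ∈ Icc 0 T) :
    MeasurableEmbedding (extFlow X t) := by
  refine (hX.map_extFlow ht).1.measurableEmbedding fun x x' h => ?_
  by_cases hx : x ∈ halfPlane <;> by_cases hx' : x' ∈ halfPlane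
  · rw [extFlow_of_mem X t hx, extFlow_of_mem X t hx'] at h
    exact hX.injOn ht hx hx' h
  · rw [extFlow_of_mem X t hx, extFlow_of_notMem X t hx'] at h
    exact absurd (h ▸ hX.mem t ht x hx) hx'
  · rw [extFlow_of_notMem X t hx, extFlow_of_mem X t hx'] at h
    exact absurd (h ▸ hX.mem t ht x' hx') hx
  · rwa [extFlow_of_notMem X t hx, extFlow_of_notMem X t hx'] at h

theorem measurePreserving_extFlow (hX : IsVelocityFlow T M w X) {t : ℝ} (ht : t ∈ Icc 0 T) :
    MeasurePreserving (extFlow X t) ringVol ringVol :=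
  ⟨(hX.map_extFlow ht).1, (hX.map_extFlow ht).2⟩

end IsVelocityFlow

/-! ### Vorticity measures and linearity of the Biot-Savart law. -/

/-- The measure `x_r w dx` on the half plane. -/
def vortexMeasure (w : Plane → ℝ) : Measure Plane :=
  ringVol.withDensity fun x => ENNReal.ofReal (w x)

lemma ringVol_absolutelyContinuous : ringVol ≪ halfVol := withDensity_absolutelyContinuous _ _

lemma halfVol_absolutelyContinuous : halfVol ≪ ringVol := by
  refine withDensity_absolutelyContinuous' (by fun_prop) ?_
  filter_upwards [ae_halfVol_pos] with x hx
  simpa using hx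

instance : NullSingletonClass halfVol := by unfold halfVol; infer_instance

instance : SFinite ringVol := by unfold ringVol; infer_instance

instance (w : Plane → ℝ) : SFinite (vortexMeasure w) := by unfold vortexMeasure; infer_instance

lemma vortexMeasure_absolutelyContinuous (w : Plane → ℝ) : vortexMeasure w ≪ halfVol :=
  (withDensity_absolutelyContinuous _ _).trans ringVol_absolutelyContinuous

instance (w : Plane → ℝ) : NullSingletonClass (vortexMeasure w) :=
  ⟨fun x => vortexMeasure_absolutelyContinuous w (measure_singleton x)⟩

lemma ae_vortexMeasure_mem (w : Plane → ℝ) : ∀ᵐ x ∂vortexMeasure w, x ∈ halfPlane :=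
  (vortexMeasure_absolutelyContinuous w).ae_le (ae_restrict_mem measurableSet_halfPlane)

lemma vortexMeasure_eq {w : Plane → ℝ} (hm : AEStronglyMeasurable w halfVol) :
    vortexMeasure w = halfVol.withDensity fun x => ENNReal.ofReal (x 1 * w x) := by
  have hm' : AEMeasurable (fun x => ENNReal.ofReal (w x)) halfVol := hm.aemeasurable.ennreal_ofReal
  rw [vortexMeasure, ringVol, ← withDensity_mul₀ (by fun_prop) hm']
  refine withDensity_congr_ae ?_
  filter_upwards [ae_halfVol_pos] with x hx
  rw [Pi.mul_apply, ← ENNReal.ofReal_mul hx.le]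

lemma integral_vortexMeasure {w : Plane → ℝ} (hm : AEStronglyMeasurable w halfVol)
    (h0 : ∀ᵐ x ∂halfVol, 0 ≤ w x) {E : Type*} [NormedAddCommGroup E] [NormedSpace ℝ E]
    (f : Plane → E) :
    ∫ x, f x ∂vortexMeasure w = ∫ x, (x 1 * w x) • f x ∂halfVol := by
  have hm' : AEMeasurable (fun x : Plane => ENNReal.ofReal (x 1 * w x)) halfVol :=
    (AEMeasurable.mul (by fun_prop) hm.aemeasurable).ennreal_ofReal
  rw [vortexMeasure_eq hm, integral_withDensity_eq_integral_toReal_smul₀ hm' (by simp)]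
  refine integral_congr_ae ?_
  filter_upwards [ae_halfVol_pos, h0] with x hx hx0
  rw [ENNReal.toReal_ofReal (mul_nonneg hx.le hx0)]

/-- Transport of the density by a measure preserving embedding is transport of the measure. This
allows integrals over a blob at time t to be pulled back to its initial distribution. -/
lemma map_vortexMeasure {φ : Plane → Plane} (hφ : MeasurePreserving φ ringVol ringVol)
    (he : MeasurableEmbedding φ) {w w₀ : Plane → ℝ} (h : w ∘ φ =ᵐ[ringVol] w₀) :
    (vortexMeasure w₀).map φ = vortexMeasure w := by
  ext s hs
  rw [Measure.map_apply hφ.measurable hs, vortexMeasure, vortexMeasure,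
    withDensity_apply _ (hφ.measurable hs), withDensity_apply _ hs,
    ← hφ.setLIntegral_comp_preimage_emb he (fun x => ENNReal.ofReal (w x))]
  refine lintegral_congr_ae (ae_restrict_of_ae ?_)
  filter_upwards [h] with x hx
  rw [← hx, Function.comp]

lemma biotSavart_smul (c : ℝ) (w : Plane → ℝ) (x : Plane) :
    biotSavart (fun y => c * w y) x = c • biotSavart w x := by
  have h1 : ∀ y θ (a : ℝ), c * w y * a / bsDenom x y θ = c * (w y * a / bsDenom x y θ) := by
    intros; ring
  have h2 : ∀ y a : ℝ, y ^ 2 * (c * a) = c * (y ^ 2 * a) := by intros; ring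
  ext i
  fin_cases i <;>
    simp only [biotSavart, h1, intervalIntegral.integral_const_mul, h2, integral_const_mul,
      PiLp.smul_apply, smul_eq_mul] <;> simp <;> ring

lemma biotSavart_congr {w w' : Plane → ℝ} (h : w =ᵐ[halfVol] w') (x : Plane) :
    biotSavart w x = biotSavart w' x := by
  have key : ∀ f : Plane → ℝ → ℝ, ∫ y, (y 1) ^ 2 * (∫ θ in (-π)..π, w y * f y θ / bsDenom x y θ)
      ∂halfVol = ∫ y, (y 1) ^ 2 * (∫ θ in (-π)..π, w' y * f y θ / bsDenom x y θ) ∂halfVol := by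
    intro f
    refine integral_congr_ae ?_
    filter_upwards [h] with y hy
    simp only [hy]
  unfold biotSavart
  rw [key fun y θ => x 1 * cos θ - y 1, key fun y θ => (x 0 - y 0) * cos θ]

lemma Admissible.mono {M M' : ℝ} {w : Plane → ℝ} (hw : Admissible M w) (h : M ≤ M') :
    Admissible M' w :=
  ⟨hw.meas, hw.bound.mono fun _ hy => hy.trans h, hw.mass.trans (ENNReal.ofReal_le_ofReal h)⟩

lemma Admissible.add {M M' : ℝ} {w w' : Plane → ℝ} (hM : 0 ≤ M) (hM' : 0 ≤ M')
    (hw : Admissible M w) (hw' : Admissible M' w') :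
    Admissible (M + M') (fun y => w y + w' y) where
  meas := hw.meas.add hw'.meas
  bound := by
    filter_upwards [hw.bound, hw'.bound] with y h h'
    rw [mul_add]; exact (abs_add_le _ _).trans (add_le_add h h')
  mass := by
    have hm : AEMeasurable (fun y : Plane => ENNReal.ofReal ((y 1) ^ 2 * |w y|)) halfVol :=
      (AEMeasurable.mul (by fun_prop)
        (continuous_abs.measurable.comp_aemeasurable hw.meas.aemeasurable)).ennreal_ofReal
    rw [ENNReal.ofReal_add hM hM']
    refine le_trans ?_ (add_le_add hw.mass hw'.mass)
    rw [← lintegral_add_left' hm]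
    refine lintegral_mono fun y => ?_
    rw [← ENNReal.ofReal_add (by positivity) (by positivity), ← mul_add]
    gcongr
    exact abs_add_le _ _

lemma Admissible.bs_add {M M' : ℝ} {w w' : Plane → ℝ} (hM : 0 < M) (hM' : 0 < M')
    (hw : Admissible M w) (hw' : Admissible M' w') (δ : ℝ) (x : Plane) :
    bs δ (fun y => w y + w' y) x = bs δ w x + bs δ w' x := by
  unfold bs
  rw [← integral_add (hw.kern_integrable hM δ x).1 (hw'.kern_integrable hM' δ x).1]
  congr 1; ext1 q
  rw [← add_smul]; ring_nf

lemma Admissible.zero {M : ℝ} (hM : 0 ≤ M) : Admissible M (fun _ => 0) where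
  meas := aestronglyMeasurable_const
  bound := by simp [hM]
  mass := by simp

lemma admissible_sum {ι : Type*} (s : Finset ι) {M : ℝ} {w : ι → Plane → ℝ} (hM : 0 < M)
    (hw : ∀ j ∈ s, Admissible M (w j)) (δ : ℝ) (x : Plane) :
    Admissible (((s.card : ℝ) + 1) * M) (fun y => ∑ j ∈ s, w j y) ∧
    bs δ (fun y => ∑ j ∈ s, w j y) x = ∑ j ∈ s, bs δ (w j) x := by
  classical
  induction s using Finset.induction_on with
  | empty => simpa [bs] using Admissible.zero hM.le
  | insert a s ha ih =>
    obtain ⟨h1, h2⟩ := ih fun j hj => hw j (Finset.mem_insert_of_mem hj)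
    have h3 := hw a (Finset.mem_insert_self a s)
    simp only [Finset.sum_insert ha, Finset.card_insert_of_notMem ha]
    have hp : 0 < ((s.card : ℝ) + 1) * M := by positivity
    refine ⟨(h3.add hM.le hp.le h1).mono (le_of_eq ?_), ?_⟩
    · push_cast; ring
    · rw [h3.bs_add hM hp h1, h2]

/-- The flow of a weak solution solves the differential equation of the Biot-Savart law. -/
lemma IsWeakSolution.exists_isVelocityFlow {ε T : ℝ} {ω₀ : Plane → ℝ} {ω : ℝ → Plane → ℝ}
    {u X : ℝ → Plane → Plane} (h : IsWeakSolution ε T ω₀ ω u X) :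
    ∃ M, IsVelocityFlow T M (fun t y => (1 / |log ε|) * ω t y) X := by
  obtain ⟨C₁, hC₁⟩ := h.rω_Linfty.2
  obtain ⟨C₂, hC₂⟩ := h.r2ω_L1.2
  set c : ℝ := 1 / |log ε| with hc
  have hc0 : 0 ≤ c := by positivity
  refine ⟨c * C₁ + c * C₂ + 1, by positivity, ?_, ?_, h.flow_zero, h.flow_mem, ?_⟩
  · exact h.ω_Linfty.1.const_mul c
  · have hj := h.ω_Linfty.1
    filter_upwards [hC₁, hC₂, hj.prodMk_left] with t h1 h2 h3
    refine ⟨AEStronglyMeasurable.const_mul h3 c, ?_, ?_⟩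
    · rw [eLpNorm_exponent_top] at h1
      filter_upwards [enorm_ae_le_eLpNormEssSup (fun x : Plane => x 1 * ω t x) halfVol] with y hy
      have h4 : ‖y 1 * ω t y‖ ≤ C₁ := by
        have := hy.trans h1
        rwa [← ofReal_norm, ENNReal.ofReal_le_iff_le_toReal ENNReal.coe_ne_top,
          ENNReal.coe_toReal] at this
      rw [Real.norm_eq_abs] at h4
      calc |y 1 * (c * ω t y)| = c * |y 1 * ω t y| := by
            rw [mul_left_comm, abs_mul, abs_of_nonneg hc0]
        _ ≤ c * C₁ := by gcongr
        _ ≤ _ := by nlinarith [mul_nonneg hc0 C₂.2]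
    · rw [eLpNorm_one_eq_lintegral_enorm] at h2
      calc ∫⁻ y, ENNReal.ofReal ((y 1) ^ 2 * |c * ω t y|) ∂halfVol
          = ∫⁻ y, ENNReal.ofReal c * ‖(y 1) ^ 2 * ω t y‖ₑ ∂halfVol := by
            refine lintegral_congr fun y => ?_
            rw [← ofReal_norm, ← ENNReal.ofReal_mul hc0, Real.norm_eq_abs, abs_mul,
              abs_mul ((y 1) ^ 2), abs_of_nonneg hc0, abs_of_nonneg (sq_nonneg (y 1)),
              mul_left_comm]
        _ = ENNReal.ofReal c * ∫⁻ y, ‖(y 1) ^ 2 * ω t y‖ₑ ∂halfVol :=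
            lintegral_const_mul' _ _ ENNReal.ofReal_ne_top
        _ ≤ ENNReal.ofReal c * C₂ := by gcongr
        _ = ENNReal.ofReal (c * C₂) := by
            rw [ENNReal.ofReal_mul hc0, ENNReal.ofReal_coe_nnreal]
        _ ≤ _ := by
            refine ENNReal.ofReal_le_ofReal ?_
            nlinarith [mul_nonneg hc0 C₁.2]
  · intro x hx t ht
    have := h.flow_deriv x hx t ht
    rwa [h.velocity t ht _ (h.flow_mem t ht x hx), ← biotSavart_smul] at this

/-! ### Transported blobs: mass, density bound, decomposition of the vorticity. -/

namespace BlobFlow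

variable {N : ℕ} {Xs : Plane} {Y : Fin N → Plane} {γ M₀ ε T : ℝ} (S : BlobFlow Xs Y γ M₀ ε T)

lemma exists_flow : ∃ M, IsVelocityFlow T M (fun t y => (1 / |log ε|) * S.ω t y) S.X :=
  S.isWeakSolution.exists_isVelocityFlow

lemma measurePreserving {t : ℝ} (ht : t ∈ Icc 0 T) :
    MeasurePreserving (extFlow S.X t) ringVol ringVol :=
  let ⟨_, h⟩ := S.exists_flow; h.measurePreserving_extFlow ht

lemma measurableEmbedding {t : ℝ} (ht : t ∈ Icc 0 T) : MeasurableEmbedding (extFlow S.X t) :=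
  let ⟨_, h⟩ := S.exists_flow; h.measurableEmbedding_extFlow ht

lemma blob_comp (i : Fin N) {t : ℝ} (ht : t ∈ Icc 0 T) :
    S.blob i t ∘ extFlow S.X t =ᵐ[ringVol] S.blob₀ i := by
  filter_upwards [ringVol_absolutelyContinuous.ae_le (S.blob_transport i t ht), ae_ringVol_mem]
    with x hx hxH
  rw [Function.comp, extFlow_of_mem _ _ hxH, hx]

lemma ae_map {p : Plane → Prop} {t : ℝ} (ht : t ∈ Icc 0 T)
    (h : ∀ᵐ x ∂ringVol, p (extFlow S.X t x)) : ∀ᵐ x ∂ringVol, p x := by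
  rw [← (S.measurePreserving ht).map_eq]
  exact (S.measurableEmbedding ht).ae_map_iff.2 h

/-- Measurability at positive times is inherited from the initial blob through the measure
preserving embedding. -/
lemma blob_meas (i : Fin N) {t : ℝ} (ht : t ∈ Icc 0 T) :
    AEStronglyMeasurable (S.blob i t) halfVol := by
  refine AEStronglyMeasurable.mono_ac halfVol_absolutelyContinuous ?_
  rw [← (S.measurePreserving ht).aestronglyMeasurable_comp_iff (S.measurableEmbedding ht)]
  exact ((S.blob₀_meas i).mono_ac ringVol_absolutelyContinuous).congr (S.blob_comp i ht).symm

lemma blob_nonneg (i : Fin N) {t : ℝ} (ht : t ∈ Icc 0 T) : ∀ᵐ x ∂halfVol, 0 ≤ S.blob i t x := by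
  refine halfVol_absolutelyContinuous.ae_le (S.ae_map ht ?_)
  filter_upwards [S.blob_comp i ht, ringVol_absolutelyContinuous.ae_le (S.blob₀_nonneg i)]
    with x hx h0
  rw [Function.comp] at hx; rwa [hx]

lemma blob₀_le (i : Fin N) : ∀ᵐ x ∂halfVol, S.blob₀ i x ≤ M₀ / ε ^ 2 := by
  filter_upwards [ae_all_iff.2 S.blob₀_nonneg, S.blob₀_bound] with x h0 h
  exact (Finset.single_le_sum (fun j _ => h0 j) (Finset.mem_univ i)).trans ((le_abs_self _).trans h)

lemma blob_le (i : Fin N) {t : ℝ} (ht : t ∈ Icc 0 T) :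
    ∀ᵐ x ∂halfVol, S.blob i t x ≤ M₀ / ε ^ 2 := by
  refine halfVol_absolutelyContinuous.ae_le (S.ae_map ht ?_)
  filter_upwards [S.blob_comp i ht, ringVol_absolutelyContinuous.ae_le (S.blob₀_le i)]
    with x hx h0
  rw [Function.comp] at hx; rwa [hx]

/-- Both sides agree after composition with the flow, and `ae_map` turns this into agreement almost
everywhere. -/
lemma ω_eq_sum {t : ℝ} (ht : t ∈ Icc 0 T) : S.ω t =ᵐ[halfVol] fun x => ∑ i, S.blob i t x := by
  refine halfVol_absolutelyContinuous.ae_le (S.ae_map ht ?_)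
  filter_upwards [ringVol_absolutelyContinuous.ae_le (S.isWeakSolution.transport t ht),
    ae_all_iff.2 fun i => S.blob_comp i ht, ae_ringVol_mem] with x hx h hxH
  rw [extFlow_of_mem _ _ hxH, hx]
  refine Finset.sum_congr rfl fun i _ => ?_
  rw [← h i, Function.comp, extFlow_of_mem _ _ hxH]

/-- The measure `x_r ω_i(t, x) dx`. -/
def blobMeasure (i : Fin N) (t : ℝ) : Measure Plane := vortexMeasure (S.blob i t)

lemma map_blobMeasure (i : Fin N) {t : ℝ} (ht : t ∈ Icc 0 T) :
    (vortexMeasure (S.blob₀ i)).map (extFlow S.X t) = S.blobMeasure i t :=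
  map_vortexMeasure (S.measurePreserving ht) (S.measurableEmbedding ht) (S.blob_comp i ht)

lemma blobMeasure₀_univ (hγ : 0 < γ) (i : Fin N) :
    vortexMeasure (S.blob₀ i) univ = ENNReal.ofReal γ := by
  have h : ∫ x, x 1 * S.blob₀ i x ∂halfVol = γ := S.blob₀_mass i
  have hint : Integrable (fun x : Plane => x 1 * S.blob₀ i x) halfVol := by
    by_contra hn
    rw [integral_undef hn] at h; exact hγ.ne h
  rw [vortexMeasure_eq (S.blob₀_meas i), withDensity_apply _ MeasurableSet.univ,
    Measure.restrict_univ, ← ofReal_integral_eq_lintegral_ofReal hint ?_, h]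
  filter_upwards [ae_halfVol_pos, S.blob₀_nonneg i] with x h1 h2 using mul_nonneg h1.le h2

lemma blobMeasure_univ (hγ : 0 < γ) (i : Fin N) {t : ℝ} (ht : t ∈ Icc 0 T) :
    S.blobMeasure i t univ = ENNReal.ofReal γ := by
  rw [← S.map_blobMeasure i ht, Measure.map_apply (S.measurePreserving ht).measurable
    MeasurableSet.univ, preimage_univ, S.blobMeasure₀_univ hγ]

lemma blobMeasure_le (i : Fin N) {t : ℝ} (ht : t ∈ Icc 0 T) :
    S.blobMeasure i t ≤ ENNReal.ofReal (M₀ / ε ^ 2) • ringVol := by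
  rw [blobMeasure, vortexMeasure, ← withDensity_const]
  refine withDensity_mono ?_
  filter_upwards [ringVol_absolutelyContinuous.ae_le (S.blob_le i ht)] with x hx
  exact ENNReal.ofReal_le_ofReal hx

lemma integral_blobMeasure (i : Fin N) {t : ℝ} (ht : t ∈ Icc 0 T) {E : Type*}
    [NormedAddCommGroup E] [NormedSpace ℝ E] (f : Plane → E) :
    ∫ x, f x ∂S.blobMeasure i t = ∫ x, (x 1 * S.blob i t x) • f x ∂halfVol :=
  integral_vortexMeasure (S.blob_meas i ht) (S.blob_nonneg i ht) f

/-- A blob which lives at heights at most `R` is admissible. -/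
lemma admissible_blob (hγ : 0 < γ) (hM₀ : 0 < M₀) (i : Fin N) {t R : ℝ}
    (ht : t ∈ Icc 0 T) (hR : 0 ≤ R) (h : ∀ᵐ x ∂S.blobMeasure i t, x 1 ≤ R) :
    Admissible (R * (M₀ / ε ^ 2) + R * γ) (S.blob i t) where
  meas := S.blob_meas i ht
  bound := by
    have hm : AEMeasurable (fun x => ENNReal.ofReal (S.blob i t x)) ringVol :=
      ((S.blob_meas i ht).mono_ac ringVol_absolutelyContinuous).aemeasurable.ennreal_ofReal
    rw [blobMeasure, vortexMeasure, ae_withDensity_iff' hm] at h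
    filter_upwards [halfVol_absolutelyContinuous.ae_le h, S.blob_nonneg i ht, S.blob_le i ht,
      ae_halfVol_pos] with x h h0 h1 hx
    have hp : 0 ≤ M₀ / ε ^ 2 := by positivity
    rw [abs_of_nonneg (mul_nonneg hx.le h0)]
    rcases h0.eq_or_lt with h2 | h2
    · rw [← h2, mul_zero]; positivity
    · have := h (by simpa using h2)
      nlinarith [mul_le_mul this h1 h0 hR, mul_nonneg hR hγ.le]
  mass := by
    have hm : AEMeasurable (fun x : Plane => ENNReal.ofReal (x 1 * S.blob i t x)) halfVol :=
      (AEMeasurable.mul (by fun_prop) (S.blob_meas i ht).aemeasurable).ennreal_ofReal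
    calc ∫⁻ y, ENNReal.ofReal ((y 1) ^ 2 * |S.blob i t y|) ∂halfVol
        = ∫⁻ y, ENNReal.ofReal (y 1 * S.blob i t y) * ENNReal.ofReal (y 1) ∂halfVol := by
          refine lintegral_congr_ae ?_
          filter_upwards [S.blob_nonneg i ht, ae_halfVol_pos] with x h0 hx
          rw [← ENNReal.ofReal_mul (mul_nonneg hx.le h0), abs_of_nonneg h0]; ring_nf
      _ = ∫⁻ y, ENNReal.ofReal (y 1) ∂S.blobMeasure i t := by
          rw [blobMeasure, vortexMeasure_eq (S.blob_meas i ht),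
            lintegral_withDensity_eq_lintegral_mul₀ hm (by fun_prop)]
          rfl
      _ ≤ ∫⁻ _, ENNReal.ofReal R ∂S.blobMeasure i t :=
          lintegral_mono_ae (h.mono fun x hx => ENNReal.ofReal_le_ofReal hx)
      _ = ENNReal.ofReal (R * γ) := by
          rw [lintegral_const, S.blobMeasure_univ hγ i ht, ENNReal.ofReal_mul hR]
      _ ≤ _ := by
          refine ENNReal.ofReal_le_ofReal ?_
          have : 0 ≤ R * (M₀ / ε ^ 2) := by positivity
          linarith

lemma velocity_eq_sum {M t : ℝ} (hM : 0 < M) (ht : t ∈ Icc 0 T)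
    (h : ∀ j, Admissible M (S.blob j t)) {x : Plane} (hx : x ∈ halfPlane) :
    S.u t x = ∑ j, bs 0 (S.blob j t) x := by
  obtain ⟨h1, h2⟩ := admissible_sum Finset.univ hM (fun j _ => h j) 0 x
  rw [S.isWeakSolution.velocity t ht x hx, biotSavart_congr (S.ω_eq_sum ht),
    h1.biotSavart_eq (by positivity), h2]

lemma ae_blobMeasure_iff (i : Fin N) {t : ℝ} (ht : t ∈ Icc 0 T) {p : Plane → Prop} :
    (∀ᵐ x ∂S.blobMeasure i t, p x) ↔
      ∀ᵐ x ∂vortexMeasure (S.blob₀ i), p (extFlow S.X t x) := by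
  rw [← S.map_blobMeasure i ht]
  exact (S.measurableEmbedding ht).ae_map_iff

end BlobFlow

/-! ### Essential supports and the exit time. -/

lemma ae_mem_essSupport (f : Plane → ℝ) : ∀ᵐ x ∂halfVol, f x ≠ 0 → x ∈ essSupport f := by
  rw [ae_iff]
  refine measure_null_of_locally_null _ fun x hx => ?_
  simp only [Set.mem_ofPred_eq, Classical.not_imp, essSupport, not_forall, not_not] at hx
  obtain ⟨-, U, hU, h0⟩ := hx
  refine ⟨U ∩ Function.support f, ?_, h0⟩
  refine inter_mem (mem_nhdsWithin_of_mem_nhds hU) (mem_of_superset self_mem_nhdsWithin ?_)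
  intro y hy
  simp only [Set.mem_ofPred_eq, Classical.not_imp] at hy
  exact hy.1

lemma ae_vortexMeasure_of_essSupport {w : Plane → ℝ} (hm : AEStronglyMeasurable w halfVol)
    {R : Set Plane} (h : essSupport w ⊆ R) : ∀ᵐ x ∂vortexMeasure w, x ∈ R := by
  have hm' : AEMeasurable (fun x => ENNReal.ofReal (w x)) ringVol :=
    (hm.mono_ac ringVol_absolutelyContinuous).aemeasurable.ennreal_ofReal
  rw [vortexMeasure, ae_withDensity_iff' hm']
  filter_upwards [ringVol_absolutelyContinuous.ae_le (ae_mem_essSupport w)] with x hx h0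
  exact h (hx fun hw => h0 (by simp [hw]))

/-- The closed rectangle `|x_r - r_i| ≤ d / √|log ε|`, `|x_z - z^*| ≤ H`. -/
def slab {N : ℕ} (Xs : Plane) (Y : Fin N → Plane) (ε d H : ℝ) (i : Fin N) : Set Plane :=
  {x | |x 1 - initCenter Xs Y ε i 1| ≤ d / √|log ε| ∧ |x 0 - Xs 0| ≤ H}

lemma isClosed_slab {N : ℕ} (Xs : Plane) (Y : Fin N → Plane) (ε d H : ℝ) (i : Fin N) :
    IsClosed (slab Xs Y ε d H i) :=
  (isClosed_le (f := fun x : Plane => |x 1 - initCenter Xs Y ε i 1|) (by fun_prop)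
    continuous_const).inter
    (isClosed_le (f := fun x : Plane => |x 0 - Xs 0|) (by fun_prop) continuous_const)

namespace BlobFlow

variable {N : ℕ} {Xs : Plane} {Y : Fin N → Plane} {γ M₀ ε T : ℝ} (S : BlobFlow Xs Y γ M₀ ε T)

lemma exitTime_nonneg (d₀ h₀ : ℝ) : 0 ≤ S.exitTime d₀ h₀ :=
  Real.sSup_nonneg fun _ ht => ht.1.1

lemma exitTime_le (hT : 0 ≤ T) (d₀ h₀ : ℝ) : S.exitTime d₀ h₀ ≤ T :=
  Real.sSup_le (fun _ ht => ht.1.2) hT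

lemma Icc_exitTime_subset (hT : 0 ≤ T) (d₀ h₀ : ℝ) : Icc 0 (S.exitTime d₀ h₀) ⊆ Icc 0 T :=
  Icc_subset_Icc_right (S.exitTime_le hT d₀ h₀)

lemma ae_blobMeasure_of_lt (i : Fin N) {d₀ h₀ H t : ℝ} (hT : 0 ≤ T) (hH : h₀ ≤ H) (ht0 : 0 ≤ t)
    (ht : t < S.exitTime d₀ h₀) : ∀ᵐ x ∂S.blobMeasure i t, x ∈ slab Xs Y ε d₀ H i := by
  have hne : {t : ℝ | t ∈ Icc 0 T ∧ ∀ s ∈ Icc 0 t, ∀ i : Fin N,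
      -- If no time were allowed, the supremum would be that of the empty set, which is 0, and no t
      -- ≥ 0 could lie strictly below it.
      essSupport (S.blob i s) ⊆ rect Xs ε (initCenter Xs Y ε i 1) d₀ h₀}.Nonempty := by
    by_contra hn
    rw [exitTime, Set.not_nonempty_iff_eq_empty.1 hn, Real.sSup_empty] at ht
    linarith
  obtain ⟨t', ht', htt'⟩ := exists_lt_of_lt_csSup hne ht
  have h := ae_vortexMeasure_of_essSupport
    (S.blob_meas i ⟨ht0, ht.le.trans (S.exitTime_le hT d₀ h₀)⟩) (ht'.2 t ⟨ht0, htt'.le⟩ i)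
  filter_upwards [h] with x hx
  exact ⟨hx.2.1, hx.2.2.trans hH⟩

/-- Up to the exit time, almost all trajectories stay in the closed rectangle. -/
lemma ae_trajectory (i : Fin N) {d₀ h₀ H : ℝ} (hT : 0 ≤ T) (hH : h₀ ≤ H)
    (hball : Metric.closedBall (initCenter Xs Y ε i) ε ⊆ slab Xs Y ε d₀ H i) :
    ∀ᵐ x ∂vortexMeasure (S.blob₀ i), ∀ t ∈ Icc 0 (S.exitTime d₀ h₀),
      extFlow S.X t x ∈ slab Xs Y ε d₀ H i := by
  have h0 := ae_vortexMeasure_of_essSupport (S.blob₀_meas i) ((S.blob₀_supp i).trans hball)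
  -- Rational times need only countably many null sets; continuity of trajectories and closedness of
  -- the slab then give all times, including the exit time, at which the support condition itself
  -- need not hold.
  have hq : ∀ᵐ x ∂vortexMeasure (S.blob₀ i), ∀ q : ℚ, 0 ≤ (q : ℝ) → (q : ℝ) < S.exitTime d₀ h₀ →
      extFlow S.X q x ∈ slab Xs Y ε d₀ H i := by
    refine ae_all_iff.2 fun q => ?_
    by_cases h : 0 ≤ (q : ℝ) ∧ (q : ℝ) < S.exitTime d₀ h₀
    · have := (S.ae_blobMeasure_iff i ⟨h.1, h.2.le.trans (S.exitTime_le hT d₀ h₀)⟩).1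
        (S.ae_blobMeasure_of_lt i hT hH h.1 h.2)
      filter_upwards [this] with x hx _ _ using hx
    · exact Eventually.of_forall fun x h1 h2 => absurd ⟨h1, h2⟩ h
  filter_upwards [h0, hq, ae_vortexMeasure_mem (S.blob₀ i)] with x hx0 hx hxH t ht
  rw [extFlow_of_mem _ _ hxH]
  simp only [extFlow_of_mem _ _ hxH] at hx
  -- A vanishing exit time may come from the supremum of the empty set, so the only available
  -- information is that the initial ball lies in the slab.
  rcases (S.exitTime_nonneg d₀ h₀).eq_or_lt with he | he
  · have : t = 0 := le_antisymm (he ▸ ht.2) ht.1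
    rw [this, S.isWeakSolution.flow_zero x hxH]; exact hx0
  · obtain ⟨M, hM⟩ := S.exists_flow
    have hc : ContinuousWithinAt (fun s => S.X s x)
        (Ioo 0 (S.exitTime d₀ h₀) ∩ range ((↑) : ℚ → ℝ)) t :=
      (hM.continuousOn hxH t (S.Icc_exitTime_subset hT d₀ h₀ ht)).mono
        ((inter_subset_left.trans Ioo_subset_Icc_self).trans (S.Icc_exitTime_subset hT d₀ h₀))
    have hcl : t ∈ closure (Ioo 0 (S.exitTime d₀ h₀) ∩ range ((↑) : ℚ → ℝ)) := by
      have h1 : Ioo 0 (S.exitTime d₀ h₀) ⊆ closure (Ioo 0 (S.exitTime d₀ h₀) ∩ range _) :=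
        Dense.open_subset_closure_inter (Rat.denseRange_cast (𝕜 := ℝ)) isOpen_Ioo
      have h2 := closure_minimal h1 isClosed_closure
      rw [closure_Ioo he.ne] at h2
      exact h2 ht
    have := hc.mem_closure hcl (t := slab Xs Y ε d₀ H i) (by
      rintro s ⟨hs, q, rfl⟩; exact hx q hs.1.le hs.2)
    rwa [(isClosed_slab Xs Y ε d₀ H i).closure_eq] at this

lemma ae_blobMeasure_slab (i : Fin N) {d₀ h₀ H : ℝ} (hT : 0 ≤ T) (hH : h₀ ≤ H)
    (hball : Metric.closedBall (initCenter Xs Y ε i) ε ⊆ slab Xs Y ε d₀ H i) {t : ℝ}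
    (ht : t ∈ Icc 0 (S.exitTime d₀ h₀)) :
    ∀ᵐ x ∂S.blobMeasure i t, x ∈ slab Xs Y ε d₀ H i := by
  rw [S.ae_blobMeasure_iff i (S.Icc_exitTime_subset hT d₀ h₀ ht)]
  filter_upwards [S.ae_trajectory i hT hH hball] with x hx using hx t ht

end BlobFlow

/-! ### Geometry of the rectangles for small ε. -/

lemma tendsto_abs_log : Tendsto (fun ε => |log ε|) (𝓝[>] (0 : ℝ)) atTop :=
  tendsto_abs_atBot_atTop.comp tendsto_log_nhdsGT_zero

lemma tendsto_inv_sqrt_abs_log :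
    Tendsto (fun ε => 1 / √|log ε|) (𝓝[>] (0 : ℝ)) (𝓝 0) := by
  simp only [one_div]
  exact (tendsto_sqrt_atTop.comp tendsto_abs_log).inv_tendsto_atTop

lemma tendsto_mul_sqrt_abs_log :
    Tendsto (fun ε => ε * √|log ε|) (𝓝[>] (0 : ℝ)) (𝓝 0) := by
  have h1 : Tendsto (fun ε : ℝ => ε * log ε) (𝓝[>] 0) (𝓝 0) := by
    simpa using tendsto_log_mul_rpow_nhdsGT_zero (r := 1) one_pos |>.congr fun x => by
      rw [Real.rpow_one, mul_comm]
  have h2 : Tendsto (fun ε : ℝ => ε + |ε * log ε|) (𝓝[>] 0) (𝓝 0) := by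
    have := (tendsto_nhdsWithin_of_tendsto_nhds (s := Ioi 0) tendsto_id).add h1.abs (α := ℝ)
    simpa using this
  refine squeeze_zero' ?_ ?_ h2
  · filter_upwards [self_mem_nhdsWithin] with ε hε
    have : (0 : ℝ) < ε := hε
    positivity
  · filter_upwards [self_mem_nhdsWithin] with ε hε
    have h : (0 : ℝ) < ε := hε
    have h3 : √|log ε| ≤ 1 + |log ε| := by
      rw [Real.sqrt_le_left (by positivity)]; nlinarith [abs_nonneg (log ε)]
    calc ε * √|log ε| ≤ ε * (1 + |log ε|) := by gcongr
      _ = ε + |ε * log ε| := by rw [abs_mul, abs_of_pos h]; ring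

/-- For small `ε`, the rectangles lie at heights close to `r^*`, and contain the initial balls. -/
lemma eventually_geometry {N : ℕ} (Xs : Plane) (hXs : Xs ∈ halfPlane) (Y : Fin N → Plane) {d₀ : ℝ}
    (hd : 0 < d₀) : ∃ ε₀ > 0, ∀ ε ∈ Ioc 0 ε₀, ε < 1 / 2 ∧ 1 ≤ |log ε| ∧ ∀ i,
      Metric.closedBall (initCenter Xs Y ε i) ε ⊆ slab Xs Y ε d₀ 1 i ∧
      |initCenter Xs Y ε i 1 - Xs 1| + d₀ / √|log ε| ≤ Xs 1 / 2 := by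
  have hr : 0 < Xs 1 := hXs
  have h1 : ∀ᶠ ε in 𝓝[>] (0 : ℝ), ε < 1 / 2 :=
    mem_nhdsWithin_of_mem_nhds (Iio_mem_nhds (by norm_num))
  have h2 : ∀ᶠ ε in 𝓝[>] (0 : ℝ), 1 ≤ |log ε| := tendsto_abs_log.eventually_ge_atTop 1
  have h3 : ∀ᶠ ε in 𝓝[>] (0 : ℝ), ε * √|log ε| < d₀ :=
    tendsto_mul_sqrt_abs_log.eventually (gt_mem_nhds hd)
  -- The axial half-width of the slabs is 1 rather than h₀, so the threshold for ε does not depend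
  -- on h₀; the centre offset and the radius ε each use up at most one half.
  have h4 : ∀ i, ∀ᶠ ε in 𝓝[>] (0 : ℝ), 1 / √|log ε| * |Y i 0| < 1 / 2 := fun i =>
    (tendsto_inv_sqrt_abs_log.mul_const |Y i 0|).eventually (gt_mem_nhds (by norm_num))
  have h5 : ∀ i, ∀ᶠ ε in 𝓝[>] (0 : ℝ), 1 / √|log ε| * (|Y i 1| + d₀) < Xs 1 / 2 := fun i =>
    (tendsto_inv_sqrt_abs_log.mul_const (|Y i 1| + d₀)).eventually
      (gt_mem_nhds (by rw [zero_mul]; positivity))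
  obtain ⟨ε₀, hε₀, h⟩ := mem_nhdsGT_iff_exists_Ioc_subset.1
    (h1.and (h2.and (h3.and ((eventually_all.2 h4).and (eventually_all.2 h5)))))
  refine ⟨ε₀, hε₀, fun ε hε => ?_⟩
  obtain ⟨e1, e2, e3, e4, e5⟩ := h hε
  have hL : 0 < √|log ε| := Real.sqrt_pos.2 (by linarith)
  refine ⟨e1, e2, fun i => ⟨fun x hx => ?_, ?_⟩⟩
  · rw [Metric.mem_closedBall, dist_eq_norm] at hx
    have hx0 := (abs_apply_le_norm (x - initCenter Xs Y ε i) 0).trans hx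
    have hx1 := (abs_apply_le_norm (x - initCenter Xs Y ε i) 1).trans hx
    refine ⟨?_, ?_⟩
    · rw [PiLp.sub_apply] at hx1
      refine hx1.trans ?_
      rw [le_div_iff₀ hL]; exact e3.le
    · have h6 : x 0 - Xs 0 = (x - initCenter Xs Y ε i) 0 + 1 / √|log ε| * Y i 0 := by
        simp [initCenter]; ring
      rw [h6]
      refine (abs_add_le _ _).trans ?_
      rw [abs_mul, abs_of_pos (by positivity : 0 < 1 / √|log ε|)]
      linarith [e4 i]
  · have h6 : initCenter Xs Y ε i 1 - Xs 1 = 1 / √|log ε| * Y i 1 := by simp [initCenter]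
    rw [h6, abs_mul, abs_of_pos (by positivity : 0 < 1 / √|log ε|)]
    refine le_of_eq_of_le ?_ (e5 i).le
    ring

/-! ### The stream function of a vortex ring. -/

/-- `D = A + 2 B (1 - cos θ)`. -/
def ringDist (A B θ : ℝ) : ℝ := A + 2 * B * (1 - cos θ)

/-- `∫ cos^k θ D^{-3/2} dθ`. -/
def cosMoment (k : ℕ) (A B : ℝ) : ℝ := ∫ θ in (-π)..π, cos θ ^ k * ringDist A B θ ^ (-(3 / 2) : ℝ)

/-- The stream function of a vortex ring in the variables `A = |x - y|²`, `B = x_r y_r`. -/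
def stream (A B : ℝ) : ℝ := B / (4 * π) * ∫ θ in (-π)..π, cos θ * ringDist A B θ ^ (-(1 / 2) : ℝ)

/-- `∂_A` of the stream function. -/
def streamA (A B : ℝ) : ℝ := -(B / (8 * π)) * cosMoment 1 A B

/-- `∂_B` of the stream function. -/
def streamB (A B : ℝ) : ℝ := B / (4 * π) * (cosMoment 0 A B - cosMoment 1 A B)

section

variable {A B : ℝ}

lemma ringDist_pos (hA : 0 < A) (hB : 0 ≤ B) (θ : ℝ) : 0 < ringDist A B θ := by
  have := cos_le_one θ
  have : 0 ≤ 2 * B * (1 - cos θ) := by nlinarith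
  unfold ringDist; linarith

lemma le_ringDist (hB : 0 ≤ B) (θ : ℝ) : A ≤ ringDist A B θ := by
  have := cos_le_one θ
  have : 0 ≤ 2 * B * (1 - cos θ) := by nlinarith
  unfold ringDist; linarith

lemma continuous_ringDist (A B : ℝ) : Continuous (ringDist A B) := by
  unfold ringDist; fun_prop

lemma continuous_ringDist_rpow (hA : 0 < A) (hB : 0 ≤ B) (p : ℝ) :
    Continuous fun θ => ringDist A B θ ^ p :=
  (continuous_ringDist A B).rpow_const fun θ => Or.inl (ringDist_pos hA hB θ).ne'

lemma intervalIntegrable_cosMoment (hA : 0 < A) (hB : 0 ≤ B) (k : ℕ) (p : ℝ) (a b : ℝ) :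
    IntervalIntegrable (fun θ => cos θ ^ k * ringDist A B θ ^ p) volume a b :=
  ((continuous_cos.pow k).mul (continuous_ringDist_rpow hA hB p)).intervalIntegrable a b

lemma integral_cos_expand (hA : 0 < A) (hB : 0 ≤ B) :
    ∫ θ in (-π)..π, cos θ * ringDist A B θ ^ (-(1 / 2) : ℝ) =
      (A + 2 * B) * cosMoment 1 A B - 2 * B * cosMoment 2 A B := by
  rw [cosMoment, cosMoment, ← intervalIntegral.integral_const_mul,
    ← intervalIntegral.integral_const_mul, ← intervalIntegral.integral_sub
      ((intervalIntegrable_cosMoment hA hB 1 _ _ _).const_mul _)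
      ((intervalIntegrable_cosMoment hA hB 2 _ _ _).const_mul _)]
  refine intervalIntegral.integral_congr fun θ _ => ?_
  have hD := ringDist_pos hA hB θ
  have : ringDist A B θ ^ (-(1 / 2) : ℝ) = ringDist A B θ * ringDist A B θ ^ (-(3 / 2) : ℝ) := by
    rw [← Real.rpow_one_add' hD.le (by norm_num)]; norm_num
  simp only [this]
  unfold ringDist; ring

/-- The derivative of sin θ · D^{-1/2} integrates to zero over a period. Combined with
`integral_cos_expand`, which writes D^{-1/2} as D · D^{-3/2}, it eliminates the second cosine
moment; this is how homogeneity of the stream function is obtained. -/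
lemma integral_cos_parts (hA : 0 < A) (hB : 0 ≤ B) :
    ∫ θ in (-π)..π, cos θ * ringDist A B θ ^ (-(1 / 2) : ℝ) =
      B * (cosMoment 0 A B - cosMoment 2 A B) := by
  have hd : ∀ θ, HasDerivAt (fun θ => sin θ * ringDist A B θ ^ (-(1 / 2) : ℝ))
      (cos θ * ringDist A B θ ^ (-(1 / 2) : ℝ) -
        B * (cos θ ^ 0 * ringDist A B θ ^ (-(3 / 2) : ℝ) -
          cos θ ^ 2 * ringDist A B θ ^ (-(3 / 2) : ℝ))) θ := by
    intro θ
    have h1 : HasDerivAt (ringDist A B) (2 * B * sin θ) θ := by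
      have := (((hasDerivAt_cos θ).const_sub 1).const_mul (2 * B)).const_add A
      rw [neg_neg] at this
      exact this
    have h2 := h1.rpow_const (p := -(1 / 2)) (Or.inl (ringDist_pos hA hB θ).ne')
    refine ((hasDerivAt_sin θ).mul h2).congr_deriv ?_
    have e : (-(1 / 2) - 1 : ℝ) = -(3 / 2) := by norm_num
    rw [e]
    linear_combination (-B * ringDist A B θ ^ (-(3 / 2) : ℝ)) * (sin_sq_add_cos_sq θ)
  have hi1 := intervalIntegrable_cosMoment hA hB 1 (-(1 / 2)) (-π) π
  have hi0 := intervalIntegrable_cosMoment hA hB 0 (-(3 / 2)) (-π) π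
  have hi2 := intervalIntegrable_cosMoment hA hB 2 (-(3 / 2)) (-π) π
  simp only [pow_one] at hi1
  have := intervalIntegral.integral_eq_sub_of_hasDerivAt (a := -π) (b := π) (fun θ _ => hd θ)
    (hi1.sub ((hi0.sub hi2).const_mul B))
  rw [intervalIntegral.integral_sub hi1 ((hi0.sub hi2).const_mul B),
    intervalIntegral.integral_const_mul, intervalIntegral.integral_sub hi0 hi2] at this
  simp only [sin_pi, sin_neg, neg_zero, zero_mul, sub_zero] at this
  unfold cosMoment
  linarith

/-- Homogeneity of degree `1/2` of the stream function. -/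
lemma stream_euler (hA : 0 < A) (hB : 0 ≤ B) :
    A * streamA A B + B * streamB A B = stream A B / 2 := by
  have h1 := integral_cos_expand hA hB
  have h2 := integral_cos_parts hA hB
  unfold stream streamA streamB
  set I := ∫ θ in (-π)..π, cos θ * ringDist A B θ ^ (-(1 / 2) : ℝ)
  have h3 : I = 2 * B * cosMoment 0 A B - (A + 2 * B) * cosMoment 1 A B := by linarith
  rw [h3]; field_simp; ring

lemma hasFDerivAt_stream (hA : 0 < A) (hB : 0 < B) :
    HasFDerivAt (fun p : ℝ × ℝ => stream p.1 p.2)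
      (streamA A B • ContinuousLinearMap.fst ℝ ℝ ℝ + streamB A B • ContinuousLinearMap.snd ℝ ℝ ℝ)
      (A, B) := by
  have hpi : -π ≤ π := by linarith [pi_pos]
  set f1 := ContinuousLinearMap.fst ℝ ℝ ℝ
  set f2 := ContinuousLinearMap.snd ℝ ℝ ℝ
  set F : ℝ × ℝ → ℝ → ℝ := fun p θ => cos θ * ringDist p.1 p.2 θ ^ (-(1 / 2) : ℝ)
  set F' : ℝ × ℝ → ℝ → (ℝ × ℝ →L[ℝ] ℝ) := fun p θ =>
    (-(1 / 2) * (cos θ ^ 1 * ringDist p.1 p.2 θ ^ (-(3 / 2) : ℝ))) • f1 +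
      (cos θ ^ 2 * ringDist p.1 p.2 θ ^ (-(3 / 2) : ℝ) -
        cos θ ^ 1 * ringDist p.1 p.2 θ ^ (-(3 / 2) : ℝ)) • f2
  have hs : {p : ℝ × ℝ | A / 2 < p.1 ∧ 0 < p.2} ∈ 𝓝 (A, B) :=
    (IsOpen.inter (isOpen_lt continuous_const continuous_fst)
      (isOpen_lt continuous_const continuous_snd)).mem_nhds ⟨by simpa using hA, hB⟩
  have hcont : ∀ p ∈ {p : ℝ × ℝ | A / 2 < p.1 ∧ 0 < p.2}, Continuous (F p) := fun p hp =>
    continuous_cos.mul (continuous_ringDist_rpow ((half_pos hA).trans hp.1) hp.2.le _)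
  have hF'c : Continuous (F' (A, B)) := by
    have h := continuous_ringDist_rpow hA hB.le (-(3 / 2))
    simp only [F']
    fun_prop
  have key := hasFDerivAt_integral_of_dominated_of_fderiv_le (μ := volume.restrict (Ioc (-π) π))
    (F := F) (F' := F') (x₀ := (A, B)) (bound := fun _ => 3 * (A / 2) ^ (-(3 / 2) : ℝ)) hs ?_ ?_ ?_
    ?_ ?_ ?_
  · have hint : ∫ θ, F' (A, B) θ ∂(volume.restrict (Ioc (-π) π)) =
        (-(1 / 2) * cosMoment 1 A B) • f1 + (cosMoment 2 A B - cosMoment 1 A B) • f2 := by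
      have i1 := intervalIntegrable_cosMoment hA hB.le 1 (-(3 / 2)) (-π) π
      have i2 := intervalIntegrable_cosMoment hA hB.le 2 (-(3 / 2)) (-π) π
      rw [← intervalIntegral.integral_of_le hpi]
      simp only [F']
      rw [intervalIntegral.integral_add, intervalIntegral.integral_smul_const,
        intervalIntegral.integral_smul_const, intervalIntegral.integral_const_mul,
        intervalIntegral.integral_sub i2 i1]
      · rfl
      · exact ⟨(i1.const_mul _).1.smul_const _, (i1.const_mul _).2.smul_const _⟩
      · exact ⟨(i2.sub i1).1.smul_const _, (i2.sub i1).2.smul_const _⟩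
    rw [hint] at key
    have h2 : HasFDerivAt (fun p : ℝ × ℝ => p.2 / (4 * π)) ((4 * π)⁻¹ • f2) (A, B) := by
      have := (f2.hasFDerivAt (x := (A, B))).const_mul (4 * π)⁻¹
      refine this.congr_of_eventuallyEq (Eventually.of_forall fun p => ?_)
      simp [f2, div_eq_inv_mul]
    have h3 := h2.mul key
    have e : (fun p : ℝ × ℝ => stream p.1 p.2) = (fun p : ℝ × ℝ => p.2 / (4 * π)) *
        fun p => ∫ θ, F p θ ∂(volume.restrict (Ioc (-π) π)) := by
      ext p
      rw [Pi.mul_apply, stream, intervalIntegral.integral_of_le hpi]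
    rw [e]
    refine h3.congr_fderiv ?_
    -- The derivative of the prefactor in B produces the integral itself; rewriting it by parts
    -- cancels the second moment and leaves the form of `streamB`.
    have hI : ∫ θ, F (A, B) θ ∂(volume.restrict (Ioc (-π) π)) =
        B * (cosMoment 0 A B - cosMoment 2 A B) := by
      rw [← integral_cos_parts hA hB.le, intervalIntegral.integral_of_le hpi]
    rw [hI]
    ext <;> simp [f1, f2, streamA, streamB] <;> field_simp <;> ring
  · filter_upwards [hs] with p hp using (hcont p hp).aestronglyMeasurable
  · exact ((hcont (A, B) (mem_of_mem_nhds hs)).intervalIntegrable (-π) π).1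
  · exact hF'c.aestronglyMeasurable
  · refine Eventually.of_forall fun θ p hp => ?_
    have hp1 : 0 < p.1 := (half_pos hA).trans hp.1
    have hD := ringDist_pos hp1 hp.2.le θ
    have hle : ringDist p.1 p.2 θ ^ (-(3 / 2) : ℝ) ≤ (A / 2) ^ (-(3 / 2) : ℝ) :=
      Real.rpow_le_rpow_of_nonpos (half_pos hA) (hp.1.le.trans (le_ringDist hp.2.le θ))
        (by norm_num)
    set R := ringDist p.1 p.2 θ ^ (-(3 / 2) : ℝ)
    have hR : 0 ≤ R := Real.rpow_nonneg hD.le _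
    have hc := abs_cos_le_one θ
    have hf1 : ‖f1‖ ≤ 1 := ContinuousLinearMap.norm_fst_le ..
    have hf2 : ‖f2‖ ≤ 1 := ContinuousLinearMap.norm_snd_le ..
    refine (norm_add_le _ _).trans ?_
    rw [norm_smul, norm_smul]
    have e1 : ‖-(1 / 2) * (cos θ ^ 1 * R)‖ ≤ R := by
      rw [Real.norm_eq_abs, abs_mul, abs_mul, abs_of_nonneg hR, pow_one]
      norm_num; nlinarith
    have e2 : ‖cos θ ^ 2 * R - cos θ ^ 1 * R‖ ≤ 2 * R := by
      rw [← sub_mul, Real.norm_eq_abs, abs_mul, abs_of_nonneg hR, pow_one]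
      gcongr
      have := abs_le.1 hc
      rw [abs_le]; constructor <;> nlinarith
    calc _ ≤ R * 1 + 2 * R * 1 := by gcongr
      _ = 3 * R := by ring
      _ ≤ _ := by gcongr
  · exact integrable_const _
  · refine Eventually.of_forall fun θ p hp => ?_
    have hp1 : 0 < p.1 := (half_pos hA).trans hp.1
    have hD := ringDist_pos hp1 hp.2.le θ
    have h1 : HasFDerivAt (fun p : ℝ × ℝ => ringDist p.1 p.2 θ)
        (f1 + (2 * (1 - cos θ)) • f2) p := by
      have h := (f1.hasFDerivAt (x := p)).add ((f2.hasFDerivAt (x := p)).const_mul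
        (2 * (1 - cos θ)))
      refine h.congr_of_eventuallyEq (Eventually.of_forall fun q => ?_)
      simp [f1, f2, ringDist]; ring
    have h2 := (h1.rpow_const (p := -(1 / 2)) (Or.inl hD.ne')).const_mul (cos θ)
    refine h2.congr_fderiv ?_
    have e : (-(1 / 2) - 1 : ℝ) = -(3 / 2) := by norm_num
    rw [e]
    ext <;> simp [f1, f2, F'] <;> ring

/-- An explicit primitive is θ (a² + cθ²)^{-1/2} / a², and each endpoint contributes at most 1/(a²
√c). -/
lemma integral_inv_cube_le {a c : ℝ} (ha : 0 < a) (hc : 0 < c) :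
    ∫ θ in (-π)..π, (a ^ 2 + c * θ ^ 2) ^ (-(3 / 2) : ℝ) ≤ 2 / (a ^ 2 * √c) := by
  have hpos : ∀ θ : ℝ, 0 < a ^ 2 + c * θ ^ 2 := fun θ => by positivity
  have hd : ∀ θ : ℝ, HasDerivAt (fun θ => θ * (a ^ 2 + c * θ ^ 2) ^ (-(1 / 2) : ℝ))
      (a ^ 2 * (a ^ 2 + c * θ ^ 2) ^ (-(3 / 2) : ℝ)) θ := by
    intro θ
    have h1 : HasDerivAt (fun θ : ℝ => a ^ 2 + c * θ ^ 2) (c * (2 * θ)) θ := by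
      simpa using ((hasDerivAt_pow 2 θ).const_mul c).const_add (a ^ 2)
    have h2 := (hasDerivAt_id θ).mul (h1.rpow_const (p := -(1 / 2)) (Or.inl (hpos θ).ne'))
    refine h2.congr_deriv ?_
    have e : (-(1 / 2) - 1 : ℝ) = -(3 / 2) := by norm_num
    have e2 : (a ^ 2 + c * θ ^ 2) ^ (-(1 / 2) : ℝ) =
        (a ^ 2 + c * θ ^ 2) * (a ^ 2 + c * θ ^ 2) ^ (-(3 / 2) : ℝ) := by
      rw [← Real.rpow_one_add' (hpos θ).le (by norm_num)]; norm_num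
    rw [e, e2]
    simp only [id]
    ring
  have hcont : Continuous fun θ : ℝ => (a ^ 2 + c * θ ^ 2) ^ (-(3 / 2) : ℝ) :=
    (by fun_prop : Continuous fun θ : ℝ => a ^ 2 + c * θ ^ 2).rpow_const
      fun θ => Or.inl (hpos θ).ne'
  have h := intervalIntegral.integral_eq_sub_of_hasDerivAt (a := -π) (b := π) (fun θ _ => hd θ)
    ((hcont.const_mul (a ^ 2)).intervalIntegrable _ _)
  rw [intervalIntegral.integral_const_mul] at h
  have hb : π * (a ^ 2 + c * π ^ 2) ^ (-(1 / 2) : ℝ) ≤ 1 / √c := by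
    rw [Real.rpow_neg (hpos π).le, ← Real.sqrt_eq_rpow, ← div_eq_mul_inv,
      div_le_div_iff₀ (Real.sqrt_pos.2 (hpos π)) (Real.sqrt_pos.2 hc), one_mul]
    apply Real.le_sqrt_of_sq_le
    rw [mul_pow, Real.sq_sqrt hc.le]; nlinarith [sq_nonneg a]
  have hs : (-π) ^ 2 = π ^ 2 := by ring
  rw [hs] at h
  have h3 : a ^ 2 * ∫ θ in (-π)..π, (a ^ 2 + c * θ ^ 2) ^ (-(3 / 2) : ℝ) ≤ 2 / √c := by
    rw [h]; have : 2 / √c = 1 / √c + 1 / √c := by ring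
    linarith
  rw [mul_comm (a ^ 2), ← div_div, le_div_iff₀ (by positivity)]
  linarith

lemma quadratic_le_ringDist (hB : 0 ≤ B) {θ : ℝ} (hθ : |θ| ≤ π) :
    A + 4 / π ^ 2 * B * θ ^ 2 ≤ ringDist A B θ := by
  have h := Real.cos_le_one_sub_mul_cos_sq hθ
  have : 2 * B * (2 / π ^ 2 * θ ^ 2) ≤ 2 * B * (1 - cos θ) := by gcongr; linarith
  unfold ringDist
  calc A + 4 / π ^ 2 * B * θ ^ 2 = A + 2 * B * (2 / π ^ 2 * θ ^ 2) := by ring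
    _ ≤ _ := by linarith

lemma abs_cosMoment_le (hA : 0 < A) (hB : 0 < B) (k : ℕ) :
    |cosMoment k A B| ≤ π / (A * √B) := by
  have hpi : -π ≤ π := by linarith [pi_pos]
  have hsq : √A ^ 2 = A := Real.sq_sqrt hA.le
  have hcont : Continuous fun θ : ℝ => (√A ^ 2 + 4 / π ^ 2 * B * θ ^ 2) ^ (-(3 / 2) : ℝ) :=
    (by fun_prop : Continuous fun θ : ℝ => √A ^ 2 + 4 / π ^ 2 * B * θ ^ 2).rpow_const
      fun θ => Or.inl (by rw [hsq]; positivity)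
  have h1 : |cosMoment k A B| ≤
      ∫ θ in (-π)..π, (√A ^ 2 + 4 / π ^ 2 * B * θ ^ 2) ^ (-(3 / 2) : ℝ) := by
    rw [cosMoment, ← Real.norm_eq_abs]
    refine intervalIntegral.norm_integral_le_of_norm_le hpi ?_ (hcont.intervalIntegrable _ _)
    refine Eventually.of_forall fun θ hθ => ?_
    have hD := ringDist_pos hA hB.le θ
    rw [norm_mul, norm_pow, Real.norm_eq_abs, Real.norm_eq_abs,
      abs_of_nonneg (Real.rpow_nonneg hD.le _), hsq]
    have h2 := quadratic_le_ringDist (A := A) hB.le (abs_le.2 ⟨hθ.1.le, hθ.2⟩)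
    calc _ ≤ 1 * ringDist A B θ ^ (-(3 / 2) : ℝ) := by
          gcongr
          · exact pow_le_one₀ (abs_nonneg _) (abs_cos_le_one θ)
      _ ≤ _ := by
          rw [one_mul]
          exact Real.rpow_le_rpow_of_nonpos (by positivity) h2 (by norm_num)
  refine h1.trans ((integral_inv_cube_le (Real.sqrt_pos.2 hA) (by positivity)).trans (le_of_eq ?_))
  have : √(4 / π ^ 2 * B) = 2 / π * √B := by
    rw [show 4 / π ^ 2 * B = (2 / π) ^ 2 * B by ring, Real.sqrt_mul (by positivity),
      Real.sqrt_sq (by positivity)]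
  rw [this, hsq]; field_simp

/-- The stream function is logarithmic in A, so its logarithmic derivative A ∂_A stays bounded down
to A = 0. -/
lemma abs_mul_streamA_le (hA : 0 < A) (hB : 0 < B) : |A * streamA A B| ≤ √B / 8 := by
  have h := abs_cosMoment_le hA hB 1
  rw [streamA, abs_mul, abs_mul, abs_of_pos hA, abs_neg, abs_of_pos (by positivity)]
  calc A * (B / (8 * π) * |cosMoment 1 A B|) ≤ A * (B / (8 * π) * (π / (A * √B))) := by gcongr
    _ = B / √B / 8 := by field_simp
    _ = √B / 8 := by rw [Real.div_sqrt]

/-- The logarithmic singularity of the stream function. -/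
lemma abs_stream_sub_arsinh_le (hA : 0 < A) (hB : 0 < B) :
    |stream A B - √B / (2 * π) * arsinh (2 * √(B / A))| ≤ √B / 2 := by
  have hpi : -π ≤ π := by linarith [pi_pos]
  have hsB : 0 < √B := Real.sqrt_pos.2 hB
  have hBs : √B ^ 2 = B := Real.sq_sqrt hB.le
  have hDs : ∀ θ, ringDist A B θ = A + 4 * B * sin (θ / 2) ^ 2 := by
    intro θ
    have : cos θ = 1 - 2 * sin (θ / 2) ^ 2 := by
      have h := Real.cos_two_mul (θ / 2)
      rw [mul_div_cancel₀ θ two_ne_zero] at h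
      rw [h, Real.cos_sq']; ring
    rw [ringDist, this]; ring
  -- With cos(θ/2) in place of cos θ the integral is elementary. The replacement costs a bounded
  -- integrand, since |cos θ - cos(θ/2)| ≤ 2|sin(θ/2)| ≤ √D/√B.
  have hd : ∀ θ, HasDerivAt (fun θ => arsinh (2 * √(B / A) * sin (θ / 2)))
      (√B * (cos (θ / 2) * ringDist A B θ ^ (-(1 / 2) : ℝ))) θ := by
    intro θ
    have h1 : HasDerivAt (fun θ : ℝ => sin (θ / 2)) (cos (θ / 2) * (1 / 2)) θ := by
      simpa using ((hasDerivAt_id θ).div_const 2).sin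
    have h2 := (h1.const_mul (2 * √(B / A))).arsinh
    refine h2.congr_deriv ?_
    have hD := ringDist_pos hA hB.le θ
    rw [Real.rpow_neg hD.le, ← Real.sqrt_eq_rpow, smul_eq_mul]
    have h3 : 1 + (2 * √(B / A) * sin (θ / 2)) ^ 2 = ringDist A B θ / A := by
      rw [mul_pow, mul_pow, Real.sq_sqrt (by positivity), hDs]; field_simp; ring
    rw [h3, Real.sqrt_div hD.le, Real.sqrt_div hB.le]
    have hA' : 0 < √A := Real.sqrt_pos.2 hA
    have hD' : 0 < √(ringDist A B θ) := Real.sqrt_pos.2 hD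
    field_simp
  have hc := continuous_ringDist_rpow hA hB.le (-(1 / 2))
  have hint := intervalIntegral.integral_eq_sub_of_hasDerivAt (a := -π) (b := π) (fun θ _ => hd θ)
    ((by fun_prop : Continuous fun θ =>
      √B * (cos (θ / 2) * ringDist A B θ ^ (-(1 / 2) : ℝ))).intervalIntegrable _ _)
  rw [intervalIntegral.integral_const_mul, neg_div, sin_neg, mul_neg, arsinh_neg,
    Real.sin_pi_div_two, mul_one] at hint
  set I := ∫ θ in (-π)..π, cos θ * ringDist A B θ ^ (-(1 / 2) : ℝ) with hI
  set J := ∫ θ in (-π)..π, cos (θ / 2) * ringDist A B θ ^ (-(1 / 2) : ℝ) with hJ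
  have hdiff : |I - J| ≤ 1 / √B * |π - -π| := by
    rw [hI, hJ, ← intervalIntegral.integral_sub
      ((by fun_prop : Continuous _).intervalIntegrable _ _)
      ((by fun_prop : Continuous _).intervalIntegrable _ _), ← Real.norm_eq_abs]
    refine intervalIntegral.norm_integral_le_of_norm_le_const fun θ hθ => ?_
    rw [uIoc_of_le hpi] at hθ
    have hD := ringDist_pos hA hB.le θ
    have hcn : 0 ≤ cos (θ / 2) :=
      Real.cos_nonneg_of_neg_pi_div_two_le_of_le (by linarith [hθ.1]) (by linarith [hθ.2])
    have hc1 := Real.cos_le_one (θ / 2)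
    have hss := Real.sin_sq_add_cos_sq (θ / 2)
    have hcos : cos θ = 2 * cos (θ / 2) ^ 2 - 1 := by
      have h := Real.cos_two_mul (θ / 2)
      rwa [mul_div_cancel₀ θ two_ne_zero] at h
    rw [← sub_mul, Real.norm_eq_abs, abs_mul, abs_of_nonneg (Real.rpow_nonneg hD.le _),
      Real.rpow_neg hD.le, ← Real.sqrt_eq_rpow, ← div_eq_mul_inv,
      div_le_div_iff₀ (Real.sqrt_pos.2 hD) hsB, one_mul]
    have h1 : |cos θ - cos (θ / 2)| ≤ 2 * |sin (θ / 2)| := by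
      have h4 : |cos θ - cos (θ / 2)| ≤ 2 * sin (θ / 2) ^ 2 := by
        rw [hcos, abs_le]; constructor <;> nlinarith
      refine h4.trans ?_
      rw [← sq_abs]
      nlinarith [abs_nonneg (sin (θ / 2)), Real.abs_sin_le_one (θ / 2)]
    calc |cos θ - cos (θ / 2)| * √B ≤ 2 * |sin (θ / 2)| * √B := by gcongr
      _ ≤ √(ringDist A B θ) := by
          apply Real.le_sqrt_of_sq_le
          rw [mul_pow, mul_pow, sq_abs, hBs, hDs]; linarith
  have hst : stream A B - √B / (2 * π) * arsinh (2 * √(B / A)) = B / (4 * π) * (I - J) := by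
    have h5 : √B / (2 * π) * arsinh (2 * √(B / A)) = B / (4 * π) * J := by
      have : arsinh (2 * √(B / A)) = √B * J / 2 := by linarith
      rw [this]; nth_rw 3 [← hBs]; field_simp; ring
    rw [h5, stream]; ring
  rw [hst, abs_mul, abs_of_pos (by positivity)]
  calc B / (4 * π) * |I - J| ≤ B / (4 * π) * (1 / √B * |π - -π|) := by gcongr
    _ = B / √B / 2 := by
        rw [sub_neg_eq_add, abs_of_pos (by positivity)]; field_simp; norm_num
    _ = √B / 2 := by rw [Real.div_sqrt]

end

/-! ### The velocity of a vortex ring and the Green function. -/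

/-- The velocity at `x` of a vortex ring through `y`. -/
def ringKern (δ : ℝ) (x y : Plane) : Plane := ∫ θ in (-π)..π, kern δ x y θ

lemma den_eq_ringDist (δ : ℝ) (x y : Plane) (θ : ℝ) :
    den δ x y θ = ringDist (‖x - y‖ ^ 2 + δ ^ 2) (x 1 * y 1) θ := by
  unfold den ringDist; ring

section

variable {δ : ℝ} {x y : Plane}

lemma continuous_kern_angle (hA : 0 < ‖x - y‖ ^ 2 + δ ^ 2) (hB : 0 ≤ x 1 * y 1) :
    Continuous (kern δ x y) := by
  have h := continuous_ringDist_rpow hA hB (-(3 / 2))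
  simp only [← den_eq_ringDist] at h
  have : kern δ x y = fun θ => ((4 * π)⁻¹ * den δ x y θ ^ (-(3 / 2) : ℝ)) •
      !₂[-(x 1 * cos θ - y 1), (x 0 - y 0) * cos θ] := by
    ext1 θ; exact kern_eq_smul δ x y θ
  rw [this]
  fun_prop

lemma ringKern_apply (hA : 0 < ‖x - y‖ ^ 2 + δ ^ 2) (hB : 0 ≤ x 1 * y 1) (i : Fin 2) :
    ringKern δ x y i = ∫ θ in (-π)..π, kern δ x y θ i :=
  ((EuclideanSpace.proj i : Plane →L[ℝ] ℝ).intervalIntegral_comp_comm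
    ((continuous_kern_angle hA hB).intervalIntegrable _ _)).symm

lemma ringKern_zero (hA : 0 < ‖x - y‖ ^ 2 + δ ^ 2) (hB : 0 ≤ x 1 * y 1) :
    ringKern δ x y 0 = (4 * π)⁻¹ * (y 1 * cosMoment 0 (‖x - y‖ ^ 2 + δ ^ 2) (x 1 * y 1) -
      x 1 * cosMoment 1 (‖x - y‖ ^ 2 + δ ^ 2) (x 1 * y 1)) := by
  rw [ringKern_apply hA hB, cosMoment, cosMoment, ← intervalIntegral.integral_const_mul,
    ← intervalIntegral.integral_const_mul, ← intervalIntegral.integral_sub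
      ((intervalIntegrable_cosMoment hA hB 0 _ _ _).const_mul _)
      ((intervalIntegrable_cosMoment hA hB 1 _ _ _).const_mul _),
    ← intervalIntegral.integral_const_mul]
  refine intervalIntegral.integral_congr fun θ _ => ?_
  simp only [kern_zero_apply, den_eq_ringDist]
  ring

lemma ringKern_one (hA : 0 < ‖x - y‖ ^ 2 + δ ^ 2) (hB : 0 ≤ x 1 * y 1) :
    ringKern δ x y 1 = (4 * π)⁻¹ * ((x 0 - y 0) *
      cosMoment 1 (‖x - y‖ ^ 2 + δ ^ 2) (x 1 * y 1)) := by
  rw [ringKern_apply hA hB, cosMoment, ← intervalIntegral.integral_const_mul,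
    ← intervalIntegral.integral_const_mul]
  refine intervalIntegral.integral_congr fun θ _ => ?_
  simp only [kern_one_apply, den_eq_ringDist]
  ring

/-- The velocity field of a vortex ring is the rotated gradient of the stream function. -/
lemma stream_gradient (hA : 0 < ‖x - y‖ ^ 2 + δ ^ 2) (hB : 0 ≤ x 1 * y 1) (v : Plane) :
    streamA (‖x - y‖ ^ 2 + δ ^ 2) (x 1 * y 1) * (2 * ((x 0 - y 0) * v 0 + (x 1 - y 1) * v 1)) +
      streamB (‖x - y‖ ^ 2 + δ ^ 2) (x 1 * y 1) * (y 1 * v 1) =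
    x 1 * y 1 * (ringKern δ x y 0 * v 1 - ringKern δ x y 1 * v 0) := by
  rw [ringKern_zero hA hB, ringKern_one hA hB, streamA, streamB]
  field_simp
  ring

end

/-- Evenness in θ and the substitution θ = 2φ, under which D = 4B (sin² φ + A/(4B)). -/
lemma green_eq {x y : Plane} (hx : x ∈ halfPlane) (hy : y ∈ halfPlane) (hxy : x ≠ y) :
    green x y = -stream (‖x - y‖ ^ 2) (x 1 * y 1) := by
  have hB : 0 < x 1 * y 1 := mul_pos hx hy
  set B := x 1 * y 1
  set A := ‖x - y‖ ^ 2 with hA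
  have hA0 : 0 < A := by
    have := norm_pos_iff.2 (sub_ne_zero.2 hxy); positivity
  have hsym : ∫ θ in (-π)..π, cos θ * ringDist A B θ ^ (-(1 / 2) : ℝ) =
      2 * ∫ θ in (0 : ℝ)..π, cos θ * ringDist A B θ ^ (-(1 / 2) : ℝ) := by
    have hc : Continuous fun θ => cos θ * ringDist A B θ ^ (-(1 / 2) : ℝ) :=
      continuous_cos.mul (continuous_ringDist_rpow hA0 hB.le _)
    have hneg : ∫ θ in (-π)..0, cos θ * ringDist A B θ ^ (-(1 / 2) : ℝ) =
        ∫ θ in (0 : ℝ)..π, cos θ * ringDist A B θ ^ (-(1 / 2) : ℝ) := by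
      have h := intervalIntegral.integral_comp_neg (a := 0) (b := π)
        (fun θ => cos θ * ringDist A B θ ^ (-(1 / 2) : ℝ))
      rw [neg_zero] at h
      rw [← h]
      simp [ringDist]
    rw [← intervalIntegral.integral_add_adjacent_intervals (hc.intervalIntegrable (-π) 0)
      (hc.intervalIntegrable 0 π), hneg, two_mul]
  have hsub : ∫ θ in (0 : ℝ)..π, cos θ * ringDist A B θ ^ (-(1 / 2) : ℝ) =
      2 * ∫ φ in (0 : ℝ)..(π / 2), cos (2 * φ) * ringDist A B (2 * φ) ^ (-(1 / 2) : ℝ) := by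
    have := intervalIntegral.mul_integral_comp_mul_left (a := 0) (b := π / 2) (c := 2)
      (f := fun θ => cos θ * ringDist A B θ ^ (-(1 / 2) : ℝ))
    rw [this]; congr 1 <;> ring
  have hprof : ∫ φ in (0 : ℝ)..(π / 2), cos (2 * φ) * ringDist A B (2 * φ) ^ (-(1 / 2) : ℝ) =
      (2 * √B)⁻¹ * greenProfile (A / B) := by
    rw [greenProfile, ← intervalIntegral.integral_const_mul]
    refine intervalIntegral.integral_congr fun φ _ => ?_
    have h1 : ringDist A B (2 * φ) = (4 * B) * (sin φ ^ 2 + A / B / 4) := by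
      rw [ringDist, Real.cos_two_mul, Real.cos_sq']; field_simp; ring
    have h2 : 0 ≤ sin φ ^ 2 + A / B / 4 := by positivity
    have h3 : √(4 * B) = 2 * √B := by
      rw [Real.sqrt_mul (by norm_num), show (4 : ℝ) = 2 ^ 2 by norm_num,
        Real.sqrt_sq (by norm_num)]
    rw [h1, Real.rpow_neg (by positivity), ← Real.sqrt_eq_rpow, Real.sqrt_mul (by positivity), h3,
      mul_inv, div_eq_mul_inv]
    ring
  have hs : 0 < √B := Real.sqrt_pos.2 hB
  have hsB : √B ^ 2 = B := Real.sq_sqrt hB.le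
  have e : green x y = -(1 / (2 * π)) * √B * greenProfile (A / B) := rfl
  rw [e, stream, hsym, hsub, hprof]
  have e2 : B / (4 * π) * (2 * (2 * ((2 * √B)⁻¹ * greenProfile (A / B)))) =
      √B ^ 2 / (4 * π) * (2 * (2 * ((2 * √B)⁻¹ * greenProfile (A / B)))) := by rw [hsB]
  rw [e2]
  field_simp
  ring

lemma hasFDerivAt_norm_sub_sq (x y : Plane) :
    HasFDerivAt (fun x : Plane => ‖x - y‖ ^ 2) (linForm (2 * (x 0 - y 0)) (2 * (x 1 - y 1))) x := by
  have h0 : HasFDerivAt (fun x : Plane => x 0) (EuclideanSpace.proj 0 : Plane →L[ℝ] ℝ) x :=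
    (EuclideanSpace.proj 0 : Plane →L[ℝ] ℝ).hasFDerivAt
  have h1 : HasFDerivAt (fun x : Plane => x 1) (EuclideanSpace.proj 1 : Plane →L[ℝ] ℝ) x :=
    (EuclideanSpace.proj 1 : Plane →L[ℝ] ℝ).hasFDerivAt
  have e : (fun x : Plane => ‖x - y‖ ^ 2) = fun x => (x 0 - y 0) ^ 2 + (x 1 - y 1) ^ 2 := by
    ext x; exact norm_sub_sq_eq x y
  rw [e]
  refine (((h0.sub_const (y 0)).pow 2).add ((h1.sub_const (y 1)).pow 2)).congr_fderiv ?_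
  ext v
  simp [linForm]

lemma hasFDerivAt_coord (x : Plane) (i : Fin 2) :
    HasFDerivAt (fun x : Plane => x i) (EuclideanSpace.proj i : Plane →L[ℝ] ℝ) x :=
  (EuclideanSpace.proj i : Plane →L[ℝ] ℝ).hasFDerivAt

/-- This identifies the exterior field, defined through the Green function, with the Biot-Savart
velocity of the other blobs; the factor x_r cancels the prefactor 1/x_r. -/
lemma gradPerp_green {x y : Plane} (hx : x ∈ halfPlane) (hy : y ∈ halfPlane) (hxy : x ≠ y) :
    gradPerp (fun x' => green x' y) x = (x 1 * y 1) • ringKern 0 x y := by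
  have hB : 0 < x 1 * y 1 := mul_pos hx hy
  have hA : 0 < ‖x - y‖ ^ 2 := by
    have := norm_pos_iff.2 (sub_ne_zero.2 hxy); positivity
  have hA' : 0 < ‖x - y‖ ^ 2 + 0 ^ 2 := by simpa using hA
  have hev : (fun x' => green x' y) =ᶠ[𝓝 x] fun x' => -stream (‖x' - y‖ ^ 2) (x' 1 * y 1) := by
    filter_upwards [isOpen_halfPlane.mem_nhds hx, isOpen_ne.mem_nhds hxy] with x' hx' hne
      using green_eq hx' hy hne
  have hp : HasFDerivAt (fun x' : Plane => (‖x' - y‖ ^ 2, x' 1 * y 1))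
      ((linForm (2 * (x 0 - y 0)) (2 * (x 1 - y 1))).prod
        (y 1 • (EuclideanSpace.proj 1 : Plane →L[ℝ] ℝ))) x :=
    (hasFDerivAt_norm_sub_sq x y).prodMk ((hasFDerivAt_coord x 1).mul_const (y 1))
  have hs := ((hasFDerivAt_stream hA hB).comp x hp).neg
  have hg : fderiv ℝ (fun x' => green x' y) x = _ := hev.fderiv_eq.trans hs.fderiv
  have key : ∀ v : Plane, fderiv ℝ (fun x' => green x' y) x v =
      -(x 1 * y 1 * (ringKern 0 x y 0 * v 1 - ringKern 0 x y 1 * v 0)) := by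
    intro v
    rw [hg, ← stream_gradient hA' hB.le v]
    simp only [neg_apply, ContinuousLinearMap.comp_apply,
      add_apply, smul_apply, ContinuousLinearMap.prod_apply,
      ContinuousLinearMap.coe_fst', ContinuousLinearMap.coe_snd', linForm_apply,
      PiLp.proj_apply, smul_eq_mul]
    ring_nf
  ext i
  fin_cases i <;> simp [gradPerp, key]

/-! ### Estimates away from the singularity -/

lemma integral_inv_sq_le {a c : ℝ} (ha : 0 < a) (hc : 0 < c) :
    ∫ θ in (-π)..π, (a ^ 2 + c * θ ^ 2)⁻¹ ≤ π / (a * √c) := by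
  have hpos : ∀ θ : ℝ, 0 < a ^ 2 + c * θ ^ 2 := fun θ => by positivity
  have hsc : 0 < √c := Real.sqrt_pos.2 hc
  have hd : ∀ θ : ℝ, HasDerivAt (fun θ => (a * √c)⁻¹ * arctan (√c / a * θ))
      (a ^ 2 + c * θ ^ 2)⁻¹ θ := by
    intro θ
    have h := (((hasDerivAt_id θ).const_mul (√c / a)).arctan).const_mul (a * √c)⁻¹
    refine h.congr_deriv ?_
    simp only [id, mul_one, mul_pow, div_pow, Real.sq_sqrt hc.le]
    have := hpos θ
    field_simp
  have hcont : Continuous fun θ : ℝ => (a ^ 2 + c * θ ^ 2)⁻¹ :=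
    (by fun_prop : Continuous fun θ : ℝ => a ^ 2 + c * θ ^ 2).inv₀ fun θ => (hpos θ).ne'
  rw [intervalIntegral.integral_eq_sub_of_hasDerivAt (a := -π) (b := π) (fun θ _ => hd θ)
    (hcont.intervalIntegrable _ _), mul_neg, arctan_neg]
  have := (arctan_lt_pi_div_two (√c / a * π)).le
  have hp : 0 < (a * √c)⁻¹ := by positivity
  rw [div_eq_inv_mul π]
  have h2 := mul_le_mul_of_nonneg_left this hp.le
  linarith

section

variable {y : Plane} {a l : ℝ}

lemma quadratic_le_den (ha : 0 ≤ a) (hl : 0 ≤ l) (hy : l ≤ y 1) {z : Plane} (hz : l ≤ z 1)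
    (hzy : a ≤ |z 1 - y 1|) (δ : ℝ) {θ : ℝ} (hθ : |θ| ≤ π) :
    a ^ 2 + (2 / π * l) ^ 2 * θ ^ 2 ≤ den δ z y θ := by
  rw [den_eq_ringDist]
  have hB : l * l ≤ z 1 * y 1 := mul_le_mul hz hy hl (hl.trans hz)
  refine le_trans ?_ (quadratic_le_ringDist (by nlinarith) hθ)
  have h1 : a ^ 2 ≤ ‖z - y‖ ^ 2 := by
    rw [norm_sub_sq_eq]
    have : a ^ 2 ≤ |z 1 - y 1| ^ 2 := by gcongr
    rw [sq_abs] at this; nlinarith [sq_nonneg (z 0 - y 0)]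
  have h2 : (2 / π * l) ^ 2 * θ ^ 2 ≤ 4 / π ^ 2 * (z 1 * y 1) * θ ^ 2 := by
    have : (2 / π * l) ^ 2 = 4 / π ^ 2 * (l * l) := by ring
    rw [this]; gcongr
  nlinarith [sq_nonneg δ]

lemma norm_sub_sq_pos_of_le (ha : 0 < a) {z : Plane} (hzy : a ≤ |z 1 - y 1|) (δ : ℝ) :
    0 < ‖z - y‖ ^ 2 + δ ^ 2 := by
  have h : 0 < |z 1 - y 1| := ha.trans_le hzy
  rw [norm_sub_sq_eq]
  have := sq_pos_of_pos h
  rw [sq_abs] at this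
  positivity

lemma norm_ringKern_le (ha : 0 < a) (hl : 0 < l) (hy : l ≤ y 1) {z : Plane} (hz : l ≤ z 1)
    (hzy : a ≤ |z 1 - y 1|) : ‖ringKern 0 z y‖ ≤ 5 / (a * l) := by
  have hpi : -π ≤ π := by linarith [pi_pos]
  have hc : 0 < (2 / π * l) ^ 2 := by positivity
  have hcont : Continuous fun θ : ℝ => (a ^ 2 + (2 / π * l) ^ 2 * θ ^ 2)⁻¹ :=
    (by fun_prop : Continuous fun θ : ℝ => a ^ 2 + (2 / π * l) ^ 2 * θ ^ 2).inv₀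
      fun θ => by positivity
  have h1 : ‖ringKern 0 z y‖ ≤ ∫ θ in (-π)..π, (a ^ 2 + (2 / π * l) ^ 2 * θ ^ 2)⁻¹ := by
    refine intervalIntegral.norm_integral_le_of_norm_le hpi ?_ (hcont.intervalIntegrable _ _)
    refine Eventually.of_forall fun θ hθ => (norm_kern_le 0 z y θ).trans ?_
    rw [Real.sq_sqrt (den_nonneg _ _ _ _)]
    have := quadratic_le_den ha.le hl.le hy hz hzy 0 (abs_le.2 ⟨hθ.1.le, hθ.2⟩)
    gcongr
  refine h1.trans ((integral_inv_sq_le ha hc).trans ?_)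
  rw [Real.sqrt_sq (by positivity)]
  have hpi2 : π ^ 2 ≤ 10 := by nlinarith [pi_lt_d2, pi_pos]
  calc π / (a * (2 / π * l)) = π ^ 2 / 2 / (a * l) := by field_simp
    _ ≤ 5 / (a * l) := by gcongr; linarith

/-- The derivative of the kernel is of order (distance in ℝ³)^{-3}, and integration around a ring of
height at least l gains one power of a: the result is of order 1/(a² l). For different blobs a is of
order 1/√|log ε|, which produces the factor |log ε|. -/
lemma norm_ringKern_sub_le (ha : 0 < a) (hl : 0 < l) (hy : l ≤ y 1) {s : Set Plane}
    (hs : Convex ℝ s) (hsl : ∀ z ∈ s, l ≤ z 1) (hsa : ∀ z ∈ s, a ≤ |z 1 - y 1|) {x x' : Plane}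
    (hx : x ∈ s) (hx' : x' ∈ s) :
    ‖ringKern 0 x y - ringKern 0 x' y‖ ≤ 2 * π / (a ^ 2 * l) * ‖x - x'‖ := by
  have hpi : -π ≤ π := by linarith [pi_pos]
  have hc : 0 < (2 / π * l) ^ 2 := by positivity
  have hcont : Continuous fun θ : ℝ => (a ^ 2 + (2 / π * l) ^ 2 * θ ^ 2) ^ (-(3 / 2) : ℝ) :=
    (by fun_prop : Continuous fun θ : ℝ => a ^ 2 + (2 / π * l) ^ 2 * θ ^ 2).rpow_const
      fun θ => Or.inl (by positivity)
  have hint : ∀ z ∈ s, IntervalIntegrable (kern 0 z y) volume (-π) π := fun z hz =>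
    (continuous_kern_angle (norm_sub_sq_pos_of_le ha (hsa z hz) 0)
      (mul_nonneg (hl.le.trans (hsl z hz)) (hl.le.trans hy))).intervalIntegrable _ _
  have h1 : ‖ringKern 0 x y - ringKern 0 x' y‖ ≤
      ∫ θ in (-π)..π, 2 * (a ^ 2 + (2 / π * l) ^ 2 * θ ^ 2) ^ (-(3 / 2) : ℝ) * ‖x - x'‖ := by
    rw [ringKern, ringKern, ← intervalIntegral.integral_sub (hint x hx) (hint x' hx')]
    refine intervalIntegral.norm_integral_le_of_norm_le hpi ?_
      (((hcont.const_mul 2).mul_const _).intervalIntegrable _ _)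
    refine Eventually.of_forall fun θ hθ => ?_
    have hq : ∀ z ∈ s, a ^ 2 + (2 / π * l) ^ 2 * θ ^ 2 ≤ den 0 z y θ := fun z hz =>
      quadratic_le_den ha.le hl.le hy (hsl z hz) (hsa z hz) 0 (abs_le.2 ⟨hθ.1.le, hθ.2⟩)
    have hp : 0 < a ^ 2 + (2 / π * l) ^ 2 * θ ^ 2 := by positivity
    refine hs.norm_image_sub_le_of_norm_hasFDerivWithin_le
      (f := fun z => kern 0 z y θ) (f' := fun z => kernDeriv 0 z y θ)
      (fun z hz => (hasFDerivAt_kern (hp.trans_le (hq z hz))).hasFDerivWithinAt)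
      (fun z hz => ?_) hx' hx
    refine (norm_kernDeriv_le (hp.trans_le (hq z hz))).trans ?_
    gcongr 2 * ?_
    exact Real.rpow_le_rpow_of_nonpos hp (hq z hz) (by norm_num)
  refine h1.trans ?_
  rw [intervalIntegral.integral_mul_const, intervalIntegral.integral_const_mul]
  gcongr
  have h2 := integral_inv_cube_le ha hc
  rw [Real.sqrt_sq (by positivity)] at h2
  calc 2 * ∫ θ in (-π)..π, (a ^ 2 + (2 / π * l) ^ 2 * θ ^ 2) ^ (-(3 / 2) : ℝ)
      ≤ 2 * (2 / (a ^ 2 * (2 / π * l))) := by gcongr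
    _ = 2 * π / (a ^ 2 * l) := by field_simp

end

/-! ### The Biot-Savart law in terms of vortex rings -/

lemma Admissible.bs_eq_integral_ringKern {M : ℝ} {w : Plane → ℝ} (hM : 0 < M)
    (hw : Admissible M w) (h0 : ∀ᵐ y ∂halfVol, 0 ≤ w y) (δ : ℝ) (x : Plane) :
    Integrable (fun y => y 1 • ringKern δ x y) (vortexMeasure w) ∧
      bs δ w x = ∫ y, y 1 • ringKern δ x y ∂vortexMeasure w := by
  have hpi : -π ≤ π := by linarith [pi_pos]
  have hi := (hw.kern_integrable hM δ x).1
  rw [cylMeasure] at hi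
  have hinner : ∀ y : Plane, ∫ θ, ((y 1) ^ 2 * w y) • kern δ x y θ ∂volume.restrict (Ioc (-π) π) =
      (y 1 * w y) • (y 1 • ringKern δ x y) := by
    intro y
    rw [integral_smul, ringKern, intervalIntegral.integral_of_le hpi, smul_smul]
    congr 1; ring
  constructor
  · have hm' : AEMeasurable (fun x : Plane => ENNReal.ofReal (x 1 * w x)) halfVol :=
      (AEMeasurable.mul (by fun_prop) hw.meas.aemeasurable).ennreal_ofReal
    rw [vortexMeasure_eq hw.meas, integrable_withDensity_iff_integrable_smul₀' hm' (by simp)]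
    have := hi.integral_prod_left
    simp only [hinner] at this
    refine this.congr ?_
    filter_upwards [ae_halfVol_pos, h0] with y hy hy0
    rw [ENNReal.toReal_ofReal (mul_nonneg hy.le hy0)]
  · rw [integral_vortexMeasure hw.meas h0, bs, cylMeasure, integral_prod _ hi]
    simp only [hinner]

/-! ### Separated configurations -/

/-- `∑_{n ≠ 0} 1 / n²`. -/
def inverseSquareSum : ℝ := ∑' n : ℤ, 1 / (n : ℝ) ^ 2

lemma inverseSquareSum_nonneg : 0 ≤ inverseSquareSum := tsum_nonneg fun n => by positivity

/-- Measured from f_i in units of 4d, the integer parts of the other points are distinct and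
nonzero, and at most twice the true distance in modulus. The sum is thus dominated by the series of
inverse squares of integers, independently of the number of points; this is why C^* sees neither N
nor the configuration. -/
lemma sum_inv_sq_le {ι : Type*} [Fintype ι] [DecidableEq ι] {f : ι → ℝ} {d : ℝ} (hd : 0 < d)
    (hf : ∀ j k, j ≠ k → 4 * d ≤ |f j - f k|) (i : ι) :
    ∑ j ∈ Finset.univ.erase i, 1 / (f i - f j) ^ 2 ≤ inverseSquareSum / (4 * d ^ 2) := by
  set n : ι → ℤ := fun j => ⌊(f j - f i) / (4 * d)⌋ with hn
  have hinj : Function.Injective n := by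
    intro j k hjk
    by_contra hne
    have h1 := Int.abs_sub_lt_one_of_floor_eq_floor hjk
    rw [← sub_div, abs_div, abs_of_pos (by positivity : 0 < 4 * d), div_lt_one (by positivity),
      sub_sub_sub_cancel_right] at h1
    linarith [hf j k hne]
  have hterm : ∀ j ∈ Finset.univ.erase i,
      1 / (f i - f j) ^ 2 ≤ 1 / (4 * d ^ 2) * (1 / (n j : ℝ) ^ 2) := by
    intro j hj
    have hne : j ≠ i := Finset.ne_of_mem_erase hj
    have hn0 : n j ≠ 0 := by
      intro h
      have hi : n i = 0 := by simp [hn]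
      exact hne (hinj (h.trans hi.symm))
    set τ := (f j - f i) / (4 * d) with hτ
    have h1 : 1 ≤ |τ| := by
      rw [hτ, abs_div, abs_of_pos (by positivity : 0 < 4 * d), le_div_iff₀ (by positivity)]
      linarith [hf j i hne]
    have h2 : |(n j : ℝ)| ≤ 2 * |τ| := by
      have h3 := Int.floor_le τ
      have h4 := Int.lt_floor_add_one τ
      have h5 : |(n j : ℝ) - τ| ≤ 1 := by
        rw [abs_le]; constructor <;> linarith
      have h6 := abs_add_le ((n j : ℝ) - τ) τ
      rw [sub_add_cancel] at h6
      linarith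
    have hn1 : 0 < (n j : ℝ) ^ 2 := by positivity
    have h7 : 4 * d ^ 2 * (n j : ℝ) ^ 2 ≤ (f i - f j) ^ 2 := by
      have h8 : (n j : ℝ) ^ 2 ≤ (2 * |τ|) ^ 2 := by
        rw [← sq_abs (n j : ℝ)]; gcongr
      rw [mul_pow, sq_abs, hτ, div_pow] at h8
      have h9 : (f i - f j) ^ 2 = (f j - f i) ^ 2 := by ring
      rw [h9]
      calc 4 * d ^ 2 * (n j : ℝ) ^ 2 ≤ 4 * d ^ 2 * (2 ^ 2 * ((f j - f i) ^ 2 / (4 * d) ^ 2)) := by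
            gcongr
        _ = (f j - f i) ^ 2 := by field_simp; norm_num
    rw [div_mul_div_comm, one_mul]
    exact one_div_le_one_div_of_le (by positivity) h7
  calc ∑ j ∈ Finset.univ.erase i, 1 / (f i - f j) ^ 2
      ≤ ∑ j ∈ Finset.univ.erase i, 1 / (4 * d ^ 2) * (1 / (n j : ℝ) ^ 2) := Finset.sum_le_sum hterm
    _ = 1 / (4 * d ^ 2) * ∑ m ∈ (Finset.univ.erase i).image n, 1 / (m : ℝ) ^ 2 := by
        rw [← Finset.mul_sum, Finset.sum_image fun a _ b _ h => hinj h]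
    _ ≤ 1 / (4 * d ^ 2) * inverseSquareSum := by
        gcongr
        exact (Real.summable_one_div_int_pow.2 one_lt_two).sum_le_tsum _ fun m _ => by positivity
    _ = _ := by ring

lemma IsSeparation.le_abs_sub {N : ℕ} {Y : Fin N → Plane} {d₀ : ℝ} (h : IsSeparation Y d₀)
    {i j : Fin N} (hij : i ≠ j) : 4 * d₀ ≤ |Y i 1 - Y j 1| := by
  have hN : 2 ≤ N := by
    by_contra hN
    have : Subsingleton (Fin N) := Fin.subsingleton_iff_le_one.2 (by omega)
    exact hij (Subsingleton.elim _ _)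
  have := (h.2 hN).2 ⟨i, j, hij, rfl⟩
  linarith

/-! ### Small scales and separation of the rectangles. -/

/-- Smallness of `ε`, depending only on the configuration. -/
structure SmallScale {N : ℕ} (Xs : Plane) (Y : Fin N → Plane) (d₀ ε : ℝ) : Prop where
  pos : 0 < ε
  lt : ε < 1 / 2
  log : 1 ≤ |Real.log ε|
  ball : ∀ i, Metric.closedBall (initCenter Xs Y ε i) ε ⊆ slab Xs Y ε d₀ 1 i
  height : ∀ i, |initCenter Xs Y ε i 1 - Xs 1| + d₀ / √|Real.log ε| ≤ Xs 1 / 2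

lemma exists_smallScale {N : ℕ} {Xs : Plane} (hXs : Xs ∈ halfPlane) (Y : Fin N → Plane) {d₀ : ℝ}
    (hd : 0 < d₀) : ∃ ε₀ > 0, ∀ ε ∈ Ioc 0 ε₀, SmallScale Xs Y d₀ ε := by
  obtain ⟨ε₀, h0, h⟩ := eventually_geometry Xs hXs Y hd
  refine ⟨ε₀, h0, fun ε hε => ?_⟩
  obtain ⟨h1, h2, h3⟩ := h ε hε
  exact ⟨hε.1, h1, h2, fun i => (h3 i).1, fun i => (h3 i).2⟩

lemma convex_slab {N : ℕ} (Xs : Plane) (Y : Fin N → Plane) (ε d H : ℝ) (i : Fin N) :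
    Convex ℝ (slab Xs Y ε d H i) := by
  intro x hx y hy a b ha hb hab
  obtain ⟨h1, h2⟩ := hx
  obtain ⟨h3, h4⟩ := hy
  rw [abs_le] at h1 h2 h3 h4
  have hb' : b = 1 - a := by linarith
  subst hb'
  constructor <;> rw [abs_le] <;> constructor <;>
    simp only [PiLp.add_apply, PiLp.smul_apply, smul_eq_mul] <;> nlinarith

namespace SmallScale

variable {N : ℕ} {Xs : Plane} {Y : Fin N → Plane} {d₀ ε : ℝ}

lemma sqrt_log_pos (h : SmallScale Xs Y d₀ ε) : 0 < √|Real.log ε| :=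
  Real.sqrt_pos.2 (one_pos.trans_le h.log)

lemma height_mem (h : SmallScale Xs Y d₀ ε) {i : Fin N} {x : Plane} (hx : x ∈ slab Xs Y ε d₀ 1 i) :
    Xs 1 / 2 ≤ x 1 ∧ x 1 ≤ 3 / 2 * Xs 1 := by
  have h1 := abs_le.1 hx.1
  have h2 := h.height i
  have h3 := abs_le.1 (le_refl |initCenter Xs Y ε i 1 - Xs 1|)
  constructor <;> linarith

lemma mem_halfPlane (h : SmallScale Xs Y d₀ ε) (hXs : Xs ∈ halfPlane) {i : Fin N} {x : Plane}
    (hx : x ∈ slab Xs Y ε d₀ 1 i) : x ∈ halfPlane :=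
  lt_of_lt_of_le (half_pos hXs) (h.height_mem hx).1

/-- Each point lies within d₀/√|log ε| of the height of its centre, and the total displacement 2d₀
is at most half of |Y_{i,r} - Y_{j,r}|, so half of the initial separation of the centres remains. -/
lemma height_gap (h : SmallScale Xs Y d₀ ε) (hsep : IsSeparation Y d₀) {i j : Fin N} (hij : i ≠ j)
    {x y : Plane} (hx : x ∈ slab Xs Y ε d₀ 1 i) (hy : y ∈ slab Xs Y ε d₀ 1 j) :
    |Y i 1 - Y j 1| / (2 * √|Real.log ε|) ≤ |x 1 - y 1| := by
  have hs := h.sqrt_log_pos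
  have h1 := hsep.le_abs_sub hij
  have e : ∀ k, initCenter Xs Y ε k 1 = Xs 1 + 1 / √|Real.log ε| * Y k 1 := by
    intro k; simp [initCenter]
  have h2 : (Y i 1 - Y j 1) / √|Real.log ε| = (x 1 - y 1) - (x 1 - initCenter Xs Y ε i 1) +
      (y 1 - initCenter Xs Y ε j 1) := by rw [e, e]; ring
  have h3 : |(Y i 1 - Y j 1) / (√|Real.log ε|)| ≤ |x 1 - y 1| + d₀ / √|Real.log ε| +
      d₀ / √|Real.log ε| := by
    rw [h2]
    refine (abs_add_le _ _).trans (add_le_add ((abs_sub _ _).trans ?_) hy.1)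
    exact add_le_add le_rfl hx.1
  rw [abs_div, abs_of_pos hs] at h3
  have h4 : 2 * (d₀ / √|Real.log ε|) ≤ |Y i 1 - Y j 1| / (2 * √|Real.log ε|) := by
    rw [← mul_div_assoc, div_le_div_iff₀ hs (by positivity)]
    nlinarith
  have h5 : |Y i 1 - Y j 1| / √|Real.log ε| =
      2 * (|Y i 1 - Y j 1| / (2 * √|Real.log ε|)) := by field_simp
  linarith

end SmallScale

/-! ### Size and Lipschitz constant of the exterior field. -/

namespace BlobFlow

variable {N : ℕ} {Xs : Plane} {Y : Fin N → Plane} {γ M₀ ε T d₀ h₀ : ℝ}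

/-- A bound for `|x_r ω_i|` and `∫ x_r² ω_i`. -/
def sizeBound (Xs : Plane) (γ M₀ ε : ℝ) : ℝ := 3 / 2 * Xs 1 * (M₀ / ε ^ 2) + 3 / 2 * Xs 1 * γ

lemma sizeBound_pos (hXs : Xs ∈ halfPlane) (hγ : 0 < γ) (hM₀ : 0 < M₀) :
    0 < sizeBound Xs γ M₀ ε := by
  have : 0 < Xs 1 := hXs
  unfold sizeBound; positivity

variable (S : BlobFlow Xs Y γ M₀ ε T)

lemma ae_slab (hε : SmallScale Xs Y d₀ ε) (hT : 0 ≤ T) (hh : h₀ ≤ 1) (i : Fin N) {t : ℝ}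
    (ht : t ∈ Icc 0 (S.exitTime d₀ h₀)) : ∀ᵐ x ∂S.blobMeasure i t, x ∈ slab Xs Y ε d₀ 1 i :=
  S.ae_blobMeasure_slab i hT hh (hε.ball i) ht

lemma admissible (hXs : Xs ∈ halfPlane) (hε : SmallScale Xs Y d₀ ε) (hT : 0 ≤ T) (hh : h₀ ≤ 1)
    (hγ : 0 < γ) (hM₀ : 0 < M₀) (i : Fin N) {t : ℝ} (ht : t ∈ Icc 0 (S.exitTime d₀ h₀)) :
    Admissible (sizeBound Xs γ M₀ ε) (S.blob i t) :=
  S.admissible_blob hγ hM₀ i (S.Icc_exitTime_subset hT d₀ h₀ ht)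
    (mul_nonneg (by norm_num) (le_of_lt hXs))
    ((S.ae_slab hε hT hh i ht).mono fun _ hx => (hε.height_mem hx).2)

lemma exteriorField_eq_integral (hT : 0 ≤ T) (i : Fin N) {t : ℝ}
    (ht : t ∈ Icc 0 (S.exitTime d₀ h₀)) {x : Plane} (hx : x ∈ halfPlane) :
    S.exteriorField i t x =
      ∑ j ∈ Finset.univ.erase i, ∫ y, y 1 • ringKern 0 x y ∂S.blobMeasure j t := by
  have hx1 : x 1 ≠ 0 := ne_of_gt hx
  rw [exteriorField, Finset.smul_sum]
  refine Finset.sum_congr rfl fun j _ => ?_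
  rw [← S.integral_blobMeasure j (S.Icc_exitTime_subset hT d₀ h₀ ht), ← integral_smul]
  refine integral_congr_ae ?_
  have hne : ∀ᵐ y ∂S.blobMeasure j t, y ≠ x := by
    rw [ae_iff]
    simp [blobMeasure]
  filter_upwards [hne, ae_vortexMeasure_mem (S.blob j t)] with y hy hyH
  rw [gradPerp_green hx hyH hy.symm, smul_smul]
  congr 1; field_simp

lemma exteriorField_eq_bs (hXs : Xs ∈ halfPlane) (hε : SmallScale Xs Y d₀ ε) (hT : 0 ≤ T)
    (hh : h₀ ≤ 1) (hγ : 0 < γ) (hM₀ : 0 < M₀) (i : Fin N) {t : ℝ}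
    (ht : t ∈ Icc 0 (S.exitTime d₀ h₀)) {x : Plane} (hx : x ∈ halfPlane) :
    S.exteriorField i t x = ∑ j ∈ Finset.univ.erase i, bs 0 (S.blob j t) x := by
  rw [S.exteriorField_eq_integral hT i ht hx]
  refine Finset.sum_congr rfl fun j _ => ?_
  rw [((S.admissible hXs hε hT hh hγ hM₀ j ht).bs_eq_integral_ringKern
    (sizeBound_pos hXs hγ hM₀) (S.blob_nonneg j (S.Icc_exitTime_subset hT d₀ h₀ ht)) 0 x).2]
  rfl

lemma real_blobMeasure_univ (hT : 0 ≤ T) (hγ : 0 < γ) (i : Fin N) {t : ℝ}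
    (ht : t ∈ Icc 0 (S.exitTime d₀ h₀)) : (S.blobMeasure i t).real univ = γ := by
  rw [Measure.real, S.blobMeasure_univ hγ i (S.Icc_exitTime_subset hT d₀ h₀ ht),
    ENNReal.toReal_ofReal hγ.le]

lemma isFiniteMeasure_blobMeasure (hT : 0 ≤ T) (hγ : 0 < γ) (i : Fin N) {t : ℝ}
    (ht : t ∈ Icc 0 (S.exitTime d₀ h₀)) : IsFiniteMeasure (S.blobMeasure i t) :=
  ⟨by rw [S.blobMeasure_univ hγ i (S.Icc_exitTime_subset hT d₀ h₀ ht)]; exact ENNReal.ofReal_lt_top⟩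

/-- The ring kernel at radial distance a is of order 1/a, hence √|log ε|. The dependence on N is
harmless: this size enters only the threshold for ε, not the Lipschitz constant. -/
lemma norm_exteriorField_le (hXs : Xs ∈ halfPlane) (hε : SmallScale Xs Y d₀ ε)
    (hsep : IsSeparation Y d₀) (hT : 0 ≤ T) (hh : h₀ ≤ 1) (hγ : 0 < γ) (i : Fin N)
    {t : ℝ} (ht : t ∈ Icc 0 (S.exitTime d₀ h₀)) {x : Plane} (hx : x ∈ slab Xs Y ε d₀ 1 i) :
    ‖S.exteriorField i t x‖ ≤ N * (8 * γ / d₀) * √|log ε| := by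
  have hr : 0 < Xs 1 := hXs
  have hd := hsep.1
  have hL := hε.sqrt_log_pos
  rw [S.exteriorField_eq_integral hT i ht (hε.mem_halfPlane hXs hx)]
  have hterm : ∀ j ∈ Finset.univ.erase i,
      ‖∫ y, y 1 • ringKern 0 x y ∂S.blobMeasure j t‖ ≤ 8 * γ / d₀ * √|log ε| := by
    intro j hj
    have hij : i ≠ j := (Finset.ne_of_mem_erase hj).symm
    have := S.isFiniteMeasure_blobMeasure hT hγ j ht
    have hb : ∀ᵐ y ∂S.blobMeasure j t,
        ‖y 1 • ringKern 0 x y‖ ≤ 3 / 2 * Xs 1 * (5 / (2 * d₀ / √|log ε| * (Xs 1 / 2))) := by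
      filter_upwards [S.ae_slab hε hT hh j ht] with y hy
      obtain ⟨h1, h2⟩ := hε.height_mem hy
      have hgap : 2 * d₀ / √|log ε| ≤ |x 1 - y 1| := by
        refine le_trans ?_ (hε.height_gap hsep hij hx hy)
        rw [div_le_div_iff₀ hL (by positivity)]
        nlinarith [hsep.le_abs_sub hij]
      rw [norm_smul, Real.norm_eq_abs, abs_of_pos (by linarith)]
      gcongr
      exact norm_ringKern_le (by positivity) (by positivity) h1 (hε.height_mem hx).1 hgap
    refine (norm_integral_le_of_norm_le_const hb).trans ?_
    rw [S.real_blobMeasure_univ hT hγ j ht]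
    have : 3 / 2 * Xs 1 * (5 / (2 * d₀ / √|log ε| * (Xs 1 / 2))) * γ =
        15 / 2 * γ / d₀ * √|log ε| := by field_simp; norm_num
    rw [this]
    gcongr; norm_num
  refine (norm_sum_le_of_le _ hterm).trans ?_
  rw [Finset.sum_const, nsmul_eq_mul, mul_assoc]
  gcongr
  exact_mod_cast (Finset.card_le_univ _).trans_eq (Fintype.card_fin N)

lemma norm_exteriorField_sub_le (hXs : Xs ∈ halfPlane) (hε : SmallScale Xs Y d₀ ε)
    (hsep : IsSeparation Y d₀) (hT : 0 ≤ T) (hh : h₀ ≤ 1) (hγ : 0 < γ) (hM₀ : 0 < M₀) (i : Fin N)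
    {t : ℝ} (ht : t ∈ Icc 0 (S.exitTime d₀ h₀)) {x x' : Plane} (hx : x ∈ slab Xs Y ε d₀ 1 i)
    (hx' : x' ∈ slab Xs Y ε d₀ 1 i) :
    ‖S.exteriorField i t x - S.exteriorField i t x'‖ ≤
      lipConst γ (6 * π * (inverseSquareSum + 1)) d₀ * |log ε| * ‖x - x'‖ := by
  have hr : 0 < Xs 1 := hXs
  have hd := hsep.1
  have hL := hε.sqrt_log_pos
  have hL2 : √|log ε| ^ 2 = |log ε| := Real.sq_sqrt (abs_nonneg _)
  rw [S.exteriorField_eq_integral hT i ht (hε.mem_halfPlane hXs hx),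
    S.exteriorField_eq_integral hT i ht (hε.mem_halfPlane hXs hx'), ← Finset.sum_sub_distrib]
  have hterm : ∀ j ∈ Finset.univ.erase i,
      ‖(∫ y, y 1 • ringKern 0 x y ∂S.blobMeasure j t) -
        ∫ y, y 1 • ringKern 0 x' y ∂S.blobMeasure j t‖ ≤
      24 * π * γ * |log ε| * ‖x - x'‖ * (1 / (Y i 1 - Y j 1) ^ 2) := by
    intro j hj
    have hij : i ≠ j := (Finset.ne_of_mem_erase hj).symm
    have hYpos : 0 < |Y i 1 - Y j 1| := lt_of_lt_of_le (by positivity) (hsep.le_abs_sub hij)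
    have hint : ∀ z : Plane, Integrable (fun y => y 1 • ringKern 0 z y) (S.blobMeasure j t) :=
      fun z => ((S.admissible hXs hε hT hh hγ hM₀ j ht).bs_eq_integral_ringKern
      (sizeBound_pos hXs hγ hM₀) (S.blob_nonneg j (S.Icc_exitTime_subset hT d₀ h₀ ht)) 0 z).1
    have := S.isFiniteMeasure_blobMeasure hT hγ j ht
    have hb : ∀ᵐ y ∂S.blobMeasure j t, ‖y 1 • ringKern 0 x y - y 1 • ringKern 0 x' y‖ ≤
        3 / 2 * Xs 1 * (2 * π / ((|Y i 1 - Y j 1| / (2 * √|log ε|)) ^ 2 * (Xs 1 / 2)) *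
          ‖x - x'‖) := by
      filter_upwards [S.ae_slab hε hT hh j ht] with y hy
      obtain ⟨h1, h2⟩ := hε.height_mem hy
      rw [← smul_sub, norm_smul, Real.norm_eq_abs, abs_of_pos (by linarith)]
      gcongr
      exact norm_ringKern_sub_le (by positivity) (by positivity) h1 (convex_slab Xs Y ε d₀ 1 i)
        (fun z hz => (hε.height_mem hz).1) (fun z hz => hε.height_gap hsep hij hz hy) hx hx'
    rw [← integral_sub (hint x) (hint x')]
    refine (norm_integral_le_of_norm_le_const hb).trans (le_of_eq ?_)
    rw [S.real_blobMeasure_univ hT hγ j ht, ← sq_abs (Y i 1 - Y j 1), div_pow, mul_pow, hL2]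
    field_simp; ring
  refine (norm_sum_le_of_le _ hterm).trans ?_
  rw [← Finset.mul_sum]
  -- Of the constant 24π for each pair, the factor 1/4 of the inverse square bound leaves 6π.
  have hs := sum_inv_sq_le hd (f := fun j => Y j 1) (fun j k hjk => hsep.le_abs_sub hjk) i
  calc _ ≤ 24 * π * γ * |log ε| * ‖x - x'‖ * (inverseSquareSum / (4 * d₀ ^ 2)) := by gcongr
    _ = γ * (6 * π * inverseSquareSum) / d₀ ^ 2 * |log ε| * ‖x - x'‖ := by field_simp; ring
    _ ≤ _ := by unfold lipConst; gcongr; linarith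

end BlobFlow

lemma rect_subset_slab {N : ℕ} {Xs : Plane} {Y : Fin N → Plane} {ε d₀ h₀ : ℝ} (hh : h₀ ≤ 1)
    (i : Fin N) : rect Xs ε (initCenter Xs Y ε i 1) d₀ h₀ ⊆ slab Xs Y ε d₀ 1 i :=
  fun _ hx => ⟨hx.2.1, hx.2.2.trans hh⟩

theorem isExteriorLipConst {Xs : Plane} (hXs : Xs ∈ halfPlane) :
    IsExteriorLipConst Xs (6 * π * (inverseSquareSum + 1)) := by
  refine ⟨by have := inverseSquareSum_nonneg; positivity, fun N Y d₀ M₀ _ hsep hM₀ => ?_⟩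
  obtain ⟨ε₀, h0, h⟩ := exists_smallScale hXs Y hsep.1
  refine ⟨ε₀, h0, fun ε hε γ hγ h₀ hh T₀ hT S i t ht x hx y hy => ?_⟩
  exact S.norm_exteriorField_sub_le hXs (h ε hε) hsep hT.le hh.2 hγ hM₀ i ht
    (rect_subset_slab hh.2 i hx) (rect_subset_slab hh.2 i hy)

/-! ### Pointwise estimates for the renormalised energy. -/

/-- Heights `a, b` of two points of a blob, `A` the squared distance. -/
structure NearRing (r κ L A₁ a b A : ℝ) : Prop where
  r_pos : 0 < r
  κ_nonneg : 0 ≤ κ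
  one_le : 1 ≤ L
  A_pos : 0 < A
  A_le : A ≤ A₁
  a_near : |a - r| ≤ κ / √L
  b_near : |b - r| ≤ κ / √L
  a_ge : r / 2 ≤ a
  a_le : a ≤ 3 / 2 * r
  b_ge : r / 2 ≤ b
  b_le : b ≤ 3 / 2 * r

namespace NearRing

variable {r κ L A₁ a b A : ℝ}

lemma a_pos (h : NearRing r κ L A₁ a b A) : 0 < a := by linarith [h.a_ge, h.r_pos]

lemma b_pos (h : NearRing r κ L A₁ a b A) : 0 < b := by linarith [h.b_ge, h.r_pos]

lemma symm (h : NearRing r κ L A₁ a b A) : NearRing r κ L A₁ b a A :=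
  ⟨h.r_pos, h.κ_nonneg, h.one_le, h.A_pos, h.A_le, h.b_near, h.a_near, h.b_ge, h.b_le, h.a_ge,
    h.a_le⟩

lemma sqrt_ge (h : NearRing r κ L A₁ a b A) : r / 2 ≤ √(a * b) := by
  apply Real.le_sqrt_of_sq_le
  nlinarith [h.a_ge, h.b_ge, h.r_pos]

lemma sqrt_le (h : NearRing r κ L A₁ a b A) : √(a * b) ≤ 3 / 2 * r := by
  rw [Real.sqrt_le_left (by linarith [h.r_pos])]
  nlinarith [h.a_le, h.b_le, h.a_pos, h.b_pos, h.r_pos]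

lemma sq_sqrt (h : NearRing r κ L A₁ a b A) : √(a * b) ^ 2 = a * b :=
  Real.sq_sqrt (mul_pos h.a_pos h.b_pos).le

lemma sqrtL_pos (h : NearRing r κ L A₁ a b A) : 0 < √L :=
  Real.sqrt_pos.2 (one_pos.trans_le h.one_le)

lemma abs_sqrt_sub_le (h : NearRing r κ L A₁ a b A) : |√(a * b) - r| ≤ 5 / 2 * (κ / √L) := by
  have hr := h.r_pos
  have h1 : (√(a * b) - r) * (√(a * b) + r) = r * (b - r) + b * (a - r) := by
    have := h.sq_sqrt; linear_combination this
  have h2 : |√(a * b) - r| * r ≤ |√(a * b) - r| * |√(a * b) + r| := by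
    gcongr
    rw [abs_of_pos (by positivity)]
    linarith [Real.sqrt_nonneg (a * b)]
  have h3 : |√(a * b) - r| * |√(a * b) + r| ≤ r * (κ / √L) + 3 / 2 * r * (κ / √L) := by
    rw [← abs_mul, h1]
    refine (abs_add_le _ _).trans ?_
    rw [abs_mul, abs_mul, abs_of_pos hr, abs_of_pos h.b_pos]
    exact add_le_add (mul_le_mul_of_nonneg_left h.b_near hr.le)
      (mul_le_mul h.b_le h.a_near (abs_nonneg _) (by positivity))
  have h4 : |√(a * b) - r| * r ≤ 5 / 2 * (κ / √L) * r := by linarith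
  exact le_of_mul_le_mul_right h4 hr

end NearRing

/-- The stream function up to bounded terms. -/
lemma exists_stream_log_bound {r : ℝ} (hr : 0 < r) (A₁ : ℝ) : ∃ K > 0, ∀ κ L a b A : ℝ,
    NearRing r κ L A₁ a b A → |stream A (a * b) + √(a * b) / (2 * π) * log √A| ≤ K := by
  set U := 3 * r + √(A₁ + 9 * r ^ 2)
  refine ⟨3 / 2 * r * (|log r| + |log U|) + 3 / 4 * r, by positivity, fun κ L a b A h => ?_⟩
  have hA := h.A_pos
  have hB : 0 < a * b := mul_pos h.a_pos h.b_pos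
  have hsA : 0 < √A := Real.sqrt_pos.2 hA
  have hs0 := h.sqrt_ge
  have hs1 := h.sqrt_le
  have h1 := abs_stream_sub_arsinh_le hA hB
  set s := √(a * b) with hs
  have hspos : 0 < s := by linarith
  have hssq : s ^ 2 = a * b := h.sq_sqrt
  set W := 2 * s + √(A + 4 * (a * b)) with hW
  have hWr : r ≤ W := by linarith [Real.sqrt_nonneg (A + 4 * (a * b))]
  have hWU : W ≤ U := by
    have : √(A + 4 * (a * b)) ≤ √(A₁ + 9 * r ^ 2) := by
      apply Real.sqrt_le_sqrt
      rw [← hssq]; nlinarith [h.A_le]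
    linarith
  -- The singular part is isolated as -log √A; the remaining logarithm has its argument W between r
  -- and U.
  have harsinh : arsinh (2 * √(a * b / A)) = log W - log √A := by
    rw [arsinh, ← Real.log_div (by linarith) hsA.ne']
    congr 1
    have h2 : 1 + (2 * √(a * b / A)) ^ 2 = (A + 4 * (a * b)) / A := by
      rw [mul_pow, Real.sq_sqrt (by positivity)]; field_simp
      ring
    rw [h2, Real.sqrt_div (by positivity : 0 ≤ A + 4 * (a * b)), Real.sqrt_div hB.le, hW]
    ring
  rw [harsinh] at h1
  have hlogW : |log W| ≤ |log r| + |log U| := by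
    have h2 := Real.log_le_log hr hWr
    have h3 := Real.log_le_log (hr.trans_le hWr) hWU
    rw [abs_le]
    constructor
    · linarith [neg_abs_le (log r), abs_nonneg (log U)]
    · linarith [le_abs_self (log U), abs_nonneg (log r)]
  have h2 : stream A (a * b) + s / (2 * π) * log √A =
      (stream A (a * b) - s / (2 * π) * (log W - log √A)) + s / (2 * π) * log W := by ring
  rw [h2]
  refine (abs_add_le _ _).trans ?_
  have h3 : s / (2 * π) ≤ 3 / 2 * r := by
    rw [div_le_iff₀ (by positivity)]
    nlinarith [pi_gt_three]
  have h4 : |s / (2 * π) * log W| ≤ 3 / 2 * r * (|log r| + |log U|) := by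
    rw [abs_mul, abs_of_pos (by positivity)]
    gcongr
  linarith

/-- The integrand of the renormalised energy. -/
def defect (r L : ℝ) (a b A : ℝ) : ℝ :=
  L / (4 * π * r) * ((a ^ 2 + b ^ 2) / 2 + r ^ 2) - stream A (a * b)

namespace NearRing

variable {r κ L A₁ a b A : ℝ}

/-- Completing squares: (a² + b²)/2 + r² - 2r√(ab) = (a - b)²/2 + (√(ab) - r)², which is O(κ²/L) for
heights within κ/√L of r. After multiplication by L/(4πr) the error is bounded, and the main term
joins the logarithm of the stream function to form log(√A/ε). -/
lemma abs_defect_sub_le (h : NearRing r κ L A₁ a b A) {K : ℝ}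
    (hK : |stream A (a * b) + √(a * b) / (2 * π) * log √A| ≤ K) :
    |defect r L a b A - √(a * b) / (2 * π) * (log √A + L)| ≤ κ ^ 2 / r + K := by
  have hr := h.r_pos
  have hL : 0 < L := one_pos.trans_le h.one_le
  have hs := h.sq_sqrt
  have hLs : √L ^ 2 = L := Real.sq_sqrt hL.le
  have hsL := h.sqrtL_pos
  have e : defect r L a b A - √(a * b) / (2 * π) * (log √A + L) =
      L / (4 * π * r) * ((a - b) ^ 2 / 2 + (√(a * b) - r) ^ 2) -
        (stream A (a * b) + √(a * b) / (2 * π) * log √A) := by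
    have h1 : (a - b) ^ 2 / 2 + (√(a * b) - r) ^ 2 =
        (a ^ 2 + b ^ 2) / 2 + r ^ 2 - 2 * r * √(a * b) := by linear_combination hs
    rw [h1, defect]; field_simp; ring
  rw [e]
  refine (abs_sub _ _).trans (add_le_add ?_ hK)
  have h2 : |a - b| ≤ 2 * (κ / √L) := by
    have h3 := abs_sub (a - r) (b - r)
    rw [sub_sub_sub_cancel_right] at h3
    linarith [h.a_near, h.b_near]
  have h4 : (a - b) ^ 2 ≤ (2 * (κ / √L)) ^ 2 := by rw [← sq_abs (a - b)]; gcongr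
  have h5 : (√(a * b) - r) ^ 2 ≤ (5 / 2 * (κ / √L)) ^ 2 := by
    rw [← sq_abs (√(a * b) - r)]; gcongr; exact h.abs_sqrt_sub_le
  have h6 : (κ / √L) ^ 2 = κ ^ 2 / L := by rw [div_pow, hLs]
  rw [mul_pow, h6] at h4 h5
  rw [abs_of_nonneg (by positivity)]
  calc _ ≤ L / (4 * π * r) * (2 ^ 2 * (κ ^ 2 / L) / 2 + (5 / 2) ^ 2 * (κ ^ 2 / L)) := by gcongr
    _ = 33 / (16 * π) * (κ ^ 2 / r) := by field_simp; ring
    _ ≤ 1 * (κ ^ 2 / r) := by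
        gcongr
        rw [div_le_one (by positivity)]; linarith [pi_gt_three]
    _ = _ := one_mul _

/-- The logarithmic distance is controlled by the renormalised energy. -/
lemma abs_log_le (h : NearRing r κ L A₁ a b A) {K : ℝ}
    (hK : |defect r L a b A - √(a * b) / (2 * π) * (log √A + L)| ≤ K) {ψ : ℝ} (hψ : 0 ≤ ψ)
    (hlog : -(log √A + L) ≤ ψ) :
    |log √A + L| ≤ 4 * π / r * (defect r L a b A + K) + 6 * ψ := by
  have hr := h.r_pos
  have hs0 := h.sqrt_ge
  have hs1 := h.sqrt_le
  set s := √(a * b)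
  set q := log √A + L
  have h1 := (abs_le.1 hK).1
  have h2 : |q| ≤ q + 2 * ψ := by
    rw [abs_le]; constructor
    · linarith
    · linarith
  have h3 : s / (2 * π) * |q| ≤ defect r L a b A + K + s / (2 * π) * (2 * ψ) := by
    have h4 : s / (2 * π) * |q| ≤ s / (2 * π) * (q + 2 * ψ) := by
      gcongr
    nlinarith
  have h5 : r / (4 * π) * |q| ≤ s / (2 * π) * |q| := by
    have : r / (4 * π) ≤ s / (2 * π) := by
      rw [div_le_div_iff₀ (by positivity) (by positivity)]; nlinarith [pi_pos]
    gcongr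
  have h6 : s / (2 * π) * (2 * ψ) ≤ 3 / 2 * r / (2 * π) * (2 * ψ) := by gcongr
  have h7 : r / (4 * π) * |q| ≤ defect r L a b A + K + 3 / 2 * r / (2 * π) * (2 * ψ) := by linarith
  have h8 : |q| = 4 * π / r * (r / (4 * π) * |q|) := by field_simp
  rw [h8]
  calc 4 * π / r * (r / (4 * π) * |q|)
      ≤ 4 * π / r * (defect r L a b A + K + 3 / 2 * r / (2 * π) * (2 * ψ)) := by gcongr
    _ = _ := by field_simp; ring

/-- Cancellation of the leading order terms in the radial velocity. -/
lemma abs_radial_coeff_le (h : NearRing r κ L A₁ a b A) {K : ℝ}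
    (hK : |stream A (a * b) + √(a * b) / (2 * π) * log √A| ≤ K) :
    |a / (4 * π * r) - 1 / L * (streamB A (a * b) * b)| ≤
      (κ / r + 1 + 2 / r * (K + r)) * (1 + |log √A + L|) / √L := by
  have hr := h.r_pos
  have ha := h.a_pos
  have hL : 0 < L := one_pos.trans_le h.one_le
  have hsL := h.sqrtL_pos
  have hLs : √L ^ 2 = L := Real.sq_sqrt hL.le
  have hs0 := h.sqrt_ge
  have hs1 := h.sqrt_le
  have hB : 0 < a * b := mul_pos h.a_pos h.b_pos
  have heu := stream_euler h.A_pos hB.le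
  have hA := abs_mul_streamA_le h.A_pos hB
  set s := √(a * b)
  set q := log √A + L with hq
  set R := stream A (a * b) + s / (2 * π) * log √A with hR
  have hs : 0 < s := by linarith
  have hst : stream A (a * b) = s / (2 * π) * (L - q) + R := by rw [hR, hq]; ring
  -- Homogeneity trades ∂_B for the stream function and A ∂_A. Inserting L minus the logarithmic
  -- distance for -log √A, the leading term is s/(4πa), with s = √(ab), which differs from a/(4πr)
  -- only by O(κ/√L); all else carries a factor 1/L.
  have hb : streamB A (a * b) * b = (stream A (a * b) / 2 - A * streamA A (a * b)) / a := by
    rw [← heu]; field_simp; ring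
  have e : a / (4 * π * r) - 1 / L * (streamB A (a * b) * b) =
      ((a - r) * (a + r) - r * (s - r)) / (4 * π * r * a) + s / (4 * π * a) * q / L -
        (R / 2 - A * streamA A (a * b)) / a / L := by
    rw [hb, hst]; field_simp; ring
  rw [e]
  have t1 : |((a - r) * (a + r) - r * (s - r)) / (4 * π * r * a)| ≤ κ / r / √L := by
    rw [abs_div, abs_of_pos (by positivity : 0 < 4 * π * r * a), div_le_iff₀ (by positivity)]
    have h1 : |(a - r) * (a + r) - r * (s - r)| ≤ κ / √L * (5 / 2 * r) + r * (5 / 2 * (κ / √L)) := by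
      refine (abs_sub _ _).trans ?_
      rw [abs_mul, abs_mul, abs_of_pos hr]
      refine add_le_add (mul_le_mul h.a_near ?_ (abs_nonneg _) ?_)
        (mul_le_mul_of_nonneg_left h.abs_sqrt_sub_le hr.le)
      · rw [abs_of_pos (by positivity)]; linarith [h.a_le]
      · exact div_nonneg h.κ_nonneg hsL.le
    refine h1.trans ?_
    have hk : 0 ≤ κ / √L := div_nonneg h.κ_nonneg hsL.le
    have h2 : κ / r / √L * (4 * π * r * a) = κ / √L * (4 * π * a) := by field_simp
    rw [h2]
    have h3 : 5 * r ≤ 4 * π * a := by nlinarith [pi_gt_three, h.a_ge]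
    nlinarith
  have hLsq : √L ≤ L := by
    rw [Real.sqrt_le_left hL.le]; nlinarith [h.one_le]
  have t2 : |s / (4 * π * a) * q / L| ≤ |q| / √L := by
    rw [abs_div, abs_mul, abs_of_pos hL, abs_of_pos (by positivity : 0 < s / (4 * π * a))]
    have h3 : s / (4 * π * a) ≤ 1 := by
      rw [div_le_one (by positivity)]; nlinarith [pi_gt_three, h.a_ge]
    have h4 : s / (4 * π * a) * |q| ≤ |q| := mul_le_of_le_one_left (abs_nonneg q) h3
    gcongr
  have t3 : |(R / 2 - A * streamA A (a * b)) / a / L| ≤ 2 / r * (K + r) / √L := by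
    rw [abs_div, abs_div, abs_of_pos hL, abs_of_pos ha]
    have h5 : |R / 2 - A * streamA A (a * b)| ≤ K + r := by
      refine (abs_sub _ _).trans ?_
      rw [abs_div, abs_of_pos (by norm_num : (0 : ℝ) < 2)]
      have := abs_nonneg R
      linarith
    have hKr : 0 ≤ K + r := (abs_nonneg _).trans h5
    have h6 : |R / 2 - A * streamA A (a * b)| / a ≤ 2 / r * (K + r) := by
      rw [div_le_iff₀ ha]
      calc _ ≤ K + r := h5
        _ = 2 / r * (K + r) * (r / 2) := by field_simp
        _ ≤ _ := by gcongr; exact h.a_ge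
    gcongr
  refine (abs_sub _ _).trans ((add_le_add (abs_add_le _ _) le_rfl).trans ?_)
  have hK0 : 0 ≤ K := (abs_nonneg _).trans hK
  have hk := h.κ_nonneg
  have hq0 := abs_nonneg q
  have hfin : κ / r + |q| + 2 / r * (K + r) ≤ (κ / r + 1 + 2 / r * (K + r)) * (1 + |q|) := by
    have e1 : 0 ≤ κ / r := by positivity
    have e2 : 0 ≤ 2 / r * (K + r) := by positivity
    nlinarith [mul_nonneg e1 hq0, mul_nonneg e2 hq0]
  calc _ ≤ κ / r / √L + |q| / √L + 2 / r * (K + r) / √L := by linarith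
    _ = (κ / r + |q| + 2 / r * (K + r)) / √L := by ring
    _ ≤ _ := by gcongr

end NearRing

/-! ### Potential of the inverse distance -/

lemma lintegral_inv_dist_ball {ε : ℝ} (hε : 0 < ε) (x : Plane) :
    ∫⁻ y : Plane, ENNReal.ofReal ((Iio ε).indicator (fun ρ => ε / ρ) ‖x - y‖) =
      ENNReal.ofReal (2 * (volume : Measure Plane).real (Metric.ball 0 1) * ε ^ 2) := by
  have hdim : Module.finrank ℝ Plane = 2 := by simp
  have hrad : ∀ ρ ∈ Ioi (0 : ℝ), ρ ^ (2 - 1) • (Iio ε).indicator (fun ρ => ε / ρ) ρ =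
      (Iio ε).indicator (fun _ => ε) ρ := by
    intro ρ hρ
    have : ρ ≠ 0 := ne_of_gt hρ
    by_cases h : ρ ∈ Iio ε
    · simp only [indicator_of_mem h, smul_eq_mul]; norm_num; field_simp
    · simp [indicator_of_notMem h]
  have hind : IntegrableOn (fun ρ => ρ ^ (2 - 1) • (Iio ε).indicator (fun ρ => ε / ρ) ρ)
      (Ioi 0) := by
    rw [integrableOn_congr_fun hrad measurableSet_Ioi, IntegrableOn,
      integrable_indicator_iff measurableSet_Iio, IntegrableOn,
      Measure.restrict_restrict measurableSet_Iio, inter_comm, Ioi_inter_Iio]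
    exact integrable_const _
  have hint : Integrable (fun y : Plane => (Iio ε).indicator (fun ρ => ε / ρ) ‖y‖) := by
    rw [integrable_fun_norm_addHaar volume (f := (Iio ε).indicator fun ρ => ε / ρ), hdim]
    exact hind
  have h1 : ∫⁻ y : Plane, ENNReal.ofReal ((Iio ε).indicator (fun ρ => ε / ρ) ‖x - y‖) =
      ∫⁻ y : Plane, ENNReal.ofReal ((Iio ε).indicator (fun ρ => ε / ρ) ‖y‖) :=
    lintegral_sub_left_eq_self
      (fun y : Plane => ENNReal.ofReal ((Iio ε).indicator (fun ρ => ε / ρ) ‖y‖)) x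
  rw [h1, ← ofReal_integral_eq_lintegral_ofReal hint
    (Eventually.of_forall fun y => indicator_apply_nonneg fun _ => by positivity),
    integral_fun_norm_addHaar volume, hdim, setIntegral_congr_fun measurableSet_Ioi hrad,
    integral_indicator measurableSet_Iio, Measure.restrict_restrict measurableSet_Iio, inter_comm,
    Ioi_inter_Iio]
  congr 1
  simp [hε.le]
  ring

/-- Beyond distance ε the integrand is at most 1 and contributes the mass γ. Within distance ε the
density is at most M₀ x_r/ε², while the integral of ε/|x - y| is of order ε². The sum is bounded
independently of ε. -/
lemma lintegral_inv_dist_le {μ : Measure Plane} {ε M₀ R γ : ℝ} (hε : 0 < ε) (hM₀ : 0 < M₀)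
    (hR : 0 < R) (hγ : 0 < γ) (hμ : μ ≤ ENNReal.ofReal (M₀ / ε ^ 2) • ringVol)
    (hmass : μ univ = ENNReal.ofReal γ) (hheight : ∀ᵐ x ∂μ, x 1 ≤ R) (x : Plane) :
    ∫⁻ y, ENNReal.ofReal (ε / ‖x - y‖) ∂μ ≤
      ENNReal.ofReal (M₀ * R * (2 * (volume : Measure Plane).real (Metric.ball 0 1)) + γ) := by
  set g : Plane → ℝ≥0∞ := fun y => ENNReal.ofReal ((Iio ε).indicator (fun ρ => ε / ρ) ‖x - y‖)
  have hgm : Measurable g :=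
    (((by fun_prop : Measurable fun ρ : ℝ => ε / ρ).indicator measurableSet_Iio).comp
      (by fun_prop)).ennreal_ofReal
  set v := (volume : Measure Plane).real (Metric.ball 0 1)
  have hv : 0 ≤ v := measureReal_nonneg
  have hpt : ∀ y, ENNReal.ofReal (ε / ‖x - y‖) ≤ g y + 1 := by
    intro y
    by_cases h : ‖x - y‖ ∈ Iio ε
    · simp only [g, indicator_of_mem h]; exact le_self_add
    · refine le_trans ?_ le_add_self
      rw [← ENNReal.ofReal_one]
      refine ENNReal.ofReal_le_ofReal ?_
      have h' : ε ≤ ‖x - y‖ := not_lt.1 h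
      rw [div_le_one (hε.trans_le h')]; exact h'
  have hset : MeasurableSet {y : Plane | y 1 ≤ R} := measurableSet_le (by fun_prop) (by fun_prop)
  have hg1 : ∫⁻ y, g y ∂μ ≤ ENNReal.ofReal (M₀ * R * (2 * v)) := by
    calc ∫⁻ y, g y ∂μ = ∫⁻ y in {y | y 1 ≤ R}, g y ∂μ := by
          rw [Measure.restrict_eq_self_of_ae_mem (s := {y : Plane | y 1 ≤ R}) hheight]
      _ ≤ ∫⁻ y in {y | y 1 ≤ R}, g y ∂(ENNReal.ofReal (M₀ / ε ^ 2) • ringVol) :=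
          lintegral_mono' (Measure.restrict_mono le_rfl hμ) le_rfl
      _ = ENNReal.ofReal (M₀ / ε ^ 2) * ∫⁻ y in {y | y 1 ≤ R}, g y ∂ringVol := by
          rw [Measure.restrict_smul, lintegral_smul_measure, smul_eq_mul]
      _ = ENNReal.ofReal (M₀ / ε ^ 2) *
            ∫⁻ y in {y | y 1 ≤ R}, ENNReal.ofReal (y 1) * g y ∂halfVol := by
          rw [ringVol, setLIntegral_withDensity_eq_setLIntegral_mul _ (by fun_prop) hgm hset]
          rfl
      _ ≤ ENNReal.ofReal (M₀ / ε ^ 2) *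
            ∫⁻ y in {y | y 1 ≤ R}, ENNReal.ofReal R * g y ∂halfVol := by
          refine mul_le_mul_right ?_ _
          refine setLIntegral_mono' hset fun y hy => ?_
          gcongr
          exact hy
      _ ≤ ENNReal.ofReal (M₀ / ε ^ 2) * ∫⁻ y, ENNReal.ofReal R * g y := by
          refine mul_le_mul_right ?_ _
          exact lintegral_mono' (Measure.restrict_le_self.trans Measure.restrict_le_self) le_rfl
      _ = ENNReal.ofReal (M₀ * R * (2 * v)) := by
          rw [lintegral_const_mul _ hgm, lintegral_inv_dist_ball hε, ← ENNReal.ofReal_mul hR.le,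
            ← ENNReal.ofReal_mul (by positivity)]
          congr 1; field_simp; rfl
  calc ∫⁻ y, ENNReal.ofReal (ε / ‖x - y‖) ∂μ ≤ ∫⁻ y, (g y + 1) ∂μ := lintegral_mono hpt
    _ = ∫⁻ y, g y ∂μ + ENNReal.ofReal γ := by
        rw [lintegral_add_right _ measurable_const, lintegral_one, hmass]
    _ ≤ ENNReal.ofReal (M₀ * R * (2 * v)) + ENNReal.ofReal γ := by gcongr
    _ = _ := (ENNReal.ofReal_add (by positivity) hγ.le).symm

lemma integrable_inv_dist {μ : Measure Plane} {ε M₀ R γ : ℝ} (hε : 0 < ε) (hM₀ : 0 < M₀)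
    (hR : 0 < R) (hγ : 0 < γ) (hμ : μ ≤ ENNReal.ofReal (M₀ / ε ^ 2) • ringVol)
    (hmass : μ univ = ENNReal.ofReal γ) (hheight : ∀ᵐ x ∂μ, x 1 ≤ R) :
    Integrable (fun p : Plane × Plane => ε / ‖p.1 - p.2‖) (μ.prod μ) ∧
    ∫ p, ε / ‖p.1 - p.2‖ ∂μ.prod μ ≤
      (M₀ * R * (2 * (volume : Measure Plane).real (Metric.ball 0 1)) + γ) * γ := by
  have : IsFiniteMeasure μ := ⟨by rw [hmass]; exact ENNReal.ofReal_lt_top⟩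
  set C := M₀ * R * (2 * (volume : Measure Plane).real (Metric.ball 0 1)) + γ
  have hC : 0 ≤ C := by
    have : 0 ≤ (volume : Measure Plane).real (Metric.ball 0 1) := measureReal_nonneg
    positivity
  have hm : Measurable fun p : Plane × Plane => ε / ‖p.1 - p.2‖ := by fun_prop
  have h0 : 0 ≤ᵐ[μ.prod μ] fun p : Plane × Plane => ε / ‖p.1 - p.2‖ :=
    Eventually.of_forall fun p => by positivity
  have hl : ∫⁻ p, ENNReal.ofReal (ε / ‖p.1 - p.2‖) ∂μ.prod μ ≤ ENNReal.ofReal (C * γ) := by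
    rw [lintegral_prod _ hm.ennreal_ofReal.aemeasurable]
    calc _ ≤ ∫⁻ _, ENNReal.ofReal C ∂μ :=
          lintegral_mono fun x => lintegral_inv_dist_le hε hM₀ hR hγ hμ hmass hheight x
      _ = ENNReal.ofReal (C * γ) := by rw [lintegral_const, hmass, ENNReal.ofReal_mul hC]
  constructor
  · refine ⟨hm.aestronglyMeasurable, ?_⟩
    rw [hasFiniteIntegral_iff_ofReal h0]
    exact hl.trans_lt ENNReal.ofReal_lt_top
  · rw [integral_eq_lintegral_of_nonneg_ae h0 hm.aestronglyMeasurable]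
    exact ENNReal.toReal_le_of_le_ofReal (by positivity) hl

/-! ### Measurability -/

lemma measurable_ringDist : Measurable fun z : (ℝ × ℝ) × ℝ => ringDist z.1.1 z.1.2 z.2 := by
  unfold ringDist; fun_prop

@[fun_prop]
lemma measurable_cosMoment (k : ℕ) : Measurable fun p : ℝ × ℝ => cosMoment k p.1 p.2 := by
  have hm : Measurable fun z : (ℝ × ℝ) × ℝ =>
      cos z.2 ^ k * ringDist z.1.1 z.1.2 z.2 ^ (-(3 / 2) : ℝ) :=
    Measurable.mul (by fun_prop) (measurable_ringDist.pow_const _)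
  have h := hm.stronglyMeasurable.integral_prod_right' (ν := volume.restrict (Ioc (-π) π))
  have e : (fun p : ℝ × ℝ => cosMoment k p.1 p.2) = fun p => ∫ θ in Ioc (-π) π,
      cos θ ^ k * ringDist p.1 p.2 θ ^ (-(3 / 2) : ℝ) := by
    ext p; exact intervalIntegral.integral_of_le (by linarith [pi_pos])
  rw [e]; exact h.measurable

@[fun_prop]
lemma measurable_stream : Measurable fun p : ℝ × ℝ => stream p.1 p.2 := by
  have hm : Measurable fun z : (ℝ × ℝ) × ℝ =>
      cos z.2 * ringDist z.1.1 z.1.2 z.2 ^ (-(1 / 2) : ℝ) :=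
    Measurable.mul (by fun_prop) (measurable_ringDist.pow_const _)
  have h := hm.stronglyMeasurable.integral_prod_right' (ν := volume.restrict (Ioc (-π) π))
  have e : (fun p : ℝ × ℝ => stream p.1 p.2) = fun p => p.2 / (4 * π) * ∫ θ in Ioc (-π) π,
      cos θ * ringDist p.1 p.2 θ ^ (-(1 / 2) : ℝ) := by
    ext p; rw [stream, intervalIntegral.integral_of_le (by linarith [pi_pos])]
  rw [e]; exact Measurable.mul (by fun_prop) h.measurable

@[fun_prop]
lemma measurable_streamA : Measurable fun p : ℝ × ℝ => streamA p.1 p.2 := by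
  unfold streamA; fun_prop

@[fun_prop]
lemma measurable_streamB : Measurable fun p : ℝ × ℝ => streamB p.1 p.2 := by
  unfold streamB; fun_prop

lemma measurable_ringKern (δ : ℝ) : Measurable fun p : Plane × Plane => ringKern δ p.1 p.2 := by
  have hm : Measurable fun z : (Plane × Plane) × ℝ => kern δ z.1.1 z.1.2 z.2 := by
    unfold kern den; fun_prop
  have h := hm.stronglyMeasurable.integral_prod_right' (ν := volume.restrict (Ioc (-π) π))
  have e : (fun p : Plane × Plane => ringKern δ p.1 p.2) = fun p => ∫ θ in Ioc (-π) π,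
      kern δ p.1 p.2 θ := by
    ext1 p; exact intervalIntegral.integral_of_le (by linarith [pi_pos])
  rw [e]; exact h.measurable

lemma norm_ringKern_le_of_pos {δ : ℝ} (hδ : 0 < δ) {x y : Plane} (hx : x ∈ halfPlane)
    (hy : y ∈ halfPlane) : ‖ringKern δ x y‖ ≤ (‖x‖ + ‖y‖) * (δ ^ 3)⁻¹ * (2 * π) := by
  have hB : 0 ≤ x 1 * y 1 := (mul_pos hx hy).le
  have hb := intervalIntegral.norm_integral_le_of_norm_le_const (a := -π) (b := π)
    (f := kern δ x y) (C := (‖x‖ + ‖y‖) * (δ ^ 3)⁻¹) fun θ _ => by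
      have hA : 0 < ‖x - y‖ ^ 2 + δ ^ 2 := by positivity
      have hD : δ ^ 2 ≤ den δ x y θ := by
        rw [den_eq_ringDist]
        exact le_trans (by nlinarith [sq_nonneg ‖x - y‖]) (le_ringDist hB θ)
      have hD0 : 0 < den δ x y θ := lt_of_lt_of_le (by positivity) hD
      have hr : den δ x y θ ^ (-(3 / 2) : ℝ) ≤ (δ ^ 3)⁻¹ := by
        rw [rpow_neg_three_halves hD0.le]
        have : δ ≤ √(den δ x y θ) := Real.le_sqrt_of_sq_le hD
        gcongr
      have hr0 : 0 ≤ den δ x y θ ^ (-(3 / 2) : ℝ) := Real.rpow_nonneg hD0.le _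
      rw [kern_eq_smul, norm_smul, Real.norm_eq_abs, abs_of_nonneg (by positivity)]
      have hx0 := abs_apply_le_norm x 0
      have hx1 := abs_apply_le_norm x 1
      have hy0 := abs_apply_le_norm y 0
      have hy1 := abs_apply_le_norm y 1
      have hc := abs_cos_le_one θ
      have hn : ‖(!₂[-(x 1 * cos θ - y 1), (x 0 - y 0) * cos θ] : Plane)‖ ≤
          2 * (‖x‖ + ‖y‖) := by
        refine (norm_le_abs_add _).trans ?_
        simp only [Matrix.cons_val_zero, Matrix.cons_val_one, abs_neg, abs_mul]
        have e1 : |x 1 * cos θ - y 1| ≤ ‖x‖ + ‖y‖ := by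
          refine (abs_sub _ _).trans (add_le_add ?_ hy1)
          rw [abs_mul]; nlinarith [abs_nonneg (x 1), abs_nonneg (cos θ)]
        have e2 : |x 0 - y 0| * |cos θ| ≤ ‖x‖ + ‖y‖ := by
          have := (abs_sub (x 0) (y 0)).trans (add_le_add hx0 hy0)
          nlinarith [abs_nonneg (x 0 - y 0), abs_nonneg (cos θ)]
        linarith
      have h4 := four_pi_inv_le
      calc (4 * π)⁻¹ * den δ x y θ ^ (-(3 / 2) : ℝ) *
            ‖(!₂[-(x 1 * cos θ - y 1), (x 0 - y 0) * cos θ] : Plane)‖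
          ≤ 1 / 12 * (δ ^ 3)⁻¹ * (2 * (‖x‖ + ‖y‖)) := by gcongr
        _ = 1 / 6 * ((‖x‖ + ‖y‖) * (δ ^ 3)⁻¹) := by ring
        _ ≤ 1 * ((‖x‖ + ‖y‖) * (δ ^ 3)⁻¹) := by gcongr; norm_num
        _ = _ := one_mul _
  refine hb.trans (le_of_eq ?_)
  rw [sub_neg_eq_add, abs_of_pos (by positivity)]; ring

lemma Admissible.continuous_bs {M : ℝ} {w : Plane → ℝ} (hM : 0 < M) (hw : Admissible M w) :
    Continuous (bs 0 w) := by
  have hu : TendstoUniformly (fun n : ℕ => bs (1 / ((n : ℝ) + 1)) w) (bs 0 w) atTop := by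
    rw [Metric.tendstoUniformly_iff]
    intro e he
    have hlim : Tendsto (fun n : ℕ => 55 * M * √(1 / ((n : ℝ) + 1))) atTop (𝓝 0) := by
      have := (tendsto_one_div_add_atTop_nhds_zero_nat (𝕜 := ℝ)).sqrt.const_mul (55 * M)
      simpa using this
    filter_upwards [hlim.eventually (gt_mem_nhds he)] with n hn x
    rw [dist_comm, dist_eq_norm]
    exact (hw.norm_bs_sub_le hM (by positivity) x).trans_lt hn
  refine hu.continuous (Eventually.of_forall fun n => ?_).frequently
  exact continuous_iff_continuousAt.2 fun x =>
    (hw.hasFDerivAt_bs hM (by positivity) x).continuousAt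

lemma Admissible.continuous_bs_of_pos {M δ : ℝ} {w : Plane → ℝ} (hM : 0 < M) (hδ : 0 < δ)
    (hw : Admissible M w) : Continuous (bs δ w) :=
  continuous_iff_continuousAt.2 fun x => (hw.hasFDerivAt_bs hM hδ x).continuousAt

/-! ### Evolution of the energy integrand. -/

/-- The rate of change of the defect, when `x, y` move with velocities `V, W`. -/
def defectRate (r L : ℝ) (x y V W : Plane) (A : ℝ) : ℝ :=
  L / (4 * π * r) * (x 1 * V 1 + y 1 * W 1) -
    (streamA A (x 1 * y 1) * (2 * ((x 0 - y 0) * (V 0 - W 0) + (x 1 - y 1) * (V 1 - W 1))) +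
      streamB A (x 1 * y 1) * (y 1 * V 1 + x 1 * W 1))

lemma defectRate_add (r L : ℝ) (x y V W V' W' : Plane) (A : ℝ) :
    defectRate r L x y (V + V') (W + W') A =
      defectRate r L x y V W A + defectRate r L x y V' W' A := by
  simp only [defectRate, PiLp.add_apply]; ring

lemma defectRate_smul (r L c : ℝ) (x y V W : Plane) (A : ℝ) :
    defectRate r L x y (c • V) (c • W) A = c * defectRate r L x y V W A := by
  simp only [defectRate, PiLp.smul_apply, smul_eq_mul]; ring

lemma hasDerivAt_coord {x : ℝ → Plane} {V : Plane} {t : ℝ} (hx : HasDerivAt x V t) (i : Fin 2) :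
    HasDerivAt (fun s => x s i) (V i) t :=
  (hasFDerivAt_coord (x t) i).comp_hasDerivAt t hx

lemma hasDerivAt_defect {r L δ : ℝ} (hδ : 0 < δ) {x y : ℝ → Plane} {V W : Plane}
    {t : ℝ} (hx : HasDerivAt x V t) (hy : HasDerivAt y W t) (hxH : x t ∈ halfPlane)
    (hyH : y t ∈ halfPlane) :
    HasDerivAt (fun s => defect r L (x s 1) (y s 1) (‖x s - y s‖ ^ 2 + δ ^ 2))
      (defectRate r L (x t) (y t) V W (‖x t - y t‖ ^ 2 + δ ^ 2)) t := by
  have h0 := (hasDerivAt_coord hx 0).sub (hasDerivAt_coord hy 0)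
  have h1 := (hasDerivAt_coord hx 1).sub (hasDerivAt_coord hy 1)
  have hA : HasDerivAt (fun s => ‖x s - y s‖ ^ 2 + δ ^ 2)
      (2 * ((x t 0 - y t 0) * (V 0 - W 0) + (x t 1 - y t 1) * (V 1 - W 1))) t := by
    have e : (fun s => ‖x s - y s‖ ^ 2 + δ ^ 2) =
        fun s => (x s 0 - y s 0) ^ 2 + (x s 1 - y s 1) ^ 2 + δ ^ 2 := by
      ext s; rw [norm_sub_sq_eq]
    rw [e]
    refine (((h0.pow 2).add (h1.pow 2)).add_const (δ ^ 2)).congr_deriv ?_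
    simp; ring
  have hB : HasDerivAt (fun s => x s 1 * y s 1) (V 1 * y t 1 + x t 1 * W 1) t :=
    (hasDerivAt_coord hx 1).mul (hasDerivAt_coord hy 1)
  have hA0 : 0 < ‖x t - y t‖ ^ 2 + δ ^ 2 := by positivity
  have hS := (hasFDerivAt_stream hA0 (mul_pos hxH hyH)).comp_hasDerivAt t (hA.prodMk hB)
  have hq := (((((hasDerivAt_coord hx 1).pow 2).add ((hasDerivAt_coord hy 1).pow 2)).div_const
    2).add_const (r ^ 2)).const_mul (L / (4 * π * r))
  refine (hq.sub hS).congr_deriv ?_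
  simp only [defectRate, add_apply, smul_apply, ContinuousLinearMap.coe_fst',
    ContinuousLinearMap.coe_snd', smul_eq_mul]
  simp
  ring

/-- The rate is a sum of two terms exchanged by swapping the points. Each involves the kernel only
through its cross product with the velocity, which is what integrates to zero for the self-generated
velocity. -/
lemma defectRate_eq {r L δ : ℝ} (hδ : 0 < δ) {x y : Plane} (hx : x ∈ halfPlane)
    (hy : y ∈ halfPlane) (V W : Plane) :
    defectRate r L x y V W (‖x - y‖ ^ 2 + δ ^ 2) =
      (L / (4 * π * r) * (x 1 * V 1) -
        x 1 * y 1 * (ringKern δ x y 0 * V 1 - ringKern δ x y 1 * V 0)) +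
      (L / (4 * π * r) * (y 1 * W 1) -
        y 1 * x 1 * (ringKern δ y x 0 * W 1 - ringKern δ y x 1 * W 0)) := by
  have hB : 0 ≤ x 1 * y 1 := (mul_pos hx hy).le
  have hA : 0 < ‖x - y‖ ^ 2 + δ ^ 2 := by positivity
  have h1 := stream_gradient hA hB V
  have hA' : 0 < ‖y - x‖ ^ 2 + δ ^ 2 := by positivity
  have h2 := stream_gradient hA' (by linarith : 0 ≤ y 1 * x 1) W
  rw [norm_sub_rev y x, mul_comm (y 1) (x 1)] at h2
  rw [mul_comm (y 1) (x 1), ← h1, ← h2, defectRate]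
  ring

lemma ringKern_one_antisymm {δ : ℝ} (hδ : 0 < δ) {x y : Plane} (hx : x ∈ halfPlane)
    (hy : y ∈ halfPlane) : ringKern δ y x 1 = -ringKern δ x y 1 := by
  have hB : 0 ≤ x 1 * y 1 := (mul_pos hx hy).le
  rw [ringKern_one (by positivity) hB, ringKern_one (by positivity) (by linarith),
    norm_sub_rev y x, mul_comm (y 1) (x 1)]
  ring

lemma abs_streamB_le {A B : ℝ} (hA : 0 < A) (hB : 0 < B) : |streamB A B| ≤ √B / (2 * A) := by
  have h0 := abs_cosMoment_le hA hB 0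
  have h1 := abs_cosMoment_le hA hB 1
  rw [streamB, abs_mul, abs_of_pos (by positivity)]
  calc B / (4 * π) * |cosMoment 0 A B - cosMoment 1 A B|
      ≤ B / (4 * π) * (π / (A * √B) + π / (A * √B)) := by
        gcongr; exact (abs_sub _ _).trans (add_le_add h0 h1)
    _ = B / √B / (2 * A) := by field_simp; norm_num
    _ = √B / (2 * A) := by rw [Real.div_sqrt]

lemma abs_dot_le (u v : Plane) : |u 0 * v 0 + u 1 * v 1| ≤ ‖u‖ * ‖v‖ := by
  apply abs_le_of_sq_le_sq _ (by positivity)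
  rw [mul_pow, norm_sq_eq, norm_sq_eq]
  nlinarith [sq_nonneg (u 0 * v 1 - u 1 * v 0)]

lemma norm_sub_le_sqrt (x y : Plane) (δ : ℝ) : ‖x - y‖ ≤ √(‖x - y‖ ^ 2 + δ ^ 2) :=
  Real.le_sqrt_of_sq_le (by nlinarith [sq_nonneg δ])

/-- A rough bound of the rate. -/
lemma exists_defectRate_bound {r L δ : ℝ} (hr : 0 < r) (hL : 0 < L) (hδ : 0 < δ) (A₁ : ℝ) :
    ∃ C > 0, ∀ κ (x y V W : Plane), NearRing r κ L A₁ (x 1) (y 1) (‖x - y‖ ^ 2 + δ ^ 2) →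
      |defectRate r L x y V W (‖x - y‖ ^ 2 + δ ^ 2)| ≤ C * (‖V‖ + ‖W‖) := by
  refine ⟨L / (4 * π * r) * (3 / 2 * r) + 3 / 2 * r / δ ^ 2 * √A₁ +
    3 / 2 * r / δ ^ 2 * (3 / 2 * r), by positivity, fun κ x y V W h => ?_⟩
  set A := ‖x - y‖ ^ 2 + δ ^ 2 with hAdef
  have hA := h.A_pos
  have hAδ : δ ^ 2 ≤ A := by rw [hAdef]; nlinarith [sq_nonneg ‖x - y‖]
  have ha := h.a_pos
  have hb := h.b_pos
  have hB : 0 < x 1 * y 1 := mul_pos ha hb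
  have hs := h.sqrt_le
  have hsA : |streamA A (x 1 * y 1)| ≤ 3 / 2 * r / (2 * δ ^ 2) := by
    have h1 := abs_mul_streamA_le hA hB
    rw [abs_mul, abs_of_pos hA] at h1
    have h2 : |streamA A (x 1 * y 1)| * δ ^ 2 ≤ A * |streamA A (x 1 * y 1)| := by
      rw [mul_comm]; gcongr
    rw [le_div_iff₀ (by positivity)]; nlinarith
  have hsB : |streamB A (x 1 * y 1)| ≤ 3 / 2 * r / δ ^ 2 := by
    refine (abs_streamB_le hA hB).trans ?_
    gcongr; linarith
  have hV := abs_apply_le_norm V 1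
  have hW := abs_apply_le_norm W 1
  have hd := (abs_dot_le (x - y) (V - W)).trans (mul_le_mul
    ((norm_sub_le_sqrt x y δ).trans (Real.sqrt_le_sqrt h.A_le)) (_root_.norm_sub_le V W)
    (norm_nonneg _) (Real.sqrt_nonneg _))
  simp only [PiLp.sub_apply] at hd
  rw [defectRate]
  have e1 : |x 1 * V 1 + y 1 * W 1| ≤ 3 / 2 * r * (‖V‖ + ‖W‖) := by
    refine (abs_add_le _ _).trans ?_
    rw [abs_mul, abs_mul, abs_of_pos ha, abs_of_pos hb, mul_add]
    exact add_le_add (mul_le_mul h.a_le hV (abs_nonneg _) (by positivity))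
      (mul_le_mul h.b_le hW (abs_nonneg _) (by positivity))
  have e2 : |y 1 * V 1 + x 1 * W 1| ≤ 3 / 2 * r * (‖V‖ + ‖W‖) := by
    refine (abs_add_le _ _).trans ?_
    rw [abs_mul, abs_mul, abs_of_pos ha, abs_of_pos hb, mul_add]
    exact add_le_add (mul_le_mul h.b_le hV (abs_nonneg _) (by positivity))
      (mul_le_mul h.a_le hW (abs_nonneg _) (by positivity))
  refine (abs_sub _ _).trans ((add_le_add le_rfl (abs_add_le _ _)).trans ?_)
  rw [abs_mul, abs_mul, abs_mul, abs_mul, abs_of_pos (by positivity : 0 < L / (4 * π * r)),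
    abs_of_pos (by norm_num : (0 : ℝ) < 2)]
  calc _ ≤ L / (4 * π * r) * (3 / 2 * r * (‖V‖ + ‖W‖)) +
        (3 / 2 * r / (2 * δ ^ 2) * (2 * (√A₁ * (‖V‖ + ‖W‖))) +
          3 / 2 * r / δ ^ 2 * (3 / 2 * r * (‖V‖ + ‖W‖))) := by gcongr
    _ = _ := by field_simp; ring

/-- The effect of the exterior field on the renormalised energy. -/
lemma abs_defectRate_exterior_le {r κ L A₁ δ K Fb Fl : ℝ} {x y V W : Plane}
    (hFl : 0 ≤ Fl) (h : NearRing r κ L A₁ (x 1) (y 1) (‖x - y‖ ^ 2 + δ ^ 2))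
    (hK : |stream (‖x - y‖ ^ 2 + δ ^ 2) (x 1 * y 1) +
      √(x 1 * y 1) / (2 * π) * log √(‖x - y‖ ^ 2 + δ ^ 2)| ≤ K)
    (hV : ‖V‖ ≤ Fb * √L) (hW : ‖W‖ ≤ Fb * √L) (hVW : ‖V - W‖ ≤ Fl * L * ‖x - y‖) :
    |1 / L * defectRate r L x y V W (‖x - y‖ ^ 2 + δ ^ 2)| ≤
      (2 * (κ / r + 1 + 2 / r * (K + r)) * Fb + Fl * r) *
        (1 + |log √(‖x - y‖ ^ 2 + δ ^ 2) + L|) := by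
  set A := ‖x - y‖ ^ 2 + δ ^ 2 with hAdef
  have hr := h.r_pos
  have hA := h.A_pos
  have hL : 0 < L := one_pos.trans_le h.one_le
  have hsL := h.sqrtL_pos
  have hB : 0 < x 1 * y 1 := mul_pos h.a_pos h.b_pos
  have c1 := h.abs_radial_coeff_le hK
  have c2 := h.symm.abs_radial_coeff_le (K := K) (by rw [mul_comm (y 1)]; exact hK)
  rw [mul_comm (y 1) (x 1)] at c2
  set q := |log √A + L|
  set c := κ / r + 1 + 2 / r * (K + r)
  have hA8 := abs_mul_streamA_le hA hB
  have hs := h.sqrt_le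
  -- Collecting the radial velocities exhibits the coefficient of size (1 + |log|)/√L, which
  -- compensates a field of size √L. In the last term the Lipschitz constant of order L meets the
  -- prefactor 1/L and the bounded product A ∂_A.
  have e : 1 / L * defectRate r L x y V W A =
      (x 1 / (4 * π * r) - 1 / L * (streamB A (x 1 * y 1) * y 1)) * V 1 +
      (y 1 / (4 * π * r) - 1 / L * (streamB A (x 1 * y 1) * x 1)) * W 1 -
      2 / L * (streamA A (x 1 * y 1) *
        ((x 0 - y 0) * (V 0 - W 0) + (x 1 - y 1) * (V 1 - W 1))) := by
    rw [defectRate]; field_simp; ring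
  have t1 : ∀ (a v : ℝ), |a| ≤ c * (1 + q) / √L → |v| ≤ Fb * √L → |a * v| ≤ c * (1 + q) * Fb := by
    intro a v h1 h2
    rw [abs_mul]
    calc |a| * |v| ≤ c * (1 + q) / √L * (Fb * √L) :=
          mul_le_mul h1 h2 (abs_nonneg _) ((abs_nonneg _).trans h1)
      _ = _ := by field_simp
  have hd := (abs_dot_le (x - y) (V - W)).trans (mul_le_mul_of_nonneg_left hVW (norm_nonneg _))
  simp only [PiLp.sub_apply] at hd
  have t3 : |2 / L * (streamA A (x 1 * y 1) *
        ((x 0 - y 0) * (V 0 - W 0) + (x 1 - y 1) * (V 1 - W 1)))| ≤ Fl * r := by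
    rw [abs_mul, abs_mul, abs_of_pos (by positivity : 0 < 2 / L)]
    have h3 : ‖x - y‖ ^ 2 ≤ A := by rw [hAdef]; nlinarith [sq_nonneg δ]
    have h4 : |streamA A (x 1 * y 1)| * ‖x - y‖ ^ 2 ≤ 3 / 2 * r / 8 := by
      calc _ ≤ |streamA A (x 1 * y 1)| * A := by gcongr
        _ = |A * streamA A (x 1 * y 1)| := by rw [abs_mul, abs_of_pos hA, mul_comm]
        _ ≤ _ := by linarith
    calc _ ≤ 2 / L * (|streamA A (x 1 * y 1)| * (‖x - y‖ * (Fl * L * ‖x - y‖))) := by gcongr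
      _ = 2 * Fl * (|streamA A (x 1 * y 1)| * ‖x - y‖ ^ 2) := by field_simp
      _ ≤ 2 * Fl * (3 / 2 * r / 8) := by gcongr
      _ ≤ Fl * r := by nlinarith [mul_nonneg hFl hr.le]
  rw [e]
  refine (abs_sub _ _).trans ((add_le_add (abs_add_le _ _) le_rfl).trans ?_)
  have u1 := t1 _ _ c1 ((abs_apply_le_norm V 1).trans hV)
  have u2 := t1 _ _ c2 ((abs_apply_le_norm W 1).trans hW)
  have hq : 0 ≤ q := abs_nonneg _
  nlinarith [mul_nonneg (mul_nonneg hFl hr.le) hq]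

/-! ### The self-interaction -/

section SelfInteraction

variable {M γ ρ r L δ : ℝ} {w : Plane → ℝ}

/-- The self-interaction does not change the renormalised energy, up to the regularisation. -/
lemma integral_defectRate_self (hM : 0 < M) (hw : Admissible M w) (h0 : ∀ᵐ y ∂halfVol, 0 ≤ w y)
    (hγ : 0 < γ) (hmass : vortexMeasure w univ = ENNReal.ofReal γ)
    (hρ : ∀ᵐ x ∂vortexMeasure w, ‖x‖ ≤ ρ) (hr : 0 < r) (hL : 0 < L) (hδ : 0 < δ) :
    Integrable (fun p : Plane × Plane => defectRate r L p.1 p.2 (bs 0 w p.1) (bs 0 w p.2)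
      (‖p.1 - p.2‖ ^ 2 + δ ^ 2)) ((vortexMeasure w).prod (vortexMeasure w)) ∧
    ∫ p : Plane × Plane, defectRate r L p.1 p.2 (bs 0 w p.1) (bs 0 w p.2)
      (‖p.1 - p.2‖ ^ 2 + δ ^ 2) ∂(vortexMeasure w).prod (vortexMeasure w) ≤
      2 * (L / (4 * π * r) * γ * (ρ * (55 * M * √δ)) +
        ρ * (2 * (31 * M) * (55 * M * √δ))) * γ := by
  set μ := vortexMeasure w
  have hfin : IsFiniteMeasure μ := ⟨by rw [hmass]; exact ENNReal.ofReal_lt_top⟩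
  have hreal : μ.real univ = γ := by rw [Measure.real, hmass, ENNReal.toReal_ofReal hγ.le]
  have hne : μ ≠ 0 := by
    intro h
    rw [h] at hmass
    simp at hmass; linarith
  have hρ0 : 0 ≤ ρ := by
    have : (ae μ).NeBot := ae_neBot.2 hne
    obtain ⟨x, hx⟩ := hρ.exists
    exact (norm_nonneg x).trans hx
  set V := bs 0 w
  set k := bs δ w
  have hVc : Continuous V := hw.continuous_bs hM
  have hVb : ∀ x, ‖V x‖ ≤ 31 * M := hw.norm_bs_le hM 0
  have hkb : ∀ x, ‖k x‖ ≤ 31 * M := hw.norm_bs_le hM δ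
  have hkV : ∀ x, ‖k x - V x‖ ≤ 55 * M * √δ := hw.norm_bs_sub_le hM hδ
  have hkc : Continuous k := hw.continuous_bs_of_pos hM hδ
  have hK := measurable_ringKern δ
  have hG : ∀ᵐ x ∂μ, x ∈ halfPlane ∧ ‖x‖ ≤ ρ := (ae_vortexMeasure_mem w).and hρ
  have hGG : ∀ᵐ p ∂μ.prod μ, (p.1 ∈ halfPlane ∧ ‖p.1‖ ≤ ρ) ∧ (p.2 ∈ halfPlane ∧ ‖p.2‖ ≤ ρ) := by
    have h1 := (Measure.quasiMeasurePreserving_fst (μ := μ) (ν := μ)).ae hG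
    have h2 := (Measure.quasiMeasurePreserving_snd (μ := μ) (ν := μ)).ae hG
    exact h1.and h2
  set c := L / (4 * π * r) with hc
  have hc0 : 0 < c := by positivity
  set Kb := (ρ + ρ) * (δ ^ 3)⁻¹ * (2 * π) with hKb
  have hKb0 : 0 ≤ Kb := by positivity
  -- the kernel, tested with the velocity
  set f : Plane × Plane → ℝ := fun p =>
    p.1 1 * p.2 1 * (ringKern δ p.1 p.2 0 * V p.1 1 - ringKern δ p.1 p.2 1 * V p.1 0) with hf
  set g : Plane × Plane → ℝ := fun p => p.1 1 * p.2 1 * ringKern δ p.1 p.2 1 with hg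
  have hKi : ∀ i, Measurable fun p : Plane × Plane => ringKern δ p.1 p.2 i := fun i => by fun_prop
  have hVi : ∀ i, Measurable fun x : Plane => V x i := fun i => by
    have := hVc.measurable; fun_prop
  have hfm : Measurable f := by
    have := hKi 0; have := hKi 1; have := hVi 0; have := hVi 1
    simp only [hf]; fun_prop
  have hgm : Measurable g := by
    have := hKi 1
    simp only [hg]; fun_prop
  have hKbound : ∀ᵐ p ∂μ.prod μ, ‖ringKern δ p.1 p.2‖ ≤ Kb := by
    filter_upwards [hGG] with p hp
    refine (norm_ringKern_le_of_pos hδ hp.1.1 hp.2.1).trans ?_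
    rw [hKb]
    have := hp.1.2; have := hp.2.2
    gcongr
  have hfi : Integrable f (μ.prod μ) := by
    refine Integrable.of_bound hfm.aestronglyMeasurable (ρ * ρ * (Kb * (31 * M) + Kb * (31 * M))) ?_
    filter_upwards [hGG, hKbound] with p hp hk
    have e1 := (abs_apply_le_norm p.1 1).trans hp.1.2
    have e2 := (abs_apply_le_norm p.2 1).trans hp.2.2
    have e3 := fun i => (abs_apply_le_norm (ringKern δ p.1 p.2) i).trans hk
    have e4 := fun i => (abs_apply_le_norm (V p.1) i).trans (hVb p.1)
    rw [Real.norm_eq_abs, hf, abs_mul, abs_mul]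
    have e5 : |ringKern δ p.1 p.2 0 * V p.1 1 - ringKern δ p.1 p.2 1 * V p.1 0| ≤
        Kb * (31 * M) + Kb * (31 * M) := by
      refine (abs_sub _ _).trans ?_
      rw [abs_mul, abs_mul]
      exact add_le_add (mul_le_mul (e3 0) (e4 1) (abs_nonneg _) hKb0)
        (mul_le_mul (e3 1) (e4 0) (abs_nonneg _) hKb0)
    gcongr
  have hgi : Integrable g (μ.prod μ) := by
    refine Integrable.of_bound hgm.aestronglyMeasurable (ρ * ρ * Kb) ?_
    filter_upwards [hGG, hKbound] with p hp hk
    have e1 := (abs_apply_le_norm p.1 1).trans hp.1.2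
    have e2 := (abs_apply_le_norm p.2 1).trans hp.2.2
    have e3 := (abs_apply_le_norm (ringKern δ p.1 p.2) 1).trans hk
    rw [Real.norm_eq_abs, hg, abs_mul, abs_mul]
    exact mul_le_mul (mul_le_mul e1 e2 (abs_nonneg _) hρ0) e3 (abs_nonneg _) (by positivity)
  have hki : ∀ x, Integrable (fun y => y 1 • ringKern δ x y) μ ∧
      k x = ∫ y, y 1 • ringKern δ x y ∂μ := fun x => hw.bs_eq_integral_ringKern hM h0 δ x
  have hkcoord : ∀ x i, ∫ y, y 1 * ringKern δ x y i ∂μ = k x i := by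
    intro x i
    rw [(hki x).2]
    exact ((EuclideanSpace.proj i : Plane →L[ℝ] ℝ).integral_comp_comm (hki x).1)
  have hkint : ∀ x i, Integrable (fun y => y 1 * ringKern δ x y i) μ := fun x i =>
    (EuclideanSpace.proj i : Plane →L[ℝ] ℝ).integrable_comp (hki x).1
  -- the inner integrals
  have hfint : ∫ p, f p ∂μ.prod μ = ∫ x, x 1 * (k x 0 * V x 1 - k x 1 * V x 0) ∂μ := by
    rw [integral_prod _ hfi]
    congr 1; ext1 x
    have e : ∀ y, f (x, y) = x 1 * V x 1 * (y 1 * ringKern δ x y 0) -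
        x 1 * V x 0 * (y 1 * ringKern δ x y 1) := fun y => by simp only [hf]; ring
    simp only [e]
    rw [integral_sub ((hkint x 0).const_mul _) ((hkint x 1).const_mul _), integral_const_mul,
      integral_const_mul, hkcoord, hkcoord]
    ring
  have hgint : ∫ p, g p ∂μ.prod μ = ∫ x, x 1 * k x 1 ∂μ := by
    rw [integral_prod _ hgi]
    congr 1; ext1 x
    have e : ∀ y, g (x, y) = x 1 * (y 1 * ringKern δ x y 1) := fun y => by simp only [hg]; ring
    simp only [e]
    rw [integral_const_mul, hkcoord]
  -- Conservation of ∫ x_r² ω under the regularised self-interaction: the radial kernel is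
  -- antisymmetric under exchange of the two points.
  have hg0 : ∫ x, x 1 * k x 1 ∂μ = 0 := by
    have h1 : ∫ p, g p.swap ∂μ.prod μ = ∫ p, g p ∂μ.prod μ := integral_prod_swap g
    have h2 : ∫ p, g p.swap ∂μ.prod μ = -∫ p, g p ∂μ.prod μ := by
      rw [← integral_neg]
      refine integral_congr_ae ?_
      filter_upwards [hGG] with p hp
      simp only [hg, Prod.fst_swap, Prod.snd_swap]
      rw [ringKern_one_antisymm hδ hp.1.1 hp.2.1]; ring
    rw [← hgint]; linarith
  -- the first moments
  have hVint : ∀ i, Integrable (fun x : Plane => x 1 * V x i) μ := fun i => by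
    refine Integrable.of_bound (Measurable.mul (by fun_prop) (hVi i)).aestronglyMeasurable
      (ρ * (31 * M)) ?_
    filter_upwards [hG] with x hx
    rw [Real.norm_eq_abs, abs_mul]
    exact mul_le_mul ((abs_apply_le_norm x 1).trans hx.2) ((abs_apply_le_norm _ i).trans (hVb x))
      (abs_nonneg _) hρ0
  have hkint' : Integrable (fun x : Plane => x 1 * k x 1) μ := by
    have := hkc.measurable
    refine Integrable.of_bound (by fun_prop : Measurable _).aestronglyMeasurable (ρ * (31 * M)) ?_
    filter_upwards [hG] with x hx
    rw [Real.norm_eq_abs, abs_mul]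
    exact mul_le_mul ((abs_apply_le_norm x 1).trans hx.2) ((abs_apply_le_norm _ 1).trans (hkb x))
      (abs_nonneg _) hρ0
  have hV1 : |∫ x, x 1 * V x 1 ∂μ| ≤ ρ * (55 * M * √δ) * γ := by
    have : ∫ x, x 1 * V x 1 ∂μ = ∫ x, (x 1 * V x 1 - x 1 * k x 1) ∂μ := by
      rw [integral_sub (hVint 1) hkint', hg0, sub_zero]
    rw [this, ← hreal, ← Real.norm_eq_abs]
    refine norm_integral_le_of_norm_le_const ?_
    filter_upwards [hG] with x hx
    rw [← mul_sub, norm_mul, norm_sub_rev, Real.norm_eq_abs, Real.norm_eq_abs]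
    exact mul_le_mul ((abs_apply_le_norm x 1).trans hx.2)
      ((abs_apply_le_norm (k x - V x) 1).trans (hkV x)) (abs_nonneg _) hρ0
  -- Conservation of the kinetic energy: the cross product of V with itself is zero, so only the
  -- regularisation error k - V contributes.
  have hcross : |∫ x, x 1 * (k x 0 * V x 1 - k x 1 * V x 0) ∂μ| ≤
      ρ * (2 * (31 * M) * (55 * M * √δ)) * γ := by
    rw [← hreal, ← Real.norm_eq_abs]
    refine norm_integral_le_of_norm_le_const ?_
    filter_upwards [hG] with x hx
    have e1 := fun i => (abs_apply_le_norm (V x) i).trans (hVb x)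
    have e2 := fun i => (abs_apply_le_norm (k x - V x) i).trans (hkV x)
    have e : k x 0 * V x 1 - k x 1 * V x 0 = (k x - V x) 0 * V x 1 - (k x - V x) 1 * V x 0 := by
      simp only [PiLp.sub_apply]; ring
    rw [norm_mul, Real.norm_eq_abs, Real.norm_eq_abs, e]
    refine mul_le_mul ((abs_apply_le_norm x 1).trans hx.2) ?_ (abs_nonneg _) hρ0
    refine (abs_sub _ _).trans ?_
    rw [abs_mul, abs_mul]
    have hp : 0 ≤ 55 * M * √δ := by positivity
    have := mul_le_mul (e2 0) (e1 1) (abs_nonneg _) hp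
    have := mul_le_mul (e2 1) (e1 0) (abs_nonneg _) hp
    linarith
  -- assembling
  set s : Plane × Plane → ℝ := fun p => c * (p.1 1 * V p.1 1) - f p with hs
  have hVprod : Integrable (fun p : Plane × Plane => c * (p.1 1 * V p.1 1)) (μ.prod μ) :=
    ((hVint 1).comp_fst μ).const_mul c
  have hsi : Integrable s (μ.prod μ) := hVprod.sub hfi
  have hsint : ∫ p, s p ∂μ.prod μ = c * γ * (∫ x, x 1 * V x 1 ∂μ) -
      ∫ x, x 1 * (k x 0 * V x 1 - k x 1 * V x 0) ∂μ := by
    rw [hs, integral_sub hVprod hfi, hfint, integral_const_mul,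
      integral_fun_fst (fun x : Plane => x 1 * V x 1), hreal, smul_eq_mul]
    ring
  have hswap : Integrable (fun p => s p.swap) (μ.prod μ) := hsi.swap
  have heq : (fun p : Plane × Plane => defectRate r L p.1 p.2 (V p.1) (V p.2)
      (‖p.1 - p.2‖ ^ 2 + δ ^ 2)) =ᵐ[μ.prod μ] fun p => s p + s p.swap := by
    filter_upwards [hGG] with p hp
    rw [defectRate_eq hδ hp.1.1 hp.2.1]
    rfl
  refine ⟨(hsi.add hswap).congr heq.symm, ?_⟩
  rw [integral_congr_ae heq, integral_add hsi hswap, integral_prod_swap s, hsint]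
  have b1 : c * γ * (∫ x, x 1 * V x 1 ∂μ) ≤ c * γ * (ρ * (55 * M * √δ) * γ) :=
    mul_le_mul_of_nonneg_left ((le_abs_self _).trans hV1) (by positivity)
  have b2 := (neg_le_abs _).trans hcross
  nlinarith

end SelfInteraction

/-! ### Gronwall's inequality and uniform bounds on the slabs. -/

/-- Gronwall's inequality. -/
lemma add_div_le_mul_exp {f : ℝ → ℝ} {a b τ : ℝ} (ha : 0 < a) (hc : ContinuousOn f (Icc 0 τ))
    (hd : ∀ t ∈ Ioo 0 τ, ∃ f', HasDerivAt f f' t ∧ f' ≤ a * f t + b) {t : ℝ} (ht : t ∈ Icc 0 τ) :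
    f t + b / a ≤ (f 0 + b / a) * exp (a * t) := by
  set g : ℝ → ℝ := fun s => exp (-(a * s)) * (f s + b / a)
  have hexp : ∀ s, HasDerivAt (fun s => exp (-(a * s))) (exp (-(a * s)) * -a) s := fun s => by
    simpa using ((hasDerivAt_id s).const_mul a).neg.exp
  have hg : ∀ s ∈ Ioo 0 τ, ∃ g', HasDerivAt g g' s ∧ g' ≤ 0 := by
    intro s hs
    obtain ⟨f', h1, h2⟩ := hd s hs
    refine ⟨_, (hexp s).mul (h1.add_const (b / a)), ?_⟩
    have h3 : exp (-(a * s)) * -a * (f s + b / a) + exp (-(a * s)) * f' =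
        exp (-(a * s)) * (f' - (a * f s + b)) := by field_simp; ring
    rw [h3]
    exact mul_nonpos_of_nonneg_of_nonpos (exp_pos _).le (by linarith)
  have hanti : AntitoneOn g (Icc 0 τ) := by
    refine antitoneOn_of_deriv_nonpos (convex_Icc 0 τ) ?_ ?_ ?_
    · exact (by fun_prop : ContinuousOn (fun s => exp (-(a * s))) _).mul (hc.add continuousOn_const)
    · rw [interior_Icc]
      intro s hs
      obtain ⟨g', h1, -⟩ := hg s hs
      exact h1.differentiableAt.differentiableWithinAt
    · rw [interior_Icc]
      intro s hs
      obtain ⟨g', h1, h2⟩ := hg s hs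
      rwa [h1.deriv]
  have h := hanti ⟨le_rfl, ht.1.trans ht.2⟩ ht ht.1
  simp only [g, mul_zero, neg_zero, exp_zero, one_mul] at h
  calc f t + b / a = exp (a * t) * (exp (-(a * t)) * (f t + b / a)) := by
        rw [← mul_assoc, ← exp_add]; simp
    _ ≤ exp (a * t) * (f 0 + b / a) := by gcongr
    _ = _ := mul_comm _ _

/-- A bound for the radial displacements at scale `1 / √|log ε|`. -/
def radialSpread {N : ℕ} (Y : Fin N → Plane) (d₀ : ℝ) : ℝ := ∑ j, |Y j 1| + d₀

namespace SmallScale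

variable {N : ℕ} {Xs : Plane} {Y : Fin N → Plane} {d₀ ε : ℝ}

lemma nearRing (h : SmallScale Xs Y d₀ ε) (hXs : Xs ∈ halfPlane) (hd : 0 < d₀) {i : Fin N}
    {x y : Plane} (hx : x ∈ slab Xs Y ε d₀ 1 i) (hy : y ∈ slab Xs Y ε d₀ 1 i) {δ : ℝ} (hδ : 0 < δ)
    (hδ1 : δ ≤ 1) : NearRing (Xs 1) (radialSpread Y d₀) |Real.log ε| (5 + Xs 1 ^ 2) (x 1) (y 1)
      (‖x - y‖ ^ 2 + δ ^ 2) := by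
  have hr : 0 < Xs 1 := hXs
  have hs := h.sqrt_log_pos
  have hnear : ∀ z ∈ slab Xs Y ε d₀ 1 i, |z 1 - Xs 1| ≤ radialSpread Y d₀ / √|Real.log ε| := by
    intro z hz
    have e : initCenter Xs Y ε i 1 - Xs 1 = Y i 1 / √|Real.log ε| := by
      simp [initCenter]; ring
    have h1 : z 1 - Xs 1 = (z 1 - initCenter Xs Y ε i 1) + Y i 1 / √|Real.log ε| := by
      rw [← e]; ring
    rw [h1]
    refine (abs_add_le _ _).trans ((add_le_add hz.1 le_rfl).trans ?_)
    rw [abs_div, abs_of_pos hs, ← add_div]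
    unfold radialSpread
    have := Finset.single_le_sum (f := fun j => |Y j 1|) (fun j _ => abs_nonneg _)
      (Finset.mem_univ i)
    exact div_le_div_of_nonneg_right (by linarith) hs.le
  obtain ⟨hx1, hx2⟩ := h.height_mem hx
  obtain ⟨hy1, hy2⟩ := h.height_mem hy
  refine ⟨hr, ?_, h.log, by positivity, ?_, hnear x hx, hnear y hy, hx1, hx2, hy1, hy2⟩
  · unfold radialSpread; positivity
  -- The bound 5 + r² collects 2² from the axial extent, r² from the radial one, and δ² ≤ 1.
  · rw [norm_sub_sq_eq]
    have hx0 := abs_le.1 hx.2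
    have hy0 := abs_le.1 hy.2
    have e1 : (x 0 - y 0) ^ 2 ≤ 2 ^ 2 := sq_le_sq' (by linarith) (by linarith)
    have e2 : (x 1 - y 1) ^ 2 ≤ Xs 1 ^ 2 := sq_le_sq' (by linarith) (by linarith)
    nlinarith

lemma norm_le (h : SmallScale Xs Y d₀ ε) (hXs : Xs ∈ halfPlane) {i : Fin N} {x : Plane}
    (hx : x ∈ slab Xs Y ε d₀ 1 i) : ‖x‖ ≤ |Xs 0| + 1 + 3 / 2 * Xs 1 := by
  refine (norm_le_abs_add x).trans (add_le_add ?_ ?_)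
  · have h1 : x 0 = Xs 0 + (x 0 - Xs 0) := by ring
    rw [h1]
    exact (abs_add_le _ _).trans (add_le_add le_rfl hx.2)
  · have h2 : 0 < x 1 := h.mem_halfPlane hXs hx
    rw [abs_of_pos h2]
    exact (h.height_mem hx).2

lemma log_eq (h : SmallScale Xs Y d₀ ε) : Real.log ε = -|Real.log ε| := by
  rw [abs_of_neg (Real.log_neg h.pos (by linarith [h.lt])), neg_neg]

end SmallScale

lemma measurable_defect (r L δ : ℝ) : Measurable fun p : Plane × Plane =>
    defect r L (p.1 1) (p.2 1) (‖p.1 - p.2‖ ^ 2 + δ ^ 2) := by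
  have h : Measurable fun p : Plane × Plane =>
      stream (‖p.1 - p.2‖ ^ 2 + δ ^ 2) (p.1 1 * p.2 1) :=
    measurable_stream.comp (f := fun p : Plane × Plane =>
      (‖p.1 - p.2‖ ^ 2 + δ ^ 2, p.1 1 * p.2 1)) (by fun_prop)
  unfold defect
  exact Measurable.sub (by fun_prop) h

lemma measurable_defectRate (r L δ : ℝ) {V : Plane → Plane} (hV : Measurable V) :
    Measurable fun p : Plane × Plane =>
      defectRate r L p.1 p.2 (V p.1) (V p.2) (‖p.1 - p.2‖ ^ 2 + δ ^ 2) := by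
  have hp : Measurable fun p : Plane × Plane => (‖p.1 - p.2‖ ^ 2 + δ ^ 2, p.1 1 * p.2 1) := by
    fun_prop
  have hA : Measurable fun p : Plane × Plane =>
      streamA (‖p.1 - p.2‖ ^ 2 + δ ^ 2) (p.1 1 * p.2 1) := measurable_streamA.comp hp
  have hB : Measurable fun p : Plane × Plane =>
      streamB (‖p.1 - p.2‖ ^ 2 + δ ^ 2) (p.1 1 * p.2 1) := measurable_streamB.comp hp
  unfold defectRate
  exact Measurable.sub (by fun_prop) ((hA.mul (by fun_prop)).add (hB.mul (by fun_prop)))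

/-- A bound of the defect at fixed regularisation. -/
lemma exists_defect_bound {r δ : ℝ} (hr : 0 < r) (hδ : 0 < δ) (κ L A₁ : ℝ) :
    ∃ C, ∀ x y : Plane, NearRing r κ L A₁ (x 1) (y 1) (‖x - y‖ ^ 2 + δ ^ 2) →
      |defect r L (x 1) (y 1) (‖x - y‖ ^ 2 + δ ^ 2)| ≤ C := by
  obtain ⟨K, hK, h⟩ := exists_stream_log_bound hr A₁
  refine ⟨κ ^ 2 / r + K + 3 / 2 * r / (2 * π) * (|log δ| + |log √A₁| + |L|), fun x y hn => ?_⟩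
  have h1 := hn.abs_defect_sub_le (h κ L _ _ _ hn)
  set A := ‖x - y‖ ^ 2 + δ ^ 2 with hA
  have hδA : δ ≤ √A := Real.le_sqrt_of_sq_le (by rw [hA]; nlinarith [sq_nonneg ‖x - y‖])
  have hlog : |log √A| ≤ |log δ| + |log √A₁| := by
    have h2 := Real.log_le_log hδ hδA
    have h3 := Real.log_le_log (hδ.trans_le hδA) (Real.sqrt_le_sqrt hn.A_le)
    rw [abs_le]
    constructor
    · linarith [neg_abs_le (log δ), abs_nonneg (log √A₁)]
    · linarith [le_abs_self (log √A₁), abs_nonneg (log δ)]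
  have h4 : |√(x 1 * y 1) / (2 * π) * (log √A + L)| ≤
      3 / 2 * r / (2 * π) * (|log δ| + |log √A₁| + |L|) := by
    rw [abs_mul, abs_of_nonneg (by positivity)]
    have := hn.sqrt_le
    gcongr
    exact (abs_add_le _ _).trans (add_le_add hlog le_rfl)
  have h5 := abs_add_le (defect r L (x 1) (y 1) A - √(x 1 * y 1) / (2 * π) * (log √A + L))
    (√(x 1 * y 1) / (2 * π) * (log √A + L))
  rw [sub_add_cancel] at h5
  linarith

/-! ### The renormalised energy and its time derivative. -/

namespace BlobFlow

variable {N : ℕ} {Xs : Plane} {Y : Fin N → Plane} {γ M₀ ε T d₀ h₀ : ℝ}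
  (S : BlobFlow Xs Y γ M₀ ε T)

/-- The renormalised energy of a blob, regularised at distances below `δ`. -/
def renormEnergy (i : Fin N) (δ t : ℝ) : ℝ :=
  ∫ p : Plane × Plane, defect (Xs 1) |log ε| (p.1 1) (p.2 1) (‖p.1 - p.2‖ ^ 2 + δ ^ 2)
    ∂(S.blobMeasure i t).prod (S.blobMeasure i t)

/-- The velocity generated by all blobs. -/
def totalVel (t : ℝ) (x : Plane) : Plane := ∑ j, bs 0 (S.blob j t) x

/-- Pulling back to the initial distribution puts the time dependence into the integrand, so the
energy can be differentiated under the integral along trajectories. -/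
lemma integral_prod_blobMeasure (i : Fin N) {t : ℝ} (ht : t ∈ Icc 0 T) {f : Plane × Plane → ℝ}
    (hf : Measurable f) :
    ∫ p, f p ∂(S.blobMeasure i t).prod (S.blobMeasure i t) =
      ∫ p, f (extFlow S.X t p.1, extFlow S.X t p.2)
        ∂(vortexMeasure (S.blob₀ i)).prod (vortexMeasure (S.blob₀ i)) := by
  have hm := (S.measurePreserving ht).measurable
  rw [← S.map_blobMeasure i ht, Measure.map_prod_map _ _ hm hm,
    integral_map (hm.prodMap hm).aemeasurable hf.aestronglyMeasurable]
  rfl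

lemma ae_trajectory_pair (hε : SmallScale Xs Y d₀ ε) (hT : 0 ≤ T)
    (hh : h₀ ≤ 1) (i : Fin N) :
    ∀ᵐ p ∂(vortexMeasure (S.blob₀ i)).prod (vortexMeasure (S.blob₀ i)),
      (p.1 ∈ halfPlane ∧ p.2 ∈ halfPlane) ∧ ∀ t ∈ Icc 0 (S.exitTime d₀ h₀),
        extFlow S.X t p.1 ∈ slab Xs Y ε d₀ 1 i ∧ extFlow S.X t p.2 ∈ slab Xs Y ε d₀ 1 i := by
  have h := (ae_vortexMeasure_mem (S.blob₀ i)).and (S.ae_trajectory i hT hh (hε.ball i))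
  have h1 := (Measure.quasiMeasurePreserving_fst (μ := vortexMeasure (S.blob₀ i))
    (ν := vortexMeasure (S.blob₀ i))).ae h
  have h2 := (Measure.quasiMeasurePreserving_snd (μ := vortexMeasure (S.blob₀ i))
    (ν := vortexMeasure (S.blob₀ i))).ae h
  filter_upwards [h1, h2] with p hp1 hp2
  exact ⟨⟨hp1.1, hp2.1⟩, fun t ht => ⟨hp1.2 t ht, hp2.2 t ht⟩⟩

lemma ae_slab_pair (hε : SmallScale Xs Y d₀ ε) (hT : 0 ≤ T) (hh : h₀ ≤ 1) (i : Fin N) {t : ℝ}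
    (ht : t ∈ Icc 0 (S.exitTime d₀ h₀)) :
    ∀ᵐ p ∂(S.blobMeasure i t).prod (S.blobMeasure i t),
      p.1 ∈ slab Xs Y ε d₀ 1 i ∧ p.2 ∈ slab Xs Y ε d₀ 1 i := by
  have h := S.ae_slab hε hT hh i ht
  have : SFinite (S.blobMeasure i t) := by unfold blobMeasure; infer_instance
  exact ((Measure.quasiMeasurePreserving_fst (μ := S.blobMeasure i t)
    (ν := S.blobMeasure i t)).ae h).and ((Measure.quasiMeasurePreserving_snd
    (μ := S.blobMeasure i t) (ν := S.blobMeasure i t)).ae h)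

lemma hasDerivAt_extFlow (hXs : Xs ∈ halfPlane) (hε : SmallScale Xs Y d₀ ε) (hT : 0 ≤ T)
    (hh : h₀ ≤ 1) (hγ : 0 < γ) (hM₀ : 0 < M₀) {t : ℝ} (ht : t ∈ Ioo 0 (S.exitTime d₀ h₀))
    {x : Plane} (hx : x ∈ halfPlane) :
    HasDerivAt (fun s => extFlow S.X s x)
      ((1 / |log ε|) • S.totalVel t (extFlow S.X t x)) t := by
  have htT : t ∈ Ioo 0 T := ⟨ht.1, ht.2.trans_le (S.exitTime_le hT d₀ h₀)⟩
  have ht' : t ∈ Icc 0 T := Ioo_subset_Icc_self htT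
  have h1 := (S.isWeakSolution.flow_deriv x hx t ht').hasDerivAt (Icc_mem_nhds htT.1 htT.2)
  have hXt := S.isWeakSolution.flow_mem t ht' x hx
  rw [S.velocity_eq_sum (sizeBound_pos hXs hγ hM₀) ht'
    (fun j => S.admissible hXs hε hT hh hγ hM₀ j (Ioo_subset_Icc_self ht)) hXt] at h1
  simp only [extFlow_of_mem S.X _ hx]
  exact h1

lemma norm_totalVel_le (hXs : Xs ∈ halfPlane) (hε : SmallScale Xs Y d₀ ε) (hT : 0 ≤ T)
    (hh : h₀ ≤ 1) (hγ : 0 < γ) (hM₀ : 0 < M₀) {t : ℝ} (ht : t ∈ Icc 0 (S.exitTime d₀ h₀))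
    (x : Plane) : ‖S.totalVel t x‖ ≤ N * (31 * sizeBound Xs γ M₀ ε) := by
  refine (norm_sum_le_of_le _ fun j _ => (S.admissible hXs hε hT hh hγ hM₀ j ht).norm_bs_le
    (sizeBound_pos hXs hγ hM₀) 0 x).trans ?_
  simp

lemma continuous_totalVel (hXs : Xs ∈ halfPlane) (hε : SmallScale Xs Y d₀ ε) (hT : 0 ≤ T)
    (hh : h₀ ≤ 1) (hγ : 0 < γ) (hM₀ : 0 < M₀) {t : ℝ} (ht : t ∈ Icc 0 (S.exitTime d₀ h₀)) :
    Continuous (S.totalVel t) :=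
  continuous_finsetSum _ fun j _ => (S.admissible hXs hε hT hh hγ hM₀ j ht).continuous_bs
    (sizeBound_pos hXs hγ hM₀)

lemma extFlow_mem_halfPlane {t : ℝ} (ht : t ∈ Icc 0 T) {x : Plane} (hx : x ∈ halfPlane) :
    extFlow S.X t x ∈ halfPlane := by
  rw [extFlow_of_mem S.X t hx]
  exact S.isWeakSolution.flow_mem t ht x hx

/-- The defect along the trajectories. -/
def flowDefect (δ t : ℝ) (p : Plane × Plane) : ℝ :=
  defect (Xs 1) |log ε| (extFlow S.X t p.1 1) (extFlow S.X t p.2 1)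
    (‖extFlow S.X t p.1 - extFlow S.X t p.2‖ ^ 2 + δ ^ 2)

/-- The rate of change of the defect in the velocity field of all blobs. -/
def totalRate (δ t : ℝ) (p : Plane × Plane) : ℝ :=
  1 / |log ε| * defectRate (Xs 1) |log ε| p.1 p.2 (S.totalVel t p.1) (S.totalVel t p.2)
    (‖p.1 - p.2‖ ^ 2 + δ ^ 2)

lemma hasDerivAt_flowDefect (hXs : Xs ∈ halfPlane) (hε : SmallScale Xs Y d₀ ε) (hT : 0 ≤ T)
    (hh : h₀ ≤ 1) (hγ : 0 < γ) (hM₀ : 0 < M₀) {δ : ℝ} (hδ : 0 < δ) {t : ℝ}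
    (ht : t ∈ Ioo 0 (S.exitTime d₀ h₀)) {p : Plane × Plane} (h1 : p.1 ∈ halfPlane)
    (h2 : p.2 ∈ halfPlane) :
    HasDerivAt (fun s => S.flowDefect δ s p)
      (S.totalRate δ t (extFlow S.X t p.1, extFlow S.X t p.2)) t := by
  have ht' := S.Icc_exitTime_subset hT d₀ h₀ (Ioo_subset_Icc_self ht)
  have h := hasDerivAt_defect (r := Xs 1) (L := |log ε|) hδ
    (S.hasDerivAt_extFlow hXs hε hT hh hγ hM₀ ht h1)
    (S.hasDerivAt_extFlow hXs hε hT hh hγ hM₀ ht h2) (S.extFlow_mem_halfPlane ht' h1)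
    (S.extFlow_mem_halfPlane ht' h2)
  rw [defectRate_smul] at h
  exact h

lemma continuousOn_flowDefect (hT : 0 ≤ T) {δ : ℝ} (hδ : 0 < δ) {p : Plane × Plane}
    (h1 : p.1 ∈ halfPlane) (h2 : p.2 ∈ halfPlane) :
    ContinuousOn (fun s => S.flowDefect δ s p) (Icc 0 (S.exitTime d₀ h₀)) := by
  have hsub := S.Icc_exitTime_subset hT d₀ h₀
  obtain ⟨M, hM⟩ := S.exists_flow
  have hcx : ∀ x ∈ halfPlane, ContinuousOn (fun t => extFlow S.X t x)
      (Icc 0 (S.exitTime d₀ h₀)) := fun x hx => by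
    simp only [extFlow_of_mem S.X _ hx]
    exact (hM.continuousOn hx).mono hsub
  have hc1 := hcx _ h1
  have hc2 := hcx _ h2
  have hcoord : ∀ {f : ℝ → Plane} {s : Set ℝ}, ContinuousOn f s →
      ContinuousOn (fun t => f t 1) s := fun hf => by fun_prop
  have h3 := hcoord hc1
  have h4 := hcoord hc2
  have hg : ContinuousOn (fun t =>
      (‖extFlow S.X t p.1 - extFlow S.X t p.2‖ ^ 2 + δ ^ 2,
        extFlow S.X t p.1 1 * extFlow S.X t p.2 1)) (Icc 0 (S.exitTime d₀ h₀)) :=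
    (((hc1.sub hc2).norm.pow 2).add continuousOn_const).prodMk (h3.mul h4)
  have hstream : ContinuousOn (fun t => stream
      (‖extFlow S.X t p.1 - extFlow S.X t p.2‖ ^ 2 + δ ^ 2)
      (extFlow S.X t p.1 1 * extFlow S.X t p.2 1)) (Icc 0 (S.exitTime d₀ h₀)) := by
    intro t ht
    have hA : 0 < ‖extFlow S.X t p.1 - extFlow S.X t p.2‖ ^ 2 + δ ^ 2 := by positivity
    have hB : 0 < extFlow S.X t p.1 1 * extFlow S.X t p.2 1 :=
      mul_pos (S.extFlow_mem_halfPlane (hsub ht) h1) (S.extFlow_mem_halfPlane (hsub ht) h2)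
    exact ContinuousAt.comp_continuousWithinAt (f := fun t =>
      (‖extFlow S.X t p.1 - extFlow S.X t p.2‖ ^ 2 + δ ^ 2,
        extFlow S.X t p.1 1 * extFlow S.X t p.2 1)) (hasFDerivAt_stream hA hB).continuousAt
      (hg t ht)
  unfold flowDefect defect
  exact (continuousOn_const.mul ((((h3.pow 2).add (h4.pow 2)).div_const 2).add
    continuousOn_const)).sub hstream

lemma measurable_flowDefect (hT : 0 ≤ T) (δ : ℝ) {t : ℝ} (ht : t ∈ Icc 0 (S.exitTime d₀ h₀)) :
    Measurable (S.flowDefect δ t) := by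
  have hm := (S.measurePreserving (S.Icc_exitTime_subset hT d₀ h₀ ht)).measurable
  have h := (measurable_defect (Xs 1) (|log ε|) δ).comp (hm.prodMap hm)
  have e : S.flowDefect δ t = (fun p : Plane × Plane => defect (Xs 1) |log ε| (p.1 1) (p.2 1)
      (‖p.1 - p.2‖ ^ 2 + δ ^ 2)) ∘ Prod.map (extFlow S.X t) (extFlow S.X t) := by
    ext p
    simp only [flowDefect, Function.comp_apply, Prod.map_fst, Prod.map_snd]
  rw [e]
  exact h

lemma measurable_totalRate (hXs : Xs ∈ halfPlane) (hε : SmallScale Xs Y d₀ ε) (hT : 0 ≤ T)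
    (hh : h₀ ≤ 1) (hγ : 0 < γ) (hM₀ : 0 < M₀) (δ : ℝ) {t : ℝ}
    (ht : t ∈ Icc 0 (S.exitTime d₀ h₀)) : Measurable (S.totalRate δ t) :=
  (measurable_defectRate _ _ δ
    (S.continuous_totalVel hXs hε hT hh hγ hM₀ ht).measurable).const_mul _

lemma renormEnergy_eq (hT : 0 ≤ T) (i : Fin N) (δ : ℝ) {t : ℝ}
    (ht : t ∈ Icc 0 (S.exitTime d₀ h₀)) : S.renormEnergy i δ t =
      ∫ p, S.flowDefect δ t p ∂(vortexMeasure (S.blob₀ i)).prod (vortexMeasure (S.blob₀ i)) :=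
  S.integral_prod_blobMeasure i (S.Icc_exitTime_subset hT d₀ h₀ ht)
    (measurable_defect (Xs 1) |log ε| δ)

lemma exists_flowDefect_bound (hXs : Xs ∈ halfPlane) (hε : SmallScale Xs Y d₀ ε) (hd : 0 < d₀)
    (hT : 0 ≤ T) (hh : h₀ ≤ 1) (i : Fin N) {δ : ℝ} (hδ : 0 < δ) (hδ1 : δ ≤ 1) :
    ∃ C : ℝ, ∀ t ∈ Icc 0 (S.exitTime d₀ h₀),
      ∀ᵐ p ∂(vortexMeasure (S.blob₀ i)).prod (vortexMeasure (S.blob₀ i)),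
        ‖S.flowDefect δ t p‖ ≤ C := by
  obtain ⟨C, hC⟩ := exists_defect_bound (r := Xs 1) hXs hδ (radialSpread Y d₀) |log ε|
    (5 + Xs 1 ^ 2)
  refine ⟨C, fun t ht => ?_⟩
  filter_upwards [S.ae_trajectory_pair (h₀ := h₀) hε hT hh i] with p hp
  exact hC _ _ (hε.nearRing hXs hd (hp.2 t ht).1 (hp.2 t ht).2 hδ hδ1)

lemma exists_totalRate_bound (hXs : Xs ∈ halfPlane) (hε : SmallScale Xs Y d₀ ε) (hd : 0 < d₀)
    (hT : 0 ≤ T) (hh : h₀ ≤ 1) (hγ : 0 < γ) (hM₀ : 0 < M₀) (i : Fin N) {δ : ℝ} (hδ : 0 < δ)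
    (hδ1 : δ ≤ 1) :
    ∃ C : ℝ, ∀ t ∈ Icc 0 (S.exitTime d₀ h₀), ∀ x ∈ slab Xs Y ε d₀ 1 i,
      ∀ y ∈ slab Xs Y ε d₀ 1 i, ‖S.totalRate δ t (x, y)‖ ≤ C := by
  have hL : 0 < |log ε| := one_pos.trans_le hε.log
  obtain ⟨C, hC0, hC⟩ := exists_defectRate_bound (r := Xs 1) hXs hL hδ (5 + Xs 1 ^ 2)
  refine ⟨1 / |log ε| * (C * (N * (31 * sizeBound Xs γ M₀ ε) +
    N * (31 * sizeBound Xs γ M₀ ε))), fun t ht x hx y hy => ?_⟩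
  rw [totalRate, norm_mul, Real.norm_eq_abs, Real.norm_eq_abs,
    abs_of_pos (by positivity : 0 < 1 / |log ε|)]
  refine mul_le_mul_of_nonneg_left ?_ (by positivity)
  refine (hC _ _ _ _ _ (hε.nearRing hXs hd hx hy hδ hδ1)).trans ?_
  exact mul_le_mul_of_nonneg_left (add_le_add (S.norm_totalVel_le hXs hε hT hh hγ hM₀ ht _)
    (S.norm_totalVel_le hXs hε hT hh hγ hM₀ ht _)) hC0.le

lemma isFiniteMeasure_vortexMeasure (hγ : 0 < γ) (i : Fin N) :
    IsFiniteMeasure (vortexMeasure (S.blob₀ i)) :=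
  ⟨by rw [S.blobMeasure₀_univ hγ i]; exact ENNReal.ofReal_lt_top⟩

/-- The renormalised energy is continuous up to the exit time. -/
lemma continuousOn_renormEnergy (hXs : Xs ∈ halfPlane) (hε : SmallScale Xs Y d₀ ε) (hd : 0 < d₀)
    (hT : 0 ≤ T) (hh : h₀ ≤ 1) (hγ : 0 < γ) (i : Fin N) {δ : ℝ} (hδ : 0 < δ)
    (hδ1 : δ ≤ 1) :
    ContinuousOn (S.renormEnergy i δ) (Icc 0 (S.exitTime d₀ h₀)) := by
  have := S.isFiniteMeasure_vortexMeasure hγ i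
  obtain ⟨C, hC⟩ := S.exists_flowDefect_bound hXs hε hd hT hh i hδ hδ1
  refine ContinuousOn.congr ?_ fun t ht => S.renormEnergy_eq hT i δ ht
  refine continuousOn_of_dominated (bound := fun _ => C)
    (fun t ht => (S.measurable_flowDefect hT δ ht).aestronglyMeasurable) hC
    (integrable_const C) ?_
  filter_upwards [S.ae_trajectory_pair (h₀ := h₀) hε hT hh i] with p hp
  exact S.continuousOn_flowDefect hT hδ hp.1.1 hp.1.2

/-- The derivative of the renormalised energy. -/
lemma hasDerivAt_renormEnergy (hXs : Xs ∈ halfPlane) (hε : SmallScale Xs Y d₀ ε) (hd : 0 < d₀)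
    (hT : 0 ≤ T) (hh : h₀ ≤ 1) (hγ : 0 < γ) (hM₀ : 0 < M₀) (i : Fin N) {δ : ℝ} (hδ : 0 < δ)
    (hδ1 : δ ≤ 1) {t : ℝ} (ht : t ∈ Ioo 0 (S.exitTime d₀ h₀)) :
    HasDerivAt (S.renormEnergy i δ)
      (∫ p, S.totalRate δ t p ∂(S.blobMeasure i t).prod (S.blobMeasure i t)) t := by
  have := S.isFiniteMeasure_vortexMeasure hγ i
  have hpair := S.ae_trajectory_pair (h₀ := h₀) hε hT hh i
  have htI := Ioo_subset_Icc_self ht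
  have hsub := S.Icc_exitTime_subset hT d₀ h₀
  have hm := (S.measurePreserving (hsub htI)).measurable
  have hrate := S.measurable_totalRate hXs hε hT hh hγ hM₀ δ htI
  obtain ⟨C, hC⟩ := S.exists_flowDefect_bound hXs hε hd hT hh i hδ hδ1
  obtain ⟨C', hC'⟩ := S.exists_totalRate_bound hXs hε hd hT hh hγ hM₀ i hδ hδ1
  have key := hasDerivAt_integral_of_dominated_loc_of_deriv_le
    (μ := (vortexMeasure (S.blob₀ i)).prod (vortexMeasure (S.blob₀ i)))
    (F := fun s p => S.flowDefect δ s p)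
    (F' := fun s p => S.totalRate δ s (extFlow S.X s p.1, extFlow S.X s p.2))
    (x₀ := t) (s := Ioo 0 (S.exitTime d₀ h₀)) (bound := fun _ => C')
    (Ioo_mem_nhds ht.1 ht.2) ?_ ?_ ?_ ?_ (integrable_const _) ?_
  · rw [S.integral_prod_blobMeasure i (hsub htI) hrate]
    refine key.2.congr_of_eventuallyEq ?_
    filter_upwards [Ioo_mem_nhds ht.1 ht.2] with s hs using
      S.renormEnergy_eq hT i δ (Ioo_subset_Icc_self hs)
  · filter_upwards [Ioo_mem_nhds ht.1 ht.2] with s hs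
    exact (S.measurable_flowDefect hT δ (Ioo_subset_Icc_self hs)).aestronglyMeasurable
  · exact Integrable.of_bound (S.measurable_flowDefect hT δ htI).aestronglyMeasurable C (hC t htI)
  · exact (hrate.comp (hm.prodMap hm)).aestronglyMeasurable
  · filter_upwards [hpair] with p hp s hs
    have hsI := Ioo_subset_Icc_self hs
    exact hC' s hsI _ (hp.2 s hsI).1 _ (hp.2 s hsI).2
  · filter_upwards [hpair] with p hp s hs using
      S.hasDerivAt_flowDefect hXs hε hT hh hγ hM₀ hδ hs hp.1.1 hp.1.2

end BlobFlow

/-! ### Energy inequality and the mean logarithmic distance. -/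

namespace BlobFlow

variable {N : ℕ} {Xs : Plane} {Y : Fin N → Plane} {γ M₀ ε T d₀ h₀ : ℝ}
  (S : BlobFlow Xs Y γ M₀ ε T)

/-- The logarithm of a distance, measured at scale `ε` and regularised below `δ`. -/
def logDist (ε δ : ℝ) (p : Plane × Plane) : ℝ := log √(‖p.1 - p.2‖ ^ 2 + δ ^ 2) + |log ε|

lemma measurable_logDist (ε δ : ℝ) : Measurable (logDist ε δ) := by
  unfold logDist; fun_prop

/-- A bound of the potential of the inverse distance on blobs. -/
def inverseDistBound (Xs : Plane) (γ M₀ : ℝ) : ℝ :=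
  (M₀ * (3 / 2 * Xs 1) * (2 * (volume : Measure Plane).real (Metric.ball 0 1)) + γ) * γ

lemma inverseDistBound_nonneg (hXs : Xs ∈ halfPlane) (hγ : 0 < γ) (hM₀ : 0 < M₀) :
    0 ≤ inverseDistBound Xs γ M₀ := by
  have : 0 < Xs 1 := hXs
  have : 0 ≤ (volume : Measure Plane).real (Metric.ball 0 1) := measureReal_nonneg
  unfold inverseDistBound; positivity

/-- `K` bounds the stream function at heights near `r`, up to the logarithmic term. -/
def IsStreamBound (r A₁ K : ℝ) : Prop := 0 < K ∧ ∀ κ L a b A : ℝ, NearRing r κ L A₁ a b A →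
  |stream A (a * b) + √(a * b) / (2 * π) * log √A| ≤ K

lemma measureReal_prod_univ (hT : 0 ≤ T) (hγ : 0 < γ) (i : Fin N) {t : ℝ}
    (ht : t ∈ Icc 0 (S.exitTime d₀ h₀)) :
    ((S.blobMeasure i t).prod (S.blobMeasure i t)).real univ = γ ^ 2 := by
  have := S.isFiniteMeasure_blobMeasure hT hγ i ht
  rw [← univ_prod_univ, measureReal_prod_prod, S.real_blobMeasure_univ hT hγ i ht, sq]

lemma ae_ne_pair (hT : 0 ≤ T) (hγ : 0 < γ) (i : Fin N) {t : ℝ}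
    (ht : t ∈ Icc 0 (S.exitTime d₀ h₀)) :
    ∀ᵐ p ∂(S.blobMeasure i t).prod (S.blobMeasure i t), p.1 ≠ p.2 := by
  have := S.isFiniteMeasure_blobMeasure hT hγ i ht
  have hms : MeasurableSet {p : Plane × Plane | p.1 ≠ p.2} :=
    (isClosed_eq continuous_fst continuous_snd).measurableSet.compl
  rw [Measure.ae_prod_iff_ae_ae hms]
  refine Eventually.of_forall fun x => ?_
  rw [ae_iff]
  simp [blobMeasure]

lemma integrable_defect (hXs : Xs ∈ halfPlane) (hε : SmallScale Xs Y d₀ ε) (hd : 0 < d₀)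
    (hT : 0 ≤ T) (hh : h₀ ≤ 1) (hγ : 0 < γ) (i : Fin N) {δ : ℝ} (hδ : 0 < δ)
    (hδ1 : δ ≤ 1) {t : ℝ} (ht : t ∈ Icc 0 (S.exitTime d₀ h₀)) :
    Integrable (fun p : Plane × Plane => defect (Xs 1) |log ε| (p.1 1) (p.2 1)
      (‖p.1 - p.2‖ ^ 2 + δ ^ 2)) ((S.blobMeasure i t).prod (S.blobMeasure i t)) := by
  have := S.isFiniteMeasure_blobMeasure hT hγ i ht
  obtain ⟨C, hC⟩ := exists_defect_bound (r := Xs 1) hXs hδ (radialSpread Y d₀) |log ε|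
    (5 + Xs 1 ^ 2)
  refine Integrable.of_bound (measurable_defect _ _ δ).aestronglyMeasurable C ?_
  filter_upwards [S.ae_slab_pair hε hT hh i ht] with p hp
  exact hC _ _ (hε.nearRing hXs hd hp.1 hp.2 hδ hδ1)

/-- The renormalised energy controls the logarithmic distances inside a blob. -/
lemma integral_abs_logDist_le (hXs : Xs ∈ halfPlane) (hε : SmallScale Xs Y d₀ ε) (hd : 0 < d₀)
    (hT : 0 ≤ T) (hh : h₀ ≤ 1) (hγ : 0 < γ) (hM₀ : 0 < M₀) {K : ℝ}
    (hK : IsStreamBound (Xs 1) (5 + Xs 1 ^ 2) K) (i : Fin N) {δ : ℝ} (hδ : 0 < δ)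
    (hδ1 : δ ≤ 1) {t : ℝ} (ht : t ∈ Icc 0 (S.exitTime d₀ h₀)) :
    Integrable (fun p => |logDist ε δ p|) ((S.blobMeasure i t).prod (S.blobMeasure i t)) ∧
    ∫ p, |logDist ε δ p| ∂(S.blobMeasure i t).prod (S.blobMeasure i t) ≤
      4 * π / Xs 1 * (S.renormEnergy i δ t + (radialSpread Y d₀ ^ 2 / Xs 1 + K) * γ ^ 2) +
        6 * inverseDistBound Xs γ M₀ := by
  have hfin := S.isFiniteMeasure_blobMeasure hT hγ i ht
  have hr : 0 < Xs 1 := hXs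
  have htT := S.Icc_exitTime_subset hT d₀ h₀ ht
  have hpsi := integrable_inv_dist hε.pos hM₀ (by positivity : 0 < 3 / 2 * Xs 1) hγ
    (S.blobMeasure_le i htT) (S.blobMeasure_univ hγ i htT)
    ((S.ae_slab hε hT hh i ht).mono fun _ hx => (hε.height_mem hx).2)
  have hdef := S.integrable_defect hXs hε hd hT hh hγ i hδ hδ1 ht
  have hpt : ∀ᵐ p ∂(S.blobMeasure i t).prod (S.blobMeasure i t), |logDist ε δ p| ≤
      4 * π / Xs 1 * (defect (Xs 1) |log ε| (p.1 1) (p.2 1) (‖p.1 - p.2‖ ^ 2 + δ ^ 2) +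
        (radialSpread Y d₀ ^ 2 / Xs 1 + K)) + 6 * (ε / ‖p.1 - p.2‖) := by
    filter_upwards [S.ae_slab_pair hε hT hh i ht, S.ae_ne_pair hT hγ i ht] with p hp hne
    have hn := hε.nearRing hXs hd hp.1 hp.2 hδ hδ1
    have hdist : 0 < ‖p.1 - p.2‖ := norm_pos_iff.2 (sub_ne_zero.2 hne)
    have hεp := hε.pos
    refine hn.abs_log_le (hn.abs_defect_sub_le (hK.2 _ _ _ _ _ hn)) (by positivity) ?_
    have h1 : log ‖p.1 - p.2‖ ≤ log √(‖p.1 - p.2‖ ^ 2 + δ ^ 2) :=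
      Real.log_le_log hdist (norm_sub_le_sqrt _ _ _)
    -- The energy controls the logarithm with its sign; its negative part is bounded by the inverse
    -- distance, integrable uniformly in ε.
    have h2 : log (ε / ‖p.1 - p.2‖) ≤ ε / ‖p.1 - p.2‖ := by
      have := Real.log_le_sub_one_of_pos (by positivity : 0 < ε / ‖p.1 - p.2‖)
      linarith
    rw [Real.log_div hεp.ne' hdist.ne', hε.log_eq] at h2
    linarith
  have hdc : Integrable (fun p : Plane × Plane =>
      defect (Xs 1) |log ε| (p.1 1) (p.2 1) (‖p.1 - p.2‖ ^ 2 + δ ^ 2) +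
        (radialSpread Y d₀ ^ 2 / Xs 1 + K)) ((S.blobMeasure i t).prod (S.blobMeasure i t)) :=
    hdef.add (integrable_const _)
  have hbd : Integrable (fun p : Plane × Plane =>
      4 * π / Xs 1 * (defect (Xs 1) |log ε| (p.1 1) (p.2 1) (‖p.1 - p.2‖ ^ 2 + δ ^ 2) +
        (radialSpread Y d₀ ^ 2 / Xs 1 + K)) + 6 * (ε / ‖p.1 - p.2‖))
      ((S.blobMeasure i t).prod (S.blobMeasure i t)) :=
    (hdc.const_mul _).add (hpsi.1.const_mul 6)
  have hint : Integrable (fun p => |logDist ε δ p|)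
      ((S.blobMeasure i t).prod (S.blobMeasure i t)) :=
    hbd.mono' (measurable_logDist ε δ).abs.aestronglyMeasurable (by simpa using hpt)
  refine ⟨hint, (integral_mono_ae hint hbd hpt).trans ?_⟩
  rw [integral_add (hdc.const_mul _) (hpsi.1.const_mul 6),
    integral_const_mul, integral_const_mul, integral_add hdef (integrable_const _),
    integral_const, S.measureReal_prod_univ hT hγ i ht, smul_eq_mul,
    mul_comm (γ ^ 2)]
  exact add_le_add le_rfl (mul_le_mul_of_nonneg_left hpsi.2 (by norm_num))

/-- A bound of the effect of the exterior field. -/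
def interactionBound (N : ℕ) (Xs : Plane) (κ γ d₀ K : ℝ) : ℝ :=
  2 * (κ / Xs 1 + 1 + 2 / Xs 1 * (K + Xs 1)) * (N * (8 * γ / d₀)) +
    lipConst γ (6 * π * (inverseSquareSum + 1)) d₀ * Xs 1

lemma lipConst_pos (hγ : 0 < γ) (hd : 0 < d₀) :
    0 < lipConst γ (6 * π * (inverseSquareSum + 1)) d₀ := by
  have := inverseSquareSum_nonneg
  unfold lipConst; positivity

lemma interactionBound_pos (hXs : Xs ∈ halfPlane) (hγ : 0 < γ) (hd : 0 < d₀) {κ K : ℝ}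
    (hκ : 0 ≤ κ) (hK : 0 < K) : 0 < interactionBound N Xs κ γ d₀ K := by
  have hr : 0 < Xs 1 := hXs
  have := lipConst_pos hγ hd
  unfold interactionBound; positivity

/-- The self-interaction, at regularisation `δ`. -/
def selfBound (Xs : Plane) (γ M₀ ε : ℝ) : ℝ :=
  2 * (|log ε| / (4 * π * Xs 1) * γ * ((|Xs 0| + 1 + 3 / 2 * Xs 1) *
    (55 * sizeBound Xs γ M₀ ε)) + (|Xs 0| + 1 + 3 / 2 * Xs 1) *
    (2 * (31 * sizeBound Xs γ M₀ ε) * (55 * sizeBound Xs γ M₀ ε))) * γ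

/-- On the slab the velocity is the self-generated one plus the exterior field, and the rate is
linear in the velocity. The first part contributes at most 1 by the choice of δ; the second is
bounded pointwise by the logarithmic distance. -/
lemma integral_totalRate_le (hXs : Xs ∈ halfPlane) (hε : SmallScale Xs Y d₀ ε)
    (hsep : IsSeparation Y d₀) (hT : 0 ≤ T) (hh : h₀ ≤ 1) (hγ : 0 < γ) (hM₀ : 0 < M₀) {K : ℝ}
    (hK : IsStreamBound (Xs 1) (5 + Xs 1 ^ 2) K) (i : Fin N) {δ : ℝ} (hδ : 0 < δ)
    (hδ1 : δ ≤ 1) (hself : selfBound Xs γ M₀ ε * √δ ≤ 1) {t : ℝ}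
    (ht : t ∈ Icc 0 (S.exitTime d₀ h₀)) :
    ∫ p, S.totalRate δ t p ∂(S.blobMeasure i t).prod (S.blobMeasure i t) ≤
      1 + interactionBound N Xs (radialSpread Y d₀) γ d₀ K * (γ ^ 2 +
        ∫ p, |logDist ε δ p| ∂(S.blobMeasure i t).prod (S.blobMeasure i t)) := by
  have hfin := S.isFiniteMeasure_blobMeasure hT hγ i ht
  have hr : 0 < Xs 1 := hXs
  have hd := hsep.1
  have htT := S.Icc_exitTime_subset hT d₀ h₀ ht
  have hL : 0 < |log ε| := one_pos.trans_le hε.log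
  obtain ⟨hli, -⟩ := S.integral_abs_logDist_le hXs hε hd hT hh hγ hM₀ hK i hδ hδ1 ht
  obtain ⟨hsi, hsb⟩ := integral_defectRate_self (sizeBound_pos hXs hγ hM₀)
    (S.admissible hXs hε hT hh hγ hM₀ i ht) (S.blob_nonneg i htT) hγ (S.blobMeasure_univ hγ i htT)
    ((S.ae_slab hε hT hh i ht).mono fun x hx => hε.norm_le hXs hx) hr hL hδ
  have hpt : ∀ᵐ p ∂(S.blobMeasure i t).prod (S.blobMeasure i t), S.totalRate δ t p ≤
      1 / |log ε| * defectRate (Xs 1) |log ε| p.1 p.2 (bs 0 (S.blob i t) p.1)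
        (bs 0 (S.blob i t) p.2) (‖p.1 - p.2‖ ^ 2 + δ ^ 2) +
      interactionBound N Xs (radialSpread Y d₀) γ d₀ K * (1 + |logDist ε δ p|) := by
    filter_upwards [S.ae_slab_pair hε hT hh i ht] with p hp
    have hn := hε.nearRing hXs hd hp.1 hp.2 hδ hδ1
    have hsum : ∀ x ∈ slab Xs Y ε d₀ 1 i,
        S.totalVel t x = bs 0 (S.blob i t) x + S.exteriorField i t x := fun x hx => by
      rw [S.exteriorField_eq_bs hXs hε hT hh hγ hM₀ i ht (hε.mem_halfPlane hXs hx),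
        Finset.add_sum_erase _ (fun j => bs 0 (S.blob j t) x) (Finset.mem_univ i)]
      rfl
    have hext := abs_defectRate_exterior_le (lipConst_pos hγ hd).le hn (hK.2 _ _ _ _ _ hn)
      (S.norm_exteriorField_le hXs hε hsep hT hh hγ i ht hp.1)
      (S.norm_exteriorField_le hXs hε hsep hT hh hγ i ht hp.2)
      (S.norm_exteriorField_sub_le hXs hε hsep hT hh hγ hM₀ i ht hp.1 hp.2)
    rw [totalRate, hsum _ hp.1, hsum _ hp.2, defectRate_add, mul_add]
    exact add_le_add le_rfl ((le_abs_self _).trans hext)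
  have hti : Integrable (S.totalRate δ t) ((S.blobMeasure i t).prod (S.blobMeasure i t)) := by
    obtain ⟨C, hC⟩ := S.exists_totalRate_bound hXs hε hd hT hh hγ hM₀ i hδ hδ1
    refine Integrable.of_bound
      (S.measurable_totalRate hXs hε hT hh hγ hM₀ δ ht).aestronglyMeasurable C ?_
    filter_upwards [S.ae_slab_pair hε hT hh i ht] with p hp
    exact hC t ht _ hp.1 _ hp.2
  have h1i : Integrable (fun p => 1 + |logDist ε δ p|)
      ((S.blobMeasure i t).prod (S.blobMeasure i t)) := (integrable_const 1).add hli
  change Integrable _ ((S.blobMeasure i t).prod (S.blobMeasure i t)) at hsi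
  have hsi' := hsi.const_mul (1 / |log ε|)
  refine (integral_mono_ae hti (hsi'.add (h1i.const_mul _)) hpt).trans ?_
  simp only [Pi.add_apply]
  rw [integral_add hsi' (h1i.const_mul _), integral_const_mul, integral_const_mul,
    integral_add (integrable_const 1) hli, integral_const, S.measureReal_prod_univ hT hγ i ht,
    smul_eq_mul, mul_one]
  refine add_le_add ?_ le_rfl
  have h2 : 1 / |log ε| ≤ 1 := by rw [div_le_one hL]; exact hε.log
  have h3 : selfBound Xs γ M₀ ε * √δ = 2 * (|log ε| / (4 * π * Xs 1) * γ *
      ((|Xs 0| + 1 + 3 / 2 * Xs 1) * (55 * sizeBound Xs γ M₀ ε * √δ)) +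
      (|Xs 0| + 1 + 3 / 2 * Xs 1) * (2 * (31 * sizeBound Xs γ M₀ ε) *
      (55 * sizeBound Xs γ M₀ ε * √δ))) * γ := by
    unfold selfBound; ring
  have h4 := hsb.trans (h3.symm.le.trans hself)
  calc _ ≤ 1 / |log ε| * 1 := mul_le_mul_of_nonneg_left h4 (by positivity)
    _ ≤ 1 := by rw [mul_one]; exact h2

/-- The renormalised energy is initially bounded. -/
lemma renormEnergy_zero_le (hXs : Xs ∈ halfPlane) (hε : SmallScale Xs Y d₀ ε) (hd : 0 < d₀)
    (hT : 0 ≤ T) (hh : h₀ ≤ 1) (hγ : 0 < γ) {K : ℝ}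
    (hK : IsStreamBound (Xs 1) (5 + Xs 1 ^ 2) K) (i : Fin N) {δ : ℝ} (hδ : 0 < δ)
    (hδε : δ ≤ ε) :
    S.renormEnergy i δ 0 ≤ (2 * Xs 1 + (radialSpread Y d₀ ^ 2 / Xs 1 + K)) * γ ^ 2 := by
  have hfin := S.isFiniteMeasure_vortexMeasure hγ i
  have hr : 0 < Xs 1 := hXs
  have hεp := hε.pos
  have hδ1 : δ ≤ 1 := hδε.trans (by linarith [hε.lt])
  have h0 : (0 : ℝ) ∈ Icc 0 (S.exitTime d₀ h₀) := ⟨le_rfl, S.exitTime_nonneg d₀ h₀⟩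
  rw [S.renormEnergy_eq hT i δ h0]
  have hball : ∀ᵐ x ∂vortexMeasure (S.blob₀ i),
      x ∈ Metric.closedBall (initCenter Xs Y ε i) ε :=
    ae_vortexMeasure_of_essSupport (S.blob₀_meas i) (S.blob₀_supp i)
  have hbp := ((Measure.quasiMeasurePreserving_fst (μ := vortexMeasure (S.blob₀ i))
    (ν := vortexMeasure (S.blob₀ i))).ae hball).and ((Measure.quasiMeasurePreserving_snd
    (μ := vortexMeasure (S.blob₀ i)) (ν := vortexMeasure (S.blob₀ i))).ae hball)
  have hmass : ((vortexMeasure (S.blob₀ i)).prod (vortexMeasure (S.blob₀ i))).real univ =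
      γ ^ 2 := by
    rw [← univ_prod_univ, measureReal_prod_prod, Measure.real, S.blobMeasure₀_univ hγ i,
      ENNReal.toReal_ofReal hγ.le, sq]
  rw [← hmass]
  obtain ⟨C, hC⟩ := S.exists_flowDefect_bound hXs hε hd hT hh i hδ hδ1
  have hint : Integrable (S.flowDefect δ 0)
      ((vortexMeasure (S.blob₀ i)).prod (vortexMeasure (S.blob₀ i))) :=
    Integrable.of_bound (S.measurable_flowDefect hT δ h0).aestronglyMeasurable C (hC 0 h0)
  refine (integral_mono_ae hint (integrable_const (2 * Xs 1 +
    (radialSpread Y d₀ ^ 2 / Xs 1 + K))) ?_).trans_eq (by rw [integral_const, smul_eq_mul, mul_comm])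
  filter_upwards [hbp, S.ae_trajectory_pair (h₀ := h₀) hε hT hh i] with p hp htr
  have he : ∀ x ∈ halfPlane, extFlow S.X 0 x = x := fun x hx => by
    rw [extFlow_of_mem S.X 0 hx, S.isWeakSolution.flow_zero x hx]
  obtain ⟨hs1, hs2⟩ := htr.2 0 h0
  rw [he _ htr.1.1] at hs1
  rw [he _ htr.1.2] at hs2
  rw [flowDefect, he _ htr.1.1, he _ htr.1.2]
  have hn := hε.nearRing hXs hd hs1 hs2 hδ hδ1
  have hdist : ‖p.1 - p.2‖ ≤ 2 * ε := by
    rw [← dist_eq_norm]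
    refine (dist_triangle_right _ _ (initCenter Xs Y ε i)).trans ?_
    have := Metric.mem_closedBall.1 hp.1
    have := Metric.mem_closedBall.1 hp.2
    linarith
  -- Here δ ≤ ε is needed: otherwise the regularised distance would not be comparable to ε at time
  -- zero.
  have hA : √(‖p.1 - p.2‖ ^ 2 + δ ^ 2) ≤ 3 * ε := by
    rw [Real.sqrt_le_left (by positivity)]
    nlinarith [norm_nonneg (p.1 - p.2)]
  have hlog : log √(‖p.1 - p.2‖ ^ 2 + δ ^ 2) + |log ε| ≤ 2 := by
    have h1 := Real.log_le_log (Real.sqrt_pos.2 hn.A_pos) hA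
    rw [Real.log_mul (by norm_num) hεp.ne', hε.log_eq] at h1
    have h2 := Real.log_le_sub_one_of_pos (by norm_num : (0 : ℝ) < 3)
    linarith
  have h3 := (abs_le.1 (hn.abs_defect_sub_le (hK.2 _ _ _ _ _ hn))).2
  have h4 : √(p.1 1 * p.2 1) / (2 * π) * (log √(‖p.1 - p.2‖ ^ 2 + δ ^ 2) + |log ε|) ≤
      Xs 1 * 2 := by
    refine (mul_le_mul_of_nonneg_left hlog (by positivity)).trans ?_
    have h5 : √(p.1 1 * p.2 1) / (2 * π) ≤ Xs 1 := by
      rw [div_le_iff₀ (by positivity)]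
      nlinarith [hn.sqrt_le, pi_gt_three]
    linarith
  linarith

/-- The logarithmic distances inside a blob have bounded mean. -/
theorem exists_logDist_bound (hXs : Xs ∈ halfPlane) (hsep : IsSeparation Y d₀) (hγ : 0 < γ)
    (hM₀ : 0 < M₀) : ∃ C > 0, ∀ ε, SmallScale Xs Y d₀ ε → ∀ T > 0,
      T ≤ 1 / (24 * lipConst γ (6 * π * (inverseSquareSum + 1)) d₀) → ∀ h₀ ≤ 1,
      ∀ S : BlobFlow Xs Y γ M₀ ε T, ∀ i, ∀ t ∈ Icc 0 (S.exitTime d₀ h₀), ∃ δ > 0,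
        Integrable (fun p => |logDist ε δ p|) ((S.blobMeasure i t).prod (S.blobMeasure i t)) ∧
        ∫ p, |logDist ε δ p| ∂(S.blobMeasure i t).prod (S.blobMeasure i t) ≤ C := by
  have hr : 0 < Xs 1 := hXs
  have hd := hsep.1
  obtain ⟨K, hK0, hK⟩ := exists_stream_log_bound hr (5 + Xs 1 ^ 2)
  have hKs : IsStreamBound (Xs 1) (5 + Xs 1 ^ 2) K := ⟨hK0, hK⟩
  have hκ : 0 ≤ radialSpread Y d₀ := by unfold radialSpread; positivity
  have hc := interactionBound_pos (N := N) hXs hγ hd hκ hK0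
  set c := interactionBound N Xs (radialSpread Y d₀) γ d₀ K
  set Q := radialSpread Y d₀ ^ 2 / Xs 1 + K
  have hQ : 0 < Q := by positivity
  have hψ := inverseDistBound_nonneg hXs hγ hM₀
  set ψ := inverseDistBound Xs γ M₀
  -- The coefficients of the differential inequality E' ≤ aE + b, obtained by inserting the control
  -- of the logarithmic distance by E into the bound of the rate. They depend neither on ε nor on δ.
  set a := c * (4 * π / Xs 1) with ha
  set b := 1 + c * (γ ^ 2 + (4 * π / Xs 1 * (Q * γ ^ 2) + 6 * ψ)) with hb
  have ha0 : 0 < a := by positivity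
  have hb0 : 0 < b := by positivity
  set Tm := 1 / (24 * lipConst γ (6 * π * (inverseSquareSum + 1)) d₀)
  set G := ((2 * Xs 1 + Q) * γ ^ 2 + b / a) * exp (a * Tm)
  have hG : 0 < G := by positivity
  refine ⟨4 * π / Xs 1 * (G + Q * γ ^ 2) + 6 * ψ, by positivity,
    fun ε hε T hT hTm h₀ hh S i t ht => ?_⟩
  have hεp := hε.pos
  have hLp : 0 < |log ε| := one_pos.trans_le hε.log
  have hM := sizeBound_pos (ε := ε) hXs hγ hM₀
  have hs0 : 0 ≤ selfBound Xs γ M₀ ε := by unfold selfBound; positivity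
  set s := selfBound Xs γ M₀ ε with hs
  -- The bound s on the self-interaction grows as ε → 0, so δ is chosen after ε and may be far
  -- smaller; the final constant does not see it.
  obtain ⟨δ, hδ, hδε, hself⟩ : ∃ δ > 0, δ ≤ ε ∧ s * √δ ≤ 1 := by
    refine ⟨min ε ((1 / (s + 1)) ^ 2), by positivity, min_le_left _ _, ?_⟩
    have h1 : √(min ε ((1 / (s + 1)) ^ 2)) ≤ 1 / (s + 1) := by
      rw [Real.sqrt_le_left (by positivity)]; exact min_le_right _ _
    calc _ ≤ s * (1 / (s + 1)) := by gcongr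
      _ = s / (s + 1) := by ring
      _ ≤ 1 := by rw [div_le_one (by positivity)]; linarith
  have hδ1 : δ ≤ 1 := hδε.trans (by linarith [hε.lt])
  obtain ⟨hi, hle⟩ := S.integral_abs_logDist_le hXs hε hd hT.le hh hγ hM₀ hKs i hδ hδ1 ht
  refine ⟨δ, hδ, hi, hle.trans ?_⟩
  have hgron := add_div_le_mul_exp (f := S.renormEnergy i δ) (b := b) ha0
    (S.continuousOn_renormEnergy hXs hε hd hT.le hh hγ i hδ hδ1) (fun τ hτ =>
      ⟨_, S.hasDerivAt_renormEnergy hXs hε hd hT.le hh hγ hM₀ i hδ hδ1 hτ, ?_⟩) ht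
  · have h0 := S.renormEnergy_zero_le (h₀ := h₀) hXs hε hd hT.le hh hγ hKs i hδ hδε
    have htT : t ≤ Tm := ((S.Icc_exitTime_subset hT.le d₀ h₀ ht).2).trans hTm
    have h1 : (S.renormEnergy i δ 0 + b / a) * exp (a * t) ≤ G := by
      calc _ ≤ ((2 * Xs 1 + Q) * γ ^ 2 + b / a) * exp (a * t) := by gcongr
        _ ≤ ((2 * Xs 1 + Q) * γ ^ 2 + b / a) * exp (a * Tm) := by gcongr
    have h2 : S.renormEnergy i δ t ≤ G := by
      have : 0 < b / a := by positivity
      linarith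
    gcongr
  · have hτI := Ioo_subset_Icc_self hτ
    have h1 := S.integral_totalRate_le hXs hε hsep hT.le hh hγ hM₀ hKs i hδ hδ1 hself hτI
    have h2 := (S.integral_abs_logDist_le hXs hε hd hT.le hh hγ hM₀ hKs i hδ hδ1 hτI).2
    refine h1.trans ?_
    calc _ ≤ 1 + c * (γ ^ 2 + (4 * π / Xs 1 * (S.renormEnergy i δ τ + Q * γ ^ 2) + 6 * ψ)) := by
          gcongr
      _ = _ := by rw [ha, hb]; ring

end BlobFlow

/-! ### From logarithmic distances to concentration. -/

/-- A measure whose points have bounded logarithmic distances in the mean is concentrated in a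
ball. -/
lemma exists_center {μ : Measure Plane} [IsFiniteMeasure μ] {γ ε δ C : ℝ} (hγ : 0 < γ)
    (hμ : μ.real univ = γ)
    (hi : Integrable (fun p => |BlobFlow.logDist ε δ p|) (μ.prod μ))
    (hC : ∫ p, |BlobFlow.logDist ε δ p| ∂μ.prod μ ≤ C) :
    ∃ x₀ : Plane, ∀ R > 0, ∀ m ≤ log R + |log ε|,
      m * μ.real (Metric.ball x₀ R)ᶜ ≤ C / γ := by
  have hne : μ ≠ 0 := by
    rintro rfl
    simp at hμ; linarith
  have hnull : μ {x | ¬ Integrable (fun y => |BlobFlow.logDist ε δ (x, y)|) μ} = 0 :=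
    ae_iff.1 hi.prod_right_ae
  -- The centre is a point at which the inner integral is at most its average and the slice is
  -- integrable; the latter excludes a spurious value 0 of the integral. One centre serves all
  -- radii.
  obtain ⟨x₀, hx₀, hle⟩ := exists_notMem_null_le_average hne hi.integral_prod_left hnull
  have hx₀i : Integrable (fun y => |BlobFlow.logDist ε δ (x₀, y)|) μ := by
    simpa using hx₀
  rw [average_eq, hμ, ← integral_prod _ hi, smul_eq_mul] at hle
  have hle' : ∫ y, |BlobFlow.logDist ε δ (x₀, y)| ∂μ ≤ C / γ := by
    refine hle.trans ?_
    rw [inv_mul_eq_div]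
    gcongr
  refine ⟨x₀, fun R hR m hm => ?_⟩
  have hn : 0 ≤ᵐ[μ] fun y => |BlobFlow.logDist ε δ (x₀, y)| :=
    Eventually.of_forall fun y => abs_nonneg _
  rcases le_or_gt m 0 with hm0 | hm0
  -- Markov's inequality is meaningful for m > 0; otherwise the left side is not positive.
  · exact (mul_nonpos_of_nonpos_of_nonneg hm0 measureReal_nonneg).trans
      ((integral_nonneg_of_ae hn).trans hle')
  refine le_trans ?_ ((mul_meas_ge_le_integral_of_nonneg hn hx₀i m).trans hle')
  refine mul_le_mul_of_nonneg_left (measureReal_mono fun y hy => ?_) hm0.le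
  have hy' : R ≤ ‖x₀ - y‖ := by
    rw [← dist_eq_norm, dist_comm]
    simpa using hy
  have h1 := Real.log_le_log hR (hy'.trans (norm_sub_le_sqrt x₀ y δ))
  exact (by unfold BlobFlow.logDist; linarith : m ≤ BlobFlow.logDist ε δ (x₀, y)).trans
    (le_abs_self _)

lemma ediam_ball_le (x : Plane) (R : ℝ) : Metric.ediam (Metric.ball x R) ≤ ENNReal.ofReal (2 * R) := by
  refine Metric.ediam_le fun y hy z hz => ?_
  rw [edist_dist]
  refine ENNReal.ofReal_le_ofReal ((dist_triangle_right y z x).trans ?_)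
  linarith [Metric.mem_ball.1 hy, Metric.mem_ball.1 hz]

lemma BlobFlow.setIntegral_blob {N : ℕ} {Xs : Plane} {Y : Fin N → Plane} {γ M₀ ε T : ℝ}
    (S : BlobFlow Xs Y γ M₀ ε T) (i : Fin N) {t : ℝ} (ht : t ∈ Icc 0 T) {Ω : Set Plane}
    (hΩ : MeasurableSet Ω) (hsub : Ω ⊆ halfPlane) :
    ∫ x in Ω, x 1 * S.blob i t x = (S.blobMeasure i t).real Ω := by
  have h := S.integral_blobMeasure i ht (Ω.indicator fun _ => (1 : ℝ))
  rw [integral_indicator_const _ hΩ, smul_eq_mul, mul_one] at h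
  rw [h, ← inter_eq_left.2 hsub, ← Measure.restrict_restrict hΩ, inter_eq_left.2 hsub,
    ← integral_indicator hΩ]
  congr 1; ext x
  by_cases hx : x ∈ Ω <;> simp [hx]

/-- Concentration of the blobs. -/
theorem exists_concentration {N : ℕ} {Xs : Plane} {Y : Fin N → Plane} {γ M₀ d₀ h₀ : ℝ}
    (hXs : Xs ∈ halfPlane) (hsep : IsSeparation Y d₀) (hγ : 0 < γ) (hM₀ : 0 < M₀) (hh0 : 0 < h₀)
    (hh : h₀ ≤ 1) :
    ∀ᶠ ε in 𝓝[>] (0 : ℝ), ∀ ρ ∈ Ioc (0 : ℝ) 1, ∀ T > 0,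
      T ≤ 1 / (24 * lipConst γ (6 * π * (inverseSquareSum + 1)) d₀) →
      ∀ S : BlobFlow Xs Y γ M₀ ε T, ∀ i, ∀ t ∈ Icc 0 (S.exitTime d₀ h₀), ∃ Ω : Set Plane,
        IsOpen Ω ∧ Ω ⊆ halfPlane ∧
        1 - h₀ / Xs 1 * ρ * log |log ε| ≤ 1 / γ * ∫ x in Ω, x 1 * S.blob i t x ∧
        Metric.ediam Ω ≤ ENNReal.ofReal (ε * exp (120 / ρ)) := by
  have hr : 0 < Xs 1 := hXs
  obtain ⟨C, hC0, hC⟩ := BlobFlow.exists_logDist_bound hXs hsep hγ hM₀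
  obtain ⟨ε₁, hε₁, hsmall⟩ := exists_smallScale hXs Y hsep.1
  -- The energy bound gives a mass defect of order ρ with a fixed constant; the factor log |log ε|
  -- in the claim absorbs it for small ε, uniformly in ρ.
  have hlim : ∀ᶠ ε in 𝓝[>] (0 : ℝ), C / γ ^ 2 * (Xs 1 / h₀) ≤ log |log ε| :=
    (Real.tendsto_log_atTop.comp tendsto_abs_log).eventually_ge_atTop _
  filter_upwards [hlim, Ioc_mem_nhdsGT hε₁] with ε hlog hεm ρ hρ T hT hTm S i t ht
  have hε := hsmall ε hεm
  have hεp := hε.pos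
  have hρ0 := hρ.1
  have htT := S.Icc_exitTime_subset hT.le d₀ h₀ ht
  have := S.isFiniteMeasure_blobMeasure hT.le hγ i ht
  obtain ⟨δ, -, hi, hle⟩ := hC ε hε T hT hTm h₀ hh S i t ht
  have hmass := S.real_blobMeasure_univ hT.le hγ i ht
  obtain ⟨x₀, hx₀⟩ := exists_center hγ hmass hi hle
  -- Half of the allowed diameter.
  set R := ε * exp (120 / ρ) / 2 with hR
  have hRp : 0 < R := by positivity
  have hopen : IsOpen (Metric.ball x₀ R ∩ halfPlane) := Metric.isOpen_ball.inter isOpen_halfPlane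
  refine ⟨Metric.ball x₀ R ∩ halfPlane, hopen, inter_subset_right, ?_, ?_⟩
  · rw [S.setIntegral_blob i htT hopen.measurableSet inter_subset_right]
    have hinter : (S.blobMeasure i t).real (Metric.ball x₀ R ∩ halfPlane) =
        (S.blobMeasure i t).real (Metric.ball x₀ R) :=
      measureReal_congr (inter_ae_eq_left_of_ae_eq_univ
        (eventuallyEq_univ.2 (ae_vortexMeasure_mem (S.blob i t))))
    rw [hinter]
    have hlogR : log R + |log ε| = 120 / ρ - log 2 := by
      rw [hR, Real.log_div (by positivity) two_ne_zero, Real.log_mul hεp.ne' (exp_pos _).ne',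
        Real.log_exp]
      linarith [hε.log_eq]
    -- Since ρ ≤ 1, the term 120/ρ exceeds 1/ρ by more than log 2. Keeping only 1/ρ makes Markov's
    -- bound equal to Cρ/γ.
    have hm : 1 / ρ ≤ log R + |log ε| := by
      rw [hlogR]
      have h1 : 1 ≤ 1 / ρ := by rw [le_div_iff₀ hρ0]; linarith [hρ.2]
      have h2 : 120 / ρ = 120 * (1 / ρ) := by ring
      have h3 := Real.log_le_sub_one_of_pos (by norm_num : (0 : ℝ) < 2)
      rw [h2]; linarith
    have hcompl := hx₀ R hRp (1 / ρ) hm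
    have hadd := measureReal_add_measureReal_compl (μ := S.blobMeasure i t)
      (Metric.isOpen_ball (x := x₀) (ε := R)).measurableSet
    rw [hmass] at hadd
    have h4 : (S.blobMeasure i t).real (Metric.ball x₀ R)ᶜ ≤ C / γ * ρ := by
      rw [one_div_mul_eq_div, div_le_iff₀ hρ0] at hcompl
      exact hcompl
    have h5 : C / γ ^ 2 * ρ ≤ h₀ / Xs 1 * ρ * log |log ε| := by
      calc C / γ ^ 2 * ρ = h₀ / Xs 1 * ρ * (C / γ ^ 2 * (Xs 1 / h₀)) := by field_simp
        _ ≤ _ := by gcongr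
    calc 1 - h₀ / Xs 1 * ρ * log |log ε| ≤ 1 - C / γ ^ 2 * ρ := by linarith
      _ = 1 / γ * (γ - C / γ * ρ) := by field_simp
      _ ≤ _ := by gcongr; linarith
  · refine (Metric.ediam_mono inter_subset_left).trans ((ediam_ball_le x₀ R).trans_eq ?_)
    rw [hR]; congr 1; ring

end VortexRings

end

/-! ### The proposition. -/

theorem proposition4p1 (Xs : VortexRings.Plane) (hXs : Xs ∈ VortexRings.halfPlane) :
    -- the constant `C^*` depends only on the reference point `X^* = (z^*, r^*)`
    ∃ Cs : ℝ, VortexRings.IsExteriorLipConst Xs Cs ∧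
    ∀ (N : ℕ) (Y : Fin N → VortexRings.Plane) (d₀ γ M₀ h₀ : ℝ),
      Function.Injective (fun j => Y j 1) → VortexRings.IsSeparation Y d₀ →
      0 < γ → 0 < M₀ → 0 < h₀ → h₀ ≤ min (Xs 1 / 240) (1 / 2) →
      (∀ ρ : ℝ → ℝ, (∀ᶠ ε in 𝓝[>] (0 : ℝ), 0 < ρ ε) →
        Tendsto (fun ε => ρ ε * √|log ε|) (𝓝[>] (0 : ℝ)) (𝓝 0) →
        ∃ ε₀ > 0, ∀ ε ∈ Ioc 0 ε₀, ∀ T₀ > 0, T₀ ≤ 1 / (24 * VortexRings.lipConst γ Cs d₀) →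
          ∀ S : VortexRings.BlobFlow Xs Y γ M₀ ε T₀, ∀ i : Fin N,
            ∀ t ∈ Icc 0 (S.exitTime d₀ h₀), ∃ Ω : Set VortexRings.Plane,
              IsOpen Ω ∧ Ω ⊆ VortexRings.halfPlane ∧
              1 - h₀ / Xs 1 * ρ ε * log |log ε| ≤ 1 / γ * ∫ x in Ω, x 1 * S.blob i t x ∧
              Metric.ediam Ω ≤ ENNReal.ofReal (ε * exp (120 / ρ ε))) ∧
      -- the choice `ρ(ε) = 120 / (η |ln ε|)`
      (∀ η > 0, ∃ ε₀ > 0, ∀ ε ∈ Ioc 0 ε₀, ∀ T₀ > 0,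
        T₀ ≤ 1 / (24 * VortexRings.lipConst γ Cs d₀) →
          ∀ S : VortexRings.BlobFlow Xs Y γ M₀ ε T₀, ∀ i : Fin N,
            ∀ t ∈ Icc 0 (S.exitTime d₀ h₀), ∃ Ω : Set VortexRings.Plane,
              IsOpen Ω ∧ Ω ⊆ VortexRings.halfPlane ∧
              1 - h₀ / Xs 1 * (120 / η) * (log |log ε| / |log ε|)
                ≤ 1 / γ * ∫ x in Ω, x 1 * S.blob i t x ∧
              Metric.ediam Ω ≤ ENNReal.ofReal (ε ^ (1 - η))) := by
  have hr : 0 < Xs 1 := hXs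
  refine ⟨_, VortexRings.isExteriorLipConst hXs, fun N Y d₀ γ M₀ h₀ _ hsep hγ hM₀ hh0 hh => ?_⟩
  have hh1 : h₀ ≤ 1 := hh.trans ((min_le_right _ _).trans (by norm_num))
  have hmain := VortexRings.exists_concentration (Y := Y) hXs hsep hγ hM₀ hh0 hh1
  have hlog := VortexRings.tendsto_abs_log
  constructor
  · intro ρ hρ hlim
    -- The decay of ρ √|log ε| enters as ρ ≤ 1 for small ε.
    have hev : ∀ᶠ ε in 𝓝[>] (0 : ℝ), ρ ε ∈ Ioc (0 : ℝ) 1 := by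
      filter_upwards [hρ, hlim.eventually_le_const one_pos, hlog.eventually_ge_atTop 1]
        with ε h1 h2 h3
      have h4 : 1 ≤ √|log ε| := Real.one_le_sqrt.2 h3
      exact ⟨h1, (le_mul_of_one_le_right h1.le h4).trans h2⟩
    obtain ⟨ε₀, h0, h⟩ := mem_nhdsGT_iff_exists_Ioc_subset.1 (hmain.and hev)
    exact ⟨ε₀, h0, fun ε hε => (h hε).1 (ρ ε) (h hε).2⟩
  · intro η hη
    -- For this choice of ρ, e^{120/ρ} = e^{η |log ε|} = ε^{-η}, so the diameter bound becomes
    -- ε^{1-η}. The concentration theorem is applied with this value directly, which requires only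
    -- that it lie in (0, 1].
    have hev : ∀ᶠ ε in 𝓝[>] (0 : ℝ), 120 / (η * |log ε|) ∈ Ioc (0 : ℝ) 1 ∧
        0 < |log ε| ∧ ε ∈ Ioo (0 : ℝ) 1 := by
      filter_upwards [hlog.eventually_ge_atTop (120 / η), hlog.eventually_gt_atTop 0,
        Ioo_mem_nhdsGT one_pos] with ε h1 h2 h3
      refine ⟨⟨by positivity, ?_⟩, h2, h3⟩
      rw [div_le_iff₀ hη] at h1
      rw [div_le_one (by positivity)]
      linarith
    obtain ⟨ε₀, h0, h⟩ := mem_nhdsGT_iff_exists_Ioc_subset.1 (hmain.and hev)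
    refine ⟨ε₀, h0, fun ε hε T hT hTm S i t ht => ?_⟩
    obtain ⟨h1, h2, h3, h4⟩ := h hε
    obtain ⟨Ω, hΩ, hsub, hmass, hdiam⟩ := h1 _ h2 T hT hTm S i t ht
    refine ⟨Ω, hΩ, hsub, le_of_eq_of_le ?_ hmass, hdiam.trans_eq ?_⟩
    · field_simp
    · have h5 : 120 / (120 / (η * |log ε|)) = η * |log ε| := by field_simp
      rw [h5, abs_of_neg (Real.log_neg h4.1 h4.2), sub_eq_add_neg, Real.rpow_add h4.1,
        Real.rpow_one, Real.rpow_def_of_pos h4.1]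
      congr 3
      ring
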